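/- **Setting.** Let $n\ge 3$, $0<\theta_1<\theta_2<\pi$, $\frac{n-2}{2}<p<\check p\le n-2$, and $p\ne n/2$ if $n\ge 5$. *Data.* Let $\check g$ be a Riemannian metric and $\check k$ a symmetric $(0,2)$-tensor on an end $\{y\in\mathbb R^n: |y|>R_0\}$, with $\check g_{ij}\in C^2$, $\check k_{ij}\in C^1$, $\partial^\beta(\check g_{ij}-\delta_{ij})=O(|y|^{-\check p-|\beta|})$ for $|\beta|\le 2$ and $\partial^\beta\check k_{ij}=O(|y|^{-\check p-1-|\beta|})$ for $|\beta|\le 1$. (For instance, the end of a complete asymptotically flat vacuum initial data set $(M,\check g,\check k)$ of type $(n,l+1,\alpha,\check p)$, $l\ge 4$.) *Region.* Let $e\in\mathbb R^n$ be a unit vector, write $\theta(x)$ for the angle between $x$ and $e$, and let $\Omega_0$ be a regularized cone region with vertex $0$: a connected open set with smooth boundary such that outside the open unit ball $\Omega_0=\{\theta_1<\theta<\theta_2\}$, and such that the complement of $\partial\Omega_0$ is the disjoint union of $\Omega_0$, a connected open inner region, equal to $\{\theta<\theta_1\}$ outside the open unit ball, and a connected open outer region, equal to $\{\theta>\theta_2\}$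 there; $\partial\Omega_0$ is the disjoint union $\Sigma_1\cup\Sigma_2$ of the boundaries of the inner and the outer region. *Weights and cutoff.* Let $r$ be a smooth positive function on $\mathbb R^n$ equal to $|x|$ outside the open unit ball. Let $\phi$ be smooth up to the boundary of $\Omega_0$, positive in $\Omega_0$, vanishing with nonzero gradient on $\partial\Omega_0$, and, outside the open unit ball, constant along rays from $0$, equal to $\theta-\theta_1$ near $\Sigma_1$ and to $\theta_2-\theta$ near $\Sigma_2$; let $\rho=\phi^{2N}$. Let $\chi$ be a smooth function with values in $[0,1]$, equal to $1$ in the inner and to $0$ in the outer region, and depending only on $\theta$ outside the open unit ball. *Placement.* For $a\ne 0$ let $T$ be a linear isometry with $T(-a)=|a|e$; let $\Omega=\Omega(a)=\{y: T(y-a)\in\Omega_0\}$ (so that the cones have vertex $a$ and axis $-a$), and transport $r,\phi,\rho,\chi$ by $y\mapsto T(y-a)$. The rough patch on $\Omega$ is $g=\chi\check g+(1-\chi)\delta$, $k=\chi\check k$, and $\pi^{ij}=k^{ij}-(\mathrm{Tr}_gk)g^{ij}$. Let $d\upsilon$ be the Riemannian measure of $g$. *Operators.* Let $\Phi(g,\pi)=\big(R_g+\tfrac1{n-1}(\mathrm{Tr}_g\pi)^2-|\pi|_g^2,\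 \mathrm{Div}_g\pi\big)$, let $d\Phi=d\Phi_{(g,\pi)}$ be its linearization, acting on pairs $(h,\omega)$ of a symmetric $(0,2)$- and a symmetric $(2,0)$-tensor, and let $d\Phi^*=({d\Phi^*}^{(1)},{d\Phi^*}^{(2)})$ be the formal adjoint, defined by $\int_\Omega d\Phi[h,\omega]\cdot_g(u,Z)\,d\upsilon=\int_\Omega(h,\omega)\cdot_g d\Phi^*[u,Z]\,d\upsilon$ for all smooth $(h,\omega)$ compactly supported in $\Omega$. *Spaces.* $\mathcal H_{k,-q,\rho}$ is the completion of the smooth functions with bounded support (no condition on $\partial\Omega$) for the norm $\|f\|^2=\sum_{|\beta|\le k}\int_\Omega|\partial^\beta f|^2r^{-n+2(|\beta|+q)}\rho\,dx$; $\mathcal X_{k,-q,\rho}$ is the same for vector fields. $\mathcal H_{0,-q,\rho^{-1}}$, $\mathcal X_{0,-q,\rho^{-1}}$ are the $L^2$ spaces with weight $r^{-n+2q}\rho^{-1}$. **Statement.** There is $N_0$, depending only on $n,p,\check p,\theta_1,\theta_2,\Omega_0,r,\phi$, such that for every integer $N\ge N_0$ and all $\chi$, $\check g$, $\check k$ as above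 there is $a_{\infty,L}$ such that for every $a$ with $|a|>a_{\infty,L}$, every $T$ as above and every $(f,V)\in\mathcal H_{0,-p-2,\rho^{-1}}\times\mathcal X_{0,-p-2,\rho^{-1}}$ the following holds. The functional $$\mathcal G(u,Z)=\int_\Omega\Big\{\tfrac12\Big[\big|{d\Phi^*}^{(1)}[u,Z]\big|_g^2r^{n-2p}\rho+\big|{d\Phi^*}^{(2)}[u,Z]\big|_g^2r^{n-2p-2}\rho\Big]-(f,V)\cdot_g(u,Z)\Big\}\,d\upsilon$$ is well defined on $\mathcal H_{2,-n+p+2,\rho}\times\mathcal X_{1,-n+p+2,\rho}$ (the adjoint exists and the integrand is integrable), and it has a unique minimizer $(\tilde u,\tilde Z)$ in this space. Moreover $h=r^{n-2p}\rho\,{d\Phi^*}^{(1)}[\tilde u,\tilde Z]$ and $\omega=r^{n-2p-2}\rho\,{d\Phi^*}^{(2)}[\tilde u,\tilde Z]$ solve $d\Phi_{(g,\pi)}[h,\omega]=(f,V)$ in $\Omega$ in the sense of distributions, that is, $\int_\Omega(h,\omega)\cdot_gd\Phi^*[u,Z]\,d\upsilon=\int_\Omega(f,V)\cdot_g(u,Z)\,d\upsilon$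 for all smooth $(u,Z)$ compactly supported in $\Omega$. -/

import Mathlib

open MeasureTheory Set Filter Topology
open scoped ContDiff ENNReal

noncomputable section

namespace Constraint

/-- Euclidean space, with Cartesian coordinates. -/
abbrev E (n : ℕ) : Type := EuclideanSpace ℝ (Fin n)

/-- The coordinate components, at each point, of a tensor with two indices
(both lower or both upper, according to the context). -/
abbrev Tensor2 (n : ℕ) : Type := E n → Matrix (Fin n) (Fin n) ℝ

/-- The partial derivative in the direction of the `i`-th coordinate. -/
def pd {n : ℕ} (i : Fin n) (F : E n → ℝ) (x : E n) : ℝ :=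
  fderiv ℝ F x (EuclideanSpace.single i 1)

/-! ### Riemannian geometry in coordinates -/

/-- The Christoffel symbol `Γ^k_{ij}` of the metric `g`. -/
def christoffel {n : ℕ} (g : Tensor2 n) (k i j : Fin n) (x : E n) : ℝ :=
  (1 / 2 : ℝ) * ∑ l, (g x)⁻¹ k l *
    (pd i (fun y => g y j l) x + pd j (fun y => g y i l) x - pd l (fun y => g y i j) x)

/-- The Ricci tensor
`R_{ij} = ∂_k Γ^k_{ij} - ∂_j Γ^k_{ik} + Γ^k_{kl} Γ^l_{ij} - Γ^k_{jl} Γ^l_{ik}`. -/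
def ricci {n : ℕ} (g : Tensor2 n) (i j : Fin n) (x : E n) : ℝ :=
  (∑ k, (pd k (christoffel g k i j) x - pd j (christoffel g k i k) x)) +
    ∑ k, ∑ l, (christoffel g k k l x * christoffel g l i j x -
      christoffel g k j l x * christoffel g l i k x)

/-- The scalar curvature. -/
def scalarCurvature {n : ℕ} (g : Tensor2 n) (x : E n) : ℝ :=
  ∑ i, ∑ j, (g x)⁻¹ i j * ricci g i j x

/-- The density of the Riemannian measure with respect to Lebesgue measure. -/
def volDensity {n : ℕ} (g : Tensor2 n) (x : E n) : ℝ := Real.sqrt (g x).det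

/-- The inner product of two vectors for the value `G` of the metric at a point. -/
def innerVec {n : ℕ} (G : Matrix (Fin n) (Fin n) ℝ) (V Z : E n) : ℝ :=
  ∑ i, ∑ j, G i j * V i * Z j

/-- The inner product of two `(2,0)` tensors (upper indices). -/
def innerUp {n : ℕ} (G P Q : Matrix (Fin n) (Fin n) ℝ) : ℝ :=
  ∑ i, ∑ j, ∑ k, ∑ l, G i k * G j l * P i j * Q k l

/-- The inner product of two `(0,2)` tensors (lower indices). -/
def innerLow {n : ℕ} (G P Q : Matrix (Fin n) (Fin n) ℝ) : ℝ :=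
  innerUp G⁻¹ P Q

/-- The trace of a `(2,0)` tensor. -/
def traceUp {n : ℕ} (G P : Matrix (Fin n) (Fin n) ℝ) : ℝ :=
  ∑ i, ∑ j, G i j * P i j

/-- The divergence of a symmetric `(2,0)` tensor, a vector field. -/
def divUp {n : ℕ} (g π : Tensor2 n) (x : E n) : E n :=
  WithLp.toLp 2 fun j =>
    (∑ i, pd i (fun y => π y i j) x) +
      ∑ i, ∑ k, (christoffel g i i k x * π x k j + christoffel g j i k x * π x i k)

/-- The momentum tensor `π^{ij} = k^{ij} - (tr_g k) g^{ij}`, indices raised with `g`. -/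
def momentum {n : ℕ} (g k : Tensor2 n) : Tensor2 n := fun x =>
  (g x)⁻¹ * k x * (g x)⁻¹ - ((g x)⁻¹ * k x).trace • (g x)⁻¹

/-! ### The constraint map, its linearization and the formal adjoint -/

/-- The Hamiltonian constraint `R_g + (tr_g π)² / (n - 1) - |π|²_g`. -/
def hamiltonian {n : ℕ} (g π : Tensor2 n) (x : E n) : ℝ :=
  scalarCurvature g x + (traceUp (g x) (π x)) ^ 2 / ((n : ℝ) - 1) - innerUp (g x) (π x) (π x)

/-- First component of the linearization at `(g, π)` of the constraint map
`Φ(g, π) = (hamiltonian g π, div_g π)`, evaluated on `(h, τ)`. -/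
def linHamiltonian {n : ℕ} (g π h τ : Tensor2 n) (x : E n) : ℝ :=
  deriv (fun t : ℝ => hamiltonian (g + t • h) (π + t • τ) x) 0

/-- Second component of the linearization of the constraint map. -/
def linDiv {n : ℕ} (g π h τ : Tensor2 n) (x : E n) : E n :=
  WithLp.toLp 2 fun j => deriv (fun t : ℝ => divUp (g + t • h) (π + t • τ) x j) 0

/-- Smooth functions compactly supported in `Ω`. -/
def IsTest {n : ℕ} (Ω : Set (E n)) (F : E n → ℝ) : Prop :=
  ContDiff ℝ ∞ F ∧ HasCompactSupport F ∧ tsupport F ⊆ Ω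

/-- Smooth symmetric 2-tensors compactly supported in `Ω`. -/
def IsTestTensor {n : ℕ} (Ω : Set (E n)) (h : Tensor2 n) : Prop :=
  (∀ x, (h x).IsSymm) ∧ ∀ i j, IsTest Ω fun x => h x i j

/-- Locally integrable symmetric 2-tensors on `Ω`. -/
def IsLocIntTensor {n : ℕ} (Ω : Set (E n)) (h : Tensor2 n) : Prop :=
  (∀ x, (h x).IsSymm) ∧ ∀ i j, LocallyIntegrableOn (fun x => h x i j) Ω

/-- `(A, B) = dΦ^*_{(g,π)}[u, Z]` on `Ω`: the pair of a symmetric `(0,2)` tensor and a symmetric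
`(2,0)` tensor given by
`∫_Ω dΦ[h, τ] ·_g (u, Z) dυ = ∫_Ω (h, τ) ·_g (A, B) dυ`
for all smooth `(h, τ)` with compact support in `Ω`. It is unique up to null sets. -/
def IsAdjoint {n : ℕ} (Ω : Set (E n)) (g π : Tensor2 n) (u : E n → ℝ) (Z : E n → E n)
    (AB : Tensor2 n × Tensor2 n) : Prop :=
  IsLocIntTensor Ω AB.1 ∧ IsLocIntTensor Ω AB.2 ∧
  ∀ h τ : Tensor2 n, IsTestTensor Ω h → IsTestTensor Ω τ →
    ∫ x in Ω, (linHamiltonian g π h τ x * u x + innerVec (g x) (linDiv g π h τ x) (Z x)) *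
        volDensity g x =
      ∫ x in Ω, (innerLow (g x) (h x) (AB.1 x) + innerUp (g x) (τ x) (AB.2 x)) * volDensity g x

open Classical in
/-- The formal adjoint `dΦ^*_{(g,π)}[u, Z]` (zero by convention where it does not exist). -/
def adjoint {n : ℕ} (Ω : Set (E n)) (g π : Tensor2 n) (u : E n → ℝ) (Z : E n → E n) :
    Tensor2 n × Tensor2 n :=
  if H : ∃ AB, IsAdjoint Ω g π u Z AB then H.choose else 0

/-- `(h, τ)` solves `dΦ_{(g,π)}[h, τ] = (f, V)` on `Ω` in the sense of distributions. -/
def IsLinearSolution {n : ℕ} (Ω : Set (E n)) (g π h τ : Tensor2 n)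
    (f : E n → ℝ) (V : E n → E n) : Prop :=
  IsLocIntTensor Ω h ∧ IsLocIntTensor Ω τ ∧
  ∀ (u : E n → ℝ) (Z : E n → E n), IsTest Ω u → (∀ i, IsTest Ω fun x => Z x i) →
    ∫ x in Ω, (innerLow (g x) (h x) ((adjoint Ω g π u Z).1 x) +
        innerUp (g x) (τ x) ((adjoint Ω g π u Z).2 x)) * volDensity g x =
      ∫ x in Ω, (f x * u x + innerVec (g x) (V x) (Z x)) * volDensity g x

/-! ### Doubly weighted Sobolev spaces -/

/-- The squared norm
`∑_{i ≤ k} ∑ ∫_Ω |∂_{I_1} ⋯ ∂_{I_i} F|² r^{-n+2(i+q)} ρ dx`,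
the inner sum being over all `i`-tuples of coordinate directions. -/
def normSq {n : ℕ} {F : Type*} [NormedAddCommGroup F] [NormedSpace ℝ F]
    (Ω : Set (E n)) (r ρ : E n → ℝ) (k : ℕ) (q : ℝ) (v : E n → F) : ℝ≥0∞ :=
  ∑ i ∈ Finset.range (k + 1), ∑ I : Fin i → Fin n,
    ∫⁻ x in Ω, ‖iteratedFDeriv ℝ i v x (fun j => EuclideanSpace.single (I j) 1)‖ₑ ^ 2 *
      ENNReal.ofReal (r x ^ (-(n : ℝ) + 2 * ((i : ℝ) + q)) * ρ x)

/-- The space `H_{0,-q,ρ}(Ω)`: the weighted `L²` space. -/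
def MemL2 {n : ℕ} {F : Type*} [NormedAddCommGroup F] [NormedSpace ℝ F]
    (Ω : Set (E n)) (r ρ : E n → ℝ) (q : ℝ) (v : E n → F) : Prop :=
  AEStronglyMeasurable v (volume.restrict Ω) ∧ normSq Ω r ρ 0 q v < ⊤

/-- The space `H_{k,-q,ρ}(Ω)`: the completion of the smooth functions with bounded support (no
condition on the boundary of `Ω`) for the norm above, realized inside the weighted `L²` space as
the set of limits of the sequences of such functions that are Cauchy for this norm. -/
def MemSobolev {n : ℕ} {F : Type*} [NormedAddCommGroup F] [NormedSpace ℝ F]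
    (Ω : Set (E n)) (r ρ : E n → ℝ) (k : ℕ) (q : ℝ) (v : E n → F) : Prop :=
  AEStronglyMeasurable v (volume.restrict Ω) ∧
  ∃ ψ : ℕ → E n → F,
    (∀ m, ContDiff ℝ ∞ (ψ m) ∧ HasCompactSupport (ψ m)) ∧
    Tendsto (fun m : ℕ × ℕ => normSq Ω r ρ k q (ψ m.1 - ψ m.2)) atTop (𝓝 0) ∧
    Tendsto (fun m : ℕ => normSq Ω r ρ 0 q (ψ m - v)) atTop (𝓝 0)

/-! ### The functional -/

/-- The integrand, with respect to Lebesgue measure, of the functional `𝒢`. -/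
def energyDensity {n : ℕ} (Ω : Set (E n)) (g π : Tensor2 n) (r ρ : E n → ℝ) (p : ℝ)
    (f : E n → ℝ) (V : E n → E n) (u : E n → ℝ) (Z : E n → E n) (x : E n) : ℝ :=
  ((1 / 2 : ℝ) *
      (innerLow (g x) ((adjoint Ω g π u Z).1 x) ((adjoint Ω g π u Z).1 x) *
          r x ^ ((n : ℝ) - 2 * p) * ρ x +
        innerUp (g x) ((adjoint Ω g π u Z).2 x) ((adjoint Ω g π u Z).2 x) *
          r x ^ ((n : ℝ) - 2 * p - 2) * ρ x) -
    (f x * u x + innerVec (g x) (V x) (Z x))) * volDensity g x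

/-- The functional `𝒢(u, Z)`. -/
def energy {n : ℕ} (Ω : Set (E n)) (g π : Tensor2 n) (r ρ : E n → ℝ) (p : ℝ)
    (f : E n → ℝ) (V : E n → E n) (u : E n → ℝ) (Z : E n → E n) : ℝ :=
  ∫ x in Ω, energyDensity Ω g π r ρ p f V u Z x

/-! ### Regularized cones, weights and cutoffs, with the vertex at the origin -/

/-- The polar angle of `x` measured from the direction `e`. -/
abbrev polar {n : ℕ} (e x : E n) : ℝ := InnerProductGeometry.angle e x

/-- A regularized region between the cones of angles `θ₁` and `θ₂` about `axis`, with vertex `0`: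
a smooth domain that agrees with the region between the cones outside the unit ball, and whose
boundary consists of two disjoint pieces, the boundaries of the inner and of the outer region. -/
structure RegularizedCone (n : ℕ) (θ₁ θ₂ : ℝ) where
  axis : E n
  norm_axis : ‖axis‖ = 1
  /-- the transition region -/
  carrier : Set (E n)
  /-- the inner region -/
  inner : Set (E n)
  /-- the outer region -/
  outer : Set (E n)
  isOpen_carrier : IsOpen carrier
  isOpen_inner : IsOpen inner
  isOpen_outer : IsOpen outer
  isConnected_carrier : IsConnected carrier
  isConnected_inner : IsConnected inner
  isConnected_outer : IsConnected outer
  disjoint_carrier_inner : Disjoint carrier inner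
  disjoint_carrier_outer : Disjoint carrier outer
  disjoint_inner_outer : Disjoint inner outer
  compl_eq : (carrier ∪ inner ∪ outer)ᶜ = frontier inner ∪ frontier outer
  frontier_eq : frontier carrier = frontier inner ∪ frontier outer
  disjoint_frontier : Disjoint (frontier inner) (frontier outer)
  carrier_far : ∀ x, 1 ≤ ‖x‖ → (x ∈ carrier ↔ θ₁ < polar axis x ∧ polar axis x < θ₂)
  inner_far : ∀ x, 1 ≤ ‖x‖ → (x ∈ inner ↔ polar axis x < θ₁)
  outer_far : ∀ x, 1 ≤ ‖x‖ → (x ∈ outer ↔ θ₂ < polar axis x)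
  smooth_boundary : ∀ x ∈ frontier carrier, ∃ F : E n → ℝ,
    ContDiff ℝ ∞ F ∧ fderiv ℝ F x ≠ 0 ∧ ∀ᶠ y in 𝓝 x, (y ∈ carrier ↔ 0 < F y)

/-- The radial weight: a smooth positive function equal to `|x|` outside the unit ball. -/
structure IsRadialWeight {n : ℕ} (r : E n → ℝ) : Prop where
  smooth : ContDiff ℝ ∞ r
  pos : ∀ x, 0 < r x
  far : ∀ x, 1 ≤ ‖x‖ → r x = ‖x‖

/-- The angular defining function `φ`. It is smooth up to the boundary (so it is given with a
smooth extension), positive in the domain, vanishes with nonzero gradient on the boundary, is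
constant along rays outside the unit ball (its superlevel sets are cones there), and is there equal
to `θ - θ₁`, respectively `θ₂ - θ`, near the two parts of the boundary. -/
structure IsAngularWeight {n : ℕ} {θ₁ θ₂ : ℝ} (D : RegularizedCone n θ₁ θ₂)
    (φ : E n → ℝ) : Prop where
  smooth : ContDiff ℝ ∞ φ
  pos : ∀ x ∈ D.carrier, 0 < φ x
  zero : ∀ x ∈ frontier D.carrier, φ x = 0
  grad : ∀ x ∈ frontier D.carrier, fderiv ℝ φ x ≠ 0
  ray : ∀ x ∈ D.carrier, 1 ≤ ‖x‖ → ∀ c : ℝ, 1 ≤ c → φ (c • x) = φ x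
  near : ∃ η > 0, ∀ x ∈ D.carrier, 1 ≤ ‖x‖ →
    (polar D.axis x < θ₁ + η → φ x = polar D.axis x - θ₁) ∧
    (θ₂ - η < polar D.axis x → φ x = θ₂ - polar D.axis x)

/-- The cutoff: smooth, equal to `1` in the inner and to `0` in the outer region, and a function
of the polar angle only outside the unit ball. -/
structure IsCutoff {n : ℕ} {θ₁ θ₂ : ℝ} (D : RegularizedCone n θ₁ θ₂)
    (χ : E n → ℝ) : Prop where
  smooth : ContDiff ℝ ∞ χ
  mem_Icc : ∀ x, χ x ∈ Icc (0 : ℝ) 1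
  one : ∀ x ∈ D.inner, χ x = 1
  zero : ∀ x ∈ D.outer, χ x = 0
  angular : ∃ c : ℝ → ℝ, ∀ x, 1 ≤ ‖x‖ → χ x = c (polar D.axis x)

/-! ### Asymptotically flat data and the rough patch -/

/-- Asymptotically flat data of order `q` on the end `{|y| > R₀}`, in asymptotically flat
coordinates: `g_{ij} = δ_{ij} + O^2(|y|^{-q})` is a Riemannian metric and
`k_{ij} = O^1(|y|^{-q-1})` is symmetric. The values in the ball are irrelevant. -/
structure AFEnd (n : ℕ) (q : ℝ) where
  g : Tensor2 n
  k : Tensor2 n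
  R₀ : ℝ
  R₀_pos : 0 < R₀
  posDef : ∀ y, R₀ < ‖y‖ → (g y).PosDef
  symm : ∀ y, R₀ < ‖y‖ → (k y).IsSymm
  contDiff_g : ∀ i j, ContDiffOn ℝ 2 (fun y => g y i j) {y | R₀ < ‖y‖}
  contDiff_k : ∀ i j, ContDiffOn ℝ 1 (fun y => k y i j) {y | R₀ < ‖y‖}
  decay_g : ∃ C : ℝ, ∀ i j, ∀ m : ℕ, m ≤ 2 → ∀ y, R₀ < ‖y‖ →
    ‖iteratedFDeriv ℝ m (fun z => g z i j - (1 : Matrix (Fin n) (Fin n) ℝ) i j) y‖ ≤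
      C * ‖y‖ ^ (-q - (m : ℝ))
  decay_k : ∃ C : ℝ, ∀ i j, ∀ m : ℕ, m ≤ 1 → ∀ y, R₀ < ‖y‖ →
    ‖iteratedFDeriv ℝ m (fun z => k z i j) y‖ ≤ C * ‖y‖ ^ (-q - 1 - (m : ℝ))

/-- Moves a function given in coordinates centred at the vertex to the vertex `a`: the motion
`y ↦ T (y - a)` takes `a` to the origin. -/
def place {n : ℕ} {F : Type*} (a : E n) (T : E n ≃ₗᵢ[ℝ] E n) (v : E n → F) : E n → F :=
  fun y => v (T (y - a))

/-- The region `Ω = Ω(a)`. -/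
def RegularizedCone.region {n : ℕ} {θ₁ θ₂ : ℝ} (D : RegularizedCone n θ₁ θ₂)
    (a : E n) (T : E n ≃ₗᵢ[ℝ] E n) : Set (E n) :=
  {y | T (y - a) ∈ D.carrier}

/-- The rough patch `χ g + (1 - χ) δ` of the metric with the flat one. -/
def AFEnd.patchMetric {n : ℕ} {q : ℝ} (data : AFEnd n q) (χ : E n → ℝ) : Tensor2 n :=
  fun y => χ y • data.g y + (1 - χ y) • (1 : Matrix (Fin n) (Fin n) ℝ)

/-- The rough patch `χ k` of the second fundamental form with zero. -/
def AFEnd.patchForm {n : ℕ} {q : ℝ} (data : AFEnd n q) (χ : E n → ℝ) : Tensor2 n :=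
  fun y => χ y • data.k y

/-- The momentum tensor of the rough patch. -/
def AFEnd.patchMomentum {n : ℕ} {q : ℝ} (data : AFEnd n q) (χ : E n → ℝ) : Tensor2 n :=
  momentum (data.patchMetric χ) (data.patchForm χ)

/-- Membership of `(u, Z)` in the domain `H_{2,-n+p+2,ρ} × X_{1,-n+p+2,ρ}` of `𝒢`. -/
def MemDomain {n : ℕ} (Ω : Set (E n)) (r ρ : E n → ℝ) (p : ℝ)
    (u : E n → ℝ) (Z : E n → E n) : Prop :=
  MemSobolev Ω r ρ 2 ((n : ℝ) - p - 2) u ∧ MemSobolev Ω r ρ 1 ((n : ℝ) - p - 2) Z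

/-- `(u, Z)` minimizes `𝒢` on its domain. -/
def IsMinimizer {n : ℕ} (Ω : Set (E n)) (g π : Tensor2 n) (r ρ : E n → ℝ) (p : ℝ)
    (f : E n → ℝ) (V : E n → E n) (u : E n → ℝ) (Z : E n → E n) : Prop :=
  MemDomain Ω r ρ p u Z ∧
  ∀ (u' : E n → ℝ) (Z' : E n → E n), MemDomain Ω r ρ p u' Z' →
    energy Ω g π r ρ p f V u Z ≤ energy Ω g π r ρ p f V u' Z'

/-- The conclusion for one region, one set of data and one right-hand side `(f, V)`: the functional
`𝒢` is well defined on its domain (the adjoint exists and the integral converges), it has a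
minimizer, unique up to null sets, and the minimizer `(u, Z)` gives a solution
`h = r^{n-2p} ρ dΦ^{*(1)}[u, Z]`, `τ = r^{n-2p-2} ρ dΦ^{*(2)}[u, Z]` of `dΦ[h, τ] = (f, V)`. -/
def UniquelySolvable {n : ℕ} (Ω : Set (E n)) (g π : Tensor2 n) (r ρ : E n → ℝ) (p : ℝ)
    (f : E n → ℝ) (V : E n → E n) : Prop :=
  (∀ (u : E n → ℝ) (Z : E n → E n), MemDomain Ω r ρ p u Z →
    IsAdjoint Ω g π u Z (adjoint Ω g π u Z) ∧
    IntegrableOn (energyDensity Ω g π r ρ p f V u Z) Ω) ∧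
  ∃ (u : E n → ℝ) (Z : E n → E n),
    IsMinimizer Ω g π r ρ p f V u Z ∧
    (∀ (u' : E n → ℝ) (Z' : E n → E n), IsMinimizer Ω g π r ρ p f V u' Z' →
      u' =ᵐ[volume.restrict Ω] u ∧ Z' =ᵐ[volume.restrict Ω] Z) ∧
    IsLinearSolution Ω g π
      (fun x => (r x ^ ((n : ℝ) - 2 * p) * ρ x) • (adjoint Ω g π u Z).1 x)
      (fun x => (r x ^ ((n : ℝ) - 2 * p - 2) * ρ x) • (adjoint Ω g π u Z).2 x) f V

end Constraint

end

noncomputable section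

namespace Constraint

open ENNReal (ofReal ofReal_mul ofReal_le_ofReal ofReal_ne_top ofReal_sum_of_nonneg ofReal_pow ofReal_add ofReal_one ofReal_coe_nnreal)
open Finset (sum_congr sum_nonneg mul_sum sum_le_sum sum_mul sum_add_distrib sum_comm single_le_sum sum_neg_distrib abs_sum_le_sum_abs mem_insert_self mem_insert_of_mem measurable_fun_sum sum_insert sum_sub_distrib)
open EuclideanSpace (single proj)
open Real (norm_of_nonneg toNNReal norm_eq_abs rpow_add rpow_nonneg rpow_natCast sqrt_pos sq_sqrt sqrt_nonneg rpow_mul rpow_pos_of_pos)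
open Metric (ball closedBall mem_closedBall_self isOpen_ball)
open Filter.Eventually (of_forall)

local notation "Smooth" => ContDiff ℝ ∞
local notation "𝔪" => Measure.restrict volume
local notation "𝟙" => (1 : Matrix (Fin _) (Fin _) ℝ)
local notation "Mat" n:max => Matrix (Fin n) (Fin n) ℝ
local notation "ℓ" n:max s:max => -((n : ℕ) : ℝ) + 2 * s
local notation "Fn" n:max => E n → ℝ
local notation "VF" n:max => E n → E n

/-! ### Lines and the symmetrized gradient -/

/-- Twice the symmetrized gradient of a vector field. -/
def strain {n : ℕ} (Z : VF n) (x : E n) : E n →L[ℝ] E n :=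
  fderiv ℝ Z x + ContinuousLinearMap.adjoint (fderiv ℝ Z x)

lemma continuous_strain {n : ℕ} {Z : VF n} (hZ : Smooth Z) : Continuous (strain Z) := by
  have h : Continuous (fderiv ℝ Z) := hZ.continuous_fderiv (by simp)
  exact h.add ((LinearIsometryEquiv.continuous _).comp h)

lemma abs_inner_fderiv_le {n : ℕ} (Z : VF n) (x v : E n) :
    |inner ℝ (fderiv ℝ Z x v) v| ≤ ‖strain Z x‖ * ‖v‖ ^ 2 := by
  have h : inner ℝ (strain Z x v) v = 2 * inner ℝ (fderiv ℝ Z x v) v := by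
    simp only [strain, add_apply, inner_add_left, ContinuousLinearMap.adjoint_inner_left]
    rw [real_inner_comm v (fderiv ℝ Z x v)]; ring
  have h2 : |inner ℝ (strain Z x v) v| ≤ ‖strain Z x‖ * ‖v‖ ^ 2 := by
    refine (abs_real_inner_le_norm _ _).trans ?_
    rw [pow_two, ← mul_assoc]
    gcongr
    exact ContinuousLinearMap.le_opNorm _ _
  rw [h, abs_mul, abs_two] at h2
  linarith [abs_nonneg (inner ℝ (fderiv ℝ Z x v) v)]

lemma sq_lintegral_mul_le {α : Type*} [MeasurableSpace α] (μ : Measure α) {f g : α → ℝ≥0∞}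
    (hf : AEMeasurable f μ) (hg : AEMeasurable g μ) : (∫⁻ a, f a * g a ∂μ) ^ 2 ≤ (∫⁻ a, f a ^ 2 ∂μ)
    * ∫⁻ a, g a ^ 2 ∂μ := by
  have h := ENNReal.lintegral_mul_le_Lp_mul_Lq μ Real.HolderConjugate.two_two hf hg
  have h2 := pow_le_pow_left₀ zero_le h 2
  refine h2.trans (le_of_eq ?_)
  rw [mul_pow, ← ENNReal.rpow_mul_natCast, ← ENNReal.rpow_mul_natCast]
  norm_num

lemma inner_eq_sub_integral {n : ℕ} {Z : VF n} (hZ : Smooth Z) (x v : E n) : inner ℝ (Z x) v = inner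
    ℝ (Z (x + v)) v - ∫ s in (0 : ℝ)..1, inner ℝ (fderiv ℝ Z (x + s • v) v) v := by
  have hd : ∀ s : ℝ, HasDerivAt (fun s : ℝ => inner ℝ (Z (x + s • v)) v)
      (inner ℝ (fderiv ℝ Z (x + s • v) v) v) s := by
    intro s
    have h1 : HasDerivAt (fun s : ℝ => x + s • v) v s := by
      simpa using ((hasDerivAt_id s).smul_const v).const_add x
    have h2 := ((hZ.differentiable (by simp)) (x + s • v)).hasFDerivAt.comp_hasDerivAt s h1
    simpa using h2.inner ℝ (hasDerivAt_const s v)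
  have hc : Continuous fun s : ℝ => inner ℝ (fderiv ℝ Z (x + s • v) v) v := by
    have h : Continuous (fderiv ℝ Z) := hZ.continuous_fderiv (by simp)
    have h' : Continuous fun s : ℝ => fderiv ℝ Z (x + s • v) := h.comp (by fun_prop)
    fun_prop
  have := intervalIntegral.integral_eq_sub_of_hasDerivAt (fun s _ => hd s)
    (hc.intervalIntegrable 0 1)
  rw [this]; simp

lemma enorm_inner_le {n : ℕ} {Z : VF n} (hZ : Smooth Z) (x v : E n) : ‖inner ℝ (Z x) v‖ₑ ≤ ‖v‖ₑ * ‖Z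
    (x + v)‖ₑ + ‖v‖ₑ ^ 2 * ∫⁻ s in Ioc (0 : ℝ) 1, ‖strain Z (x + s • v)‖ₑ := by
  rw [inner_eq_sub_integral hZ x v]
  refine (enorm_sub_le).trans ?_
  gcongr
  · rw [← ofReal_norm, ← ofReal_norm, ← ofReal_norm, ← ofReal_mul (norm_nonneg _), mul_comm]
    exact ofReal_le_ofReal (norm_inner_le_norm _ _)
  · rw [intervalIntegral.integral_of_le zero_le_one]
    refine (enorm_integral_le_lintegral_enorm _).trans ?_
    rw [← lintegral_const_mul' _ _ (by simp)]
    refine lintegral_mono fun s => ?_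
    rw [← ofReal_norm, ← ofReal_norm, ← ofReal_norm, ← ofReal_pow (norm_nonneg _), ← ofReal_mul
      (by positivity), mul_comm]
    exact ofReal_le_ofReal (abs_inner_fderiv_le _ _ _)

lemma lintegral_inv_add_sq_le {A : ℝ} (hA : 0 < A) : ∫⁻ s in Ioc (0 : ℝ) 1, ofReal (A + s)⁻¹ ^ 2 ≤
    ofReal A⁻¹ := by
  have hd : ∀ s ∈ uIcc (0 : ℝ) 1, HasDerivAt (fun s : ℝ => -(A + s)⁻¹) (((A + s)⁻¹) ^ 2) s := by
    intro s hs
    rw [uIcc_of_le zero_le_one] at hs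
    have hne : A + s ≠ 0 := by linarith [hs.1]
    have h1 : HasDerivAt (fun s : ℝ => A + s) 1 s := by simpa using (hasDerivAt_id s).const_add A
    have := (h1.inv hne).neg
    exact this.congr_deriv (by rw [neg_div, neg_neg, one_div, inv_pow])
  have hcont : ContinuousOn (fun s : ℝ => ((A + s)⁻¹) ^ 2) (uIcc (0 : ℝ) 1) := by
    rw [uIcc_of_le zero_le_one]
    refine ContinuousOn.pow (ContinuousOn.inv₀ (by fun_prop) ?_) 2
    intro s hs
    linarith [hs.1]
  have hI := intervalIntegral.integral_eq_sub_of_hasDerivAt hd hcont.intervalIntegrable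
  have hint : IntegrableOn (fun s : ℝ => ((A + s)⁻¹) ^ 2) (Ioc 0 1) :=
    (intervalIntegrable_iff_integrableOn_Ioc_of_le zero_le_one).1 hcont.intervalIntegrable
  have hl : ∫⁻ s in Ioc (0 : ℝ) 1, ofReal (A + s)⁻¹ ^ 2 = ofReal
      (∫ s in Ioc (0 : ℝ) 1, ((A + s)⁻¹) ^ 2) := by
    rw [ofReal_integral_eq_lintegral_ofReal hint (ae_of_all _ fun s => by positivity)]
    refine setLIntegral_congr_fun measurableSet_Ioc fun s hs => ?_
    have : 0 ≤ (A + s)⁻¹ := by have := hs.1; positivity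
    exact (ofReal_pow this 2).symm
  rw [hl, ← intervalIntegral.integral_of_le zero_le_one, hI]
  apply ofReal_le_ofReal
  have : 0 < (A + 1)⁻¹ := by positivity
  simp; linarith

lemma lintegral_pow_mul_sq_lintegral_le {n : ℕ} {φ : Fn n} (hφ : Continuous φ) (M : ℕ)
    {c : ℝ} (hc : 0 < c) (v : E n) {U V : Set (E n)} (hU : MeasurableSet U) (hV : MeasurableSet V)
    (hpos : ∀ x ∈ U, 0 < φ x) (hmem : ∀ x ∈ U, ∀ s ∈ Icc (0 : ℝ) 1, x + s • v ∈ V)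
    (hgrow : ∀ x ∈ U, ∀ s ∈ Icc (0 : ℝ) 1, c * (φ x + s) ≤ φ (x + s • v))
    {Q : E n → ℝ≥0∞} (hQ : Measurable Q) :
    ∫⁻ x in U, ofReal (φ x ^ (2 * M + 2)) *
        (∫⁻ s in Ioc (0 : ℝ) 1, Q (x + s • v)) ^ 2 ≤
      ofReal (c⁻¹ ^ (2 * M + 4)) *
        ∫⁻ z in V, ofReal (φ z ^ (2 * M + 4)) * Q z ^ 2 := by
  have hmφ : Measurable φ := hφ.measurable
  set H : ℝ → E n → ℝ≥0∞ := fun s z => V.indicator (fun z =>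
    (Iic (φ z / c)).indicator (fun _ => ofReal (c⁻¹ ^ (2 * M + 3)) *
      (ofReal (φ z ^ (2 * M + 3)) * Q z ^ 2)) s) z with hH
  have hHm : Measurable (Function.uncurry H) := by
    have : Function.uncurry H = (({p : ℝ × E n | p.2 ∈ V} ∩ {p : ℝ × E n | p.1 ≤ φ p.2 / c})).indicator
        (fun p => ofReal (c⁻¹ ^ (2 * M + 3)) *
      (ofReal (φ p.2 ^ (2 * M + 3)) * Q p.2 ^ 2)) := by
      ext ⟨s, z⟩
      by_cases h1 : z ∈ V <;> by_cases h2 : s ≤ φ z / c <;> simp [hH, Function.uncurry, h1, h2]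
    rw [this]
    refine Measurable.indicator (by fun_prop) ?_
    exact (measurable_snd hV).inter (measurableSet_le measurable_fst (by fun_prop))
  have hpt : ∀ x ∈ U, ofReal (φ x ^ (2 * M + 2)) *
        (∫⁻ s in Ioc (0 : ℝ) 1, Q (x + s • v)) ^ 2 ≤
        ∫⁻ s in Ioc (0 : ℝ) 1, H s (x + s • v) := by
    intro x hx
    have hφx := hpos x hx
    have h1 : (∫⁻ s in Ioc (0 : ℝ) 1, Q (x + s • v)) ^ 2 ≤
        ofReal (φ x)⁻¹ *
        ∫⁻ s in Ioc (0 : ℝ) 1, (ofReal (φ x + s) * Q (x + s • v)) ^ 2 := by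
      have e : ∫⁻ s in Ioc (0 : ℝ) 1, Q (x + s • v) = ∫⁻ s in Ioc (0 : ℝ) 1,
          ofReal (φ x + s)⁻¹ * (ofReal (φ x + s) * Q (x + s • v)) := by
        refine setLIntegral_congr_fun measurableSet_Ioc fun s hs => ?_
        have : 0 < φ x + s := by linarith [hs.1]
        rw [← mul_assoc, ← ofReal_mul (by positivity), inv_mul_cancel₀ this.ne']
        simp
      rw [e]
      refine (sq_lintegral_mul_le _ (by fun_prop) (by fun_prop)).trans ?_
      gcongr
      exact lintegral_inv_add_sq_le hφx
    calc _ ≤ ofReal (φ x ^ (2 * M + 2)) * (ofReal (φ x)⁻¹ *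
        ∫⁻ s in Ioc (0 : ℝ) 1, (ofReal (φ x + s) * Q (x + s • v)) ^ 2) := by gcongr
      _ = ∫⁻ s in Ioc (0 : ℝ) 1, ofReal (φ x ^ (2 * M + 1)) *
          (ofReal (φ x + s) * Q (x + s • v)) ^ 2 := by
        rw [← mul_assoc, ← ofReal_mul (by positivity),
          lintegral_const_mul' _ _ ofReal_ne_top]
        congr 2
        field_simp
        ring
      _ ≤ _ := by
        refine setLIntegral_mono' measurableSet_Ioc fun s hs => ?_
        have hs' : s ∈ Icc (0 : ℝ) 1 := ⟨hs.1.le, hs.2⟩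
        have hg := hgrow x hx s hs'
        have hs0 : 0 ≤ s := hs.1.le
        have hz : 0 < φ (x + s • v) := lt_of_lt_of_le (by positivity) hg
        have hsz : s ≤ φ (x + s • v) / c := by
          rw [le_div_iff₀ hc]; nlinarith
        have hle : φ x + s ≤ c⁻¹ * φ (x + s • v) := by
          rw [inv_mul_eq_div, le_div_iff₀ hc]; linarith
        simp only [hH, indicator_of_mem (hmem x hx s hs'), mem_Iic, hsz, indicator_of_mem]
        have key : φ x ^ (2 * M + 1) * (φ x + s) ^ 2 ≤
            c⁻¹ ^ (2 * M + 3) * φ (x + s • v) ^ (2 * M + 3) :=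
          calc φ x ^ (2 * M + 1) * (φ x + s) ^ 2
              ≤ (c⁻¹ * φ (x + s • v)) ^ (2 * M + 1) * (c⁻¹ * φ (x + s • v)) ^ 2 := by
                gcongr; linarith
            _ = _ := by ring
        calc ofReal (φ x ^ (2 * M + 1)) *
              (ofReal (φ x + s) * Q (x + s • v)) ^ 2
            = ofReal (φ x ^ (2 * M + 1) * (φ x + s) ^ 2) * Q (x + s • v) ^ 2 := by
              have hp : 0 ≤ φ x + s := by positivity
              rw [mul_pow, ofReal_mul (by positivity),
                ofReal_pow hp, mul_assoc]
          _ ≤ ofReal (c⁻¹ ^ (2 * M + 3) * φ (x + s • v) ^ (2 * M + 3)) *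
              Q (x + s • v) ^ 2 := by gcongr
          _ = _ := by rw [ofReal_mul (by positivity), mul_assoc]
  calc _ ≤ ∫⁻ x in U, ∫⁻ s in Ioc (0 : ℝ) 1, H s (x + s • v) := setLIntegral_mono' hU hpt
    _ ≤ ∫⁻ x, ∫⁻ s in Ioc (0 : ℝ) 1, H s (x + s • v) := setLIntegral_le_lintegral _ _
    _ = ∫⁻ s in Ioc (0 : ℝ) 1, ∫⁻ x, H s (x + s • v) := by
      refine lintegral_lintegral_swap ?_
      exact (hHm.comp (g := Function.uncurry H) (f := fun p : E n × ℝ => (p.2, p.1 + p.2 • v)) (by fun_prop)).aemeasurable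
    _ = ∫⁻ s in Ioc (0 : ℝ) 1, ∫⁻ z, H s z := by
      congr 1; ext s
      exact lintegral_add_right_eq_self (fun z => H s z) (s • v)
    _ = ∫⁻ z, ∫⁻ s in Ioc (0 : ℝ) 1, H s z := by
      refine lintegral_lintegral_swap hHm.aemeasurable
    _ ≤ ∫⁻ z, V.indicator (fun z => ofReal (c⁻¹ ^ (2 * M + 4)) *
          (ofReal (φ z ^ (2 * M + 4)) * Q z ^ 2)) z := by
      refine lintegral_mono fun z => ?_
      by_cases hz : z ∈ V
      swap
      · simp [hH, hz]
      simp only [hH, indicator_of_mem hz]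
      rw [lintegral_indicator measurableSet_Iic, setLIntegral_const]
      have hvol : (𝔪 (Ioc (0:ℝ) 1)) (Iic (φ z / c)) ≤ ofReal (c⁻¹ * φ z) := by
        rw [Measure.restrict_apply measurableSet_Iic, inv_mul_eq_div]
        refine (measure_mono (t := Ioc 0 (φ z / c)) fun s hs => ⟨hs.2.1, hs.1⟩).trans ?_
        simp
      refine (mul_le_mul_right hvol _).trans ?_
      rcases le_or_gt (φ z) 0 with h0 | h0
      · have : ofReal (c⁻¹ * φ z) = 0 := by
          rw [ENNReal.ofReal_eq_zero]; exact mul_nonpos_of_nonneg_of_nonpos (by positivity) h0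
        simp [this]
      · apply le_of_eq
        have : ofReal (c⁻¹ ^ (2 * M + 4)) * ofReal (φ z ^ (2 * M + 4)) =
          ofReal (c⁻¹ ^ (2 * M + 3)) * ofReal (φ z ^ (2 * M + 3)) *
            ofReal (c⁻¹ * φ z) := by
          rw [← ofReal_mul (by positivity), ← ofReal_mul (by positivity),
            ← ofReal_mul (by positivity)]
          congr 1; ring
        rw [← mul_assoc, ← mul_assoc, this]; ring
    _ = _ := by
      rw [lintegral_indicator hV, lintegral_const_mul' _ _ ofReal_ne_top]

lemma ennreal_add_sq_le (a b : ℝ≥0∞) : (a + b) ^ 2 ≤ 2 * (a ^ 2 + b ^ 2) := by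
  have := ENNReal.rpow_add_le_mul_rpow_add_rpow a b (p := 2) (by norm_num)
  norm_num at this
  exact_mod_cast this

lemma lintegral_inner_sq_le {n : ℕ} {φ : Fn n} (hφ : Continuous φ) (M : ℕ)
    {c : ℝ} (hc : 0 < c) (v : E n) {U V K : Set (E n)} (hU : MeasurableSet U)
    (hV : MeasurableSet V) (hK : MeasurableSet K)
    (hpos : ∀ x ∈ U, 0 < φ x) (hmem : ∀ x ∈ U, ∀ s ∈ Icc (0 : ℝ) 1, x + s • v ∈ V)
    (hgrow : ∀ x ∈ U, ∀ s ∈ Icc (0 : ℝ) 1, c * (φ x + s) ≤ φ (x + s • v))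
    (hend : ∀ x ∈ U, x + v ∈ K) :
    ∃ C : NNReal, ∀ Z : VF n, Smooth Z →
      ∫⁻ x in U, ofReal (φ x ^ (2 * M + 2)) * ‖inner ℝ (Z x) v‖ₑ ^ 2 ≤
        C * ((∫⁻ z in V, ofReal (φ z ^ (2 * M + 4)) * ‖strain Z z‖ₑ ^ 2) +
          ∫⁻ z in K, ofReal (φ z ^ (2 * M + 2)) * ‖Z z‖ₑ ^ 2) := by
  set C1 : NNReal := 2 * ‖v‖₊ ^ 2 * toNNReal (c⁻¹ ^ (2 * M + 2)) with hC1
  set C2 : NNReal := 2 * ‖v‖₊ ^ 4 * toNNReal (c⁻¹ ^ (2 * M + 4)) with hC2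
  refine ⟨C1 + C2, fun Z hZ => ?_⟩
  have hmφ : Measurable φ := hφ.measurable
  have hmZ : Measurable Z := hZ.continuous.measurable
  have hmq : Measurable fun z => ‖strain Z z‖ₑ := (continuous_strain hZ).measurable.enorm
  have hpt : ∀ x ∈ U, ofReal (φ x ^ (2 * M + 2)) * ‖inner ℝ (Z x) v‖ₑ ^ 2 ≤
      C1 * (K.indicator (fun z => ofReal (φ z ^ (2 * M + 2)) * ‖Z z‖ₑ ^ 2) (x + v)) +
      2 * ‖v‖ₑ ^ 4 * (ofReal (φ x ^ (2 * M + 2)) *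
        (∫⁻ s in Ioc (0 : ℝ) 1, ‖strain Z (x + s • v)‖ₑ) ^ 2) := by
    intro x hx
    have h0 := hpos x hx
    have hg := hgrow x hx 1 (by simp)
    rw [one_smul] at hg
    have hle : φ x ≤ c⁻¹ * φ (x + v) := by
      rw [inv_mul_eq_div, le_div_iff₀ hc]; nlinarith
    rw [indicator_of_mem (hend x hx)]
    calc _ ≤ ofReal (φ x ^ (2 * M + 2)) * (2 * ((‖v‖ₑ * ‖Z (x + v)‖ₑ) ^ 2 +
          (‖v‖ₑ ^ 2 * ∫⁻ s in Ioc (0 : ℝ) 1, ‖strain Z (x + s • v)‖ₑ) ^ 2)) := by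
          gcongr
          exact (pow_le_pow_left₀ zero_le (enorm_inner_le hZ x v) 2).trans (ennreal_add_sq_le _ _)
      _ = 2 * ‖v‖ₑ ^ 2 * ofReal (φ x ^ (2 * M + 2)) * ‖Z (x + v)‖ₑ ^ 2 +
          2 * ‖v‖ₑ ^ 4 * (ofReal (φ x ^ (2 * M + 2)) *
        (∫⁻ s in Ioc (0 : ℝ) 1, ‖strain Z (x + s • v)‖ₑ) ^ 2) := by ring
      _ ≤ 2 * ‖v‖ₑ ^ 2 * ofReal ((c⁻¹ * φ (x + v)) ^ (2 * M + 2)) * ‖Z (x + v)‖ₑ ^ 2 +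
          2 * ‖v‖ₑ ^ 4 * (ofReal (φ x ^ (2 * M + 2)) *
        (∫⁻ s in Ioc (0 : ℝ) 1, ‖strain Z (x + s • v)‖ₑ) ^ 2) := by gcongr
      _ = _ := by
          congr 1
          rw [mul_pow, ofReal_mul (by positivity), hC1]
          push_cast
          simp only [ofReal, enorm]
          ring
  have hswap : ∫⁻ x in U, K.indicator
      (fun z => ofReal (φ z ^ (2 * M + 2)) * ‖Z z‖ₑ ^ 2) (x + v) ≤
      ∫⁻ z in K, ofReal (φ z ^ (2 * M + 2)) * ‖Z z‖ₑ ^ 2 := by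
    refine (setLIntegral_le_lintegral _ _).trans (le_of_eq ?_)
    rw [lintegral_add_right_eq_self (fun x => K.indicator
      (fun z => ofReal (φ z ^ (2 * M + 2)) * ‖Z z‖ₑ ^ 2) x) v, lintegral_indicator hK]
  have hH := lintegral_pow_mul_sq_lintegral_le hφ M hc v hU hV hpos hmem hgrow hmq
  calc _ ≤ ∫⁻ x in U, (C1 * (K.indicator
        (fun z => ofReal (φ z ^ (2 * M + 2)) * ‖Z z‖ₑ ^ 2) (x + v)) +
      2 * ‖v‖ₑ ^ 4 * (ofReal (φ x ^ (2 * M + 2)) *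
        (∫⁻ s in Ioc (0 : ℝ) 1, ‖strain Z (x + s • v)‖ₑ) ^ 2)) := setLIntegral_mono' hU hpt
    _ = C1 * (∫⁻ x in U, K.indicator
        (fun z => ofReal (φ z ^ (2 * M + 2)) * ‖Z z‖ₑ ^ 2) (x + v)) +
      2 * ‖v‖ₑ ^ 4 * ∫⁻ x in U, (ofReal (φ x ^ (2 * M + 2)) *
        (∫⁻ s in Ioc (0 : ℝ) 1, ‖strain Z (x + s • v)‖ₑ) ^ 2) := by
      rw [lintegral_add_left', lintegral_const_mul' _ _ (by simp), lintegral_const_mul' _ _ ?_]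
      · exact ENNReal.mul_ne_top (by simp) (by simp)
      · refine (Measurable.const_mul ?_ _).aemeasurable
        exact (Measurable.indicator (by fun_prop) hK).comp (by fun_prop)
    _ ≤ C1 * (∫⁻ z in K, ofReal (φ z ^ (2 * M + 2)) * ‖Z z‖ₑ ^ 2) +
      2 * ‖v‖ₑ ^ 4 * (ofReal (c⁻¹ ^ (2 * M + 4)) *
        ∫⁻ z in V, ofReal (φ z ^ (2 * M + 4)) * ‖strain Z z‖ₑ ^ 2) := by gcongr
    _ = C1 * (∫⁻ z in K, ofReal (φ z ^ (2 * M + 2)) * ‖Z z‖ₑ ^ 2) +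
      C2 * ∫⁻ z in V, ofReal (φ z ^ (2 * M + 4)) * ‖strain Z z‖ₑ ^ 2 := by
      rw [hC2, ← mul_assoc]; push_cast; rfl
    _ ≤ _ := by
      push_cast
      rw [mul_add, add_comm]
      gcongr
      · exact le_add_self
      · exact le_self_add

lemma enorm_sq_le_sum_inner {n : ℕ} {η : ℝ} (hη : 0 < η) (v z : E n) : ‖z‖ₑ ^ 2 ≤ ofReal
    (2 * η⁻¹ ^ 2) * ∑ k : Fin n,
      (‖inner ℝ z (v + η • single k (1 : ℝ))‖ₑ ^ 2 + ‖inner ℝ z v‖ₑ ^ 2) := by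
  have hreal : ‖z‖ ^ 2 ≤ (2 * η⁻¹ ^ 2) * ∑ k : Fin n,
      (‖inner ℝ z (v + η • single k (1 : ℝ))‖ ^ 2 + ‖inner ℝ z v‖ ^ 2) := by
    rw [EuclideanSpace.norm_sq_eq, mul_sum]
    refine sum_le_sum fun k _ => ?_
    have h1 : inner ℝ z (v + η • single k (1 : ℝ)) = inner ℝ z v + η * z k := by
      rw [inner_add_right, inner_smul_right, EuclideanSpace.inner_single_right]
      simp
    have h2 : z k = η⁻¹ * ((inner ℝ z v + η * z k) - inner ℝ z v) := by field_simp; ring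
    rw [h1, norm_eq_abs, norm_eq_abs, norm_eq_abs, sq_abs, sq_abs, sq_abs]
    nth_rewrite 1 [h2]
    rw [mul_pow, mul_comm (2 : ℝ), mul_assoc]
    gcongr
    nlinarith [sq_nonneg ((inner ℝ z v + η * z k) + inner ℝ z v)]
  have e : ∀ y : ℝ, ‖y‖ₑ ^ 2 = ofReal (‖y‖ ^ 2) := fun y => by
    rw [← ofReal_norm, ofReal_pow (norm_nonneg _)]
  rw [← ofReal_norm, ← ofReal_pow (norm_nonneg _)]
  refine (ofReal_le_ofReal hreal).trans (le_of_eq ?_)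
  rw [ofReal_mul (by positivity), ofReal_sum_of_nonneg (fun _ _ => by positivity)]
  congr 1
  refine sum_congr rfl fun k _ => ?_
  rw [e, e, ofReal_add (by positivity) (by positivity)]

lemma lintegral_norm_sq_le_of_segments {n : ℕ} {φ : Fn n} (hφ : Continuous φ) (M : ℕ)
    {c η : ℝ} (hc : 0 < c) (hη : 0 < η) (w : E n) {U V K : Set (E n)} (hU : MeasurableSet U)
    (hV : MeasurableSet V) (hK : MeasurableSet K)
    (hpos : ∀ x ∈ U, 0 < φ x)
    (hmem : ∀ x ∈ U, ∀ v, ‖v - w‖ ≤ η → ∀ s ∈ Icc (0 : ℝ) 1, x + s • v ∈ V)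
    (hgrow : ∀ x ∈ U, ∀ v, ‖v - w‖ ≤ η → ∀ s ∈ Icc (0 : ℝ) 1, c * (φ x + s) ≤ φ (x + s • v))
    (hend : ∀ x ∈ U, ∀ v, ‖v - w‖ ≤ η → x + v ∈ K) :
    ∃ C : NNReal, ∀ Z : VF n, Smooth Z → ∫⁻ x in U, ofReal (φ x ^ (2 * M + 2)) * ‖Z x‖ₑ ^ 2 ≤ C *
        ((∫⁻ z in V, ofReal (φ z ^ (2 * M + 4)) * ‖strain Z z‖ₑ ^ 2) + ∫⁻ z in K, ofReal
          (φ z ^ (2 * M + 2)) * ‖Z z‖ₑ ^ 2) := by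
  have key : ∀ v : E n, ‖v - w‖ ≤ η → _ := fun v hv => lintegral_inner_sq_le hφ M hc v hU hV hK hpos
    (fun x hx => hmem x hx v hv) (fun x hx => hgrow x hx v hv) (fun x hx => hend x hx v hv)
  have hw : ‖w - w‖ ≤ η := by simp [hη.le]
  have hwk : ∀ k : Fin n, ‖(w + η • single k (1 : ℝ)) - w‖ ≤ η := fun k => by
    simp [norm_smul, abs_of_pos hη]
  obtain ⟨C0, hC0⟩ := key w hw
  choose C hC using fun k => key _ (hwk k)
  refine ⟨toNNReal (2 * η⁻¹ ^ 2) * ∑ k, (C k + C0), fun Z hZ => ?_⟩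
  set R := ((∫⁻ z in V, ofReal (φ z ^ (2 * M + 4)) * ‖strain Z z‖ₑ ^ 2) + ∫⁻ z in K, ofReal
          (φ z ^ (2 * M + 2)) * ‖Z z‖ₑ ^ 2)
  have hmφ : Measurable φ := hφ.measurable
  have hmZ : Measurable Z := hZ.continuous.measurable
  have hm : ∀ v : E n, Measurable fun x => ‖inner ℝ (Z x) v‖ₑ := fun v =>
    (hZ.continuous.inner continuous_const).measurable.enorm
  calc _ ≤ ∫⁻ x in U, ofReal (2 * η⁻¹ ^ 2) * ∑ k : Fin n, (ofReal (φ x ^ (2 * M + 2)) * ‖inner ℝ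
        (Z x) (w + η • single k (1 : ℝ))‖ₑ ^ 2 + ofReal (φ x ^ (2 * M + 2)) * ‖inner ℝ (Z x) w‖ₑ ^
        2) := by
        refine lintegral_mono fun x => ?_
        refine (mul_le_mul_right (enorm_sq_le_sum_inner hη w (Z x)) _).trans (le_of_eq ?_)
        rw [mul_left_comm, mul_sum]
        simp only [mul_add]
    _ = ofReal (2 * η⁻¹ ^ 2) * ∑ k : Fin n, ((∫⁻ x in U, ofReal (φ x ^ (2 * M + 2)) * ‖inner ℝ (Z x)
        (w + η • single k (1 : ℝ))‖ₑ ^ 2) + ∫⁻ x in U, ofReal (φ x ^ (2 * M + 2)) * ‖inner ℝ (Z x)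
        w‖ₑ ^ 2) := by
        rw [lintegral_const_mul' _ _ ofReal_ne_top, lintegral_finsetSum]
        · congr 1
          refine sum_congr rfl fun k _ => ?_
          rw [lintegral_add_left]
          have := hm (w + η • single k (1 : ℝ))
          fun_prop
        · intro k _
          have := hm (w + η • single k (1 : ℝ))
          have := hm w
          fun_prop
    _ ≤ ofReal (2 * η⁻¹ ^ 2) * ∑ k : Fin n, (C k * R + C0 * R) := by
        gcongr with k _
        · exact hC k Z hZ
        · exact hC0 Z hZ
    _ = _ := by
        push_cast
        simp only [← add_mul, ← sum_mul, ofReal, mul_assoc]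

/-! ### Cone domains: estimates far from the vertex -/

/-- A connected domain that is a cone outside the unit ball, with a defining function that is
constant along rays there, and a radial weight. -/
structure ConeDomain {n : ℕ} (Ω : Set (E n)) (φ r : Fn n) : Prop where
  isOpen : IsOpen Ω
  isPreconnected : IsPreconnected Ω
  far_point : ∃ x ∈ Ω, 1 < ‖x‖
  smooth : Smooth φ
  pos : ∀ x ∈ Ω, 0 < φ x
  zero : ∀ x ∈ frontier Ω, φ x = 0
  grad : ∀ x ∈ frontier Ω, fderiv ℝ φ x ≠ 0
  cone : ∀ x, 1 ≤ ‖x‖ → ∀ c : ℝ, 1 ≤ c → (c • x ∈ Ω ↔ x ∈ Ω)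
  ray : ∀ x ∈ Ω, 1 ≤ ‖x‖ → ∀ c : ℝ, 1 ≤ c → φ (c • x) = φ x
  weight_smooth : Smooth r
  weight_pos : ∀ x, 0 < r x
  weight_far : ∀ x, 1 ≤ ‖x‖ → r x = ‖x‖

lemma lintegral_comp_pos_smul {n : ℕ} {c : ℝ} (hc : 0 < c) (f : E n → ℝ≥0∞) : ∫⁻ x, f (c • x) =
    ofReal (c⁻¹ ^ n) * ∫⁻ x, f x := by
  have hm : Measure.map (fun x : E n => c • x) volume = ofReal (c⁻¹ ^ n) •
      (volume : Measure (E n)) := by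
    have h := Measure.map_linearMap_addHaar_eq_smul_addHaar (volume : Measure (E n))
      (f := c • (LinearMap.id : E n →ₗ[ℝ] E n)) (by simp [hc.ne'])
    simp only [LinearMap.det_smul, LinearMap.det_id, mul_one, finrank_euclideanSpace_fin] at h
    rw [abs_of_pos (by positivity), ← inv_pow] at h
    exact h
  have he : MeasurableEmbedding fun x : E n => c • x :=
    (Homeomorph.smulOfNeZero c hc.ne').measurableEmbedding
  rw [← he.lintegral_map f, hm, lintegral_smul_measure]; rfl

lemma lintegral_comp_homothety {n : ℕ} {c : ℝ} (hc : 0 < c) (y : E n) (f : E n → ℝ≥0∞) : ∫⁻ x, f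
    (y + c • (x - y)) = ofReal (c⁻¹ ^ n) * ∫⁻ x, f x := by
  have h1 := lintegral_sub_right_eq_self (μ := (volume : Measure (E n))) (fun x => f (y + c • x)) y
  have h2 := lintegral_comp_pos_smul hc (fun x => f (y + x))
  have h3 := lintegral_add_left_eq_self (μ := (volume : Measure (E n))) f y
  rw [h1, h2, h3]

lemma enorm_inner_le_lintegral_homothety {n : ℕ} {Z : VF n} (hZ : Smooth Z)
    (hs : HasCompactSupport Z) (x y : E n) : ‖inner ℝ (Z x) (x - y)‖ₑ ≤ ‖x - y‖ₑ ^ 2 *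
      ∫⁻ l in Ioi (1 : ℝ), ‖strain Z (y + l • (x - y))‖ₑ := by
  set v := x - y with hv
  rcases eq_or_ne v 0 with h0 | h0
  · simp [h0]
  have hd : ∀ s : ℝ, HasDerivAt (fun s : ℝ => inner ℝ (Z (y + s • v)) v)
      (inner ℝ (fderiv ℝ Z (y + s • v) v) v) s := by
    intro s
    have h1 : HasDerivAt (fun s : ℝ => y + s • v) v s := by
      simpa using ((hasDerivAt_id s).smul_const v).const_add y
    have h2 := ((hZ.differentiable (by simp)) (y + s • v)).hasFDerivAt.comp_hasDerivAt s h1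
    simpa using h2.inner ℝ (hasDerivAt_const s v)
  have hc : Continuous fun s : ℝ => inner ℝ (fderiv ℝ Z (y + s • v) v) v := by
    have h : Continuous (fderiv ℝ Z) := hZ.continuous_fderiv (by simp)
    have h' : Continuous fun s : ℝ => fderiv ℝ Z (y + s • v) := h.comp (by fun_prop)
    fun_prop
  obtain ⟨R, hR⟩ := hs.isCompact.isBounded.subset_closedBall 0
  obtain ⟨L, hL1, hL⟩ : ∃ L : ℝ, 1 ≤ L ∧ Z (y + L • v) = 0 := by
    have hvp : 0 < ‖v‖ := norm_pos_iff.2 h0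
    refine ⟨max 1 ((|R| + ‖y‖ + 1) / ‖v‖), le_max_left _ _, ?_⟩
    set L := max 1 ((|R| + ‖y‖ + 1) / ‖v‖)
    by_contra hne
    have hmem := hR (subset_tsupport _ hne)
    rw [mem_closedBall_zero_iff] at hmem
    have h1 : |R| + ‖y‖ + 1 ≤ L * ‖v‖ := by rw [← div_le_iff₀ hvp]; exact le_max_right _ _
    have hL0 : 0 ≤ L := zero_le_one.trans (le_max_left _ _)
    have h2 : L * ‖v‖ ≤ ‖y + L • v‖ + ‖y‖ := by
      have := norm_sub_le (y + L • v) y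
      rwa [add_sub_cancel_left, norm_smul, norm_of_nonneg hL0] at this
    linarith [le_abs_self R]
  have hI := intervalIntegral.integral_eq_sub_of_hasDerivAt (fun s _ => hd s)
    (hc.intervalIntegrable 1 L)
  have hx : y + (1 : ℝ) • v = x := by simp [hv]
  rw [hL, hx, inner_zero_left, zero_sub, intervalIntegral.integral_of_le hL1] at hI
  rw [← enorm_neg, ← hI]
  refine (enorm_integral_le_lintegral_enorm _).trans ?_
  refine (lintegral_mono_set Ioc_subset_Ioi_self).trans ?_
  rw [← lintegral_const_mul' _ _ (by simp)]
  refine lintegral_mono fun s => ?_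
  rw [← ofReal_norm, ← ofReal_norm, ← ofReal_norm, ← ofReal_pow (norm_nonneg _), ← ofReal_mul
    (by positivity), mul_comm]
  exact ofReal_le_ofReal (abs_inner_fderiv_le _ _ _)

lemma sq_lintegral_Ioi_le {α : ℝ} (hα : 0 < α) : ∃ C : NNReal, ∀ Q : ℝ → ℝ≥0∞, Measurable Q →
    (∫⁻ l in Ioi (1 : ℝ), Q l) ^ 2 ≤ C * ∫⁻ l in Ioi (1 : ℝ), ofReal (l ^ (1 + 2 * α)) * Q l ^
      2 := by
  have hint : IntegrableOn (fun l : ℝ => l ^ (-(1 + 2 * α))) (Ioi 1) := integrableOn_Ioi_rpow_of_lt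
    (by linarith) one_pos
  have hfin : ∫⁻ l in Ioi (1 : ℝ), ofReal (l ^ (-(1 + 2 * α))) < ⊤ := hint.lintegral_lt_top
  refine ⟨(∫⁻ l in Ioi (1 : ℝ), ofReal (l ^ (-(1 + 2 * α)))).toNNReal, fun Q hQ => ?_⟩
  rw [ENNReal.coe_toNNReal hfin.ne]
  set a : ℝ := (1 + 2 * α) / 2 with ha
  have e : ∫⁻ l in Ioi (1 : ℝ), Q l = ∫⁻ l in Ioi (1 : ℝ), ofReal (l ^ (-a)) *
      (ofReal (l ^ a) * Q l) := by
    refine setLIntegral_congr_fun measurableSet_Ioi fun l hl => ?_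
    have hl0 : 0 < l := zero_lt_one.trans hl
    rw [← mul_assoc, ← ofReal_mul (by positivity), ← rpow_add hl0]
    simp
  rw [e]
  refine (sq_lintegral_mul_le _ (by fun_prop) (by fun_prop)).trans (le_of_eq ?_)
  congr 1
  · refine setLIntegral_congr_fun measurableSet_Ioi fun l hl => ?_
    have hl0 : 0 < l := zero_lt_one.trans hl
    rw [← ofReal_pow (by positivity), ← rpow_natCast, ← rpow_mul hl0.le]
    congr 2; rw [ha]; push_cast; ring
  · refine setLIntegral_congr_fun measurableSet_Ioi fun l hl => ?_
    have hl0 : 0 < l := zero_lt_one.trans hl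
    rw [mul_pow, ← ofReal_pow (by positivity), ← rpow_natCast, ← rpow_mul hl0.le]
    congr 3; rw [ha]; push_cast; ring

lemma rpow_le_of_comparable {R s t : ℝ} (e : ℝ) (hR : 1 ≤ R) (hs : 0 < s) (hst : s ≤ t)
    (hts : t ≤ R * s) : s ^ e ≤ R ^ |e| * t ^ e := by
  have ht : 0 < t := hs.trans_le hst
  rcases le_total 0 e with h | h
  · have h1 : s ^ e ≤ t ^ e := Real.rpow_le_rpow hs.le hst h
    have h2 : (1 : ℝ) ≤ R ^ |e| := Real.one_le_rpow hR (abs_nonneg _)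
    nlinarith [rpow_nonneg ht.le e]
  · rw [abs_of_nonpos h]
    have h1 : (R * s) ^ e ≤ t ^ e := Real.rpow_le_rpow_of_nonpos ht hts h
    rw [Real.mul_rpow (by linarith) hs.le] at h1
    have hRp : 0 < R ^ (-e) := rpow_pos_of_pos (by linarith) _
    have h2 := mul_le_mul_of_nonneg_left h1 hRp.le
    rw [← mul_assoc, ← rpow_add (by linarith)] at h2
    simpa using h2

lemma measurable_uncurry_indicator {X : Type*} [MeasurableSpace X] {F : Set X}
    (hF : MeasurableSet F) {g : X → ℝ} (hg : Measurable g) {G : X → ℝ≥0∞} (hG : Measurable G) :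
    Measurable (Function.uncurry fun (l : ℝ) (z : X) => F.indicator
      (fun z => (Iio (g z)).indicator (fun _ => G z) l) z) := by
  have : (Function.uncurry fun (l : ℝ) (z : X) => F.indicator
      (fun z => (Iio (g z)).indicator (fun _ => G z) l) z) =
      ({p : ℝ × X | p.2 ∈ F} ∩ {p : ℝ × X | p.1 < g p.2}).indicator (fun p => G p.2) := by
    ext ⟨s, z⟩
    by_cases h1 : z ∈ F <;> by_cases h2 : s < g z <;> simp [Function.uncurry, h1, h2]
  rw [this]
  refine Measurable.indicator (by fun_prop) ?_
  exact (measurable_snd hF).inter (measurableSet_lt measurable_fst (by fun_prop))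

/-- The part of the domain far from the vertex. -/
abbrev farPart {n : ℕ} (Ω : Set (E n)) : Set (E n) := Ω ∩ {z | 1 < ‖z‖}

def farEnergy {n : ℕ} (Ω : Set (E n)) (φ : Fn n) (M : ℕ) (τ : ℝ) (Z : VF n) : ℝ≥0∞ :=
  ∫⁻ z in farPart Ω, ofReal (φ z ^ (2 * M + 4) * ‖z‖ ^ τ) * ‖strain Z z‖ₑ ^ 2

lemma lintegral_inner_sq_le_farEnergy {n : ℕ} {Ω : Set (E n)} {φ r : Fn n}
    (D : ConeDomain Ω φ r) (M : ℕ) {α : ℝ} (hα : 0 < α) {U B : Set (E n)} (hU : MeasurableSet U)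
    (y : E n) {m R : ℝ} (hm : 0 < m)
    (hB : ∀ w ∈ B, w ∈ Ω ∧ 1 < ‖w‖ ∧ ‖w‖ ≤ R ∧ m ≤ φ w)
    (hUB : ∀ x ∈ U, ∀ l : ℝ, 1 < l → x - (1 - l⁻¹) • y ∈ B) (hUR : ∀ x ∈ U, ‖x - y‖ ≤ R) :
    ∃ C : NNReal, ∀ Z : VF n, Smooth Z → HasCompactSupport Z →
      ∫⁻ x in U, ‖inner ℝ (Z x) (x - y)‖ₑ ^ 2 ≤
        C * farEnergy Ω φ M (2 + 2 * α - n) Z := by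
  obtain ⟨Cα, hCα⟩ := sq_lintegral_Ioi_le hα
  set e : ℝ := 1 + 2 * α - n with he
  set k : ℝ := (max R 1) ^ |e| * m⁻¹ ^ (2 * M + 4) with hk
  have hk0 : 0 ≤ k := by positivity
  set C0 : ℝ≥0∞ := ofReal R ^ 4 * Cα * ofReal k with hC0
  have hC0top : C0 ≠ ⊤ := by
    simp [hC0, ENNReal.mul_eq_top]
  refine ⟨C0.toNNReal, fun Z hZ hs => ?_⟩
  rw [ENNReal.coe_toNNReal hC0top]
  have hmq : Measurable fun z => ‖strain Z z‖ₑ := (continuous_strain hZ).measurable.enorm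
  have hmφ : Measurable φ := D.smooth.continuous.measurable
  have hfm : MeasurableSet (farPart Ω) :=
    D.isOpen.measurableSet.inter (measurableSet_lt measurable_const measurable_norm)
  set G : E n → ℝ≥0∞ := fun z => ofReal (φ z ^ (2 * M + 4) * ‖z‖ ^ e) * ‖strain Z z‖ₑ ^ 2
    with hG
  set H : ℝ → E n → ℝ≥0∞ := fun l z =>
    (farPart Ω).indicator (fun z => (Iio ‖z‖).indicator (fun _ => G z) l) z with hH
  have hGm : Measurable G := by fun_prop
  have hHm : Measurable (Function.uncurry H) := measurable_uncurry_indicator hfm measurable_norm hGm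
  have hpt : ∀ x ∈ U, ‖inner ℝ (Z x) (x - y)‖ₑ ^ 2 ≤ C0 *
      ∫⁻ l in Ioi (1 : ℝ), ofReal (l ^ (n : ℝ)) * H l (y + l • (x - y)) := by
    intro x hx
    have hxR : ‖x - y‖ₑ ≤ ofReal R := by
      rw [← ofReal_norm]; exact ofReal_le_ofReal (hUR x hx)
    have hmeas : Measurable fun l : ℝ => ‖strain Z (y + l • (x - y))‖ₑ :=
      hmq.comp (by fun_prop)
    calc _ ≤ (‖x - y‖ₑ ^ 2 * ∫⁻ l in Ioi (1 : ℝ), ‖strain Z (y + l • (x - y))‖ₑ) ^ 2 :=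
          pow_le_pow_left₀ zero_le (enorm_inner_le_lintegral_homothety hZ hs x y) 2
      _ ≤ (ofReal R ^ 2) ^ 2 * (Cα * ∫⁻ l in Ioi (1 : ℝ),
            ofReal (l ^ (1 + 2 * α)) * ‖strain Z (y + l • (x - y))‖ₑ ^ 2) := by
          rw [mul_pow]
          gcongr
          exact hCα _ hmeas
      _ ≤ (ofReal R ^ 2) ^ 2 * (Cα * (ofReal k * ∫⁻ l in Ioi (1 : ℝ),
            ofReal (l ^ (n : ℝ)) * H l (y + l • (x - y)))) := by
          rw [← lintegral_const_mul' _ _ ofReal_ne_top]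
          refine mul_le_mul_right (mul_le_mul_right ?_ _) _
          refine setLIntegral_mono' measurableSet_Ioi fun l hl => ?_
          have hl1 : 1 < l := hl
          have hl0 : 0 < l := zero_lt_one.trans hl1
          obtain ⟨hwΩ, hw1, hwR, hwm⟩ := hB _ (hUB x hx l hl1)
          set w := x - (1 - l⁻¹) • y with hw
          have hz : y + l • (x - y) = l • w := by
            rw [hw, smul_sub, smul_sub, smul_smul, mul_sub, mul_inv_cancel₀ hl0.ne', mul_one,
              sub_smul, one_smul]
            abel
          rw [hz]
          have hzn : ‖l • w‖ = l * ‖w‖ := by rw [norm_smul, norm_of_nonneg hl0.le]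
          have hzfar : l • w ∈ farPart Ω := by
            refine ⟨(D.cone w hw1.le l hl1.le).2 hwΩ, ?_⟩
            rw [mem_ofPred_eq, hzn]; nlinarith
          have hlz : l < ‖l • w‖ := by rw [hzn]; nlinarith
          have hφz : φ (l • w) = φ w := D.ray w hwΩ hw1.le l hl1.le
          simp only [hH, indicator_of_mem hzfar, mem_Iio, hlz, indicator_of_mem, hG]
          rw [← mul_assoc, ← mul_assoc, ← ofReal_mul (by positivity),
            ← ofReal_mul (by positivity)]
          gcongr
          have h1 : l ^ e ≤ (max R 1) ^ |e| * ‖l • w‖ ^ e := by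
            refine rpow_le_of_comparable e (le_max_right _ _) hl0 hlz.le ?_
            rw [hzn, mul_comm]
            gcongr
            exact hwR.trans (le_max_left _ _)
          have h2 : 1 ≤ m⁻¹ ^ (2 * M + 4) * φ (l • w) ^ (2 * M + 4) := by
            rw [hφz, ← mul_pow]
            refine one_le_pow₀ ?_
            rw [inv_mul_eq_div, one_le_div hm]; exact hwm
          have h3 : l ^ (1 + 2 * α) = l ^ (n : ℝ) * l ^ e := by
            rw [← rpow_add hl0, he]; congr 1; ring
          rw [h3, hk]
          have hp1 : 0 ≤ l ^ (n : ℝ) := by positivity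
          have hp2 : 0 ≤ l ^ e := by positivity
          calc l ^ (n : ℝ) * l ^ e ≤ l ^ (n : ℝ) * ((max R 1) ^ |e| * ‖l • w‖ ^ e) *
                (m⁻¹ ^ (2 * M + 4) * φ (l • w) ^ (2 * M + 4)) := by
                refine (le_mul_of_one_le_right (by positivity) h2).trans ?_
                gcongr
            _ = _ := by ring
      _ = _ := by rw [hC0]; ring
  calc _ ≤ ∫⁻ x in U, C0 *
      ∫⁻ l in Ioi (1 : ℝ), ofReal (l ^ (n : ℝ)) * H l (y + l • (x - y)) :=
        setLIntegral_mono' hU hpt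
    _ ≤ ∫⁻ x, C0 *
      ∫⁻ l in Ioi (1 : ℝ), ofReal (l ^ (n : ℝ)) * H l (y + l • (x - y)) :=
        setLIntegral_le_lintegral _ _
    _ = C0 * ∫⁻ l in Ioi (1 : ℝ), ∫⁻ x, ofReal (l ^ (n : ℝ)) * H l (y + l • (x - y)) := by
        rw [lintegral_const_mul' _ _ hC0top]
        congr 1
        refine lintegral_lintegral_swap ?_
        have : Measurable fun p : E n × ℝ => H p.2 (y + p.2 • (p.1 - y)) :=
          hHm.comp (g := Function.uncurry H)
            (f := fun p : E n × ℝ => (p.2, y + p.2 • (p.1 - y))) (by fun_prop)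
        refine Measurable.aemeasurable ?_
        exact Measurable.mul (by fun_prop) this
    _ = C0 * ∫⁻ l in Ioi (1 : ℝ), ∫⁻ z, H l z := by
        congr 1
        refine setLIntegral_congr_fun measurableSet_Ioi fun l hl => ?_
        have hl0 : 0 < l := zero_lt_one.trans hl
        rw [lintegral_const_mul' _ _ ofReal_ne_top, lintegral_comp_homothety hl0 y (H l),
          ← mul_assoc, ← ofReal_mul (by positivity), rpow_natCast, ← mul_pow,
          mul_inv_cancel₀ hl0.ne']
        simp
    _ = C0 * ∫⁻ z, ∫⁻ l in Ioi (1 : ℝ), H l z := by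
        rw [lintegral_lintegral_swap hHm.aemeasurable]
    _ ≤ C0 * ∫⁻ z, (farPart Ω).indicator (fun z =>
        ofReal (φ z ^ (2 * M + 4) * ‖z‖ ^ (2 + 2 * α - n)) * ‖strain Z z‖ₑ ^ 2) z := by
        gcongr with z
        by_cases hz : z ∈ farPart Ω
        swap
        · simp [hH, hz]
        simp only [hH, indicator_of_mem hz]
        rw [lintegral_indicator measurableSet_Iio, setLIntegral_const]
        have hz0 : 0 < ‖z‖ := zero_lt_one.trans hz.2
        have hvol : (𝔪 (Ioi (1:ℝ))) (Iio ‖z‖) ≤ ofReal ‖z‖ := by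
          rw [Measure.restrict_apply measurableSet_Iio]
          refine (measure_mono (t := Ioo 0 ‖z‖) fun s hs => ⟨zero_lt_one.trans hs.2, hs.1⟩).trans ?_
          simp
        refine (mul_le_mul_right hvol _).trans (le_of_eq ?_)
        rw [hG, mul_right_comm, ← ofReal_mul (by have := D.pos z hz.1; positivity),
          mul_assoc]
        congr 3
        rw [show (2 + 2 * α - n : ℝ) = e + 1 by rw [he]; ring, Real.rpow_add_one hz0.ne']
    _ = _ := by rw [lintegral_indicator hfm]; rfl

/-! ### Sets on which a vector field is controlled by an energy -/

/-- On `U ∩ Ω` the weighted `L²` norm of a vector field is bounded by the energy `𝓔`. -/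
def Good {n : ℕ} (Ω : Set (E n)) (φ : Fn n) (M : ℕ) (𝓔 : VF n → ℝ≥0∞)
    (U : Set (E n)) : Prop :=
  ∃ C : NNReal, ∀ Z : VF n, Smooth Z → HasCompactSupport Z →
    ∫⁻ x in U ∩ Ω, ofReal (φ x ^ (2 * M + 2)) * ‖Z x‖ₑ ^ 2 ≤ C * 𝓔 Z

section Good
variable {n : ℕ} {Ω : Set (E n)} {φ r : Fn n} {M : ℕ} {𝓔 : VF n → ℝ≥0∞}

lemma Good.mono {U V : Set (E n)} (hUV : U ⊆ V) (h : Good Ω φ M 𝓔 V) : Good Ω φ M 𝓔 U := by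
  obtain ⟨C, hC⟩ := h
  exact ⟨C, fun Z hZ hs => (lintegral_mono_set (inter_subset_inter_left _ hUV)).trans (hC Z hZ hs)⟩

lemma Good.union {U V : Set (E n)} (h : Good Ω φ M 𝓔 U) (h' : Good Ω φ M 𝓔 V) : Good Ω φ M 𝓔
    (U ∪ V) := by
  obtain ⟨C, hC⟩ := h
  obtain ⟨C', hC'⟩ := h'
  refine ⟨C + C', fun Z hZ hs => ?_⟩
  rw [union_inter_distrib_right]
  refine (lintegral_union_le _ _ _).trans ?_
  push_cast
  rw [add_mul]
  exact add_le_add (hC Z hZ hs) (hC' Z hZ hs)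

lemma Good.of_isCompact {K : Set (E n)} (hK : IsCompact K)
    (h : ∀ x ∈ K, ∃ U ∈ 𝓝 x, Good Ω φ M 𝓔 U) : Good Ω φ M 𝓔 K := by
  refine hK.induction_on (p := Good Ω φ M 𝓔) ⟨0, by simp⟩ (fun _ _ => Good.mono)
    (fun _ _ => Good.union) fun x hx => ?_
  obtain ⟨U, hU, hg⟩ := h x hx
  exact ⟨U, mem_nhdsWithin_of_mem_nhds hU, hg⟩

lemma ConeDomain.exists_good_far (D : ConeDomain Ω φ r) (M : ℕ) {α : ℝ} (hα : 0 < α) {x₁ : E n}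
    (hx : x₁ ∈ Ω) (hx1 : 1 < ‖x₁‖) : ∃ U ∈ 𝓝 x₁, Good Ω φ M (farEnergy Ω φ M (2 + 2 * α - n))
    U := by
  have hopen : IsOpen (Ω ∩ {z | 1 < ‖z‖}) := D.isOpen.inter
    (isOpen_lt continuous_const continuous_norm)
  obtain ⟨d, hd, hball⟩ := Metric.isOpen_iff.1 hopen x₁ ⟨hx, hx1⟩
  set δ := d / 3 with hδ
  have hδ0 : 0 < δ := by positivity
  set B := closedBall x₁ (2 * δ) with hBdef
  have hBc : IsCompact B := isCompact_closedBall _ _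
  have hBsub : B ⊆ Ω ∩ {z | 1 < ‖z‖} := (Metric.closedBall_subset_ball (by rw [hδ]; linarith)).trans
    hball
  have hx₁B : x₁ ∈ B := mem_closedBall_self (by positivity)
  obtain ⟨wm, hwm, hmin⟩ := hBc.exists_isMinOn ⟨x₁, hx₁B⟩ D.smooth.continuous.continuousOn
  obtain ⟨wM, hwM, hmax⟩ := hBc.exists_isMaxOn ⟨x₁, hx₁B⟩ D.smooth.continuous.continuousOn
  set U := ball x₁ δ with hUdef
  have hUm : MeasurableSet U := isOpen_ball.measurableSet
  have hUB : U ⊆ B := Metric.ball_subset_closedBall.trans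
    (Metric.closedBall_subset_closedBall (by linarith))
  have key : ∀ y : E n, ‖y‖ ≤ δ → ∃ C : NNReal, ∀ Z : VF n, Smooth Z → HasCompactSupport Z →
      ∫⁻ x in U, ‖inner ℝ (Z x) (x - y)‖ₑ ^ 2 ≤ C * farEnergy Ω φ M (2 + 2 * α - n) Z := by
    intro y hy
    refine lintegral_inner_sq_le_farEnergy D M hα hUm y (m := φ wm) (R := ‖x₁‖ + 2 * δ)
      (D.pos _ (hBsub hwm).1) (B := B) ?_ ?_ ?_
    · intro w hw
      refine ⟨(hBsub hw).1, (hBsub hw).2, ?_, hmin hw⟩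
      rw [hBdef, mem_closedBall_iff_norm] at hw
      linarith [norm_le_insert' w x₁]
    · intro x hx l hl
      rw [hUdef, mem_ball_iff_norm] at hx
      rw [hBdef, mem_closedBall_iff_norm]
      have hl0 : 0 < l := zero_lt_one.trans hl
      have hl1 : l⁻¹ ≤ 1 := inv_le_one_of_one_le₀ hl.le
      have h1 : ‖(1 - l⁻¹) • y‖ ≤ δ := by
        rw [norm_smul, norm_of_nonneg (by linarith)]
        have : 0 < l⁻¹ := by positivity
        nlinarith [norm_nonneg y]
      calc ‖x - (1 - l⁻¹) • y - x₁‖ = ‖(x - x₁) - (1 - l⁻¹) • y‖ := by congr 1; abel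
        _ ≤ ‖x - x₁‖ + ‖(1 - l⁻¹) • y‖ := norm_sub_le _ _
        _ ≤ 2 * δ := by linarith
    · intro x hx
      rw [hUdef, mem_ball_iff_norm] at hx
      linarith [norm_sub_le x y, norm_le_insert' x x₁]
  obtain ⟨C0, hC0⟩ := key 0 (by simpa using hδ0.le)
  choose C hC using fun k : Fin n => key (-(δ • single k (1 : ℝ)))
    (by rw [norm_neg, norm_smul, norm_of_nonneg hδ0.le]; simp)
  refine ⟨U, Metric.ball_mem_nhds _ hδ0, ?_⟩
  refine ⟨toNNReal (φ wM ^ (2 * M + 2)) * (toNNReal (2 * δ⁻¹ ^ 2) * ∑ k, (C k + C0)), fun Z hZ hs =>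
    ?_⟩
  set F := farEnergy Ω φ M (2 + 2 * α - n) Z with hF
  have hm : ∀ y : E n, Measurable fun x => ‖inner ℝ (Z x) (x - y)‖ₑ := fun y =>
    (hZ.continuous.inner (continuous_id.sub continuous_const)).measurable.enorm
  calc _ ≤ ∫⁻ x in U, ofReal (φ x ^ (2 * M + 2)) * ‖Z x‖ₑ ^ 2 := lintegral_mono_set
        inter_subset_left
    _ ≤ ∫⁻ x in U, ofReal (φ wM ^ (2 * M + 2)) * (ofReal (2 * δ⁻¹ ^ 2) * ∑ k : Fin n,
        (‖inner ℝ (Z x) (x - (-(δ • single k (1 : ℝ))))‖ₑ ^ 2 + ‖inner ℝ (Z x) (x - 0)‖ₑ ^ 2)) := by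
        refine setLIntegral_mono' hUm fun x hx => ?_
        have h0 := D.pos x (hBsub (hUB hx)).1
        have h1 : φ x ≤ φ wM := hmax (hUB hx)
        have h2 := enorm_sq_le_sum_inner hδ0 x (Z x)
        simp only [sub_neg_eq_add, sub_zero]
        gcongr
    _ = ofReal (φ wM ^ (2 * M + 2)) * (ofReal (2 * δ⁻¹ ^ 2) * ∑ k : Fin n,
        ((∫⁻ x in U, ‖inner ℝ (Z x) (x - (-(δ • single k (1 : ℝ))))‖ₑ ^ 2) + ∫⁻ x in U, ‖inner ℝ
          (Z x) (x - 0)‖ₑ ^ 2)) := by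
        rw [lintegral_const_mul' _ _ ofReal_ne_top, lintegral_const_mul' _ _ ofReal_ne_top,
          lintegral_finsetSum]
        · congr 2
          refine sum_congr rfl fun k _ => ?_
          rw [lintegral_add_left ((hm _).pow_const 2)]
        · intro k _
          exact ((hm _).pow_const 2).add ((hm _).pow_const 2)
    _ ≤ ofReal (φ wM ^ (2 * M + 2)) * (ofReal (2 * δ⁻¹ ^ 2) * ∑ k : Fin n, (C k * F + C0 * F)) := by
        gcongr with k _
        · exact hC k Z hZ hs
        · exact hC0 Z hZ hs
    _ = _ := by
        push_cast
        simp only [← add_mul, ← sum_mul, ofReal, mul_assoc]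

lemma exists_frontier_mem_segment {S : Set (E n)} (hS : IsOpen S) {x v : E n} (hx : x ∈ S)
    {s : ℝ} (hs : 0 ≤ s) (h : x + s • v ∉ S) :
    ∃ t ∈ Icc (0 : ℝ) s, x + t • v ∈ frontier S := by
  by_contra! hno
  set I : Set (E n) := (fun t : ℝ => x + t • v) '' Icc 0 s with hI
  have hpre : IsPreconnected I := isPreconnected_Icc.image _ (by fun_prop)
  have h1 : I ⊆ S := by
    refine hpre.subset_of_closure_inter_subset hS ⟨x, ⟨0, ⟨le_rfl, hs⟩, by simp⟩, hx⟩ ?_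
    rintro z ⟨hz, t, ht, rfl⟩
    by_contra hzS
    refine hno t ht ?_
    rw [hS.frontier_eq]
    exact ⟨hz, hzS⟩
  exact h (h1 ⟨s, ⟨hs, le_rfl⟩, rfl⟩)

lemma ConeDomain.exists_good_frontier (D : ConeDomain Ω φ r) {x₁ : E n} (hx : x₁ ∈ frontier Ω)
    {U' : Set (E n)} (hU' : IsOpen U') (hxU : x₁ ∈ U')
    (hE : ∃ C : NNReal, ∀ Z : VF n, Smooth Z → HasCompactSupport Z → ∫⁻ z in Ω ∩ U', ofReal
      (φ z ^ (2 * M + 4)) * ‖strain Z z‖ₑ ^ 2 ≤ C * 𝓔 Z)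
    (hgood : ∀ x ∈ Ω ∩ U', ∃ U ∈ 𝓝 x, Good Ω φ M 𝓔 U) : ∃ U ∈ 𝓝 x₁, Good Ω φ M 𝓔 U := by
  obtain ⟨w₀, hw₀⟩ : ∃ w₀, 0 < fderiv ℝ φ x₁ w₀ := by
    obtain ⟨w, hw⟩ := DFunLike.ne_iff.1 (D.grad x₁ hx)
    rw [zero_apply] at hw
    rcases lt_or_gt_of_ne hw with h | h
    · exact ⟨-w, by simpa using h⟩
    · exact ⟨w, h⟩
  set κ := fderiv ℝ φ x₁ w₀ / 2 with hκ
  have hκ0 : 0 < κ := by positivity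
  have hcont : Continuous fun p : E n × E n => fderiv ℝ φ p.1 p.2 := by
    have h : Continuous (fderiv ℝ φ) := D.smooth.continuous_fderiv (by simp)
    exact (h.comp continuous_fst).clm_apply continuous_snd
  have hev : ∀ᶠ p : E n × E n in 𝓝 (x₁, w₀), κ < fderiv ℝ φ p.1 p.2 := hcont.continuousAt.eventually
    (lt_mem_nhds (by rw [hκ]; linarith))
  obtain ⟨δ₁, hδ₁, hδ₁κ⟩ := Metric.eventually_nhds_iff.1 hev
  obtain ⟨δ₂, hδ₂, hδ₂U⟩ := Metric.isOpen_iff.1 hU' x₁ hxU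
  set δ := min δ₁ δ₂ / 2 with hδ
  have hδ0 : 0 < δ := by positivity
  have hδ1 : δ < δ₁ := by have := min_le_left δ₁ δ₂; rw [hδ]; linarith
  have hδ2 : δ < δ₂ := by have := min_le_right δ₁ δ₂; rw [hδ]; linarith
  have hder : ∀ z v, ‖z - x₁‖ ≤ δ → ‖v - w₀‖ ≤ δ → κ ≤ fderiv ℝ φ z v := by
    intro z v hz hv
    refine (hδ₁κ (y := (z, v)) ?_).le
    rw [Prod.dist_eq, max_lt_iff, dist_eq_norm, dist_eq_norm]
    exact ⟨hz.trans_lt hδ1, hv.trans_lt hδ1⟩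
  set t := min 1 (δ / 2 / (‖w₀‖ + δ)) with ht
  have ht0 : 0 < t := by positivity
  have htδ : t * (‖w₀‖ + δ) ≤ δ / 2 := by rw [← le_div_iff₀ (by positivity)]; exact min_le_right _ _
  have hv : ∀ v : E n, ‖v - t • w₀‖ ≤ t * δ → ‖t⁻¹ • v - w₀‖ ≤ δ ∧ ‖v‖ ≤ δ / 2 := by
    intro v hv
    constructor
    · have : t⁻¹ • v - w₀ = t⁻¹ • (v - t • w₀) := by
        rw [smul_sub, smul_smul, inv_mul_cancel₀ ht0.ne', one_smul]
      rw [this, norm_smul, norm_inv, norm_of_nonneg ht0.le, inv_mul_le_iff₀ ht0]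
      exact hv
    · have := norm_le_insert' v (t • w₀)
      rw [norm_smul, norm_of_nonneg ht0.le] at this
      linarith
  have hseg : ∀ x, ‖x - x₁‖ < δ / 2 → ∀ v : E n, ‖v - t • w₀‖ ≤ t * δ → ∀ s ∈ Icc (0 : ℝ) 1, ‖x + s
      • v - x₁‖ ≤ δ := by
    intro x hx v hv' s hs
    have h1 := (hv v hv').2
    have h2 : ‖s • v‖ ≤ ‖v‖ := by
      rw [norm_smul, norm_of_nonneg hs.1]
      exact mul_le_of_le_one_left (norm_nonneg _) hs.2
    calc ‖x + s • v - x₁‖ = ‖(x - x₁) + s • v‖ := by congr 1; abel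
      _ ≤ ‖x - x₁‖ + ‖s • v‖ := norm_add_le _ _
      _ ≤ δ := by linarith
  have hgrow : ∀ x, ‖x - x₁‖ < δ / 2 → ∀ v : E n, ‖v - t • w₀‖ ≤ t * δ → ∀ s ∈ Icc (0 : ℝ) 1, φ x +
      t * κ * s ≤ φ (x + s • v) := by
    intro x hx v hv' s hs
    have hd : ∀ s : ℝ, HasDerivAt (fun s : ℝ => φ (x + s • v)) (fderiv ℝ φ (x + s • v) v) s := by
      intro s
      have h1 : HasDerivAt (fun s : ℝ => x + s • v) v s := by
        simpa using ((hasDerivAt_id s).smul_const v).const_add x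
      exact ((D.smooth.differentiable (by simp)) (x + s • v)).hasFDerivAt.comp_hasDerivAt s h1
    have := (convex_Icc (0 : ℝ) 1).mul_sub_le_image_sub_of_le_deriv
      (f := fun s : ℝ => φ (x + s • v)) (C := t * κ)
      (fun s _ => (hd s).continuousAt.continuousWithinAt)
      (fun s _ => (hd s).differentiableAt.differentiableWithinAt) (fun s hs => by
        rw [(hd s).deriv]
        have h1 := hder (x + s • v) (t⁻¹ • v) (hseg x hx v hv' s (interior_subset hs)) (hv v hv').1
        rw [map_smul, smul_eq_mul, le_inv_mul_iff₀ ht0] at h1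
        exact h1)
      0 ⟨le_rfl, zero_le_one⟩ s hs hs.1
    simp only [sub_zero, zero_smul, add_zero] at this
    linarith
  have hmemΩ : ∀ x ∈ Ω, ‖x - x₁‖ < δ / 2 → ∀ v : E n, ‖v - t • w₀‖ ≤ t * δ → ∀ s ∈ Icc (0 : ℝ) 1, x
      + s • v ∈ Ω := by
    intro x hxΩ hx v hv' s hs
    by_contra hno
    obtain ⟨s', hs', hf⟩ := exists_frontier_mem_segment D.isOpen hxΩ hs.1 hno
    have h1 := hgrow x hx v hv' s' ⟨hs'.1, hs'.2.trans hs.2⟩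
    rw [D.zero _ hf] at h1
    have h2 := D.pos x hxΩ
    have h3 : 0 ≤ t * κ * s' := by have := hs'.1; positivity
    linarith
  set K : Set (E n) := (closure Ω ∩ closedBall x₁ δ) ∩ {z | t * κ ≤ φ z} with hK
  have hKc : IsCompact K := ((isCompact_closedBall x₁ δ).inter_left isClosed_closure).inter_right
      (isClosed_le continuous_const D.smooth.continuous)
  have hKsub : K ⊆ Ω ∩ U' := by
    rintro z ⟨⟨hz1, hz2⟩, hz3⟩
    refine ⟨?_, hδ₂U ?_⟩
    · by_contra hzΩ
      have : z ∈ frontier Ω := by rw [D.isOpen.frontier_eq]; exact ⟨hz1, hzΩ⟩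
      have h0 := D.zero z this
      rw [mem_ofPred_eq, h0] at hz3
      have : 0 < t * κ := by positivity
      linarith
    · rw [Metric.mem_closedBall] at hz2
      exact hz2.trans_lt hδ2
  obtain ⟨CK, hCK⟩ := Good.of_isCompact hKc fun x hx => hgood x (hKsub hx)
  obtain ⟨CE, hCE⟩ := hE
  set U := ball x₁ (δ / 2) ∩ Ω with hU
  have hUm : MeasurableSet U := (isOpen_ball.inter D.isOpen).measurableSet
  have hUx : ∀ x ∈ U, ‖x - x₁‖ < δ / 2 := fun x hx => mem_ball_iff_norm.1 hx.1
  obtain ⟨C, hC⟩ := lintegral_norm_sq_le_of_segments D.smooth.continuous M (c := min 1 (t * κ))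
    (η := t * δ) (by positivity) (by positivity) (t • w₀) hUm (D.isOpen.inter hU').measurableSet
    hKc.measurableSet (V := Ω ∩ U') (K := K) (fun x hx => D.pos x hx.2)
    (fun x hx v hv' s hs => ⟨hmemΩ x hx.2 (hUx x hx) v hv' s hs, hδ₂U
      (mem_ball_iff_norm.2 ((hseg x (hUx x hx) v hv' s hs).trans_lt hδ2))⟩)
    (fun x hx v hv' s hs => by
      refine le_trans ?_ (hgrow x (hUx x hx) v hv' s hs)
      rw [mul_add]
      have h1 := D.pos x hx.2
      have h2 := hs.1
      gcongr
      · exact mul_le_of_le_one_left h1.le (min_le_left _ _)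
      · exact min_le_right _ _)
    (fun x hx v hv' => by
      have h1 : (1 : ℝ) ∈ Icc (0 : ℝ) 1 := by simp
      have a := hmemΩ x hx.2 (hUx x hx) v hv' 1 h1
      have b := hseg x (hUx x hx) v hv' 1 h1
      have c := hgrow x (hUx x hx) v hv' 1 h1
      rw [one_smul] at a b c
      refine ⟨⟨subset_closure a, mem_closedBall_iff_norm.2 b⟩, ?_⟩
      have := D.pos x hx.2
      rw [mem_ofPred_eq]
      linarith)
  refine ⟨ball x₁ (δ / 2), Metric.ball_mem_nhds _ (by positivity), C * (CE + CK), fun Z hZ hs => ?_⟩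
  refine (hC Z hZ).trans ?_
  push_cast
  rw [mul_assoc, add_mul]
  gcongr
  · exact hCE Z hZ hs
  · have := hCK Z hZ hs
    rwa [inter_eq_left.2 (hKsub.trans inter_subset_left)] at this

lemma ConeDomain.exists_good_of_connected (D : ConeDomain Ω φ r)
    (hE : ∀ R : ℝ, ∃ C : NNReal, ∀ Z : VF n, Smooth Z → HasCompactSupport Z → ∫⁻ z in Ω ∩ ball 0 R,
      ofReal (φ z ^ (2 * M + 4)) * ‖strain Z z‖ₑ ^ 2 ≤ C * 𝓔 Z)
    {x₀ : E n} (hx₀ : x₀ ∈ Ω) (hg : ∃ U ∈ 𝓝 x₀, Good Ω φ M 𝓔 U) :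
    ∀ x ∈ Ω, ∃ U ∈ 𝓝 x, Good Ω φ M 𝓔 U := by
  set G : Set (E n) := {x | ∃ U ∈ 𝓝 x, Good Ω φ M 𝓔 U} with hG
  have hGo : IsOpen G := by
    rw [isOpen_iff_mem_nhds]
    rintro x ⟨U, hU, hgU⟩
    filter_upwards [eventually_mem_nhds_iff.2 hU] with y hy
    exact ⟨U, hy, hgU⟩
  suffices Ω ⊆ G from this
  refine D.isPreconnected.subset_of_closure_inter_subset hGo ⟨x₀, hx₀, hg⟩ ?_
  rintro x ⟨hxc, hxΩ⟩
  obtain ⟨d, hd, hdΩ⟩ := Metric.isOpen_iff.1 D.isOpen x hxΩ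
  set δ := d / 2 with hδ
  have hδ0 : 0 < δ := by positivity
  set B := closedBall x δ with hB
  have hBΩ : B ⊆ Ω := (Metric.closedBall_subset_ball (by rw [hδ]; linarith)).trans hdΩ
  have hBc : IsCompact B := isCompact_closedBall _ _
  have hxB : x ∈ B := mem_closedBall_self hδ0.le
  obtain ⟨wm, hwm, hmin⟩ := hBc.exists_isMinOn ⟨x, hxB⟩ D.smooth.continuous.continuousOn
  obtain ⟨wM, hwM, hmax⟩ := hBc.exists_isMaxOn ⟨x, hxB⟩ D.smooth.continuous.continuousOn
  have hm0 := D.pos _ (hBΩ hwm)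
  have hM0 := D.pos _ (hBΩ hwM)
  obtain ⟨y, hyG, hyx⟩ := Metric.mem_closure_iff.1 hxc (δ / 4) (by positivity)
  obtain ⟨Uy, hUy, CK, hCK⟩ := hyG
  have hyΩ : y ∈ Ω := hBΩ (by rw [hB, Metric.mem_closedBall, dist_comm]; linarith)
  obtain ⟨e, he, heU⟩ := Metric.mem_nhds_iff.1 (Filter.inter_mem hUy (D.isOpen.mem_nhds hyΩ))
  set ε := min e (δ / 4) with hε
  have hε0 : 0 < ε := by positivity
  have hε1 : ε ≤ δ / 4 := min_le_right _ _
  have hεU : ball y ε ⊆ Uy ∩ Ω := (Metric.ball_subset_ball (min_le_left _ _)).trans heU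
  rw [dist_comm, dist_eq_norm] at hyx
  obtain ⟨CE, hCE⟩ := hE (‖x‖ + d)
  have hseg : ∀ x' ∈ ball x (ε / 3), ∀ v : E n, ‖v - (y - x)‖ ≤ ε / 3 → ∀ s ∈ Icc (0 : ℝ) 1, x' + s
      • v ∈ B := by
    intro x' hx' v hv s hs
    rw [mem_ball_iff_norm] at hx'
    rw [hB, mem_closedBall_iff_norm]
    have h1 : ‖s • v‖ ≤ ‖v‖ := by
      rw [norm_smul, norm_of_nonneg hs.1]
      exact mul_le_of_le_one_left (norm_nonneg _) hs.2
    have h2 := norm_le_insert' v (y - x)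
    calc ‖x' + s • v - x‖ = ‖(x' - x) + s • v‖ := by congr 1; abel
      _ ≤ ‖x' - x‖ + ‖s • v‖ := norm_add_le _ _
      _ ≤ δ := by linarith
  obtain ⟨C, hC⟩ := lintegral_norm_sq_le_of_segments D.smooth.continuous M (c := φ wm / (φ wM + 1))
    (η := ε / 3) (by positivity) (by positivity) (y - x) (U := ball x (ε / 3)) (V := B)
    (K := ball y ε) isOpen_ball.measurableSet hBc.measurableSet isOpen_ball.measurableSet
    (fun x' hx' => D.pos _ (hBΩ (by simpa using hseg x' hx' (y - x) (by simp; positivity) 0 (by simp))))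
    hseg (fun x' hx' v hv s hs => by
      have h1 : φ wm ≤ φ (x' + s • v) := hmin (hseg x' hx' v hv s hs)
      have h2 : φ x' ≤ φ wM := hmax
        (by simpa using hseg x' hx' (y - x) (by simp; positivity) 0 (by simp))
      rw [div_mul_eq_mul_div, div_le_iff₀ (by positivity)]
      have h3 := hs.2
      nlinarith)
    (fun x' hx' v hv => by
      rw [mem_ball_iff_norm] at hx' ⊢
      calc ‖x' + v - y‖ = ‖(x' - x) + (v - (y - x))‖ := by congr 1; abel
        _ ≤ ‖x' - x‖ + ‖v - (y - x)‖ := norm_add_le _ _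
        _ < ε := by linarith)
  refine ⟨ball x (ε / 3), Metric.ball_mem_nhds _ (by positivity), C * (CE + CK), fun Z hZ hs => ?_⟩
  refine (lintegral_mono_set inter_subset_left).trans ((hC Z hZ).trans ?_)
  push_cast
  rw [mul_assoc, add_mul]
  gcongr
  · refine (lintegral_mono_set ?_).trans (hCE Z hZ hs)
    intro z hz
    refine ⟨hBΩ hz, ?_⟩
    rw [hB, mem_closedBall_iff_norm] at hz
    rw [mem_ball_zero_iff]
    linarith [norm_le_insert' z x]
  · exact (lintegral_mono_set hεU).trans (hCK Z hZ hs)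

end Good

/-! ### The weighted `L²` estimate of a vector field by its symmetrized gradient -/

def coneEnergy {n : ℕ} (Ω : Set (E n)) (φ r : Fn n) (M : ℕ) (τ : ℝ) (Z : VF n) : ℝ≥0∞ :=
  ∫⁻ z in Ω, ofReal (r z ^ τ * φ z ^ (2 * M + 4)) * ‖strain Z z‖ₑ ^ 2

section LowerOrder
variable {n : ℕ} {Ω : Set (E n)} {φ r : Fn n}

lemma strain_comp_smul {Z : VF n} (hZ : Smooth Z) (c : ℝ) (x : E n) : strain (fun x => Z (c • x)) x
    = c • strain Z (c • x) := by
  have h : fderiv ℝ (fun x => Z (c • x)) x = c • fderiv ℝ Z (c • x) := by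
    have h1 : HasFDerivAt (fun x : E n => c • x) (c • ContinuousLinearMap.id ℝ (E n)) x :=
      (hasFDerivAt_id x).const_smul c
    have h2 := ((hZ.differentiable (by simp)) (c • x)).hasFDerivAt.comp x h1
    rw [show (fun x => Z (c • x)) = Z ∘ fun x => c • x from rfl, h2.fderiv]
    ext v : 1
    simp
  simp only [strain, h, map_smulₛₗ, smul_add]
  simp

lemma ConeDomain.measurableSet_far (D : ConeDomain Ω φ r) (c : ℝ) : MeasurableSet
    (Ω ∩ {z | c < ‖z‖}) := D.isOpen.measurableSet.inter
  (measurableSet_lt measurable_const measurable_norm)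

lemma ConeDomain.farEnergy_le (D : ConeDomain Ω φ r) (M : ℕ) {τ τ' : ℝ} (hτ : τ ≤ τ') (Z : VF n) :
    farEnergy Ω φ M τ Z ≤ coneEnergy Ω φ r M τ' Z := by
  refine le_trans ?_ (lintegral_mono_set (inter_subset_left (t := {z | 1 < ‖z‖})))
  refine setLIntegral_mono' (D.measurableSet_far 1) fun z hz => ?_
  have h0 := D.pos z hz.1
  have h1 : 1 < ‖z‖ := hz.2
  rw [D.weight_far z h1.le, mul_comm (φ z ^ _)]
  gcongr
  exact h1.le

lemma ConeDomain.exists_coneEnergy_bound (D : ConeDomain Ω φ r) (M : ℕ) (τ R : ℝ) : ∃ C : NNReal,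
    ∀ Z : VF n, Smooth Z → HasCompactSupport Z → ∫⁻ z in Ω ∩ ball 0 R, ofReal (φ z ^ (2 * M + 4)) *
      ‖strain Z z‖ₑ ^ 2 ≤ C * coneEnergy Ω φ r M τ Z := by
  rcases lt_or_ge R 0 with hR | hR
  · exact ⟨0, fun Z _ _ => by simp [Metric.ball_eq_empty.2 hR.le]⟩
  have hc : Continuous fun z => r z ^ τ := D.weight_smooth.continuous.rpow_const fun z => Or.inl
    (D.weight_pos z).ne'
  obtain ⟨w, hw, hmin⟩ := (isCompact_closedBall (0 : E n) R).exists_isMinOn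
    ⟨0, mem_closedBall_self hR⟩ hc.continuousOn
  have hm0 : 0 < r w ^ τ := rpow_pos_of_pos (D.weight_pos w) _
  refine ⟨toNNReal (r w ^ τ)⁻¹, fun Z hZ hs => ?_⟩
  unfold coneEnergy
  change _ ≤ ofReal _ * _
  rw [← lintegral_const_mul' _ _ ofReal_ne_top]
  refine le_trans ?_ (lintegral_mono_set (inter_subset_left (t := ball 0 R)))
  refine setLIntegral_mono' (D.isOpen.inter isOpen_ball).measurableSet fun z hz => ?_
  rw [← mul_assoc, ← ofReal_mul (by positivity)]
  gcongr
  have h1 : r w ^ τ ≤ r z ^ τ := hmin (Metric.ball_subset_closedBall hz.2)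
  have h2 := D.pos z hz.1
  rw [← mul_assoc]
  refine le_mul_of_one_le_left (by positivity) ?_
  rw [inv_mul_eq_div, one_le_div hm0]
  exact h1

lemma ConeDomain.good_annulus (D : ConeDomain Ω φ r) (M : ℕ) {α : ℝ} (hα : 0 < α) : Good Ω φ M
    (farEnergy Ω φ M (2 + 2 * α - n)) {x | 2 ≤ ‖x‖ ∧ ‖x‖ ≤ 4} := by
  set τ : ℝ := 2 + 2 * α - n with hτ
  set K : Set (E n) := closure Ω ∩ (closedBall 0 4 ∩ {x | 2 ≤ ‖x‖}) with hK
  have hKc : IsCompact K := ((isCompact_closedBall (0 : E n) 4).inter_right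
    (isClosed_le continuous_const continuous_norm)).inter_left isClosed_closure
  have hgood : Good Ω φ M (farEnergy Ω φ M τ) K := by
    refine Good.of_isCompact hKc ?_
    rintro x ⟨hxc, hx4, hx2⟩
    rw [mem_closedBall_zero_iff] at hx4
    rw [mem_ofPred_eq] at hx2
    by_cases hx : x ∈ Ω
    · exact D.exists_good_far M hα hx (by linarith)
    have hxf : x ∈ frontier Ω := by rw [D.isOpen.frontier_eq]; exact ⟨hxc, hx⟩
    have hUo : IsOpen {z : E n | 1 < ‖z‖ ∧ ‖z‖ < 5} :=
      (isOpen_lt continuous_const continuous_norm).inter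
        (isOpen_lt continuous_norm continuous_const)
    refine D.exists_good_frontier hxf hUo ⟨by linarith, by linarith⟩ ?_ fun z hz =>
      D.exists_good_far M hα hz.1 hz.2.1
    refine ⟨toNNReal (5 ^ |τ|), fun Z hZ hs => ?_⟩
    unfold farEnergy
    change _ ≤ ofReal _ * _
    rw [← lintegral_const_mul' _ _ ofReal_ne_top]
    refine le_trans ?_ (lintegral_mono_set
      (fun z hz => ⟨hz.1, hz.2.1⟩ : Ω ∩ {z : E n | 1 < ‖z‖ ∧ ‖z‖ < 5} ⊆ farPart Ω))
    refine setLIntegral_mono' (D.isOpen.inter hUo).measurableSet fun z hz => ?_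
    rw [← mul_assoc, ← ofReal_mul (by positivity)]
    gcongr
    have h1 := rpow_le_of_comparable (R := 5) (s := 1) (t := ‖z‖) τ (by norm_num) one_pos hz.2.1.le
      (by linarith [hz.2.2])
    rw [Real.one_rpow] at h1
    have h2 := D.pos z hz.1
    rw [mul_left_comm]
    exact le_mul_of_one_le_right (by positivity) h1
  obtain ⟨C, hC⟩ := hgood
  refine ⟨C, fun Z hZ hs => le_trans (lintegral_mono_set ?_) (hC Z hZ hs)⟩
  rintro x ⟨⟨h2, h4⟩, hx⟩
  exact ⟨⟨subset_closure hx, mem_closedBall_zero_iff.2 h4, h2⟩, hx⟩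

lemma ConeDomain.exists_annulus_bound (D : ConeDomain Ω φ r) (M : ℕ) {α : ℝ} (hα : 0 < α) :
    ∃ C : NNReal, ∀ Z : VF n, Smooth Z → HasCompactSupport Z → ∀ c : ℝ, 1 ≤ c →
      ∫⁻ z in Ω ∩ {z | 2 * c ≤ ‖z‖ ∧ ‖z‖ ≤ 4 * c}, ofReal (φ z ^ (2 * M + 2)) * ‖Z z‖ₑ ^ 2 ≤ C *
        (ofReal (c ^ ((n : ℝ) - 2 * α)) * ∫⁻ z in Ω ∩ {z | c < ‖z‖}, ofReal
          (φ z ^ (2 * M + 4) * ‖z‖ ^ (2 + 2 * α - n)) * ‖strain Z z‖ₑ ^ 2) := by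
  obtain ⟨C, hC⟩ := D.good_annulus M hα
  refine ⟨C, fun Z hZ hs c hc => ?_⟩
  have hc0 : 0 < c := zero_lt_one.trans_le hc
  have h := hC (fun x => Z (c • x)) (hZ.comp (contDiff_const_smul c)) (hs.comp_smul hc0.ne')
  have hnorm : ∀ x : E n, ‖c • x‖ = c * ‖x‖ := fun x => by rw [norm_smul, norm_of_nonneg hc0.le]
  have hann : MeasurableSet {x : E n | 2 ≤ ‖x‖ ∧ ‖x‖ ≤ 4} :=
    (measurableSet_le measurable_const measurable_norm).inter
      (measurableSet_le measurable_norm measurable_const)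
  have hannc : MeasurableSet {x : E n | 2 * c ≤ ‖x‖ ∧ ‖x‖ ≤ 4 * c} :=
    (measurableSet_le measurable_const measurable_norm).inter
      (measurableSet_le measurable_norm measurable_const)
  have hΩm := D.isOpen.measurableSet
  set k : ℝ := c⁻¹ ^ n with hk
  have hk0 : 0 < k := by positivity
  have hL : ∫⁻ x in {x | 2 ≤ ‖x‖ ∧ ‖x‖ ≤ 4} ∩ Ω, ofReal (φ x ^ (2 * M + 2)) * ‖Z (c • x)‖ₑ ^ 2 =
      ofReal k * ∫⁻ z in Ω ∩ {z | 2 * c ≤ ‖z‖ ∧ ‖z‖ ≤ 4 * c}, ofReal (φ z ^ (2 * M + 2)) * ‖Z z‖ₑ ^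
          2 := by
    rw [← lintegral_indicator (hann.inter hΩm), ← lintegral_indicator (hΩm.inter hannc), hk, ←
      lintegral_comp_pos_smul hc0]
    refine lintegral_congr fun x => ?_
    by_cases hx : x ∈ {x | 2 ≤ ‖x‖ ∧ ‖x‖ ≤ 4} ∩ Ω
    · obtain ⟨⟨h2, h4⟩, hxΩ⟩ := hx
      have h1 : 1 ≤ ‖x‖ := by linarith
      have hcx : c • x ∈ Ω ∩ {z | 2 * c ≤ ‖z‖ ∧ ‖z‖ ≤ 4 * c} := by
        refine ⟨(D.cone x h1 c hc).2 hxΩ, ?_, ?_⟩ <;> rw [hnorm] <;> nlinarith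
      have hxA : x ∈ {x | 2 ≤ ‖x‖ ∧ ‖x‖ ≤ 4} ∩ Ω := ⟨⟨h2, h4⟩, hxΩ⟩
      rw [indicator_of_mem hxA, indicator_of_mem hcx, D.ray x hxΩ h1 c hc]
    · rw [indicator_of_notMem hx, indicator_of_notMem]
      rintro ⟨hcΩ, h2, h4⟩
      rw [hnorm] at h2 h4
      have h2' : 2 ≤ ‖x‖ := by nlinarith
      exact hx ⟨⟨h2', by nlinarith⟩, (D.cone x (by linarith) c hc).1 hcΩ⟩
  have hR : farEnergy Ω φ M (2 + 2 * α - n) (fun x => Z (c • x)) = ofReal k *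
      (ofReal (c ^ ((n : ℝ) - 2 * α)) * ∫⁻ z in Ω ∩ {z | c < ‖z‖}, ofReal
          (φ z ^ (2 * M + 4) * ‖z‖ ^ (2 + 2 * α - n)) * ‖strain Z z‖ₑ ^ 2) := by
    unfold farEnergy farPart
    rw [← lintegral_indicator (D.measurableSet_far 1), ← lintegral_indicator (D.measurableSet_far c),
      ← lintegral_const_mul' _ _ ofReal_ne_top, hk, ← lintegral_comp_pos_smul hc0]
    refine lintegral_congr fun x => ?_
    by_cases hx : x ∈ Ω ∩ {z | 1 < ‖z‖}
    · have h1 : 1 < ‖x‖ := hx.2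
      have hcx : c • x ∈ Ω ∩ {z | c < ‖z‖} := by
        refine ⟨(D.cone x h1.le c hc).2 hx.1, ?_⟩
        rw [mem_ofPred_eq, hnorm]; nlinarith
      rw [indicator_of_mem hx, indicator_of_mem hcx, D.ray x hx.1 h1.le c hc, strain_comp_smul hZ,
        enorm_smul, hnorm, mul_pow, Real.mul_rpow hc0.le (norm_nonneg _), ← mul_assoc, ← mul_assoc,
        ← ofReal_mul (by positivity), Real.enorm_eq_ofReal hc0.le, ← ofReal_pow hc0.le, ← ofReal_mul
        (by have := D.pos x hx.1; positivity)]
      congr 2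
      have : c ^ ((n : ℝ) - 2 * α) * c ^ (2 + 2 * α - (n : ℝ)) = c ^ 2 := by
        rw [← rpow_add hc0, ← rpow_natCast]; congr 1; push_cast; ring
      rw [← this]; ring
    · rw [indicator_of_notMem hx, indicator_of_notMem, mul_zero]
      rintro ⟨hcΩ, h2⟩
      rw [mem_ofPred_eq, hnorm] at h2
      have h1 : 1 < ‖x‖ := by nlinarith
      exact hx ⟨(D.cone x h1.le c hc).1 hcΩ, h1⟩
  rw [hL, hR, mul_left_comm] at h
  have hne : ofReal k ≠ 0 := by simpa using hk0
  exact (ENNReal.mul_le_mul_iff_right hne ofReal_ne_top).1 h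

lemma sum_two_pow_rpow_le {σ : ℝ} (hσ : 0 < σ) (t : ℝ) (ht : 0 ≤ t) (m : ℕ) : ∑ j ∈ Finset.range m,
    (if (2 : ℝ) ^ j < t then ((2 : ℝ) ^ j) ^ σ else 0) ≤ 2 ^ σ / (2 ^ σ - 1) * t ^ σ := by
  have hb : 1 < (2 : ℝ) ^ σ := Real.one_lt_rpow (by norm_num) hσ
  have hb1 : 0 < (2 : ℝ) ^ σ - 1 := by linarith
  induction m with
  | zero => simp; positivity
  | succ m ih =>
    by_cases h : (2 : ℝ) ^ m < t
    · have e : ∀ j : ℕ, ((2 : ℝ) ^ j) ^ σ = ((2 : ℝ) ^ σ) ^ j := fun j => by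
        rw [← rpow_natCast, ← rpow_mul (by norm_num), mul_comm, rpow_mul (by norm_num),
          rpow_natCast]
      calc _ ≤ ∑ j ∈ Finset.range (m + 1), ((2 : ℝ) ^ σ) ^ j := by
            refine sum_le_sum fun j _ => ?_
            rw [e]
            split_ifs
            · exact le_rfl
            · positivity
        _ = (((2 : ℝ) ^ σ) ^ (m + 1) - 1) / (2 ^ σ - 1) := geom_sum_eq hb.ne' _
        _ ≤ ((2 : ℝ) ^ σ) ^ (m + 1) / (2 ^ σ - 1) := by gcongr; linarith
        _ = 2 ^ σ / (2 ^ σ - 1) * ((2 : ℝ) ^ m) ^ σ := by rw [e, pow_succ]; ring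
        _ ≤ _ := by gcongr
    · rw [Finset.sum_range_succ, if_neg h, add_zero]
      exact ih

lemma tsum_two_pow_rpow_le {σ : ℝ} (hσ : 0 < σ) (t : ℝ) (ht : 0 ≤ t) : ∑' j : ℕ,
    (if (2 : ℝ) ^ j < t then ofReal (((2 : ℝ) ^ j) ^ σ) else 0) ≤ ofReal (2 ^ σ / (2 ^ σ - 1)) *
      ofReal (t ^ σ) := by
  have hb : 1 < (2 : ℝ) ^ σ := Real.one_lt_rpow (by norm_num) hσ
  have hb1 : 0 < (2 : ℝ) ^ σ - 1 := by linarith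
  refine ENNReal.tsum_le_of_sum_range_le fun m => ?_
  rw [← ofReal_mul (by positivity)]
  refine le_trans (le_of_eq ?_) (ofReal_le_ofReal (sum_two_pow_rpow_le hσ t ht m))
  rw [ofReal_sum_of_nonneg fun j _ => by positivity]
  refine sum_congr rfl fun j _ => ?_
  split_ifs <;> simp

lemma ConeDomain.exists_far_bound (D : ConeDomain Ω φ r) (M : ℕ) {σ : ℝ} (hσ : 0 < σ) :
    ∃ C : NNReal, ∀ Z : VF n, Smooth Z → HasCompactSupport Z → ∫⁻ z in Ω ∩ {z | 2 ≤ ‖z‖}, ofReal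
          (r z ^ (ℓ n σ) * φ z ^ (2 * M + 2)) * ‖Z z‖ₑ ^ 2 ≤ C * coneEnergy Ω φ r M (ℓ n (1 + σ))
        Z := by
  obtain ⟨C, hC⟩ := D.exists_annulus_bound M (α := σ / 2) (by positivity)
  set e : ℝ := ℓ n σ with he
  set k : ℝ := 4 ^ |e| with hk
  have hk0 : 0 < k := by positivity
  set B : ℝ := 2 ^ σ / (2 ^ σ - 1) with hB
  refine ⟨toNNReal k * C * toNNReal B, fun Z hZ hs => ?_⟩
  have hmφ : Measurable φ := D.smooth.continuous.measurable
  have hmr : Measurable r := D.weight_smooth.continuous.measurable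
  have hmq : Measurable fun z => ‖strain Z z‖ₑ := (continuous_strain hZ).measurable.enorm
  set A : ℕ → Set (E n) := fun j => Ω ∩ {z | 2 * 2 ^ j ≤ ‖z‖ ∧ ‖z‖ ≤ 4 * 2 ^ j} with hA
  have hAm : ∀ j, MeasurableSet (A j) := fun j => D.isOpen.measurableSet.inter
    ((measurableSet_le measurable_const measurable_norm).inter
      (measurableSet_le measurable_norm measurable_const))
  set f : E n → ℝ≥0∞ := fun z => ofReal (φ z ^ (2 * M + 4) * ‖z‖ ^ (2 + 2 * (σ / 2) - n)) * ‖strain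
    Z z‖ₑ ^ 2 with hf
  have hfm : Measurable f := by fun_prop
  have hcover : Ω ∩ {z | 2 ≤ ‖z‖} ⊆ ⋃ j, A j := by
    rintro z ⟨hz, h2⟩
    rw [mem_ofPred_eq] at h2
    obtain ⟨j, hj1, hj2⟩ := exists_nat_pow_near (x := ‖z‖ / 2) (y := (2 : ℝ)) (by linarith)
      (by norm_num)
    refine mem_iUnion.2 ⟨j, hz, by linarith, ?_⟩
    rw [pow_succ] at hj2
    linarith
  have hstep : ∀ j : ℕ, ∫⁻ z in A j, ofReal (r z ^ e * φ z ^ (2 * M + 2)) * ‖Z z‖ₑ ^ 2 ≤ ofReal k *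
      C * ∫⁻ z in Ω ∩ {z | 1 < ‖z‖}, (if (2 : ℝ) ^ j < ‖z‖ then ofReal (((2 : ℝ) ^ j) ^ σ) else 0) *
        f z := by
    intro j
    have hj1 : (1 : ℝ) ≤ 2 ^ j := one_le_pow₀ (by norm_num)
    have hj0 : (0 : ℝ) < 2 ^ j := by positivity
    calc _ ≤ ∫⁻ z in A j, ofReal (k * (2 ^ j) ^ e) * (ofReal (φ z ^ (2 * M + 2)) * ‖Z z‖ₑ ^ 2) := by
          refine setLIntegral_mono' (hAm j) fun z hz => ?_
          have h1 : 2 * 2 ^ j ≤ ‖z‖ := hz.2.1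
          have h2 : ‖z‖ ≤ 4 * 2 ^ j := hz.2.2
          have hz0 : 0 < ‖z‖ := by linarith
          have h3 := D.pos z hz.1
          rw [D.weight_far z (by linarith), ← mul_assoc, ← ofReal_mul (by positivity)]
          gcongr
          have h4 := rpow_le_of_comparable (R := 4) (s := 2 ^ j) (t := ‖z‖) (-e) (by norm_num) hj0
            (by linarith) h2
          rw [abs_neg, Real.rpow_neg hj0.le, Real.rpow_neg hz0.le, ← div_eq_mul_inv,
            inv_eq_one_div, div_le_div_iff₀ (by positivity) (by positivity), one_mul] at h4
          exact h4
      _ ≤ ofReal (k * (2 ^ j) ^ e) * (C * (ofReal ((2 ^ j) ^ ((n : ℝ) - 2 * (σ / 2))) *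
          ∫⁻ z in Ω ∩ {z | 2 ^ j < ‖z‖}, f z)) := by
          rw [lintegral_const_mul' _ _ ofReal_ne_top]
          gcongr
          exact hC Z hZ hs _ hj1
      _ = ofReal k * C * (ofReal (((2 : ℝ) ^ j) ^ σ) * ∫⁻ z in Ω ∩ {z | 2 ^ j < ‖z‖}, f z) := by
          have : ((2 : ℝ) ^ j) ^ σ = (2 ^ j) ^ e * (2 ^ j) ^ ((n : ℝ) - 2 * (σ / 2)) := by
            rw [← rpow_add hj0, he]; congr 1; ring
          rw [this, ofReal_mul hk0.le, ofReal_mul (by positivity)]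
          ring
      _ ≤ _ := by
          gcongr
          rw [← lintegral_const_mul' _ _ ofReal_ne_top]
          refine le_trans ?_ (lintegral_mono_set (s := Ω ∩ {z | 2 ^ j < ‖z‖}) ?_)
          · refine setLIntegral_mono' (D.measurableSet_far _) fun z hz => ?_
            have : (2 : ℝ) ^ j < ‖z‖ := hz.2
            rw [if_pos this]
          · exact fun z hz => ⟨hz.1, lt_of_le_of_lt hj1 hz.2⟩
  have hm : ∀ j : ℕ, Measurable fun z : E n =>
      (if (2 : ℝ) ^ j < ‖z‖ then ofReal (((2 : ℝ) ^ j) ^ σ) else 0) * f z := fun j =>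
    (Measurable.ite (measurableSet_lt measurable_const measurable_norm) measurable_const
      measurable_const).mul hfm
  calc _ ≤ ∫⁻ z in ⋃ j, A j, ofReal (r z ^ e * φ z ^ (2 * M + 2)) * ‖Z z‖ₑ ^ 2 := lintegral_mono_set
        hcover
    _ ≤ ∑' j, ∫⁻ z in A j, ofReal (r z ^ e * φ z ^ (2 * M + 2)) * ‖Z z‖ₑ ^ 2 := lintegral_iUnion_le
        _ _
    _ ≤ ∑' j : ℕ, ofReal k * C * ∫⁻ z in Ω ∩ {z | 1 < ‖z‖},
        (if (2 : ℝ) ^ j < ‖z‖ then ofReal (((2 : ℝ) ^ j) ^ σ) else 0) * f z := ENNReal.tsum_le_tsum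
        hstep
    _ = ofReal k * C * ∫⁻ z in Ω ∩ {z | 1 < ‖z‖}, (∑' j : ℕ,
        (if (2 : ℝ) ^ j < ‖z‖ then ofReal (((2 : ℝ) ^ j) ^ σ) else 0)) * f z := by
        rw [ENNReal.tsum_mul_left, ← lintegral_tsum fun j => (hm j).aemeasurable]
        simp only [ENNReal.tsum_mul_right]
    _ ≤ ofReal k * C * ∫⁻ z in Ω ∩ {z | 1 < ‖z‖}, ofReal B *
        (ofReal (r z ^ (ℓ n (1 + σ)) * φ z ^ (2 * M + 4)) * ‖strain Z z‖ₑ ^ 2) := by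
        refine mul_le_mul_right ?_ _
        refine setLIntegral_mono' (D.measurableSet_far 1) fun z hz => ?_
        have h1 : 1 < ‖z‖ := hz.2
        have h0 : 0 < ‖z‖ := by linarith
        have hp := D.pos z hz.1
        refine (mul_le_mul_left (tsum_two_pow_rpow_le hσ ‖z‖ h0.le) _).trans (le_of_eq ?_)
        rw [hf, mul_assoc, ← mul_assoc (ofReal (‖z‖ ^ σ)), ← ofReal_mul (by positivity),
          D.weight_far z h1.le]
        congr 3
        rw [show (ℓ n (1 + σ)) = σ + (2 + 2 * (σ / 2) - n) by ring, rpow_add h0]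
        ring
    _ ≤ _ := by
        rw [lintegral_const_mul' _ _ ofReal_ne_top]
        push_cast
        rw [← mul_assoc]
        exact mul_le_mul_right (lintegral_mono_set inter_subset_left) _

lemma ConeDomain.lower_order_bound (D : ConeDomain Ω φ r) (M : ℕ) {σ : ℝ} (hσ : 0 < σ) :
    ∃ C : NNReal, ∀ Z : VF n, Smooth Z → HasCompactSupport Z → ∫⁻ z in Ω, ofReal
      (r z ^ (ℓ n σ) * φ z ^ (2 * M + 2)) * ‖Z z‖ₑ ^ 2 ≤ C * coneEnergy Ω φ r M (ℓ n (1 + σ))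
        Z := by
  obtain ⟨C₁, hC₁⟩ := D.exists_far_bound M hσ
  set τ : ℝ := ℓ n (1 + σ) with hτ
  obtain ⟨x₀, hx₀, hx₀1⟩ := D.far_point
  have hE := D.exists_coneEnergy_bound M τ
  have hint : ∀ x ∈ Ω, ∃ U ∈ 𝓝 x, Good Ω φ M (coneEnergy Ω φ r M τ) U := by
    refine D.exists_good_of_connected hE hx₀ ?_
    obtain ⟨U, hU, C, hC⟩ := D.exists_good_far M hσ hx₀ hx₀1
    refine ⟨U, hU, C, fun Z hZ hs => (hC Z hZ hs).trans ?_⟩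
    gcongr
    exact D.farEnergy_le M (by rw [hτ]; linarith) Z
  have hgood : Good Ω φ M (coneEnergy Ω φ r M τ) (closure Ω ∩ closedBall 0 2) := by
    refine Good.of_isCompact ((isCompact_closedBall (0 : E n) 2).inter_left isClosed_closure) ?_
    rintro x ⟨hxc, hx2⟩
    by_cases hx : x ∈ Ω
    · exact hint x hx
    have hxf : x ∈ frontier Ω := by rw [D.isOpen.frontier_eq]; exact ⟨hxc, hx⟩
    refine D.exists_good_frontier hxf (isOpen_ball (x := (0 : E n)) (ε := 3)) ?_ (hE 3) fun z hz =>
      hint z hz.1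
    exact Metric.closedBall_subset_ball (by norm_num) hx2
  obtain ⟨C₂, hC₂⟩ := hgood
  have hc : Continuous fun z => r z ^ (ℓ n σ) := D.weight_smooth.continuous.rpow_const fun z =>
    Or.inl (D.weight_pos z).ne'
  obtain ⟨w, hw, hmax⟩ := (isCompact_closedBall (0 : E n) 2).exists_isMaxOn
    ⟨0, mem_closedBall_self (by norm_num)⟩ hc.continuousOn
  refine ⟨C₁ + toNNReal (r w ^ (ℓ n σ)) * C₂, fun Z hZ hs => ?_⟩
  have hsub : Ω ⊆ (Ω ∩ {z | 2 ≤ ‖z‖}) ∪ ((closure Ω ∩ closedBall 0 2) ∩ Ω) := by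
    intro z hz
    rcases le_total 2 ‖z‖ with h | h
    · exact Or.inl ⟨hz, h⟩
    · exact Or.inr ⟨⟨subset_closure hz, mem_closedBall_zero_iff.2 h⟩, hz⟩
  refine (lintegral_mono_set hsub).trans ((lintegral_union_le _ _ _).trans ?_)
  push_cast
  rw [add_mul, mul_assoc]
  gcongr
  · exact hC₁ Z hZ hs
  · refine le_trans ?_ (mul_le_mul_right (hC₂ Z hZ hs) _)
    change _ ≤ ofReal _ * _
    rw [← lintegral_const_mul' _ _ ofReal_ne_top]
    refine setLIntegral_mono' ((isClosed_closure.measurableSet.inter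
      Metric.isClosed_closedBall.measurableSet).inter D.isOpen.measurableSet) fun z hz => ?_
    have h0 := D.pos z hz.2
    have h1 : r z ^ (ℓ n σ) ≤ r w ^ (ℓ n σ) := hmax hz.1.2
    rw [← mul_assoc, ← ofReal_mul (rpow_nonneg (D.weight_pos w).le _)]
    gcongr

end LowerOrder

/-! ### The gradient of a vector field: Korn's inequality on cone domains -/

section Korn
variable {n : ℕ} {x : E n} {F : Fn n} {f : Fn n} {Ω : Set (E n)}

lemma pd_component {F : VF n} (hF : DifferentiableAt ℝ F x) (i j : Fin n) : pd i (fun y => F y j) x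
    = fderiv ℝ F x (single i 1) j := by
  have h := (proj (𝕜 := ℝ) j : E n →L[ℝ] ℝ).hasFDerivAt.comp x hF.hasFDerivAt
  rw [pd, show (fun y => F y j) = (proj (𝕜 := ℝ) j : E n →L[ℝ] ℝ) ∘ F from rfl, h.fderiv]
  rfl

lemma contDiff_component {m : WithTop ℕ∞} {F : VF n} (hF : ContDiff ℝ m F) (j : Fin n) : ContDiff ℝ
    m fun y => F y j := (proj (𝕜 := ℝ) j : E n →L[ℝ] ℝ).contDiff.comp hF

lemma contDiff_pd (hF : Smooth F) (i : Fin n) : Smooth (pd i F) := by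
  have : Smooth (fderiv ℝ F) := hF.fderiv_right (by simp)
  exact this.clm_apply contDiff_const

lemma hasCompactSupport_pd (hF : HasCompactSupport F) (i : Fin n) : HasCompactSupport (pd i F) :=
  hF.fderiv_apply ℝ _

lemma norm_sq_le_sum_entries (L : E n →L[ℝ] E n) : ‖L‖ ^ 2 ≤ ∑ i, ∑ j, (L (single i 1) j) ^ 2 := by
  set S := ∑ i, ∑ j, (L (single i 1) j) ^ 2 with hS
  have hS0 : 0 ≤ S := sum_nonneg fun i _ => sum_nonneg fun j _ => sq_nonneg _
  have h : ‖L‖ ≤ Real.sqrt S := by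
    refine L.opNorm_le_bound (sqrt_nonneg _) fun x => ?_
    rw [← Real.sqrt_sq (norm_nonneg x), ← Real.sqrt_mul hS0]
    refine Real.le_sqrt_of_sq_le ?_
    have hx : L x = ∑ i, x i • L (single i 1) := by
      conv_lhs => rw [← (EuclideanSpace.basisFun (Fin n) ℝ).sum_repr x]
      simp [map_sum]
    rw [EuclideanSpace.real_norm_sq_eq, EuclideanSpace.real_norm_sq_eq, hS, sum_comm, sum_mul]
    refine sum_le_sum fun j _ => ?_
    rw [hx]
    have : (∑ i, x i • L (single i 1)) j = ∑ i, L (single i 1) j * x i := by simp [mul_comm]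
    rw [this]
    exact Finset.sum_mul_sq_le_sq_mul_sq _ _ _
  calc ‖L‖ ^ 2 ≤ Real.sqrt S ^ 2 := by gcongr
    _ = S := sq_sqrt hS0

lemma abs_entry_le (L : E n →L[ℝ] E n) (i j : Fin n) :
    |L (single i 1) j| ≤ ‖L‖ := by
  have h1 : |L (single i 1) j| ≤ ‖L (single i 1)‖ := PiLp.norm_apply_le (L (single i 1)) j
  have h2 := L.le_opNorm (single i 1)
  simp only [PiLp.norm_single, norm_one, mul_one] at h2
  exact h1.trans h2

lemma strain_entry (Z : VF n) (x : E n) (i j : Fin n) : strain Z x (single i 1) j = fderiv ℝ Z x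
    (single i 1) j + fderiv ℝ Z x (single j 1) i := by
  have h : ∀ v : E n, v j = inner ℝ v (single j (1 : ℝ)) := fun v => by
    simp [EuclideanSpace.inner_single_right]
  simp only [strain, add_apply, PiLp.add_apply]
  congr 1
  rw [h, ContinuousLinearMap.adjoint_inner_left]
  simp [EuclideanSpace.inner_single_left]

lemma hasFDerivAt_indicator {F : Type*} [NormedAddCommGroup F] [NormedSpace ℝ F] (hΩ : IsOpen Ω)
    {H : E n → F} (hH : Differentiable ℝ H) (h0 : ∀ x ∈ frontier Ω, H x = 0)
    (h1 : ∀ x ∈ frontier Ω, fderiv ℝ H x = 0) (x : E n) : HasFDerivAt (Ω.indicator H)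
    (Ω.indicator (fderiv ℝ H) x) x := by
  by_cases hx : x ∈ Ω
  · rw [indicator_of_mem hx]
    refine (hH x).hasFDerivAt.congr_of_eventuallyEq ?_
    filter_upwards [hΩ.mem_nhds hx] with y hy
    rw [indicator_of_mem hy]
  rw [indicator_of_notMem hx]
  by_cases hxc : x ∈ closure Ω
  · have hxf : x ∈ frontier Ω := by rw [hΩ.frontier_eq]; exact ⟨hxc, hx⟩
    have h := (hH x).hasFDerivAt
    rw [h1 x hxf, hasFDerivAt_iff_isLittleO_nhds_zero] at h
    rw [hasFDerivAt_iff_isLittleO_nhds_zero]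
    refine (Asymptotics.IsBigO.of_bound 1 (of_forall fun y => ?_)).trans_isLittleO h
    rw [indicator_of_notMem hx, h0 x hxf, one_mul]
    simp only [sub_zero, zero_apply]
    exact norm_indicator_le_norm_self _ _
  · refine (hasFDerivAt_const (0 : F) x).congr_of_eventuallyEq ?_
    filter_upwards [isClosed_closure.isOpen_compl.mem_nhds hxc] with y hy
    rw [indicator_of_notMem fun h => hy (subset_closure h)]

lemma integrableOn_of_compactSupport (hf : Continuous f) (hs : HasCompactSupport f) : IntegrableOn f
    Ω := (hf.integrable_of_hasCompactSupport hs).integrableOn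

lemma setIntegral_pd_eq_zero (hΩ : IsOpen Ω) {H : Fn n} (hH : Smooth H) (hs : HasCompactSupport H)
    (h0 : ∀ x ∈ frontier Ω, H x = 0) (h1 : ∀ x ∈ frontier Ω, fderiv ℝ H x = 0) (i : Fin n) :
    ∫ x in Ω, pd i H x = 0 := by
  have hd := hasFDerivAt_indicator hΩ (hH.differentiable (by simp)) h0 h1
  have hI : Integrable (Ω.indicator (pd i H)) := by
    rw [integrable_indicator_iff hΩ.measurableSet]
    exact integrableOn_of_compactSupport (contDiff_pd hH i).continuous (hasCompactSupport_pd hs i)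
  have hI' : Integrable (Ω.indicator H) := by
    rw [integrable_indicator_iff hΩ.measurableSet]
    exact integrableOn_of_compactSupport hH.continuous hs
  have hline : ∀ x, HasLineDerivAt ℝ (Ω.indicator H) (Ω.indicator (pd i H) x) x (single i 1) := by
    intro x
    have e : Ω.indicator (pd i H) x = (Ω.indicator (fderiv ℝ H) x) (single i 1) := by
      by_cases hx : x ∈ Ω <;> simp [hx, pd]
    rw [e]
    exact (hd x).hasLineDerivAt (single i 1)
  have := integral_bilinear_hasLineDerivAt_right_eq_neg_left_of_integrable
    (μ := (volume : Measure (E n))) (f := fun _ : E n => (1 : ℝ)) (f' := fun _ => (0 : ℝ))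
    (g := Ω.indicator H) (g' := Ω.indicator (pd i H)) (v := single i 1)
    (B := ContinuousLinearMap.mul ℝ ℝ) (by simp) (by simpa using hI) (by simpa using hI')
    (fun x _ => (hasFDerivAt_const (1 : ℝ) x).hasLineDerivAt _) (fun x _ => hline x)
  rw [← integral_indicator hΩ.measurableSet]
  simpa using this

lemma pd_mul {f g : Fn n} (hf : DifferentiableAt ℝ f x) (hg : DifferentiableAt ℝ g x) (i : Fin n) :
    pd i (fun y => f y * g y) x = pd i f x * g x + f x * pd i g x := by
  simp only [pd]
  rw [fderiv_fun_mul hf hg]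
  simp only [add_apply, smul_apply, smul_eq_mul]
  ring

lemma pd_comm (hf : ContDiffAt ℝ 2 f x) (i j : Fin n) : pd i (pd j f) x = pd j (pd i f) x := by
  have h : ∀ i j : Fin n, pd i (pd j f) x = fderiv ℝ (fderiv ℝ f) x (single i 1) (single j 1) := by
    intro i j
    have hd : DifferentiableAt ℝ (fderiv ℝ f) x :=
      (hf.fderiv_right (m := 1) (by norm_num)).differentiableAt (by simp)
    have h1 := hd.hasFDerivAt.clm_apply (hasFDerivAt_const (single j (1 : ℝ)) x)
    change fderiv ℝ (fun y => fderiv ℝ f y (single j 1)) x _ = _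
    rw [h1.fderiv]
    simp
  rw [h, h]
  exact (hf.isSymmSndFDerivAt (by simp)).eq _ _

lemma lintegral_fderiv_sq_le (hΩ : IsOpen Ω) {G : VF n} (hG : Smooth G) (hs : HasCompactSupport G)
    (h0 : ∀ x ∈ frontier Ω, G x = 0) (h1 : ∀ x ∈ frontier Ω, fderiv ℝ G x = 0) : ∫⁻ x in Ω, ‖fderiv
    ℝ G x‖ₑ ^ 2 ≤ ofReal (n ^ 2) * ∫⁻ x in Ω, ‖strain G x‖ₑ ^ 2 := by
  have hGd : Differentiable ℝ G := hG.differentiable (by simp)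
  set g : Fin n → Fn n := fun j y => G y j with hg
  have hgc : ∀ j, Smooth (g j) := contDiff_component hG
  have hgd : ∀ j, Differentiable ℝ (g j) := fun j => (hgc j).differentiable (by simp)
  have hgs : ∀ j, HasCompactSupport (g j) := fun j => hs.comp_left (g := fun v : E n => v j)
    (by simp)
  have hpc : ∀ i j, Continuous (pd i (g j)) := fun i j => (contDiff_pd (hgc j) i).continuous
  have hps : ∀ i j, HasCompactSupport (pd i (g j)) := fun i j => hasCompactSupport_pd (hgs j) i
  have hpd : ∀ i j x, pd i (g j) x = fderiv ℝ G x (single i 1) j := fun i j x => pd_component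
    (hGd x) i j
  have hzero : ∀ i j k l, ∫ x in Ω, pd i (fun y => g j y * pd k (g l) y) x = 0 := by
    intro i j k l
    have hgz : ∀ x ∈ frontier Ω, g j x = 0 := fun x hx => by simp [hg, h0 x hx]
    have hgz' : ∀ x ∈ frontier Ω, fderiv ℝ (g j) x = 0 := fun x hx => by
      have h := (proj (𝕜 := ℝ) j : E n →L[ℝ] ℝ).hasFDerivAt.comp x (hGd x).hasFDerivAt
      rw [h1 x hx] at h
      have := h.fderiv
      rw [ContinuousLinearMap.comp_zero] at this
      exact this
    refine setIntegral_pd_eq_zero hΩ ((hgc j).mul (contDiff_pd (hgc l) k)) ((hgs j).mul_right)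
      (fun x hx => by simp [hgz x hx]) (fun x hx => ?_) i
    rw [fderiv_fun_mul (hgd j x) ((contDiff_pd (hgc l) k).differentiable (by simp) x), hgz x hx,
      hgz' x hx]
    simp
  have hint : ∀ i j k l, IntegrableOn (fun x => pd i (g j) x * pd k (g l) x) Ω := fun i j k l =>
    integrableOn_of_compactSupport ((hpc i j).mul (hpc k l)) (hps i j).mul_right
  have hint2 : ∀ i j k l, IntegrableOn (fun x => g i x * pd j (pd k (g l)) x) Ω := fun i j k l =>
    integrableOn_of_compactSupport ((hgc i).continuous.mul (contDiff_pd (contDiff_pd (hgc l) k) j).continuous)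
      (hgs i).mul_right
  have hpp : ∀ i j, ∫ x in Ω, pd i (g j) x * pd j (g i) x = ∫ x in Ω, pd j (g j) x * pd i (g i)
      x := by
    intro i j
    have e1 := hzero i j j i
    have e2 := hzero j j i i
    have f1 : ∀ x, pd i (fun y => g j y * pd j (g i) y) x = pd i (g j) x * pd j (g i) x + g j x * pd
        i (pd j (g i)) x := fun x => pd_mul (hgd j x)
      ((contDiff_pd (hgc i) j).differentiable (by simp) x) i
    have f2 : ∀ x, pd j (fun y => g j y * pd i (g i) y) x = pd j (g j) x * pd i (g i) x + g j x * pd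
        i (pd j (g i)) x := fun x => by
      rw [pd_mul (hgd j x) ((contDiff_pd (hgc i) i).differentiable (by simp) x) j, pd_comm
        ((hgc i).contDiffAt.of_le (WithTop.coe_le_coe.2 le_top)) j i]
    simp_rw [f1] at e1
    simp_rw [f2] at e2
    rw [integral_add (hint _ _ _ _) (hint2 _ _ _ _)] at e1 e2
    linarith
  set s : Fin n → Fin n → Fn n := fun i j x => pd i (g j) x + pd j (g i) x with hs'
  have hsc : ∀ i j, Continuous (s i j) := fun i j => (hpc i j).add (hpc j i)
  have hss : ∀ i j, HasCompactSupport (s i j) := fun i j => (hps i j).add (hps j i)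
  have hsint : ∀ i j, IntegrableOn (fun x => s i j x ^ 2) Ω := fun i j =>
    integrableOn_of_compactSupport ((hsc i j).pow 2) ((hss i j).comp_left (g := fun t => t ^ 2) (by simp))
  have hpint : ∀ i j, IntegrableOn (fun x => pd i (g j) x ^ 2) Ω := fun i j =>
    integrableOn_of_compactSupport ((hpc i j).pow 2) ((hps i j).comp_left (g := fun t => t ^ 2) (by simp))
  have hmain : ∑ i, ∑ j, ∫ x in Ω, pd i (g j) x ^ 2 ≤ ∑ i, ∑ j, ∫ x in Ω, s i j x ^ 2 := by
    have hexp : ∀ i j, ∫ x in Ω, s i j x ^ 2 = (∫ x in Ω, pd i (g j) x ^ 2) +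
        (∫ x in Ω, pd j (g i) x ^ 2) + 2 * ∫ x in Ω, pd j (g j) x * pd i (g i) x := by
      intro i j
      have e := integral_add ((hpint i j).add (hpint j i)) ((hint i j j i).const_mul 2)
      simp only [Pi.add_apply] at e
      rw [← hpp i j, ← integral_const_mul, ← integral_add (hpint i j) (hpint j i), ← e]
      refine integral_congr_ae (ae_of_all _ fun x => ?_)
      simp only [hs']; ring
    have hdiv : 0 ≤ ∑ i, ∑ j, ∫ x in Ω, pd j (g j) x * pd i (g i) x := by
      have : ∑ i, ∑ j, ∫ x in Ω, pd j (g j) x * pd i (g i) x = ∫ x in Ω, (∑ i, pd i (g i) x) ^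
          2 := by
        simp_rw [sq, Finset.sum_mul_sum]
        rw [integral_finsetSum _ fun i _ => integrable_finsetSum _ fun j _ => hint i i j j]
        rw [sum_comm]
        refine sum_congr rfl fun i _ => ?_
        rw [integral_finsetSum _ fun j _ => hint i i j j]
      rw [this]
      exact integral_nonneg fun x => sq_nonneg _
    have hsymm : ∑ i, ∑ j, ∫ x in Ω, pd j (g i) x ^ 2 = ∑ i, ∑ j, ∫ x in Ω, pd i (g j) x ^ 2 :=
      sum_comm
    simp_rw [hexp, sum_add_distrib, ← mul_sum]
    rw [hsymm]
    have : 0 ≤ ∑ i, ∑ j, ∫ x in Ω, pd i (g j) x ^ 2 := sum_nonneg fun i _ => sum_nonneg fun j _ =>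
      integral_nonneg fun x => sq_nonneg _
    linarith
  have hstr : ∀ i j x, s i j x ^ 2 ≤ ‖strain G x‖ ^ 2 := by
    intro i j x
    have h := abs_entry_le (strain G x) i j
    rw [strain_entry, ← hpd, ← hpd] at h
    rw [← sq_abs]
    gcongr
  have hq : Continuous fun x => ‖strain G x‖ ^ 2 := (continuous_strain hG).norm.pow 2
  have hstrS : HasCompactSupport fun x => ‖strain G x‖ ^ 2 := by
    refine (hs.fderiv ℝ).mono' ?_
    intro x hx
    refine subset_tsupport _ ?_
    intro h
    exact hx (by simp [strain, h])
  have hqint : IntegrableOn (fun x => ‖strain G x‖ ^ 2) Ω := integrableOn_of_compactSupport hq hstrS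
  have hfin : ∑ i, ∑ j, ∫ x in Ω, pd i (g j) x ^ 2 ≤ n ^ 2 * ∫ x in Ω, ‖strain G x‖ ^ 2 := by
    refine hmain.trans ?_
    calc _ ≤ ∑ i : Fin n, ∑ j : Fin n, ∫ x in Ω, ‖strain G x‖ ^ 2 := sum_le_sum fun i _ =>
          sum_le_sum fun j _ => integral_mono (hsint i j) hqint (hstr i j)
      _ = _ := by simp; ring
  have hEq : ∀ {F : Type} [NormedAddCommGroup F] (f : E n → F), ∀ x, ‖f x‖ₑ ^ 2 = ofReal
      (‖f x‖ ^ 2) := fun f x => by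
    rw [← ofReal_norm, ofReal_pow (norm_nonneg _)]
  calc ∫⁻ x in Ω, ‖fderiv ℝ G x‖ₑ ^ 2 ≤ ∫⁻ x in Ω, ofReal (∑ i, ∑ j, pd i (g j) x ^ 2) := by
        refine lintegral_mono fun x => ?_
        rw [← ofReal_norm, ← ofReal_pow (norm_nonneg _)]
        refine ofReal_le_ofReal ((norm_sq_le_sum_entries _).trans (le_of_eq ?_))
        simp only [hpd]
    _ = ofReal (∫ x in Ω, ∑ i, ∑ j, pd i (g j) x ^ 2) := by
        rw [ofReal_integral_eq_lintegral_ofReal]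
        · exact integrable_finsetSum _ fun i _ => integrable_finsetSum _ fun j _ => hpint i j
        · exact ae_of_all _ fun x => sum_nonneg fun i _ => sum_nonneg fun j _ => sq_nonneg _
    _ ≤ ofReal (n ^ 2 * ∫ x in Ω, ‖strain G x‖ ^ 2) := by
        refine ofReal_le_ofReal (le_trans (le_of_eq ?_) hfin)
        rw [integral_finsetSum _ fun i _ => integrable_finsetSum _ fun j _ => hpint i j]
        refine sum_congr rfl fun i _ => ?_
        rw [integral_finsetSum _ fun j _ => hpint i j]
    _ = _ := by
        rw [ofReal_mul (by positivity), ofReal_integral_eq_lintegral_ofReal hqint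
          (ae_of_all _ fun x => by positivity)]
        congr 1
        refine lintegral_congr fun x => ?_
        rw [← ofReal_norm, ofReal_pow (norm_nonneg _)]

end Korn

section Korn
variable {n : ℕ} {Ω : Set (E n)} {φ r : Fn n}

lemma exists_bound_iteratedFDeriv_of_ray {S : Set (E n)} (hS : IsOpen S)
    (hcone : ∀ x, 1 ≤ ‖x‖ → ∀ c : ℝ, 1 ≤ c → (c • x ∈ S ↔ x ∈ S)) {f r : Fn n} (hf : Smooth f)
    (hray : ∀ x ∈ S, 1 ≤ ‖x‖ → ∀ c : ℝ, 1 ≤ c → f (c • x) = f x) (hr : Continuous r)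
    (hrf : ∀ x, 1 ≤ ‖x‖ → r x = ‖x‖) (j : ℕ) : ∃ C : ℝ, ∀ z ∈ S, ‖iteratedFDeriv ℝ j f z‖ * |r z| ^
    j ≤ C := by
  have hcj : Continuous fun z => iteratedFDeriv ℝ j f z := hf.continuous_iteratedFDeriv
    (by exact_mod_cast le_top)
  obtain ⟨w, hw, hmax⟩ := (isCompact_closedBall (0 : E n) 2).exists_isMaxOn
    ⟨0, mem_closedBall_self (by norm_num)⟩ (hcj.norm.mul (hr.abs.pow j)).continuousOn
  refine ⟨‖iteratedFDeriv ℝ j f w‖ * |r w| ^ j, fun z hz => ?_⟩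
  rcases le_total ‖z‖ 2 with h | h
  · exact hmax (mem_closedBall_zero_iff.2 h)
  have hz0 : 0 < ‖z‖ := by linarith
  set l := ‖z‖ / 2 with hl
  have hl0 : 0 < l := by positivity
  have hl1 : 1 ≤ l := by rw [hl]; linarith
  have hnx : ∀ y : E n, ‖l⁻¹ • y‖ = l⁻¹ * ‖y‖ := fun y => by
    rw [norm_smul, norm_of_nonneg (by positivity)]
  have hx2 : ‖l⁻¹ • z‖ = 2 := by rw [hnx, hl]; field_simp
  set g : E n →L[ℝ] E n := l⁻¹ • ContinuousLinearMap.id ℝ (E n) with hg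
  have hgn : ‖g‖ ≤ l⁻¹ := by
    refine g.opNorm_le_bound (by positivity) fun x => ?_
    rw [hg, smul_apply, ContinuousLinearMap.id_apply, hnx]
  have hev : f =ᶠ[𝓝 z] f ∘ g := by
    have h1 : ∀ᶠ y in 𝓝 z, l < ‖y‖ := continuous_norm.continuousAt.eventually
      (lt_mem_nhds (by rw [hl]; linarith))
    filter_upwards [h1, hS.mem_nhds hz] with y hy hyS
    have hy1 : 1 ≤ ‖l⁻¹ • y‖ := by rw [hnx, inv_mul_eq_div, one_le_div hl0]; exact hy.le
    have hly : l • l⁻¹ • y = y := smul_inv_smul₀ hl0.ne' y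
    have hmem : l⁻¹ • y ∈ S := by rw [← hcone _ hy1 l hl1, hly]; exact hyS
    have := hray _ hmem hy1 l hl1
    rw [hly] at this
    exact this
  have h1 : iteratedFDeriv ℝ j f z = (iteratedFDeriv ℝ j f (g z)).compContinuousLinearMap fun _ =>
      g := by
    rw [(hev.iteratedFDeriv ℝ j).eq_of_nhds]
    exact g.iteratedFDeriv_comp_right hf z (by exact_mod_cast le_top)
  have h2 : ‖iteratedFDeriv ℝ j f z‖ ≤ ‖iteratedFDeriv ℝ j f (g z)‖ * l⁻¹ ^ j := by
    rw [h1]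
    refine (ContinuousMultilinearMap.norm_compContinuousLinearMap_le _ _).trans ?_
    rw [Finset.prod_const, Finset.card_univ, Fintype.card_fin]
    gcongr
  have hgz : g z = l⁻¹ • z := by simp [hg]
  have h3 := hmax (mem_closedBall_zero_iff.2 (show ‖g z‖ ≤ 2 by rw [hgz, hx2]))
  have hrz : |r z| = l * |r (g z)| := by
    rw [hrf z (by linarith), hrf (g z) (by rw [hgz, hx2]; norm_num), hgz, hx2, hl, abs_of_pos hz0]
    norm_num
  calc _ ≤ ‖iteratedFDeriv ℝ j f (g z)‖ * l⁻¹ ^ j * (l * |r (g z)|) ^ j := by rw [hrz]; gcongr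
    _ = ‖iteratedFDeriv ℝ j f (g z)‖ * |r (g z)| ^ j * (l⁻¹ * l) ^ j := by
        rw [mul_pow, mul_pow]; ring
    _ ≤ _ := by rw [inv_mul_cancel₀ hl0.ne', one_pow, mul_one]; exact h3

lemma exists_bound_fderiv_weight {r : Fn n} (hr : Smooth r) (hrf : ∀ x, 1 ≤ ‖x‖ → r x = ‖x‖) :
    ∃ C : ℝ, ∀ z, ‖fderiv ℝ r z‖ ≤ C := by
  obtain ⟨w, hw, hmax⟩ := (isCompact_closedBall (0 : E n) 2).exists_isMaxOn
    ⟨0, mem_closedBall_self (by norm_num)⟩ (hr.continuous_fderiv (by simp)).norm.continuousOn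
  refine ⟨max ‖fderiv ℝ r w‖ 1, fun z => ?_⟩
  rcases le_total ‖z‖ 2 with h | h
  · exact (hmax (mem_closedBall_zero_iff.2 h)).trans (le_max_left _ _)
  refine le_trans ?_ (le_max_right _ _)
  refine norm_fderiv_le_of_lip' ℝ zero_le_one ?_
  have h1 : ∀ᶠ y in 𝓝 z, 1 < ‖y‖ := continuous_norm.continuousAt.eventually
    (lt_mem_nhds (by linarith))
  filter_upwards [h1] with y hy
  rw [hrf y hy.le, hrf z (by linarith), one_mul]
  exact abs_norm_sub_norm_le y z

lemma enorm_sq_eq_ofReal {F : Type*} [SeminormedAddCommGroup F] (x : F) : ‖x‖ₑ ^ 2 = ofReal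
    (‖x‖ ^ 2) := by
  rw [← ofReal_norm, ofReal_pow (norm_nonneg _)]

/-- Korn's inequality with the weights `r^τ` and `ρ`. -/
def KornBound (Ω : Set (E n)) (r ρ : Fn n) (σ : ℝ) (C : NNReal) : Prop :=
  ∀ Z : VF n, Smooth Z → HasCompactSupport Z →
    (∫⁻ z in Ω, ofReal (r z ^ (ℓ n σ) * ρ z) * ‖Z z‖ₑ ^ 2) +
      ∫⁻ z in Ω, ofReal (r z ^ (ℓ n (1 + σ)) * ρ z) * ‖fderiv ℝ Z z‖ₑ ^ 2 ≤
    C * ∫⁻ z in Ω, ofReal (r z ^ (ℓ n (1 + σ)) * ρ z) * ‖strain Z z‖ₑ ^ 2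

lemma norm_adjoint_add_le (L : E n →L[ℝ] E n) : ‖L + ContinuousLinearMap.adjoint L‖ ≤ 2 * ‖L‖ := by
  refine (norm_add_le _ _).trans ?_
  rw [LinearIsometryEquiv.norm_map]; linarith

set_option maxHeartbeats 1000000 in
lemma lintegral_weight_fderiv_le (hΩ : IsOpen Ω) {b w : Fn n} (hbsm : Smooth b)
    (hb0 : ∀ x ∈ frontier Ω, b x = 0) (hb1 : ∀ x ∈ frontier Ω, fderiv ℝ b x = 0)
    (hbpos : ∀ x ∈ Ω, 0 ≤ b x) {k : NNReal} (hbbd : ∀ x ∈ Ω, ‖fderiv ℝ b x‖ ^ 2 ≤ k * w x)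
    {Z : VF n} (hZ : Smooth Z) (hs : HasCompactSupport Z) :
    ∫⁻ x in Ω, ofReal (b x ^ 2) * ‖fderiv ℝ Z x‖ₑ ^ 2 ≤ 2 * (ofReal (n ^ 2) *
        (2 * (∫⁻ x in Ω, ofReal (b x ^ 2) * ‖strain Z x‖ₑ ^ 2) + 8 *
          (k * ∫⁻ x in Ω, ofReal (w x) * ‖Z x‖ₑ ^ 2))) + 2 *
        (k * ∫⁻ x in Ω, ofReal (w x) * ‖Z x‖ₑ ^ 2) := by
  have hΩm := hΩ.measurableSet
  have hbd : Differentiable ℝ b := hbsm.differentiable (by simp)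
  have hZd : Differentiable ℝ Z := hZ.differentiable (by simp)
  have hDZ : Continuous (fderiv ℝ Z) := hZ.continuous_fderiv (by simp)
  have hDb : Continuous (fderiv ℝ b) := hbsm.continuous_fderiv (by simp)
  have hms : Measurable fun x => (‖fderiv ℝ b x‖ₑ * ‖Z x‖ₑ) ^ 2 :=
    (hDb.enorm.measurable.mul hZ.continuous.enorm.measurable).pow_const 2
  have hDbZ : ∫⁻ x in Ω, (‖fderiv ℝ b x‖ₑ * ‖Z x‖ₑ) ^ 2 ≤ k * ∫⁻ x in Ω, ofReal (w x) * ‖Z x‖ₑ ^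
      2 := by
    rw [← lintegral_const_mul' _ _ ENNReal.coe_ne_top]
    refine setLIntegral_mono' hΩm fun x hx => ?_
    rw [mul_pow, ← mul_assoc, ← ofReal_coe_nnreal (p := k), ← ofReal_mul k.coe_nonneg]
    gcongr
    rw [enorm_sq_eq_ofReal]
    exact ofReal_le_ofReal (hbbd x hx)
  set G : VF n := fun x => b x • Z x with hG
  have hGsm : Smooth G := hbsm.smul hZ
  have hGs : HasCompactSupport G := by
    refine hs.mono fun x hx h => hx ?_
    simp only [hG, h, smul_zero]
  have hGder : ∀ x, fderiv ℝ G x = b x • fderiv ℝ Z x + (fderiv ℝ b x).smulRight (Z x) := fun x =>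
    fderiv_fun_smul (hbd x) (hZd x)
  have hcac := lintegral_fderiv_sq_le hΩ hGsm hGs (fun x hx => by simp [hG, hb0 x hx])
    (fun x hx => by ext1 v; rw [hGder]; simp [hb0 x hx, hb1 x hx])
  have hnorm : ∀ x, ‖(fderiv ℝ b x).smulRight (Z x)‖ = ‖fderiv ℝ b x‖ * ‖Z x‖ := fun x =>
    ContinuousLinearMap.norm_smulRight_apply _ _
  have hstr : ∀ x ∈ Ω, ‖strain G x‖ₑ ^ 2 ≤ 2 * (ofReal (b x ^ 2) * ‖strain Z x‖ₑ ^ 2) + 8 *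
      (‖fderiv ℝ b x‖ₑ * ‖Z x‖ₑ) ^ 2 := by
    intro x hx
    have hbx := hbpos x hx
    have h1 : strain G x = b x • strain Z x + ((fderiv ℝ b x).smulRight (Z x) +
        ContinuousLinearMap.adjoint ((fderiv ℝ b x).smulRight (Z x))) := by
      simp only [strain, hGder, map_add, map_smulₛₗ, smul_add]
      simp only [conj_trivial]
      abel
    have h2 : ‖strain G x‖ ≤ b x * ‖strain Z x‖ + 2 * (‖fderiv ℝ b x‖ * ‖Z x‖) := by
      rw [h1, ← hnorm]
      refine (norm_add_le _ _).trans ?_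
      rw [norm_smul, norm_of_nonneg hbx]
      gcongr
      exact norm_adjoint_add_le _
    have h3 : ‖strain G x‖ ^ 2 ≤ 2 * (b x ^ 2 * ‖strain Z x‖ ^ 2) + 8 * (‖fderiv ℝ b x‖ * ‖Z x‖) ^
        2 := by
      have := pow_le_pow_left₀ (norm_nonneg _) h2 2
      nlinarith [sq_nonneg (b x * ‖strain Z x‖ - 2 * (‖fderiv ℝ b x‖ * ‖Z x‖))]
    rw [enorm_sq_eq_ofReal, enorm_sq_eq_ofReal, mul_pow, enorm_sq_eq_ofReal, enorm_sq_eq_ofReal, ←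
      ofReal_mul (by positivity), ← ofReal_mul (by positivity)]
    refine (ofReal_le_ofReal h3).trans (le_of_eq ?_)
    rw [ofReal_add (by positivity) (by positivity), ofReal_mul two_pos.le, ofReal_mul (p := 8)
      (by norm_num), mul_pow]
    norm_num
  have hDG := (setLIntegral_mono' (μ := volume) hΩm hstr).trans_eq
    (lintegral_add_right _ (hms.const_mul _))
  rw [lintegral_const_mul' _ _ (by simp), lintegral_const_mul' _ _ (by simp)] at hDG
  have hpt : ∀ x ∈ Ω, ofReal (b x ^ 2) * ‖fderiv ℝ Z x‖ₑ ^ 2 ≤ 2 * ‖fderiv ℝ G x‖ₑ ^ 2 + 2 *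
      (‖fderiv ℝ b x‖ₑ * ‖Z x‖ₑ) ^ 2 := by
    intro x hx
    have hbx := hbpos x hx
    have h2 : b x * ‖fderiv ℝ Z x‖ ≤ ‖fderiv ℝ G x‖ + ‖fderiv ℝ b x‖ * ‖Z x‖ := by
      rw [← hnorm, ← norm_of_nonneg hbx, ← norm_smul]
      have : b x • fderiv ℝ Z x = fderiv ℝ G x - (fderiv ℝ b x).smulRight (Z x) := by
        rw [hGder]; simp
      rw [this]
      exact norm_sub_le _ _
    have h3 : b x ^ 2 * ‖fderiv ℝ Z x‖ ^ 2 ≤ 2 * ‖fderiv ℝ G x‖ ^ 2 + 2 * (‖fderiv ℝ b x‖ * ‖Z x‖) ^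
        2 := by
      have := pow_le_pow_left₀ (by positivity) h2 2
      nlinarith [sq_nonneg (‖fderiv ℝ G x‖ - ‖fderiv ℝ b x‖ * ‖Z x‖)]
    rw [enorm_sq_eq_ofReal, enorm_sq_eq_ofReal, mul_pow, enorm_sq_eq_ofReal, enorm_sq_eq_ofReal, ←
      ofReal_mul (by positivity), ← ofReal_mul (by positivity)]
    refine (ofReal_le_ofReal h3).trans (le_of_eq ?_)
    rw [ofReal_add (by positivity) (by positivity), ofReal_mul two_pos.le, ofReal_mul (p := 2)
      (by norm_num), mul_pow]
    norm_num
  have hgrad := (setLIntegral_mono' (μ := volume) hΩm hpt).trans_eq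
    (lintegral_add_right _ (hms.const_mul _))
  rw [lintegral_const_mul' _ _ (by simp), lintegral_const_mul' _ _ (by simp)] at hgrad
  refine hgrad.trans ?_
  gcongr
  refine hcac.trans ?_
  gcongr
  refine hDG.trans ?_
  gcongr

lemma ConeDomain.fderiv_weight (D : ConeDomain Ω φ r) (M : ℕ) (τ : ℝ) :
    (∀ x, fderiv ℝ (fun x => r x ^ τ * φ x ^ (M + 2)) x = (r x ^ τ * ((M + 2 : ℕ) * φ x ^ (M + 1)))
      • fderiv ℝ φ x + (φ x ^ (M + 2) * (τ * r x ^ (τ - 1))) • fderiv ℝ r x) ∧ ∃ K : NNReal,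
    ∀ x ∈ Ω, ‖fderiv ℝ (fun x => r x ^ τ * φ x ^ (M + 2)) x‖ ^ 2 ≤ K *
      (r x ^ (2 * (τ - 1)) * φ x ^ (2 * M + 2)) := by
  obtain ⟨Cφ, hCφ⟩ := exists_bound_iteratedFDeriv_of_ray D.isOpen D.cone D.smooth D.ray
    D.weight_smooth.continuous D.weight_far 0
  obtain ⟨Cφ', hCφ'⟩ := exists_bound_iteratedFDeriv_of_ray D.isOpen D.cone D.smooth D.ray
    D.weight_smooth.continuous D.weight_far 1
  obtain ⟨Cr, hCr⟩ := exists_bound_fderiv_weight D.weight_smooth D.weight_far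
  have hφd : Differentiable ℝ φ := D.smooth.differentiable (by simp)
  have hrd : Differentiable ℝ r := D.weight_smooth.differentiable (by simp)
  have hder : ∀ x, fderiv ℝ (fun x => r x ^ τ * φ x ^ (M + 2)) x =
      (r x ^ τ * ((M + 2 : ℕ) * φ x ^ (M + 1))) • fderiv ℝ φ x +
      (φ x ^ (M + 2) * (τ * r x ^ (τ - 1))) • fderiv ℝ r x := by
    intro x
    have h1 : HasFDerivAt (fun x => r x ^ τ) ((τ * r x ^ (τ - 1)) • fderiv ℝ r x) x :=
      (hrd x).hasFDerivAt.rpow_const (Or.inl (D.weight_pos x).ne')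
    have h2 : HasFDerivAt (fun x => φ x ^ (M + 2)) (((M + 2 : ℕ) * φ x ^ (M + 1)) • fderiv ℝ φ x)
        x := by
      have := (hφd x).hasFDerivAt.pow (M + 2)
      simpa using this
    have h3 : HasFDerivAt (fun x => r x ^ τ * φ x ^ (M + 2)) _ x := h1.mul h2
    rw [h3.fderiv, smul_smul, smul_smul]
  refine ⟨hder, toNNReal (((M + 2 : ℕ) * Cφ' + |τ| * Cr * Cφ) ^ 2), fun x hx => ?_⟩
  rw [Real.coe_toNNReal _ (sq_nonneg _)]
  have hφ0 := D.pos x hx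
  have hr0 := D.weight_pos x
  have h1 := hCφ x hx
  rw [norm_iteratedFDeriv_zero, pow_zero, mul_one, norm_of_nonneg hφ0.le] at h1
  have h2 := hCφ' x hx
  rw [norm_iteratedFDeriv_one, pow_one, abs_of_pos hr0] at h2
  have h3 := hCr x
  have hCr0 := (norm_nonneg _).trans h3
  have hsplit : r x ^ τ = r x ^ (τ - 1) * r x := by rw [← Real.rpow_add_one hr0.ne']; congr 1; ring
  have hle : ‖fderiv ℝ (fun x => r x ^ τ * φ x ^ (M + 2)) x‖ ≤ ((M + 2 : ℕ) * Cφ' + |τ| * Cr * Cφ) *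
      (r x ^ (τ - 1) * φ x ^ (M + 1)) := by
    rw [hder]
    refine (norm_add_le _ _).trans ?_
    rw [norm_smul, norm_smul, add_mul]
    refine add_le_add ?_ ?_
    · rw [norm_of_nonneg (by positivity), hsplit]
      calc _ = ((M + 2 : ℕ) * (‖fderiv ℝ φ x‖ * r x)) * (r x ^ (τ - 1) * φ x ^ (M + 1)) := by ring
        _ ≤ _ := by gcongr
    · rw [norm_mul, norm_mul, norm_of_nonneg (by positivity : 0 ≤ φ x ^ (M + 2)), norm_eq_abs,
        norm_of_nonneg (by positivity : 0 ≤ r x ^ (τ - 1))]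
      calc _ = (|τ| * ‖fderiv ℝ r x‖ * φ x) * (r x ^ (τ - 1) * φ x ^ (M + 1)) := by ring
        _ ≤ _ := by gcongr
  refine (pow_le_pow_left₀ (norm_nonneg _) hle 2).trans_eq ?_
  have : r x ^ (2 * (τ - 1)) = r x ^ (τ - 1) * r x ^ (τ - 1) := by
    rw [← rpow_add hr0]; congr 1; ring
  rw [this]; ring

lemma ConeDomain.exists_kornBound (D : ConeDomain Ω φ r) {N : ℕ} (hN : 3 ≤ N) {σ : ℝ} (hσ : 0 < σ) :
    ∃ C : NNReal, KornBound Ω r (fun x => φ x ^ (2 * N)) σ C := by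
  obtain ⟨M, rfl⟩ : ∃ M, N = M + 2 := ⟨N - 2, by omega⟩
  obtain ⟨C₀, hC₀⟩ := D.lower_order_bound M hσ
  obtain ⟨Cφ, hCφ⟩ := exists_bound_iteratedFDeriv_of_ray D.isOpen D.cone D.smooth D.ray
    D.weight_smooth.continuous D.weight_far 0
  obtain ⟨τ, hτ⟩ : ∃ τ : ℝ, 2 * τ = ℓ n (1 + σ) := ⟨(ℓ n (1 + σ)) / 2, by ring⟩
  have hτ1 : 2 * (τ - 1) = ℓ n σ := by linarith
  obtain ⟨hder, k, hk⟩ := D.fderiv_weight M τ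
  rw [hτ1] at hk
  have hΩm := D.isOpen.measurableSet
  have hbsm : Smooth fun x => r x ^ τ * φ x ^ (M + 2) :=
    (D.weight_smooth.rpow_const_of_ne fun x => (D.weight_pos x).ne').mul (D.smooth.pow _)
  have hb2 : ∀ x, (r x ^ τ * φ x ^ (M + 2)) ^ 2 = r x ^ (ℓ n (1 + σ)) * φ x ^ (2 * (M + 2)) := by
    intro x
    have : r x ^ (ℓ n (1 + σ)) = r x ^ τ * r x ^ τ := by
      rw [← rpow_add (D.weight_pos x), ← hτ]; congr 1; ring
    rw [this]; ring
  refine ⟨toNNReal (Cφ ^ 2) * C₀ + (2 * (toNNReal (n ^ 2) * (2 + 8 * (k * C₀))) + 2 * (k * C₀)),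
    fun Z hZ hs => ?_⟩
  have hlow := hC₀ Z hZ hs
  have hgrad := lintegral_weight_fderiv_le D.isOpen hbsm (fun x hx => by simp [D.zero x hx])
    (fun x hx => by rw [hder]; simp [D.zero x hx])
    (fun x hx => mul_nonneg (rpow_nonneg (D.weight_pos x).le _) (pow_nonneg (D.pos x hx).le _)) hk
    hZ hs
  simp only [hb2] at hgrad
  have hL : ∫⁻ x in Ω, ofReal (r x ^ (ℓ n σ) * φ x ^ (2 * (M + 2))) * ‖Z x‖ₑ ^ 2 ≤ ofReal (Cφ ^ 2) *
      ∫⁻ z in Ω, ofReal (r z ^ (ℓ n σ) * φ z ^ (2 * M + 2)) * ‖Z z‖ₑ ^ 2 := by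
    rw [← lintegral_const_mul' _ _ ofReal_ne_top]
    refine setLIntegral_mono' hΩm fun x hx => ?_
    rw [← mul_assoc, ← ofReal_mul (by positivity)]
    refine mul_le_mul_left (ofReal_le_ofReal ?_) _
    have h0 := D.pos x hx
    have h1 := hCφ x hx
    rw [norm_iteratedFDeriv_zero, pow_zero, mul_one, norm_of_nonneg h0.le] at h1
    have h2 := D.weight_pos x
    calc _ = φ x ^ 2 * (r x ^ (ℓ n σ) * φ x ^ (2 * M + 2)) := by ring
      _ ≤ _ := by gcongr
  have hE : coneEnergy Ω φ r M (ℓ n (1 + σ)) Z = ∫⁻ z in Ω, ofReal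
      (r z ^ (ℓ n (1 + σ)) * φ z ^ (2 * (M + 2))) * ‖strain Z z‖ₑ ^ 2 := rfl
  rw [hE] at hlow
  generalize (∫⁻ z in Ω, ofReal (r z ^ (ℓ n (1 + σ)) * φ z ^ (2 * (M + 2))) *
    ‖strain Z z‖ₑ ^ 2) = e at hlow hgrad ⊢
  generalize (∫⁻ z in Ω, ofReal (r z ^ (ℓ n σ) * φ z ^ (2 * M + 2)) *
    ‖Z z‖ₑ ^ 2) = l at hlow hgrad hL
  refine (add_le_add hL hgrad).trans ?_
  calc _ ≤ ofReal (Cφ ^ 2) * (C₀ * e) +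
        (2 * (ofReal (n ^ 2) * (2 * e + 8 * (k * (C₀ * e)))) + 2 * (k * (C₀ * e))) := by
        gcongr
    _ = (ofReal (Cφ ^ 2) * C₀ + (2 * (ofReal (n ^ 2) * (2 + 8 * (k * C₀))) + 2 * (k * C₀))) *
          e := by ring
    _ = _ := by rw [ofReal, ofReal]; push_cast; rfl

end Korn

/-- A family of open regions with weights, along a filter. -/
structure RegionFamily (n : ℕ) where
  ι : Type
  l : Filter ι
  Ω : ι → Set (E n)
  r : ι → Fn n
  isOpen : ∀ i, IsOpen (Ω i)
  pos : ∀ i x, 0 < r i x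
  weight_continuous : ∀ i, Continuous (r i)

section Partial
variable {n : ℕ} {Ω : Set (E n)} {x : E n} {F : Fn n} {f : Fn n}

lemma ContDiffOn.pd {k : ℕ} (hΩ : IsOpen Ω) (hF : ContDiffOn ℝ ((k + 1 : ℕ) : WithTop ℕ∞) F Ω)
    (a : Fin n) : ContDiffOn ℝ k (Constraint.pd a F) Ω := by
  have := hF.fderiv_of_isOpen hΩ (m := k) (by norm_cast)
  exact this.clm_apply contDiffOn_const

lemma differentiableAt_of_contDiffOn {k : ℕ} (hΩ : IsOpen Ω)
    (hF : ContDiffOn ℝ ((k + 1 : ℕ) : WithTop ℕ∞) F Ω) (hx : x ∈ Ω) : DifferentiableAt ℝ F x :=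
  (hF.differentiableOn (by simp)).differentiableAt (hΩ.mem_nhds hx)

lemma pd_congr {F G : Fn n} (hΩ : IsOpen Ω) (h : EqOn F G Ω) (a : Fin n) : EqOn (pd a F) (pd a G)
    Ω := fun x hx => by
  have : F =ᶠ[𝓝 x] G := by filter_upwards [hΩ.mem_nhds hx] with y hy using h hy
  simp only [pd, this.fderiv_eq]

lemma pd_add {f g : Fn n} (hf : DifferentiableAt ℝ f x) (hg : DifferentiableAt ℝ g x) (a : Fin n) :
    pd a (fun y => f y + g y) x = pd a f x + pd a g x := by
  simp only [pd, fderiv_fun_add hf hg, add_apply]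

lemma pd_const_mul (hf : DifferentiableAt ℝ f x) (c : ℝ) (a : Fin n) : pd a (fun y => c * f y) x = c
    * pd a f x := by
  simp only [pd, fderiv_const_mul hf, smul_apply, smul_eq_mul]

lemma pd_const (c : ℝ) (a : Fin n) (x : E n) : pd a (fun _ => c) x = 0 := by simp [pd]

lemma pd_inv (hf : DifferentiableAt ℝ f x) (h0 : f x ≠ 0) (a : Fin n) : pd a (fun y => (f y)⁻¹) x =
    -1 * (pd a f x * ((f x)⁻¹ * (f x)⁻¹)) := by
  have : HasFDerivAt (fun y => (f y)⁻¹) (-(f x ^ 2)⁻¹ • fderiv ℝ f x) x :=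
    (hasDerivAt_inv h0).comp_hasFDerivAt x hf.hasFDerivAt
  rw [pd, this.fderiv]
  simp only [smul_apply, smul_eq_mul, pd]
  ring

lemma pd_sqrt (hf : DifferentiableAt ℝ f x) (h0 : 0 < f x) (a : Fin n) : pd a
    (fun y => Real.sqrt (f y)) x = (1 / 2) * (pd a f x * (Real.sqrt (f x) * (f x)⁻¹)) := by
  have : HasFDerivAt (fun y => Real.sqrt (f y)) ((1 / (2 * Real.sqrt (f x))) • fderiv ℝ f x) x :=
    hf.hasFDerivAt.sqrt h0.ne'
  rw [pd, this.fderiv]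
  simp only [smul_apply, smul_eq_mul, pd]
  have h1 : Real.sqrt (f x) * (f x)⁻¹ = (Real.sqrt (f x))⁻¹ := by
    nth_rw 2 [← Real.mul_self_sqrt h0.le]
    field_simp
  rw [h1, one_div, mul_inv]
  ring

end Partial

section Symbol
variable {n : ℕ} {𝓕 : RegionFamily n}

/-- `F = O(σ r^{-m})`, uniformly in the family. -/
def OrderBound (𝓕 : RegionFamily n) (σ : 𝓕.ι → ℝ) (m : ℕ) (F : 𝓕.ι → Fn n) : Prop :=
  ∃ C : ℝ, 0 ≤ C ∧ ∀ᶠ i in 𝓕.l, ∀ x ∈ 𝓕.Ω i, |F i x| * 𝓕.r i x ^ m ≤ C * σ i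

/-- `∂^β F = O(σ r^{-m-|β|})` for `|β| ≤ k`, uniformly in the family. -/
def SymBound (𝓕 : RegionFamily n) (σ : 𝓕.ι → ℝ) : ℕ → ℕ → (𝓕.ι → Fn n) → Prop
  | 0, m, F => OrderBound 𝓕 σ m F
  | k + 1, m, F => OrderBound 𝓕 σ m F ∧ ∀ a, SymBound 𝓕 σ k (m + 1) fun i => pd a (F i)

/-- Symbols: families of `C^k` functions such that `∂^β F = O(σ r^{-m-|β|})` for `|β| ≤ k`. -/
structure Sym (𝓕 : RegionFamily n) (σ : 𝓕.ι → ℝ) (k m : ℕ) (F : 𝓕.ι → Fn n) : Prop where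
  smooth : ∀ᶠ i in 𝓕.l, ContDiffOn ℝ k (F i) (𝓕.Ω i)
  bound : SymBound 𝓕 σ k m F

variable {σ σ' : 𝓕.ι → ℝ} {k m m' : ℕ} {F G : 𝓕.ι → Fn n}

lemma OrderBound.congr (hF : OrderBound 𝓕 σ m F) (h : ∀ᶠ i in 𝓕.l, EqOn (F i) (G i) (𝓕.Ω i)) :
    OrderBound 𝓕 σ m G := by
  obtain ⟨C, hC0, hC⟩ := hF
  refine ⟨C, hC0, ?_⟩
  filter_upwards [hC, h] with i h1 h2 x hx
  rw [← h2 hx]; exact h1 x hx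

lemma OrderBound.mono (hF : OrderBound 𝓕 σ m F) (h : ∃ C, 0 ≤ C ∧ ∀ᶠ i in 𝓕.l, σ i ≤ C * σ' i) :
    OrderBound 𝓕 σ' m F := by
  obtain ⟨C, hC0, hC⟩ := hF
  obtain ⟨D, hD0, hD⟩ := h
  refine ⟨C * D, by positivity, ?_⟩
  filter_upwards [hC, hD] with i h1 h2 x hx
  calc _ ≤ C * σ i := h1 x hx
    _ ≤ C * (D * σ' i) := by gcongr
    _ = _ := by ring

lemma OrderBound.add (hF : OrderBound 𝓕 σ m F) (hG : OrderBound 𝓕 σ m G) : OrderBound 𝓕 σ m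
    fun i x => F i x + G i x := by
  obtain ⟨C, hC0, hC⟩ := hF
  obtain ⟨D, hD0, hD⟩ := hG
  refine ⟨C + D, by positivity, ?_⟩
  filter_upwards [hC, hD] with i h1 h2 x hx
  have h3 := pow_pos (𝓕.pos i x) m
  have h4 := abs_add_le (F i x) (G i x)
  nlinarith [h1 x hx, h2 x hx]

lemma OrderBound.mul (hσ : ∀ i, 0 ≤ σ i) (hF : OrderBound 𝓕 σ m F) (hG : OrderBound 𝓕 σ' m' G) :
    OrderBound 𝓕 (fun i => σ i * σ' i) (m + m') fun i x => F i x * G i x := by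
  obtain ⟨C, hC0, hC⟩ := hF
  obtain ⟨D, hD0, hD⟩ := hG
  refine ⟨C * D, by positivity, ?_⟩
  filter_upwards [hC, hD] with i h1 h2 x hx
  have h3 := pow_pos (𝓕.pos i x) m'
  have h4 := hσ i
  calc _ = (|F i x| * 𝓕.r i x ^ m) * (|G i x| * 𝓕.r i x ^ m') := by rw [abs_mul, pow_add]; ring
    _ ≤ (C * σ i) * (D * σ' i) := mul_le_mul (h1 x hx) (h2 x hx) (by positivity) (by positivity)
    _ = _ := by ring

lemma SymBound.order : ∀ {k : ℕ}, SymBound 𝓕 σ k m F → OrderBound 𝓕 σ m F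
  | 0, h => h
  | _ + 1, h => h.1

lemma SymBound.of_succ : ∀ {k m : ℕ} {F : 𝓕.ι → Fn n}, SymBound 𝓕 σ (k + 1) m F → SymBound 𝓕 σ k m F
  | 0, _, _, h => h.1
  | _ + 1, _, _, h => ⟨h.1, fun a => SymBound.of_succ (h.2 a)⟩

lemma SymBound.of_le {k' : ℕ} (hk : k' ≤ k) (h : SymBound 𝓕 σ k m F) : SymBound 𝓕 σ k' m F := by
  induction hk with
  | refl => exact h
  | step _ ih => exact ih h.of_succ

lemma SymBound.congr : ∀ {k m : ℕ} {F G : 𝓕.ι → Fn n}, SymBound 𝓕 σ k m F →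
    (∀ᶠ i in 𝓕.l, EqOn (F i) (G i) (𝓕.Ω i)) → SymBound 𝓕 σ k m G
  | 0, _, _, _, hF, h => OrderBound.congr hF h
  | _ + 1, _, _, _, hF, h => ⟨hF.1.congr h, fun a => (hF.2 a).congr
      (h.mono fun i hi => pd_congr (𝓕.isOpen i) hi a)⟩

lemma SymBound.mono (h : ∃ C, 0 ≤ C ∧ ∀ᶠ i in 𝓕.l, σ i ≤ C * σ' i) : ∀ {k m : ℕ} {F : 𝓕.ι → Fn n},
    SymBound 𝓕 σ k m F → SymBound 𝓕 σ' k m F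
  | 0, _, _, hF => OrderBound.mono hF h
  | _ + 1, _, _, hF => ⟨hF.1.mono h, fun a => (hF.2 a).mono h⟩

namespace Sym

lemma congr (hF : Sym 𝓕 σ k m F) (h : ∀ᶠ i in 𝓕.l, EqOn (F i) (G i) (𝓕.Ω i)) : Sym 𝓕 σ k m G :=
  ⟨(hF.smooth.and h).mono fun _ hi => hi.1.congr fun _ hx => (hi.2 hx).symm, hF.bound.congr h⟩

lemma mono (hF : Sym 𝓕 σ k m F) (h : ∃ C, 0 ≤ C ∧ ∀ᶠ i in 𝓕.l, σ i ≤ C * σ' i) : Sym 𝓕 σ' k m F :=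
    ⟨hF.smooth, hF.bound.mono h⟩

lemma of_le {k' : ℕ} (hk : k' ≤ k) (hF : Sym 𝓕 σ k m F) : Sym 𝓕 σ k' m F :=
  ⟨hF.smooth.mono fun _ h => h.of_le (by exact_mod_cast hk), hF.bound.of_le hk⟩

lemma pd (hF : Sym 𝓕 σ (k + 1) m F) (a : Fin n) : Sym 𝓕 σ k (m + 1) fun i => Constraint.pd a
    (F i) := ⟨hF.smooth.mono fun i h => ContDiffOn.pd (𝓕.isOpen i) h a, hF.bound.2 a⟩

lemma differentiableAt (hF : Sym 𝓕 σ (k + 1) m F) : ∀ᶠ i in 𝓕.l, ∀ x ∈ 𝓕.Ω i, DifferentiableAt ℝ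
    (F i) x := hF.smooth.mono fun i h _ hx => differentiableAt_of_contDiffOn (𝓕.isOpen i) h hx

lemma mk_succ (hs : ∀ᶠ i in 𝓕.l, ContDiffOn ℝ ((k + 1 : ℕ) : WithTop ℕ∞) (F i) (𝓕.Ω i))
    (h0 : OrderBound 𝓕 σ m F) (h1 : ∀ a, Sym 𝓕 σ k (m + 1) fun i => Constraint.pd a (F i)) : Sym 𝓕 σ
    (k + 1) m F := ⟨hs, h0, fun a => (h1 a).bound⟩

lemma add : ∀ {k m : ℕ} {F G : 𝓕.ι → Fn n}, Sym 𝓕 σ k m F → Sym 𝓕 σ k m G → Sym 𝓕 σ k m fun i x => F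
    i x + G i x
  | 0, _, _, _, hF, hG => ⟨(hF.smooth.and hG.smooth).mono fun _ h => h.1.add h.2, OrderBound.add
      hF.bound hG.bound⟩
  | _ + 1, _, _, _, hF, hG => by
    refine mk_succ ((hF.smooth.and hG.smooth).mono fun _ h => h.1.add h.2)
      (hF.bound.1.add hG.bound.1) fun a => ((hF.pd a).add (hG.pd a)).congr ?_
    filter_upwards [hF.differentiableAt, hG.differentiableAt] with i h1 h2 x hx
    exact (pd_add (h1 x hx) (h2 x hx) a).symm

lemma mul (hσ : ∀ i, 0 ≤ σ i) : ∀ {k m m' : ℕ} {F G : 𝓕.ι → Fn n}, Sym 𝓕 σ k m F → Sym 𝓕 σ' k m' G →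
    Sym 𝓕 (fun i => σ i * σ' i) k (m + m') fun i x => F i x * G i x
  | 0, _, _, _, _, hF, hG => ⟨(hF.smooth.and hG.smooth).mono fun _ h => h.1.mul h.2, OrderBound.mul
      hσ hF.bound hG.bound⟩
  | k + 1, m, m', F, G, hF, hG => by
    refine mk_succ ((hF.smooth.and hG.smooth).mono fun _ h => h.1.mul h.2)
      (OrderBound.mul hσ hF.bound.1 hG.bound.1) fun a => ?_
    have h1 := (hF.pd a).mul hσ (hG.of_le (Nat.le_succ k))
    have h2 := (hF.of_le (Nat.le_succ k)).mul hσ (hG.pd a)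
    rw [show m + 1 + m' = m + m' + 1 by ring] at h1
    refine (h1.add h2).congr ?_
    filter_upwards [hF.differentiableAt, hG.differentiableAt] with i h1 h2 x hx
    exact (pd_mul (h1 x hx) (h2 x hx) a).symm

lemma mul_one (hσ : ∀ i, 0 ≤ σ i) (hF : Sym 𝓕 σ k m F) (hG : Sym 𝓕 (fun _ => 1) k m' G) : Sym 𝓕 σ k
    (m + m') fun i x => F i x * G i x := by
  simpa using hF.mul hσ hG

lemma one_mul (hF : Sym 𝓕 (fun _ => 1) k m F) (hG : Sym 𝓕 σ k m' G) : Sym 𝓕 σ k (m + m') fun i x =>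
    F i x * G i x := by
  simpa using hF.mul (fun _ => zero_le_one) hG

lemma zero (hσ : ∀ i, 0 ≤ σ i) : ∀ {k m : ℕ}, Sym 𝓕 σ k m fun _ _ => 0
  | 0, m => ⟨of_forall fun _ => contDiffOn_const, 0, le_rfl, by simp⟩
  | k + 1, m => mk_succ (of_forall fun _ => contDiffOn_const) ⟨0, le_rfl, by simp⟩ fun a =>
      (zero hσ).congr (of_forall fun i x _ => (pd_const 0 a x).symm)

lemma const (c : ℝ) : ∀ {k : ℕ}, Sym 𝓕 (fun _ => 1) k 0 fun _ _ => c
  | 0 => ⟨of_forall fun _ => contDiffOn_const, |c|, abs_nonneg c, by simp⟩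
  | k + 1 => mk_succ (of_forall fun _ => contDiffOn_const) ⟨|c|, abs_nonneg c, by simp⟩ fun a =>
      (zero fun _ => zero_le_one).congr (of_forall fun i x _ => (pd_const c a x).symm)

lemma const_mul (hF : Sym 𝓕 σ k m F) (c : ℝ) : Sym 𝓕 σ k m fun i x => c * F i x := by
  simpa using (const (𝓕 := 𝓕) c (k := k)).one_mul hF

lemma neg (hF : Sym 𝓕 σ k m F) : Sym 𝓕 σ k m fun i x => -F i x := by simpa using hF.const_mul (-1)

lemma sub (hF : Sym 𝓕 σ k m F) (hG : Sym 𝓕 σ k m G) : Sym 𝓕 σ k m fun i x => F i x - G i x := by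
  simpa [sub_eq_add_neg] using hF.add hG.neg

lemma sum (hσ : ∀ i, 0 ≤ σ i) {κ : Type*} {s : Finset κ} {F : κ → 𝓕.ι → Fn n}
    (hF : ∀ j ∈ s, Sym 𝓕 σ k m (F j)) : Sym 𝓕 σ k m fun i x => ∑ j ∈ s, F j i x := by
  classical
  induction s using Finset.induction_on with
  | empty => simpa using zero hσ
  | insert j s hj ih =>
    simp only [sum_insert hj]
    exact (hF j (mem_insert_self j s)).add (ih fun k hk => hF k (mem_insert_of_mem hk))

lemma inv (hF : Sym 𝓕 (fun _ => 1) k 0 F)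
    (hc : ∃ c : ℝ, 0 < c ∧ ∀ᶠ i in 𝓕.l, ∀ x ∈ 𝓕.Ω i, c ≤ F i x) : Sym 𝓕 (fun _ => 1) k 0 fun i x =>
    (F i x)⁻¹ := by
  obtain ⟨c, hc0, hc⟩ := hc
  have h0 : OrderBound 𝓕 (fun _ => 1) 0 fun i x => (F i x)⁻¹ := by
    refine ⟨c⁻¹, by positivity, hc.mono fun i hi x hx => ?_⟩
    have := hi x hx
    rw [pow_zero, _root_.mul_one, _root_.mul_one, abs_of_nonneg (inv_nonneg.2 (hc0.le.trans this))]
    exact inv_anti₀ hc0 this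
  have hsm : ∀ {k : ℕ}, Sym 𝓕 (fun _ => 1) k 0 F → ∀ᶠ i in 𝓕.l, ContDiffOn ℝ k (fun x => (F i x)⁻¹)
      (𝓕.Ω i) := fun hF => by
    filter_upwards [hF.smooth, hc] with i h1 h2
    exact h1.inv fun x hx => (hc0.trans_le (h2 x hx)).ne'
  induction k with
  | zero => exact ⟨hsm hF, h0⟩
  | succ k ih =>
    have h1 := ih (hF.of_le (Nat.le_succ k))
    refine mk_succ (hsm hF) h0 fun a => (((hF.pd a).mul_one (fun _ => zero_le_one)
      (h1.mul_one (fun _ => zero_le_one) h1)).const_mul (-1)).congr ?_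
    filter_upwards [hF.differentiableAt, hc] with i h3 h2 x hx
    exact (pd_inv (h3 x hx) (hc0.trans_le (h2 x hx)).ne' a).symm

lemma sqrt (hF : Sym 𝓕 (fun _ => 1) k 0 F)
    (hc : ∃ c : ℝ, 0 < c ∧ ∀ᶠ i in 𝓕.l, ∀ x ∈ 𝓕.Ω i, c ≤ F i x) : Sym 𝓕 (fun _ => 1) k 0 fun i x =>
    Real.sqrt (F i x) := by
  have hinv := fun {j : ℕ} (h : Sym 𝓕 (fun _ => 1) j 0 F) => h.inv hc
  obtain ⟨c, hc0, hc⟩ := hc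
  have h0 : OrderBound 𝓕 (fun _ => 1) 0 fun i x => Real.sqrt (F i x) := by
    obtain ⟨C, hC0, hC⟩ := hF.bound.order
    refine ⟨Real.sqrt C, sqrt_nonneg _, hC.mono fun i hi x hx => ?_⟩
    have := hi x hx
    rw [pow_zero, _root_.mul_one, _root_.mul_one] at this ⊢
    rw [abs_of_nonneg (sqrt_nonneg _)]
    exact Real.sqrt_le_sqrt ((le_abs_self _).trans this)
  have hsm : ∀ {k : ℕ}, Sym 𝓕 (fun _ => 1) k 0 F → ∀ᶠ i in 𝓕.l, ContDiffOn ℝ k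
      (fun x => Real.sqrt (F i x)) (𝓕.Ω i) := fun hF => by
    filter_upwards [hF.smooth, hc] with i h1 h2
    exact h1.sqrt fun x hx => (hc0.trans_le (h2 x hx)).ne'
  induction k with
  | zero => exact ⟨hsm hF, h0⟩
  | succ k ih =>
    have h1 := ih (hF.of_le (Nat.le_succ k))
    refine mk_succ (hsm hF) h0 fun a => (((hF.pd a).mul_one (fun _ => zero_le_one)
      (h1.mul_one (fun _ => zero_le_one) (hinv (hF.of_le (Nat.le_succ k))))).const_mul (1 /
        2)).congr ?_
    filter_upwards [hF.differentiableAt, hc] with i h3 h2 x hx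
    exact (pd_sqrt (h3 x hx) (hc0.trans_le (h2 x hx)) a).symm

lemma prod_sub (hσ : ∀ i, 0 ≤ σ i) (hσ1 : ∃ C, 0 ≤ C ∧ ∀ᶠ i in 𝓕.l, σ i ≤ C * 1) {κ : Type*}
    (s : Finset κ) {F : κ → 𝓕.ι → Fn n} (c : κ → ℝ)
    (hF : ∀ j ∈ s, Sym 𝓕 σ k 0 fun i x => F j i x - c j) : Sym 𝓕 σ k 0 fun i x => ∏ j ∈ s, F j i x -
    ∏ j ∈ s, c j := by
  classical
  induction s using Finset.induction_on with
  | empty => simpa using zero hσ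
  | insert j s hj ih =>
    simp only [Finset.prod_insert hj]
    have h1 := ih fun k hk => hF k (mem_insert_of_mem hk)
    have h2 := hF j (mem_insert_self j s)
    have h3 := (h2.mono hσ1).add (const (𝓕 := 𝓕) (c j))
    refine ((h3.one_mul h1).add (h2.const_mul (∏ j ∈ s, c j))).congr (of_forall fun i x _ => ?_)
    ring

end Sym
end Symbol

section Jet
variable {n : ℕ} {x : E n}

/-- The weighted size `∑_{|β| ≤ k} r^{|β|} |∂^β v|` of the `k`-jet. -/
def jet (r : Fn n) : ℕ → Fn n → Fn n
  | 0, v, x => |v x|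
  | k + 1, v, x => |v x| + r x * ∑ a, jet r k (pd a v) x

variable {r : Fn n} {Ω : Set (E n)}

lemma jet_nonneg (hr : ∀ x, 0 < r x) (x : E n) : ∀ (k : ℕ) (v : Fn n), 0 ≤ jet r k v x
  | 0, _ => abs_nonneg _
  | k + 1, _ => add_nonneg (abs_nonneg _)
      (mul_nonneg (hr x).le (sum_nonneg fun _ _ => jet_nonneg hr x k _))

lemma abs_le_jet (hr : ∀ x, 0 < r x) (x : E n) (v : Fn n) : ∀ k, |v x| ≤ jet r k v x
  | 0 => le_rfl
  | k + 1 => le_add_of_nonneg_right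
      (mul_nonneg (hr x).le (sum_nonneg fun _ _ => jet_nonneg hr x k _))

lemma jet_le_succ (hr : ∀ x, 0 < r x) (x : E n) : ∀ (k : ℕ) (v : Fn n), jet r k v x ≤ jet r (k + 1)
    v x
  | 0, v => abs_le_jet hr x v 1
  | k + 1, _ => add_le_add le_rfl (mul_le_mul_of_nonneg_left
      (sum_le_sum fun _ _ => jet_le_succ hr x k _) (hr x).le)

lemma jet_mono (hr : ∀ x, 0 < r x) (x : E n) (v : Fn n) : Monotone fun k => jet r k v x :=
  monotone_nat_of_le_succ fun k => jet_le_succ hr x k v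

lemma jet_pd_le (hr : ∀ x, 0 < r x) (x : E n) (k : ℕ) (v : Fn n) (a : Fin n) : jet r k (pd a v) x *
    r x ≤ jet r (k + 1) v x := by
  have h1 := single_le_sum (f := fun a => jet r k (pd a v) x) (fun _ _ => jet_nonneg hr x k _)
    (Finset.mem_univ a)
  have h2 := mul_le_mul_of_nonneg_left h1 (hr x).le
  rw [jet]
  nlinarith [abs_nonneg (v x)]

lemma jet_congr (hΩ : IsOpen Ω) (hx : x ∈ Ω) : ∀ (k : ℕ) {v w : Fn n}, EqOn v w Ω → jet r k v x =
    jet r k w x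
  | 0, _, _, h => by rw [jet, jet, h hx]
  | k + 1, v, w, h => by
    rw [jet, jet, h hx]
    congr 2
    exact sum_congr rfl fun a _ => jet_congr hΩ hx k (pd_congr hΩ h a)

lemma jet_add_le (hr : ∀ x, 0 < r x) (hΩ : IsOpen Ω) (hx : x ∈ Ω) : ∀ (k : ℕ) {v w : Fn n},
    ContDiffOn ℝ k v Ω → ContDiffOn ℝ k w Ω → jet r k (fun y => v y + w y) x ≤ jet r k v x + jet r k
    w x
  | 0, v, w, _, _ => abs_add_le _ _
  | k + 1, v, w, hv, hw => by
    have h1 : ∀ a, jet r k (pd a fun y => v y + w y) x ≤ jet r k (pd a v) x + jet r k (pd a w) x :=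
        fun a => by
      rw [jet_congr hΩ hx k fun y hy => pd_add (differentiableAt_of_contDiffOn hΩ hv hy)
        (differentiableAt_of_contDiffOn hΩ hw hy) a]
      exact jet_add_le hr hΩ hx k (ContDiffOn.pd hΩ hv a) (ContDiffOn.pd hΩ hw a)
    have h2 := mul_le_mul_of_nonneg_left (sum_le_sum fun a (_ : a ∈ Finset.univ) => h1 a) (hr x).le
    rw [sum_add_distrib] at h2
    simp only [jet]
    linarith [abs_add_le (v x) (w x)]

lemma jet_mul_le {𝓕 : RegionFamily n} {σ : 𝓕.ι → ℝ} (hσ : ∀ i, 0 ≤ σ i) :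
    ∀ {k m : ℕ} {F : 𝓕.ι → Fn n}, Sym 𝓕 σ k m F → ∃ C, 0 ≤ C ∧ ∀ᶠ i in 𝓕.l, ∀ v, ContDiffOn ℝ k v
    (𝓕.Ω i) → ∀ x ∈ 𝓕.Ω i, jet (𝓕.r i) k (fun y => F i y * v y) x * 𝓕.r i x ^ m ≤ C * σ i * jet
      (𝓕.r i) k v x
  | 0, m, F, hF => by
    obtain ⟨C, hC0, hC⟩ := hF.bound.order
    refine ⟨C, hC0, hC.mono fun i hi v _ x hx => ?_⟩
    simp only [jet, abs_mul]
    have := mul_le_mul_of_nonneg_right (hi x hx) (abs_nonneg (v x))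
    linarith
  | k + 1, m, F, hF => by
    obtain ⟨C, hC0, hC⟩ := hF.bound.order
    have h1 := fun a => jet_mul_le hσ (hF.pd a)
    choose D hD0 hD using h1
    obtain ⟨K, hK0, hK⟩ := jet_mul_le hσ (hF.of_le (Nat.le_succ k))
    refine ⟨C + ∑ a, D a + K, by have := sum_nonneg fun a (_ : a ∈ Finset.univ) => hD0 a
                                 positivity, ?_⟩
    filter_upwards [hC, eventually_all.2 hD, hK, hF.smooth] with i h1 h2 h3 h4 v hv x hx
    have hr := 𝓕.pos i x
    have hj := jet_nonneg (𝓕.pos i) x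
    have hv' : ContDiffOn ℝ k v (𝓕.Ω i) := hv.of_le (by norm_cast; omega)
    have hF' : ContDiffOn ℝ k (F i) (𝓕.Ω i) := h4.of_le (by norm_cast; omega)
    have h5 : ∀ a, jet (𝓕.r i) k (pd a fun y => F i y * v y) x * 𝓕.r i x ^ (m + 1) ≤ D a * σ i * jet
        (𝓕.r i) k v x + K * σ i * (jet (𝓕.r i) k (pd a v) x * 𝓕.r i x) := by
      intro a
      rw [jet_congr (𝓕.isOpen i) hx k fun y hy => pd_mul
        (differentiableAt_of_contDiffOn (𝓕.isOpen i) h4 hy)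
        (differentiableAt_of_contDiffOn (𝓕.isOpen i) hv hy) a]
      have h6 := jet_add_le (𝓕.pos i) (𝓕.isOpen i) hx k ((ContDiffOn.pd (𝓕.isOpen i) h4 a).mul hv')
        (hF'.mul (ContDiffOn.pd (𝓕.isOpen i) hv a))
      have h7 := h2 a v hv' x hx
      have h8 := h3 (pd a v) (ContDiffOn.pd (𝓕.isOpen i) hv a) x hx
      calc _ ≤ _ := mul_le_mul_of_nonneg_right h6 (by positivity)
        _ = jet (𝓕.r i) k (fun y => pd a (F i) y * v y) x * 𝓕.r i x ^ (m + 1) +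
            (jet (𝓕.r i) k (fun y => F i y * pd a v y) x * 𝓕.r i x ^ m) * 𝓕.r i x := by ring
        _ ≤ D a * σ i * jet (𝓕.r i) k v x + (K * σ i * jet (𝓕.r i) k (pd a v) x) * 𝓕.r i x := by
          gcongr
        _ = _ := by ring
    have h6 := sum_le_sum fun a (_ : a ∈ Finset.univ) => h5 a
    rw [sum_add_distrib, ← sum_mul, ← sum_mul, ← sum_mul,
      ← mul_sum, ← sum_mul] at h6
    have h7 := jet_le_succ (𝓕.pos i) x k v
    have h8 : 𝓕.r i x * ∑ a, jet (𝓕.r i) k (pd a v) x ≤ jet (𝓕.r i) (k + 1) v x := by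
      rw [jet]; linarith [abs_nonneg (v x)]
    have h9 := abs_le_jet (𝓕.pos i) x v (k + 1)
    have hS := sum_nonneg fun a (_ : a ∈ Finset.univ) => hD0 a
    have hσi := hσ i
    have hj' := hj (k + 1) v
    calc _ = (|F i x| * 𝓕.r i x ^ m) * |v x| + (∑ a, jet (𝓕.r i) k (pd a fun y => F i y * v y) x) *
          𝓕.r i x ^ (m + 1) := by
          rw [jet, abs_mul]; ring
      _ ≤ (C * σ i) * jet (𝓕.r i) (k + 1) v x +
          ((∑ a, D a) * σ i * jet (𝓕.r i) (k + 1) v x + K * σ i * jet (𝓕.r i) (k + 1) v x) := by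
        refine add_le_add (mul_le_mul (h1 x hx) h9 (abs_nonneg _) (by positivity)) (h6.trans ?_)
        refine add_le_add (by gcongr) ?_
        refine mul_le_mul_of_nonneg_left ?_ (by positivity)
        linarith
      _ = _ := by ring

end Jet

section Dual
variable {n : ℕ} {Ω : Set (E n)} {F : Fn n} {K : Set (E n)}

lemma eq_zero_of_eqOn_compl (hK : IsClosed K) (h : ∀ x ∉ K, F x = 0) (a : Fin n) : ∀ x ∉ K, pd a F x
    = 0 := fun x hx => by
  have : F =ᶠ[𝓝 x] fun _ => 0 := by
    filter_upwards [hK.isOpen_compl.mem_nhds hx] with y hy using h y hy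
  rw [pd, this.fderiv_eq]; simp

lemma continuous_of_continuousOn_of_eq_zero (hΩ : IsOpen Ω) (hF : ContinuousOn F Ω)
    (hK : IsClosed K) (hKΩ : K ⊆ Ω) (h0 : ∀ x ∉ K, F x = 0) : Continuous F := by
  refine continuous_iff_continuousAt.2 fun x => ?_
  by_cases hx : x ∈ K
  · exact hF.continuousAt (hΩ.mem_nhds (hKΩ hx))
  · have : F =ᶠ[𝓝 x] fun _ => 0 := by
      filter_upwards [hK.isOpen_compl.mem_nhds hx] with y hy using h0 y hy
    exact continuousAt_const.congr this.symm

lemma integrable_of_continuousOn_of_eq_zero (hΩ : IsOpen Ω) (hF : ContinuousOn F Ω)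
    (hK : IsCompact K) (hKΩ : K ⊆ Ω) (h0 : ∀ x ∉ K, F x = 0) : Integrable F :=
  (continuous_of_continuousOn_of_eq_zero hΩ hF hK.isClosed hKΩ h0).integrable_of_hasCompactSupport
    (HasCompactSupport.intro hK h0)

lemma setIntegral_pd_eq_zero_of_eq_zero (hΩ : IsOpen Ω) (hF : ContDiffOn ℝ 1 F Ω) (hK : IsCompact K)
    (hKΩ : K ⊆ Ω) (h0 : ∀ x ∉ K, F x = 0) (a : Fin n) : ∫ x in Ω, pd a F x = 0 := by
  have hF' : ContDiffOn ℝ ((0 + 1 : ℕ) : WithTop ℕ∞) F Ω := by simpa using hF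
  have hp0 := eq_zero_of_eqOn_compl hK.isClosed h0 a
  have hpi : Integrable (pd a F) := integrable_of_continuousOn_of_eq_zero hΩ
    (ContDiffOn.pd hΩ hF' a).continuousOn hK hKΩ hp0
  have hFi : Integrable F := integrable_of_continuousOn_of_eq_zero hΩ hF.continuousOn hK hKΩ h0
  have hd : Differentiable ℝ F := fun x => by
    by_cases hx : x ∈ K
    · exact differentiableAt_of_contDiffOn hΩ hF' (hKΩ hx)
    · have : F =ᶠ[𝓝 x] fun _ => 0 := by
        filter_upwards [hK.isClosed.isOpen_compl.mem_nhds hx] with y hy using h0 y hy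
      exact (differentiableAt_const 0).congr_of_eventuallyEq this
  rw [setIntegral_eq_integral_of_forall_compl_eq_zero fun x hx => hp0 x fun h => hx (hKΩ h)]
  have hpi' : Integrable (fun x => fderiv ℝ F x (single a 1)) (volume : Measure (E n)) := hpi
  have := integral_mul_fderiv_eq_neg_fderiv_mul_of_integrable (μ := (volume : Measure (E n)))
    (f := fun _ : E n => (1 : ℝ)) (g := F) (v := single a 1) (by simp) (by simpa using hpi')
    (by simpa using hFi) (fun x _ => differentiableAt_const 1) (fun x _ => hd x)
  change ∫ x, fderiv ℝ F x (single a 1) = 0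
  simpa using this

def SmoothTensor (h : Tensor2 n) : Prop := ∀ a b, Smooth fun x => h x a b

/-- A family of differential operators `P` of order `k` from 2-tensors to functions, of class `C^j`,
with formal adjoint `P'`, such that `P' v = O(σ r^{-d} ∑_{|β| ≤ k} r^{|β|} |∂^β v|)`. -/
structure DualOp (𝓕 : RegionFamily n) (σ : 𝓕.ι → ℝ) (k j d : ℕ)
    (P : 𝓕.ι → Tensor2 n → Fn n) (P' : 𝓕.ι → Fn n → Tensor2 n) : Prop where
  smooth : ∀ᶠ i in 𝓕.l, ∀ h, SmoothTensor h → ContDiffOn ℝ j (P i h) (𝓕.Ω i)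
  locality : ∀ i h K, IsClosed K → (∀ x ∉ K, h x = 0) → ∀ x ∉ K, P i h x = 0
  dual_continuousOn : ∀ᶠ i in 𝓕.l, ∀ v, ContDiffOn ℝ k v (𝓕.Ω i) →
    ∀ a b, ContinuousOn (fun x => P' i v x a b) (𝓕.Ω i)
  dual : ∀ᶠ i in 𝓕.l, ∀ h, SmoothTensor h → ∀ K, IsCompact K → K ⊆ 𝓕.Ω i → (∀ x ∉ K, h x = 0) →
    ∀ v, ContDiffOn ℝ k v (𝓕.Ω i) →
      ∫ x in 𝓕.Ω i, P i h x * v x = ∫ x in 𝓕.Ω i, ∑ a, ∑ b, h x a b * P' i v x a b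
  bound : ∃ C, 0 ≤ C ∧ ∀ᶠ i in 𝓕.l, ∀ v, ContDiffOn ℝ k v (𝓕.Ω i) → ∀ x ∈ 𝓕.Ω i, ∀ a b,
    |P' i v x a b| * 𝓕.r i x ^ d ≤ C * σ i * jet (𝓕.r i) k v x

namespace DualOp
variable {𝓕 : RegionFamily n} {σ σ' : 𝓕.ι → ℝ} {k j d : ℕ}
  {P Q : 𝓕.ι → Tensor2 n → Fn n} {P' Q' : 𝓕.ι → Fn n → Tensor2 n}

lemma integrable_left {i : 𝓕.ι} {p v : Fn n} (hp : ContDiffOn ℝ j p (𝓕.Ω i))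
    (hv : ContDiffOn ℝ k v (𝓕.Ω i)) (hK : IsCompact K) (hKΩ : K ⊆ 𝓕.Ω i) (h0 : ∀ x ∉ K, p x = 0) :
    IntegrableOn (fun x => p x * v x) (𝓕.Ω i) :=
  (integrable_of_continuousOn_of_eq_zero (𝓕.isOpen i) (hp.continuousOn.mul hv.continuousOn) hK hKΩ
    fun x hx => by rw [Pi.mul_apply, h0 x hx, zero_mul]).integrableOn

lemma integrable_right {i : 𝓕.ι} {h M : Tensor2 n} (hh : SmoothTensor h)
    (hM : ∀ a b, ContinuousOn (fun x => M x a b) (𝓕.Ω i)) (hK : IsCompact K) (hKΩ : K ⊆ 𝓕.Ω i)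
    (h0 : ∀ x ∉ K, h x = 0) : IntegrableOn (fun x => ∑ a, ∑ b, h x a b * M x a b) (𝓕.Ω i) := by
  refine (integrable_of_continuousOn_of_eq_zero (𝓕.isOpen i) ?_ hK hKΩ
    fun x hx => by simp [h0 x hx]).integrableOn
  exact continuousOn_finsetSum _ fun a _ => continuousOn_finsetSum _ fun b _ =>
    (hh a b).continuous.continuousOn.mul (hM a b)

lemma entry (a b : Fin n) : DualOp 𝓕 (fun _ => 1) 0 j 0 (fun _ h x => h x a b)
    (fun _ v x => Matrix.single a b (v x)) where
  smooth := of_forall fun i h hh => ((hh a b).of_le (by exact_mod_cast le_top)).contDiffOn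
  locality i h K _ h0 x hx := by simp [h0 x hx]
  dual_continuousOn := of_forall fun i v hv a' b' => by
    by_cases hab : a = a' ∧ b = b'
    · obtain ⟨rfl, rfl⟩ := hab
      simpa using hv.continuousOn
    · simp only [Matrix.single, Matrix.of_apply, hab, if_false]
      exact continuousOn_const
  dual := of_forall fun i h _ K _ _ _ v _ => by
    congr 1
    ext x
    rw [Finset.sum_eq_single a, Finset.sum_eq_single b]
    · simp
    · intro b' _ hb; simp [hb.symm]
    · simp
    · intro a' _ ha; simp [ha.symm]
    · simp
  bound := ⟨1, zero_le_one, of_forall fun i v _ x _ a' b' => by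
    simp only [pow_zero, mul_one, one_mul, jet, Matrix.single_apply]
    split_ifs <;> simp⟩

lemma add (hP : DualOp 𝓕 σ k j d P P') (hQ : DualOp 𝓕 σ k j d Q Q') : DualOp 𝓕 σ k j d
    (fun i h x => P i h x + Q i h x) (fun i v x => P' i v x + Q' i v x) where
  smooth := (hP.smooth.and hQ.smooth).mono fun i hi h hh => (hi.1 h hh).add (hi.2 h hh)
  locality i h K hK h0 x hx := by
    rw [hP.locality i h K hK h0 x hx, hQ.locality i h K hK h0 x hx, add_zero]
  dual_continuousOn := (hP.dual_continuousOn.and hQ.dual_continuousOn).mono fun i hi v hv a b =>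
    (hi.1 v hv a b).add (hi.2 v hv a b)
  dual := by
    filter_upwards [hP.smooth, hQ.smooth, hP.dual_continuousOn, hQ.dual_continuousOn, hP.dual,
      hQ.dual] with i h1 h2 h3 h4 h5 h6 h hh K hK hKΩ h0 v hv
    simp only [add_mul, Matrix.add_apply, mul_add, sum_add_distrib]
    rw [integral_add (integrable_left (h1 h hh) hv hK hKΩ (hP.locality i h K hK.isClosed h0))
        (integrable_left (h2 h hh) hv hK hKΩ (hQ.locality i h K hK.isClosed h0)), integral_add
      (integrable_right hh (h3 v hv) hK hKΩ h0) (integrable_right hh (h4 v hv) hK hKΩ h0), h5 h hh K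
        hK hKΩ h0 v hv, h6 h hh K hK hKΩ h0 v hv]
  bound := by
    obtain ⟨C, hC0, hC⟩ := hP.bound
    obtain ⟨D, hD0, hD⟩ := hQ.bound
    refine ⟨C + D, by positivity, ?_⟩
    filter_upwards [hC, hD] with i h1 h2 v hv x hx a b
    have h3 := pow_pos (𝓕.pos i x) d
    have h4 := abs_add_le (P' i v x a b) (Q' i v x a b)
    rw [Matrix.add_apply]
    nlinarith [h1 v hv x hx a b, h2 v hv x hx a b]

lemma mono (hP : DualOp 𝓕 σ k j d P P') (h : ∃ C, 0 ≤ C ∧ ∀ᶠ i in 𝓕.l, σ i ≤ C * σ' i) : DualOp 𝓕 σ'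
    k j d P P' where
  smooth := hP.smooth
  locality := hP.locality
  dual_continuousOn := hP.dual_continuousOn
  dual := hP.dual
  bound := by
    obtain ⟨C, hC0, hC⟩ := hP.bound
    obtain ⟨D, hD0, hD⟩ := h
    refine ⟨C * D, by positivity, ?_⟩
    filter_upwards [hC, hD] with i h1 h2 v hv x hx a b
    have := jet_nonneg (𝓕.pos i) x k v
    calc _ ≤ _ := h1 v hv x hx a b
      _ ≤ C * (D * σ' i) * jet (𝓕.r i) k v x := by gcongr
      _ = _ := by ring

lemma weaken {k₁ j₁ : ℕ} (hσ : ∀ i, 0 ≤ σ i) (hP : DualOp 𝓕 σ k j d P P') (hk : k ≤ k₁)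
    (hj : j₁ ≤ j) : DualOp 𝓕 σ k₁ j₁ d P P' where
  smooth := hP.smooth.mono fun i hi h hh => (hi h hh).of_le (by exact_mod_cast hj)
  locality := hP.locality
  dual_continuousOn := hP.dual_continuousOn.mono fun i hi v hv => hi v
    (hv.of_le (by exact_mod_cast hk))
  dual := hP.dual.mono fun i hi h hh K hK hKΩ h0 v hv => hi h hh K hK hKΩ h0 v
    (hv.of_le (by exact_mod_cast hk))
  bound := by
    obtain ⟨C, hC0, hC⟩ := hP.bound
    refine ⟨C, hC0, hC.mono fun i hi v hv x hx a b => ?_⟩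
    refine (hi v (hv.of_le (by exact_mod_cast hk)) x hx a b).trans ?_
    have := hσ i
    exact mul_le_mul_of_nonneg_left (jet_mono (𝓕.pos i) x v hk) (by positivity)

lemma coef_mul {m : ℕ} {F : 𝓕.ι → Fn n} (hσ : ∀ i, 0 ≤ σ i) (hσ' : ∀ i, 0 ≤ σ' i)
    (hF : Sym 𝓕 σ' (max k j) m F) (hP : DualOp 𝓕 σ k j d P P') : DualOp 𝓕 (fun i => σ i * σ' i) k j
    (d + m) (fun i h x => F i x * P i h x) (fun i v => P' i fun x => F i x * v x) where
  smooth := by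
    filter_upwards [hF.smooth, hP.smooth] with i h1 h2 h hh
    exact (h1.of_le (by exact_mod_cast le_max_right k j)).mul (h2 h hh)
  locality i h K hK h0 x hx := by rw [hP.locality i h K hK h0 x hx, mul_zero]
  dual_continuousOn := by
    filter_upwards [hF.smooth, hP.dual_continuousOn] with i h1 h2 v hv
    exact h2 _ ((h1.of_le (by exact_mod_cast le_max_left k j)).mul hv)
  dual := by
    filter_upwards [hF.smooth, hP.dual] with i h1 h2 h hh K hK hKΩ h0 v hv
    rw [← h2 h hh K hK hKΩ h0 _ ((h1.of_le (by exact_mod_cast le_max_left k j)).mul hv)]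
    congr 1
    ext x
    ring
  bound := by
    obtain ⟨C, hC0, hC⟩ := hP.bound
    obtain ⟨D, hD0, hD⟩ := jet_mul_le hσ' (hF.of_le (le_max_left k j))
    refine ⟨C * D, by positivity, ?_⟩
    filter_upwards [hF.smooth, hC, hD] with i h0 h1 h2 v hv x hx a b
    have h3 := h1 _ ((h0.of_le (by exact_mod_cast le_max_left k j)).mul hv) x hx a b
    have h4 := h2 v hv x hx
    have hr := pow_pos (𝓕.pos i x) m
    have hσi := hσ i
    calc _ = (|P' i (fun x => F i x * v x) x a b| * 𝓕.r i x ^ d) * 𝓕.r i x ^ m := by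
          rw [pow_add]; ring
      _ ≤ (C * σ i * jet (𝓕.r i) k (fun x => F i x * v x) x) * 𝓕.r i x ^ m := by gcongr
      _ = C * σ i * (jet (𝓕.r i) k (fun x => F i x * v x) x * 𝓕.r i x ^ m) := by ring
      _ ≤ C * σ i * (D * σ' i * jet (𝓕.r i) k v x) := by gcongr
      _ = _ := by ring

lemma one_coef_mul {m : ℕ} {F : 𝓕.ι → Fn n} (hσ : ∀ i, 0 ≤ σ i)
    (hF : Sym 𝓕 (fun _ => 1) (max k j) m F) (hP : DualOp 𝓕 σ k j d P P') : DualOp 𝓕 σ k j (d + m)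
    (fun i h x => F i x * P i h x) (fun i v => P' i fun x => F i x * v x) := by
  simpa using hP.coef_mul hσ (fun _ => zero_le_one) hF

lemma coef_mul_one {m : ℕ} {F : 𝓕.ι → Fn n} (hσ : ∀ i, 0 ≤ σ i) (hF : Sym 𝓕 σ (max k j) m F)
    (hP : DualOp 𝓕 (fun _ => 1) k j d P P') : DualOp 𝓕 σ k j (d + m) (fun i h x => F i x * P i h x)
      (fun i v => P' i fun x => F i x * v x) := by
  simpa using hP.coef_mul (fun _ => zero_le_one) hσ hF

lemma zero : DualOp 𝓕 σ k j d (fun _ _ _ => 0) (fun _ _ _ => 0) where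
  smooth := of_forall fun _ _ _ => contDiffOn_const
  locality _ _ _ _ _ _ _ := rfl
  dual_continuousOn := of_forall fun _ _ _ _ _ => continuousOn_const
  dual := of_forall fun _ _ _ _ _ _ _ _ _ => by simp
  bound := ⟨0, le_rfl, by simp⟩

lemma sum {κ : Type*} {s : Finset κ} {P : κ → 𝓕.ι → Tensor2 n → Fn n}
    {P' : κ → 𝓕.ι → Fn n → Tensor2 n} (hP : ∀ c ∈ s, DualOp 𝓕 σ k j d (P c) (P' c)) :
    DualOp 𝓕 σ k j d (fun i h x => ∑ c ∈ s, P c i h x) (fun i v x => ∑ c ∈ s, P' c i v x) := by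
  classical
  induction s using Finset.induction_on with
  | empty => simpa using zero
  | insert c s hc ih =>
    simp only [sum_insert hc]
    exact (hP c (mem_insert_self c s)).add (ih fun k hk => hP k (mem_insert_of_mem hk))

lemma pd (hσ : ∀ i, 0 ≤ σ i) (hP : DualOp 𝓕 σ k (j + 1) d P P') (a : Fin n) : DualOp 𝓕 σ (k + 1) j
    (d + 1) (fun i h => Constraint.pd a (P i h)) (fun i v x => -P' i (Constraint.pd a v) x) where
  smooth := hP.smooth.mono fun i hi h hh => ContDiffOn.pd (𝓕.isOpen i) (hi h hh) a
  locality i h K hK h0 := eq_zero_of_eqOn_compl hK (hP.locality i h K hK h0) a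
  dual_continuousOn := hP.dual_continuousOn.mono fun i hi v hv b c =>
    (hi _ (ContDiffOn.pd (𝓕.isOpen i) hv a) b c).neg
  dual := by
    filter_upwards [hP.smooth, hP.dual] with i h1 h2 h hh K hK hKΩ h0 v hv
    have hΩ := 𝓕.isOpen i
    have hl := hP.locality i h K hK.isClosed h0
    have hv' : ContDiffOn ℝ 1 v (𝓕.Ω i) := hv.of_le (by norm_cast; omega)
    have hp' : ContDiffOn ℝ 1 (P i h) (𝓕.Ω i) := (h1 h hh).of_le (by norm_cast; omega)
    have h3 := setIntegral_pd_eq_zero_of_eq_zero hΩ (hp'.mul hv') hK hKΩ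
      (fun x hx => by simp [hl x hx]) a
    have hpp := ContDiffOn.pd hΩ (h1 h hh) a
    have hpv := ContDiffOn.pd hΩ hv a
    have h4 : ∫ x in 𝓕.Ω i, Constraint.pd a (P i h * v) x = ∫ x in 𝓕.Ω i,
        (Constraint.pd a (P i h) x * v x + P i h x * Constraint.pd a v x) :=
      setIntegral_congr_fun hΩ.measurableSet fun x hx => pd_mul
        (differentiableAt_of_contDiffOn hΩ (h1 h hh) hx) (differentiableAt_of_contDiffOn hΩ hv hx) a
    have h5 : ∫ x in 𝓕.Ω i, Constraint.pd a (P i h * v) x = 0 := h3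
    rw [h4, integral_add (integrable_left hpp hv hK hKΩ (eq_zero_of_eqOn_compl hK.isClosed hl a))
      (integrable_left (h1 h hh) hpv hK hKΩ hl)] at h5
    simp only [Matrix.neg_apply, mul_neg, sum_neg_distrib]
    rw [integral_neg, ← h2 h hh K hK hKΩ h0 _ hpv]
    linarith
  bound := by
    obtain ⟨C, hC0, hC⟩ := hP.bound
    refine ⟨C, hC0, hC.mono fun i hi v hv x hx b c => ?_⟩
    have h1 := hi _ (ContDiffOn.pd (𝓕.isOpen i) hv a) x hx b c
    have h2 := jet_pd_le (𝓕.pos i) x k v a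
    have hσi := hσ i
    have hr := 𝓕.pos i x
    rw [Matrix.neg_apply, abs_neg]
    calc _ = (|P' i (Constraint.pd a v) x b c| * 𝓕.r i x ^ d) * 𝓕.r i x := by rw [pow_succ]; ring
      _ ≤ (C * σ i * jet (𝓕.r i) k (Constraint.pd a v) x) * 𝓕.r i x := by gcongr
      _ = C * σ i * (jet (𝓕.r i) k (Constraint.pd a v) x * 𝓕.r i x) := by ring
      _ ≤ _ := by gcongr

lemma const_mul (hP : DualOp 𝓕 σ k j d P P') (c : ℝ) : DualOp 𝓕 σ k j d (fun i h x => c * P i h x)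
    (fun i v x => c • P' i v x) where
  smooth := hP.smooth.mono fun i hi h hh => contDiffOn_const.mul (hi h hh)
  locality i h K hK h0 x hx := by rw [hP.locality i h K hK h0 x hx, mul_zero]
  dual_continuousOn := hP.dual_continuousOn.mono fun i hi v hv a b => continuousOn_const.mul
    (hi v hv a b)
  dual := hP.dual.mono fun i hi h hh K hK hKΩ h0 v hv => by
    have e : ∀ x, ∑ a, ∑ b, h x a b * (c • P' i v x) a b = c * ∑ a, ∑ b, h x a b * P' i v x a b :=
        fun x => by
      simp only [mul_sum, Matrix.smul_apply, smul_eq_mul]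
      exact sum_congr rfl fun a _ => sum_congr rfl fun b _ => by ring
    simp only [e, mul_assoc, integral_const_mul, hi h hh K hK hKΩ h0 v hv]
  bound := by
    obtain ⟨C, hC0, hC⟩ := hP.bound
    refine ⟨|c| * C, by positivity, hC.mono fun i hi v hv x hx a b => ?_⟩
    rw [Matrix.smul_apply, smul_eq_mul, abs_mul, mul_assoc]
    calc _ ≤ |c| * _ := mul_le_mul_of_nonneg_left (hi v hv x hx a b) (abs_nonneg c)
      _ = _ := by ring

end DualOp
end Dual

section Variation
variable {n : ℕ} {Ω : Set (E n)}

/-- `X'` is the derivative at `t = 0` of the curve of functions `X`, together with its partial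
derivatives. -/
structure Varies (Ω : Set (E n)) (X : ℝ → Fn n) (X' : Fn n) : Prop where
  diff : ∀ x ∈ Ω, ∀ᶠ t in 𝓝 (0 : ℝ), DifferentiableAt ℝ (X t) x
  diff' : ∀ x ∈ Ω, DifferentiableAt ℝ X' x
  deriv : ∀ x ∈ Ω, HasDerivAt (fun t => X t x) (X' x) 0
  deriv_pd : ∀ x ∈ Ω, ∀ a, HasDerivAt (fun t => pd a (X t) x) (pd a X' x) 0

namespace Varies
variable {X Y : ℝ → Fn n} {X' Y' : Fn n}

lemma congr (hΩ : IsOpen Ω) (hX : Varies Ω X X') (h : EqOn X' Y' Ω) : Varies Ω X Y' where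
  diff := hX.diff
  diff' x hx := (hX.diff' x hx).congr_of_eventuallyEq
    (by filter_upwards [hΩ.mem_nhds hx] with y hy using (h hy).symm)
  deriv x hx := h hx ▸ hX.deriv x hx
  deriv_pd x hx a := pd_congr hΩ h a hx ▸ hX.deriv_pd x hx a

lemma congr_left (hΩ : IsOpen Ω) (hX : Varies Ω X X') (h : ∀ t, EqOn (X t) (Y t) Ω) : Varies Ω Y X'
    where
  diff x hx := (hX.diff x hx).mono fun t ht => ht.congr_of_eventuallyEq
    (by filter_upwards [hΩ.mem_nhds hx] with y hy using (h t hy).symm)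
  diff' := hX.diff'
  deriv x hx := (hX.deriv x hx).congr_of_eventuallyEq (of_forall fun t => (h t hx).symm)
  deriv_pd x hx a := (hX.deriv_pd x hx a).congr_of_eventuallyEq
    (of_forall fun t => (pd_congr hΩ (h t) a hx).symm)

lemma add (hX : Varies Ω X X') (hY : Varies Ω Y Y') : Varies Ω (fun t x => X t x + Y t x) fun x =>
    X' x + Y' x where
  diff x hx := ((hX.diff x hx).and (hY.diff x hx)).mono fun _ h => h.1.add h.2
  diff' x hx := (hX.diff' x hx).add (hY.diff' x hx)
  deriv x hx := (hX.deriv x hx).add (hY.deriv x hx)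
  deriv_pd x hx a := by
    rw [pd_add (hX.diff' x hx) (hY.diff' x hx)]
    refine ((hX.deriv_pd x hx a).add (hY.deriv_pd x hx a)).congr_of_eventuallyEq ?_
    filter_upwards [hX.diff x hx, hY.diff x hx] with t h1 h2 using pd_add h1 h2 a

lemma mul (hX : Varies Ω X X') (hY : Varies Ω Y Y') : Varies Ω (fun t x => X t x * Y t x) fun x =>
    X' x * Y 0 x + X 0 x * Y' x where
  diff x hx := ((hX.diff x hx).and (hY.diff x hx)).mono fun _ h => h.1.mul h.2
  diff' x hx := ((hX.diff' x hx).mul (hY.diff x hx).self_of_nhds).add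
    ((hX.diff x hx).self_of_nhds.mul (hY.diff' x hx))
  deriv x hx := (hX.deriv x hx).mul (hY.deriv x hx)
  deriv_pd x hx a := by
    have hX0 := (hX.diff x hx).self_of_nhds
    have hY0 := (hY.diff x hx).self_of_nhds
    have h1 := ((hX.deriv_pd x hx a).mul (hY.deriv x hx)).add
      ((hX.deriv x hx).mul (hY.deriv_pd x hx a))
    have h2 : pd a (fun x => X' x * Y 0 x + X 0 x * Y' x) x = pd a X' x * Y 0 x + pd a (X 0) x * Y'
        x + (X' x * pd a (Y 0) x + X 0 x * pd a Y' x) := by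
      rw [pd_add (f := fun x => X' x * Y 0 x) (g := fun x => X 0 x * Y' x) ((hX.diff' x hx).mul hY0) (hX0.mul (hY.diff' x hx)),
        pd_mul (hX.diff' x hx) hY0, pd_mul hX0 (hY.diff' x hx)]
      ring
    rw [h2]
    refine h1.congr_of_eventuallyEq ?_
    filter_upwards [hX.diff x hx, hY.diff x hx] with t h1 h2 using pd_mul h1 h2 a

lemma affine {G H : Fn n} (hG : ∀ x ∈ Ω, DifferentiableAt ℝ G x)
    (hH : ∀ x ∈ Ω, DifferentiableAt ℝ H x) : Varies Ω (fun t x => G x + t * H x) H where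
  diff x hx := of_forall fun t => (hG x hx).add ((hH x hx).const_mul t)
  diff' := hH
  deriv x _ := by
    have := ((hasDerivAt_id (0 : ℝ)).mul_const (H x)).const_add (G x)
    simpa using this
  deriv_pd x hx a := by
    have h1 : (fun t => pd a (fun x => G x + t * H x) x) = fun t => pd a G x + t * pd a H x := by
      ext t
      rw [pd_add (hG x hx) ((hH x hx).const_mul t), pd_const_mul (hH x hx)]
    rw [h1]
    have := ((hasDerivAt_id (0 : ℝ)).mul_const (pd a H x)).const_add (pd a G x)
    simpa using this

lemma const {G : Fn n} (hG : ∀ x ∈ Ω, DifferentiableAt ℝ G x) : Varies Ω (fun _ => G) fun _ =>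
    0 := by
  simpa using affine hG fun x _ => differentiableAt_const (0 : ℝ)

lemma sum {κ : Type*} {s : Finset κ} {X : κ → ℝ → Fn n} {X' : κ → Fn n}
    (hX : ∀ c ∈ s, Varies Ω (X c) (X' c)) : Varies Ω (fun t x => ∑ c ∈ s, X c t x) fun x => ∑ c ∈ s,
    X' c x := by
  classical
  induction s using Finset.induction_on with
  | empty => simpa using const fun x _ => differentiableAt_const (0 : ℝ)
  | insert c s hc ih =>
    simp only [sum_insert hc]
    exact (hX c (mem_insert_self c s)).add (ih fun k hk => hX k (mem_insert_of_mem hk))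

lemma const_mul (hX : Varies Ω X X') (c : ℝ) : Varies Ω (fun t x => c * X t x) fun x => c * X'
    x := by
  simpa using (const (Ω := Ω) fun x _ => differentiableAt_const c).mul hX

lemma inv (hX : Varies Ω X X') (h0 : ∀ x ∈ Ω, X 0 x ≠ 0) : Varies Ω (fun t x => (X t x)⁻¹) fun x =>
    -1 * (X' x * ((X 0 x)⁻¹ * (X 0 x)⁻¹)) := by
  have hne : ∀ x ∈ Ω, ∀ᶠ t in 𝓝 (0 : ℝ), X t x ≠ 0 := fun x hx =>
    (hX.deriv x hx).continuousAt.eventually_ne (h0 x hx)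
  have hder : ∀ x ∈ Ω, HasDerivAt (fun t => (X t x)⁻¹) (-1 * (X' x * ((X 0 x)⁻¹ * (X 0 x)⁻¹))) 0 :=
      fun x hx => by
    have e : -1 * (X' x * ((X 0 x)⁻¹ * (X 0 x)⁻¹)) = -X' x / X 0 x ^ 2 := by
      rw [div_eq_mul_inv, sq, mul_inv]; ring
    rw [e]
    exact (hX.deriv x hx).fun_inv (h0 x hx)
  refine ⟨fun x hx => ?_, fun x hx => ?_, hder, fun x hx a => ?_⟩
  · filter_upwards [hX.diff x hx, hne x hx] with t h1 h2 using h1.inv h2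
  · have hi := (hX.diff x hx).self_of_nhds.inv (h0 x hx)
    exact ((hX.diff' x hx).mul (hi.mul hi)).const_mul _
  · have hX0 := (hX.diff x hx).self_of_nhds
    have hi : DifferentiableAt ℝ (fun y => (X 0 y)⁻¹) x := hX0.inv (h0 x hx)
    have h2 : pd a (fun x => -1 * (X' x * ((X 0 x)⁻¹ * (X 0 x)⁻¹))) x = -1 *
        (pd a X' x * ((X 0 x)⁻¹ * (X 0 x)⁻¹) + pd a (X 0) x *
          (-1 * (X' x * ((X 0 x)⁻¹ * (X 0 x)⁻¹)) * (X 0 x)⁻¹ + (X 0 x)⁻¹ *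
            (-1 * (X' x * ((X 0 x)⁻¹ * (X 0 x)⁻¹))))) := by
      rw [pd_const_mul (f := fun x => X' x * ((X 0 x)⁻¹ * (X 0 x)⁻¹))
          ((hX.diff' x hx).mul (hi.mul hi)), pd_mul (f := X') (g := fun x => (X 0 x)⁻¹ * (X 0 x)⁻¹)
        (hX.diff' x hx) (hi.mul hi), pd_mul hi hi, pd_inv hX0 (h0 x hx)]
      ring
    rw [h2]
    refine (((hX.deriv_pd x hx a).mul ((hder x hx).mul (hder x hx))).const_mul
      (-1 : ℝ)).congr_of_eventuallyEq ?_
    filter_upwards [hX.diff x hx, hne x hx] with t h1 h2 using pd_inv h1 h2 a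

end Varies

/-- Curves of functions that are differentiable in the sense of `Varies`. -/
def HasVariation (Ω : Set (E n)) (X : ℝ → Fn n) : Prop := ∃ X', Varies Ω X X'

lemma HasVariation.prod {κ : Type*} {s : Finset κ} {X : κ → ℝ → Fn n}
    (hX : ∀ c ∈ s, HasVariation Ω (X c)) : HasVariation Ω fun t x => ∏ c ∈ s, X c t x := by
  classical
  induction s using Finset.induction_on with
  | empty => simpa using ⟨_, Varies.const fun x _ => differentiableAt_const (1 : ℝ)⟩
  | insert c s hc ih =>
    simp only [Finset.prod_insert hc]
    obtain ⟨A, hA⟩ := hX c (mem_insert_self c s)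
    obtain ⟨B, hB⟩ := ih fun k hk => hX k (mem_insert_of_mem hk)
    exact ⟨_, hA.mul hB⟩

lemma HasVariation.sum {κ : Type*} {s : Finset κ} {X : κ → ℝ → Fn n}
    (hX : ∀ c ∈ s, HasVariation Ω (X c)) : HasVariation Ω fun t x => ∑ c ∈ s, X c t x := by
  classical
  induction s using Finset.induction_on with
  | empty => simpa using ⟨_, Varies.const fun x _ => differentiableAt_const (0 : ℝ)⟩
  | insert c s hc ih =>
    simp only [sum_insert hc]
    obtain ⟨A, hA⟩ := hX c (mem_insert_self c s)
    obtain ⟨B, hB⟩ := ih fun k hk => hX k (mem_insert_of_mem hk)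
    exact ⟨_, hA.add hB⟩

lemma HasVariation.det {M : ℝ → Tensor2 n} (hM : ∀ a b, HasVariation Ω fun t x => M t x a b) :
    HasVariation Ω fun t x => (M t x).det := by
  simp only [Matrix.det_apply']
  refine HasVariation.sum fun s _ => ?_
  obtain ⟨A, hA⟩ := HasVariation.prod (s := Finset.univ) (X := fun (i : Fin n) t x => M t x (s i) i)
    fun i _ => hM _ _
  exact ⟨_, hA.const_mul _⟩

lemma HasVariation.inverse {M : ℝ → Tensor2 n} (hM : ∀ a b, HasVariation Ω fun t x => M t x a b)
    (h0 : ∀ x ∈ Ω, (M 0 x).det ≠ 0) (k l : Fin n) : HasVariation Ω fun t x => (M t x)⁻¹ k l := by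
  obtain ⟨A, hA⟩ := HasVariation.det hM
  have hadj : HasVariation Ω fun t x => (M t x).adjugate k l := by
    simp only [Matrix.adjugate_apply]
    refine HasVariation.det (M := fun t x => (M t x).updateRow l (Pi.single k 1)) fun a b => ?_
    by_cases h : a = l
    · subst h
      simp only [Matrix.updateRow_self]
      exact ⟨_, Varies.const fun x _ => differentiableAt_const _⟩
    · simp only [Matrix.updateRow_ne h]
      exact hM a b
  obtain ⟨B, hB⟩ := hadj
  simp only [Matrix.inv_def, Ring.inverse_eq_inv', Matrix.smul_apply, smul_eq_mul]
  exact ⟨_, (hA.inv h0).mul hB⟩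

def dInv (g h : Tensor2 n) (k l : Fin n) (x : E n) : ℝ :=
  ∑ a, ∑ b, (-1 * ((g x)⁻¹ k a * (g x)⁻¹ b l)) * h x a b

lemma varies_inverse (hΩ : IsOpen Ω) {g h : Tensor2 n}
    (hg : ∀ a b, ∀ x ∈ Ω, DifferentiableAt ℝ (fun y => g y a b) x)
    (hh : ∀ a b, ∀ x ∈ Ω, DifferentiableAt ℝ (fun y => h y a b) x) (h0 : ∀ x ∈ Ω, (g x).det ≠ 0)
    (k l : Fin n) : Varies Ω (fun t x => ((g + t • h) x)⁻¹ k l) (dInv g h k l) := by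
  have hM : ∀ a b, Varies Ω (fun t x => (g + t • h) x a b) fun x => h x a b := fun a b =>
    Varies.affine (hg a b) (hh a b)
  have hI := HasVariation.inverse (M := fun t => g + t • h) (fun a b => ⟨_, hM a b⟩)
    (fun x hx => by simpa using h0 x hx)
  choose I' hI' using hI
  refine (hI' k l).congr hΩ fun x hx => ?_
  have hdet : IsUnit (g x).det := isUnit_iff_ne_zero.2 (h0 x hx)
  -- differentiate `(g + t h) (g + t h)⁻¹ = 1`
  have h1 : ∀ a, ∑ b, (h x a b * (g x)⁻¹ b l + g x a b * I' b l x) = 0 := by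
    intro a
    have h2 : HasDerivAt (fun t : ℝ => ∑ b, (g + t • h) x a b * ((g + t • h) x)⁻¹ b l)
        (∑ b, (h x a b * (g x)⁻¹ b l + g x a b * I' b l x)) 0 := by
      refine HasDerivAt.fun_sum fun b _ => ?_
      simpa using ((hM a b).deriv x hx).fun_mul ((hI' b l).deriv x hx)
    have h3 : (fun t : ℝ => ∑ b, (g + t • h) x a b * ((g + t • h) x)⁻¹ b l) =ᶠ[𝓝 0] fun _ => 𝟙 a
        l := by
      obtain ⟨A, hA⟩ := HasVariation.det (M := fun t => g + t • h) fun a b => ⟨_, hM a b⟩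
      filter_upwards [(hA.deriv x hx).continuousAt.eventually_ne (by simpa using h0 x hx)] with t ht
      rw [← Matrix.mul_apply, Matrix.mul_nonsing_inv _ (isUnit_iff_ne_zero.2 ht)]
    exact h2.unique ((hasDerivAt_const _ _).congr_of_eventuallyEq h3)
  have h4 : ∀ a, ∑ b, g x a b * I' b l x = -∑ b, h x a b * (g x)⁻¹ b l := fun a => by
    have := h1 a
    rw [sum_add_distrib] at this
    linarith
  have h5 : I' k l x = ∑ a, (g x)⁻¹ k a * ∑ b, g x a b * I' b l x := by
    simp only [mul_sum]
    rw [sum_comm]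
    simp only [← mul_assoc, ← sum_mul, ← Matrix.mul_apply, Matrix.nonsing_inv_mul _ hdet]
    simp [Matrix.one_apply]
  rw [h5, dInv]
  refine sum_congr rfl fun a _ => ?_
  rw [h4, mul_neg, mul_sum, ← sum_neg_distrib]
  refine sum_congr rfl fun b _ => ?_
  ring

/-- The Christoffel symbols with lowered index, up to the factor `1 / 2`. -/
def lowChristoffel (g : Tensor2 n) (i j l : Fin n) (x : E n) : ℝ :=
  pd i (fun y => g y j l) x + pd j (fun y => g y i l) x + -1 * pd l (fun y => g y i j) x

/-- The derivative of the Christoffel symbols. -/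
def dChristoffel (g h : Tensor2 n) (k i j : Fin n) (x : E n) : ℝ :=
  (1 / 2 : ℝ) * ∑ l, (lowChristoffel g i j l x * dInv g h k l x +
    (g x)⁻¹ k l * lowChristoffel h i j l x)

lemma christoffel_eq (g : Tensor2 n) (k i j : Fin n) (x : E n) : christoffel g k i j x = (1 / 2 : ℝ)
    * ∑ l, (g x)⁻¹ k l * lowChristoffel g i j l x := by
  simp only [christoffel, lowChristoffel, neg_one_mul, sub_eq_add_neg]

lemma lowChristoffel_add_smul {g h : Tensor2 n} {x : E n}
    (hg : ∀ a b, DifferentiableAt ℝ (fun y => g y a b) x)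
    (hh : ∀ a b, DifferentiableAt ℝ (fun y => h y a b) x) (t : ℝ) (i j l : Fin n) : lowChristoffel
    (g + t • h) i j l x = lowChristoffel g i j l x + t * lowChristoffel h i j l x := by
  have h1 : ∀ m a b, pd m (fun y => (g + t • h) y a b) x = pd m (fun y => g y a b) x + t * pd m
      (fun y => h y a b) x := fun m a b => by
    rw [← pd_const_mul (hh a b), ← pd_add (hg a b) ((hh a b).const_mul t)]
    rfl
  simp only [lowChristoffel, h1]
  ring

lemma varies_christoffel (hΩ : IsOpen Ω) {g h : Tensor2 n}
    (hg : ∀ a b, ∀ x ∈ Ω, DifferentiableAt ℝ (fun y => g y a b) x)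
    (hh : ∀ a b, ∀ x ∈ Ω, DifferentiableAt ℝ (fun y => h y a b) x)
    (hg' : ∀ a b l, ∀ x ∈ Ω, DifferentiableAt ℝ (lowChristoffel g a b l) x)
    (hh' : ∀ a b l, ∀ x ∈ Ω, DifferentiableAt ℝ (lowChristoffel h a b l) x)
    (h0 : ∀ x ∈ Ω, (g x).det ≠ 0) (k i j : Fin n) : Varies Ω
    (fun t => christoffel (g + t • h) k i j) (dChristoffel g h k i j) := by
  have h1 := (Varies.sum (s := Finset.univ) fun l _ => (varies_inverse hΩ hg hh h0 k l).mul
    (Varies.affine (hg' i j l) (hh' i j l))).const_mul (1 / 2)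
  have h2 := h1.congr_left hΩ (Y := fun t => christoffel (g + t • h) k i j) fun t y hy => by
    simp only [christoffel_eq, lowChristoffel_add_smul (fun a b => hg a b y hy)
      (fun a b => hh a b y hy)]
  refine h2.congr hΩ fun x hx => ?_
  simp only [dChristoffel]
  congr 1
  refine sum_congr rfl fun l _ => ?_
  simp only [zero_smul, add_zero, zero_mul]
  ring

end Variation

section Linearization
variable {n : ℕ} {Ω : Set (E n)}

def dRicci (g h : Tensor2 n) (i j : Fin n) (x : E n) : ℝ :=
  (∑ k, (pd k (dChristoffel g h k i j) x + -1 * pd j (dChristoffel g h k i k) x)) +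
    ∑ k, ∑ l, (christoffel g l i j x * dChristoffel g h k k l x +
      christoffel g k k l x * dChristoffel g h l i j x +
      (-1 * christoffel g l i k x) * dChristoffel g h k j l x +
      (-1 * christoffel g k j l x) * dChristoffel g h l i k x)

/-- The derivative of the scalar curvature. -/
def dScalar (g h : Tensor2 n) (x : E n) : ℝ :=
  ∑ i, ∑ j, (ricci g i j x * dInv g h i j x + (g x)⁻¹ i j * dRicci g h i j x)

/-- The derivative of the Hamiltonian constraint in the direction of the metric. -/
def hamiltonianLow (g π h : Tensor2 n) (x : E n) : ℝ :=
  dScalar g h x +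
    (∑ i, ∑ j, (2 / ((n : ℝ) - 1) * traceUp (g x) (π x) * π x i j) * h x i j) +
    ∑ i, ∑ j, ∑ k, ∑ l, ((-1 * (g x j l * π x i j * π x k l)) * h x i k +
      (-1 * (g x i k * π x i j * π x k l)) * h x j l)

/-- The derivative of the Hamiltonian constraint in the direction of the momentum. -/
def hamiltonianUp (g π τ : Tensor2 n) (x : E n) : ℝ :=
  (∑ i, ∑ j, (2 / ((n : ℝ) - 1) * traceUp (g x) (π x) * g x i j) * τ x i j) +
    ∑ i, ∑ j, ∑ k, ∑ l, ((-1 * (g x i k * g x j l * π x k l)) * τ x i j +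
      (-1 * (g x i k * g x j l * π x i j)) * τ x k l)

/-- The derivative of the divergence in the direction of the metric. -/
def divLow (g π h : Tensor2 n) (j : Fin n) (x : E n) : ℝ :=
  ∑ i, ∑ k, (π x k j * dChristoffel g h i i k x + π x i k * dChristoffel g h j i k x)

def divLin (g τ : Tensor2 n) (j : Fin n) (x : E n) : ℝ :=
  (∑ i, pd i (fun y => τ y i j) x) +
    ∑ i, ∑ k, (christoffel g i i k x * τ x k j + christoffel g j i k x * τ x i k)

/-- Nondegenerate metrics that are twice differentiable. -/
structure RegularMetric (Ω : Set (E n)) (g : Tensor2 n) : Prop where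
  diff : ∀ a b, ∀ x ∈ Ω, DifferentiableAt ℝ (fun y => g y a b) x
  diff_low : ∀ a b l, ∀ x ∈ Ω, DifferentiableAt ℝ (lowChristoffel g a b l) x
  det_ne : ∀ x ∈ Ω, (g x).det ≠ 0

lemma SmoothTensor.diff {h : Tensor2 n} (hh : SmoothTensor h) (a b : Fin n) (x : E n) :
    DifferentiableAt ℝ (fun y => h y a b) x := (hh a b).differentiable (by simp) x

lemma SmoothTensor.contDiff_low {h : Tensor2 n} (hh : SmoothTensor h) (a b l : Fin n) : Smooth
    (lowChristoffel h a b l) := ((contDiff_pd (hh _ _) _).add (contDiff_pd (hh _ _) _)).add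
    (contDiff_const.mul (contDiff_pd (hh _ _) _))

lemma RegularMetric.varies (hΩ : IsOpen Ω) {g h : Tensor2 n} (hg : RegularMetric Ω g)
    (hh : SmoothTensor h) (k i j : Fin n) : Varies Ω (fun t => christoffel (g + t • h) k i j)
    (dChristoffel g h k i j) := varies_christoffel hΩ hg.diff (fun a b x _ => hh.diff a b x)
  hg.diff_low (fun a b l x _ => (hh.contDiff_low a b l).differentiable (by simp) x) hg.det_ne k i j

variable {g h : Tensor2 n} {x : E n}

lemma hasDerivAt_ricci (hΩ : IsOpen Ω) (hg : RegularMetric Ω g) (hh : SmoothTensor h) (hx : x ∈ Ω)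
    (i j : Fin n) : HasDerivAt (fun t : ℝ => ricci (g + t • h) i j x) (dRicci g h i j x) 0 := by
  have hΓ := hg.varies hΩ hh
  have h1 : HasDerivAt (fun t : ℝ => ∑ k, (pd k (christoffel (g + t • h) k i j) x - pd j
      (christoffel (g + t • h) k i k) x))
      (∑ k, (pd k (dChristoffel g h k i j) x - pd j (dChristoffel g h k i k) x)) 0 :=
    HasDerivAt.fun_sum fun k _ => ((hΓ k i j).deriv_pd x hx k).fun_sub ((hΓ k i k).deriv_pd x hx j)
  have h2 : HasDerivAt (fun t : ℝ => ∑ k, ∑ l,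
      (christoffel (g + t • h) k k l x * christoffel (g + t • h) l i j x - christoffel (g + t • h) k
        j l x * christoffel (g + t • h) l i k x)) _ 0 := HasDerivAt.fun_sum fun k _ =>
    HasDerivAt.fun_sum fun l _ => (((hΓ k k l).deriv x hx).fun_mul ((hΓ l i j).deriv x hx)).fun_sub
        (((hΓ k j l).deriv x hx).fun_mul ((hΓ l i k).deriv x hx))
  refine (h1.fun_add h2).congr_deriv ?_
  simp only [dRicci, zero_smul, add_zero, neg_one_mul, ← sub_eq_add_neg]
  congr 1
  refine sum_congr rfl fun k _ => sum_congr rfl fun l _ => ?_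
  ring

lemma hasDerivAt_scalarCurvature (hΩ : IsOpen Ω) (hg : RegularMetric Ω g) (hh : SmoothTensor h)
    (hx : x ∈ Ω) : HasDerivAt (fun t : ℝ => scalarCurvature (g + t • h) x) (dScalar g h x) 0 := by
  have h1 : HasDerivAt (fun t : ℝ => ∑ i, ∑ j, ((g + t • h) x)⁻¹ i j * ricci (g + t • h) i j x)
      _ 0 := HasDerivAt.fun_sum fun i _ => HasDerivAt.fun_sum fun j _ =>
    ((varies_inverse hΩ hg.diff (fun a b x _ => hh.diff a b x) hg.det_ne i j).deriv x hx).fun_mul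
      (hasDerivAt_ricci hΩ hg hh hx i j)
  refine h1.congr_deriv ?_
  simp only [dScalar, zero_smul, add_zero]
  refine sum_congr rfl fun k _ => sum_congr rfl fun l _ => ?_
  ring

lemma hasDerivAt_affine (A B : ℝ) : HasDerivAt (fun t : ℝ => A + t * B) B 0 := by
  simpa using ((hasDerivAt_id (0 : ℝ)).mul_const B).const_add A

lemma linHamiltonian_eq (hΩ : IsOpen Ω) (hg : RegularMetric Ω g) {π τ : Tensor2 n}
    (hh : SmoothTensor h) (hx : x ∈ Ω) : linHamiltonian g π h τ x = hamiltonianLow g π h x +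
    hamiltonianUp g π τ x := by
  have hgt : ∀ a b, HasDerivAt (fun t : ℝ => (g + t • h) x a b) (h x a b) 0 := fun a b =>
    hasDerivAt_affine _ _
  have hπt : ∀ a b, HasDerivAt (fun t : ℝ => (π + t • τ) x a b) (τ x a b) 0 := fun a b =>
    hasDerivAt_affine _ _
  have h1 := hasDerivAt_scalarCurvature hΩ hg hh hx
  have h2 : HasDerivAt (fun t : ℝ => ∑ i, ∑ j, (g + t • h) x i j * (π + t • τ) x i j) _ 0 :=
    HasDerivAt.fun_sum fun i _ => HasDerivAt.fun_sum fun j _ => (hgt i j).fun_mul (hπt i j)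
  have h3 : HasDerivAt (fun t : ℝ => ∑ i, ∑ j, ∑ k, ∑ l, (g + t • h) x i k * (g + t • h) x j l *
      (π + t • τ) x i j * (π + t • τ) x k l) _ 0 := HasDerivAt.fun_sum fun i _ =>
    HasDerivAt.fun_sum fun j _ => HasDerivAt.fun_sum fun k _ => HasDerivAt.fun_sum fun l _ =>
        (((hgt i k).fun_mul (hgt j l)).fun_mul (hπt i j)).fun_mul (hπt k l)
  have h4 := (h1.fun_add ((h2.fun_pow 2).div_const ((n : ℝ) - 1))).fun_sub h3
  refine h4.deriv.trans ?_
  simp only [hamiltonianLow, hamiltonianUp, zero_smul, add_zero]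
  have e1 : (2 : ℝ) * (∑ i, ∑ j, g x i j * π x i j) *
      (∑ i, ∑ j, (h x i j * π x i j + g x i j * τ x i j)) / ((n : ℝ) - 1) =
      (∑ i, ∑ j, (2 / ((n : ℝ) - 1) * traceUp (g x) (π x) * π x i j) * h x i j) + ∑ i, ∑ j,
      (2 / ((n : ℝ) - 1) * traceUp (g x) (π x) * g x i j) * τ x i j := by
    simp only [← sum_add_distrib]
    rw [← traceUp, mul_div_right_comm, mul_div_right_comm, mul_sum]
    refine sum_congr rfl fun i _ => ?_
    rw [mul_sum]
    refine sum_congr rfl fun j _ => ?_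
    ring
  have e2 : -(∑ i, ∑ j, ∑ k, ∑ l, (((h x i k * g x j l + g x i k * h x j l) * π x i j + g x i k * g
      x j l * τ x i j) * π x k l + g x i k * g x j l * π x i j * τ x k l)) =
      (∑ i, ∑ j, ∑ k, ∑ l, ((-1 * (g x j l * π x i j * π x k l)) * h x i k +
      (-1 * (g x i k * π x i j * π x k l)) * h x j l)) + ∑ i, ∑ j, ∑ k, ∑ l,
      ((-1 * (g x i k * g x j l * π x k l)) * τ x i j + (-1 * (g x i k * g x j l * π x i j)) * τ x k
      l) := by
    simp only [← sum_add_distrib, ← sum_neg_distrib]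
    refine sum_congr rfl fun i _ => sum_congr rfl fun j _ => sum_congr rfl fun k _ => sum_congr rfl
      fun l _ => ?_
    ring
  rw [sub_eq_add_neg, e2]
  have e3 := e1
  norm_num at e3 ⊢
  rw [e3]
  ring

lemma linDiv_eq (hΩ : IsOpen Ω) (hg : RegularMetric Ω g) {π τ : Tensor2 n} (hh : SmoothTensor h)
    (hτ : SmoothTensor τ) (hπ : ∀ a b, ∀ x ∈ Ω, DifferentiableAt ℝ (fun y => π y a b) x)
    (hx : x ∈ Ω) (j : Fin n) : linDiv g π h τ x j = divLow g π h j x + divLin g τ j x := by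
  have hΓ := fun k i j => (hg.varies hΩ hh k i j).deriv x hx
  have hπt : ∀ a b, HasDerivAt (fun t : ℝ => (π + t • τ) x a b) (τ x a b) 0 := fun a b =>
    hasDerivAt_affine _ _
  have h1 : HasDerivAt (fun t : ℝ => ∑ i, pd i (fun y => (π + t • τ) y i j) x)
      (∑ i, pd i (fun y => τ y i j) x) 0 := HasDerivAt.fun_sum fun i _ =>
    (Varies.affine (hπ i j) fun x _ => hτ.diff i j x).deriv_pd x hx i
  have h2 : HasDerivAt (fun t : ℝ => ∑ i, ∑ k, (christoffel (g + t • h) i i k x * (π + t • τ) x k j +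
      christoffel (g + t • h) j i k x * (π + t • τ) x i k)) _ 0 := HasDerivAt.fun_sum fun i _ =>
    HasDerivAt.fun_sum fun k _ =>
      ((hΓ i i k).fun_mul (hπt k j)).fun_add ((hΓ j i k).fun_mul (hπt i k))
  refine (h1.fun_add h2).deriv.trans ?_
  simp only [divLow, divLin, zero_smul, add_zero]
  rw [add_left_comm]
  congr 1
  simp only [← sum_add_distrib]
  refine sum_congr rfl fun i _ => sum_congr rfl fun k _ => ?_
  ring

end Linearization

section Perturbation
variable {n : ℕ} {𝓕 : RegionFamily n} {h : Tensor2 n}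

lemma Sym.prod {k : ℕ} {κ : Type*} {s : Finset κ} {F : κ → 𝓕.ι → Fn n}
    (hF : ∀ j ∈ s, Sym 𝓕 (fun _ => 1) k 0 (F j)) : Sym 𝓕 (fun _ => 1) k 0 fun i x => ∏ j ∈ s, F j i
    x := by
  classical
  induction s using Finset.induction_on with
  | empty => simpa using Sym.const 1
  | insert j s hj ih =>
    simp only [Finset.prod_insert hj]
    exact (hF j (mem_insert_self j s)).one_mul (ih fun k hk => hF k (mem_insert_of_mem hk))

lemma Sym.det {k : ℕ} {M : 𝓕.ι → Tensor2 n}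
    (hM : ∀ a b, Sym 𝓕 (fun _ => 1) k 0 fun i x => M i x a b) : Sym 𝓕 (fun _ => 1) k 0 fun i x =>
    (M i x).det := by
  simp only [Matrix.det_apply']
  exact Sym.sum (fun _ => zero_le_one) fun s _ => (Sym.prod fun j _ => hM _ _).const_mul _

lemma Sym.adjugate {k : ℕ} {M : 𝓕.ι → Tensor2 n}
    (hM : ∀ a b, Sym 𝓕 (fun _ => 1) k 0 fun i x => M i x a b) (a b : Fin n) : Sym 𝓕 (fun _ => 1) k 0
    fun i x => (M i x).adjugate a b := by
  simp only [Matrix.adjugate_apply]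
  refine Sym.det (M := fun i x => (M i x).updateRow b (Pi.single a 1)) fun c d => ?_
  by_cases h : c = b
  · subst h
    simp only [Matrix.updateRow_self]
    exact Sym.const _
  · simp only [Matrix.updateRow_ne h]
    exact hM c d

lemma Sym.pd_sub_const {σ : 𝓕.ι → ℝ} {k m : ℕ} {F : 𝓕.ι → Fn n} {c : ℝ}
    (hF : Sym 𝓕 σ (k + 1) m fun i x => F i x - c) (a : Fin n) : Sym 𝓕 σ k (m + 1) fun i =>
    Constraint.pd a (F i) := (hF.pd a).congr
  (of_forall fun i x _ => by simp only [Constraint.pd, fderiv_sub_const])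

/-- Metrics with `g - δ = O(ε)` and momenta with `π = O(ε r⁻¹)`, with derivatives. -/
structure SmallData (𝓕 : RegionFamily n) (ε : 𝓕.ι → ℝ) (g π : 𝓕.ι → Tensor2 n) : Prop where
  nonneg : ∀ i, 0 ≤ ε i
  tendsto : Tendsto ε 𝓕.l (𝓝 0)
  metric : ∀ a b, Sym 𝓕 ε 2 0 fun i x => g i x a b - 𝟙 a b
  momentum : ∀ a b, Sym 𝓕 ε 1 1 fun i x => π i x a b

namespace SmallData
variable {ε : 𝓕.ι → ℝ} {g π : 𝓕.ι → Tensor2 n}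

lemma le_one (H : SmallData 𝓕 ε g π) : ∃ C : ℝ, 0 ≤ C ∧ ∀ᶠ i in 𝓕.l, ε i ≤ C * 1 :=
  ⟨1, zero_le_one, (H.tendsto.eventually_lt_const zero_lt_one).mono fun i hi => by linarith⟩

lemma metric_one (H : SmallData 𝓕 ε g π) (a b : Fin n) : Sym 𝓕 (fun _ => 1) 2 0 fun i x => g i x a
    b := by
  simpa using ((H.metric a b).mono H.le_one).add (Sym.const (𝟙 a b))

lemma det_sub (H : SmallData 𝓕 ε g π) : Sym 𝓕 ε 2 0 fun i x => (g i x).det - 1 := by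
  have h1 := Sym.sum H.nonneg (s := Finset.univ) fun (s : Equiv.Perm (Fin n)) _ =>
    (Sym.prod_sub H.nonneg H.le_one Finset.univ (F := fun j i x => g i x (s j) j) _ fun j _ =>
      H.metric (s j) j).const_mul ((Equiv.Perm.sign s : ℤ) : ℝ)
  refine h1.congr (of_forall fun i x _ => ?_)
  simp only [mul_sub, sum_sub_distrib]
  rw [← Matrix.det_apply', ← Matrix.det_apply', Matrix.det_one]

lemma eventually_det (H : SmallData 𝓕 ε g π) : ∀ᶠ i in 𝓕.l, ∀ x ∈ 𝓕.Ω i, 1 / 2 ≤ (g i x).det := by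
  obtain ⟨C, hC0, hC⟩ := H.det_sub.bound.order
  have h1 : Tendsto (fun i => C * ε i) 𝓕.l (𝓝 0) := by simpa using H.tendsto.const_mul C
  filter_upwards [hC, h1.eventually_lt_const (show (0 : ℝ) < 1 / 2 by norm_num)] with i h2 h3 x hx
  have := h2 x hx
  rw [pow_zero, mul_one] at this
  have := abs_le.1 (this.trans h3.le)
  linarith

lemma det_one (H : SmallData 𝓕 ε g π) : Sym 𝓕 (fun _ => 1) 2 0 fun i x => (g i x).det := Sym.det
  H.metric_one

lemma inverse_one (H : SmallData 𝓕 ε g π) (a b : Fin n) : Sym 𝓕 (fun _ => 1) 2 0 fun i x =>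
    (g i x)⁻¹ a b := by
  simp only [Matrix.inv_def, Ring.inverse_eq_inv', Matrix.smul_apply, smul_eq_mul]
  exact (H.det_one.inv ⟨1 / 2, by norm_num, H.eventually_det⟩).one_mul
    (Sym.adjugate H.metric_one a b)

lemma inverse_sub (H : SmallData 𝓕 ε g π) (k l : Fin n) : Sym 𝓕 ε 2 0 fun i x => (g i x)⁻¹ k l - 𝟙 k
    l := by
  have h1 := (Sym.sum H.nonneg (s := Finset.univ) fun a _ => (H.inverse_one k a).one_mul
    (H.metric a l)).const_mul (-1)
  refine h1.congr (H.eventually_det.mono fun i hi x hx => ?_)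
  have hdet : IsUnit (g i x).det := isUnit_iff_ne_zero.2 (by linarith [hi x hx])
  simp only [mul_sub, sum_sub_distrib]
  rw [← Matrix.mul_apply, ← Matrix.mul_apply, Matrix.nonsing_inv_mul _ hdet, mul_one]
  ring

lemma volDensity_one (H : SmallData 𝓕 ε g π) : Sym 𝓕 (fun _ => 1) 2 0 fun i => volDensity (g i) :=
  H.det_one.sqrt ⟨1 / 2, by norm_num, H.eventually_det⟩

lemma volDensity_sub (H : SmallData 𝓕 ε g π) : Sym 𝓕 ε 2 0 fun i x => volDensity (g i) x - 1 := by
  have h1 : Sym 𝓕 (fun _ => 1) 2 0 fun i x => (1 + volDensity (g i) x)⁻¹ :=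
    ((Sym.const 1).add H.volDensity_one).inv ⟨1, one_pos, of_forall fun i x _ => by
      linarith [show 0 ≤ volDensity (g i) x from sqrt_nonneg _]⟩
  refine (H.det_sub.mul_one H.nonneg h1).congr (H.eventually_det.mono fun i hi x hx => ?_)
  have h0 : 0 ≤ (g i x).det := by linarith [hi x hx]
  have h2 : 0 ≤ volDensity (g i) x := sqrt_nonneg _
  have h3 : (g i x).det = volDensity (g i) x * volDensity (g i) x := (Real.mul_self_sqrt h0).symm
  simp only [h3]
  field_simp
  ring

lemma low (H : SmallData 𝓕 ε g π) (i j l : Fin n) : Sym 𝓕 ε 1 1 fun m => lowChristoffel (g m) i j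
    l := (((H.metric j l).pd_sub_const i).add ((H.metric i l).pd_sub_const j)).add
    (((H.metric i j).pd_sub_const l).const_mul (-1))

lemma christoffel (H : SmallData 𝓕 ε g π) (k i j : Fin n) : Sym 𝓕 ε 1 1 fun m =>
    Constraint.christoffel (g m) k i j := by
  have h1 := (Sym.sum H.nonneg (s := Finset.univ) fun l _ =>
    ((H.inverse_one k l).of_le one_le_two).one_mul (H.low i j l)).const_mul (1 / 2)
  exact h1.congr (of_forall fun m x _ => (christoffel_eq (g m) k i j x).symm)

lemma ricci (H : SmallData 𝓕 ε g π) (i j : Fin n) : Sym 𝓕 ε 0 2 fun m => Constraint.ricci (g m) i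
    j := by
  have hΓ := fun k i j => (H.christoffel k i j).of_le zero_le_one
  have hΓ1 := fun k i j => (hΓ k i j).mono H.le_one
  refine (Sym.sum H.nonneg fun k _ => ((H.christoffel k i j).pd k).sub
    ((H.christoffel k i k).pd j)).add (Sym.sum H.nonneg fun k _ => Sym.sum H.nonneg fun l _ =>
      ((hΓ k k l).mul_one H.nonneg (hΓ1 l i j)).sub ((hΓ k j l).mul_one H.nonneg (hΓ1 l i k)))

lemma regularMetric (H : SmallData 𝓕 ε g π) : ∀ᶠ i in 𝓕.l, RegularMetric (𝓕.Ω i) (g i) := by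
  have h1 := eventually_all.2 fun a => eventually_all.2 fun b => (H.metric_one a b).differentiableAt
  have h2 := eventually_all.2 fun a => eventually_all.2 fun b => eventually_all.2 fun l =>
    (H.low a b l).differentiableAt
  filter_upwards [h1, h2, H.eventually_det] with i h1 h2 h3
  exact ⟨h1, h2, fun x hx => by linarith [h3 x hx]⟩

end SmallData

/-- Families of differential operators that have a formal adjoint, with bounds. -/
def HasDual (𝓕 : RegionFamily n) (σ : 𝓕.ι → ℝ) (k j d : ℕ)
    (P : 𝓕.ι → Tensor2 n → Fn n) : Prop := ∃ P', DualOp 𝓕 σ k j d P P'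

namespace HasDual
variable {σ σ' : 𝓕.ι → ℝ} {k j d m : ℕ} {P Q : 𝓕.ι → Tensor2 n → Fn n} {F : 𝓕.ι → Fn n}

lemma entry (a b : Fin n) : HasDual 𝓕 (fun _ => 1) 0 j 0 fun _ h x => h x a b :=
  ⟨_, DualOp.entry a b⟩

lemma add (hP : HasDual 𝓕 σ k j d P) (hQ : HasDual 𝓕 σ k j d Q) : HasDual 𝓕 σ k j d fun i h x => P i
    h x + Q i h x := let ⟨_, h1⟩ := hP; let ⟨_, h2⟩ := hQ; ⟨_, h1.add h2⟩

lemma mono (hP : HasDual 𝓕 σ k j d P) (h : ∃ C, 0 ≤ C ∧ ∀ᶠ i in 𝓕.l, σ i ≤ C * σ' i) : HasDual 𝓕 σ'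
    k j d P := let ⟨_, h1⟩ := hP; ⟨_, h1.mono h⟩

lemma weaken {k₁ j₁ : ℕ} (hσ : ∀ i, 0 ≤ σ i) (hP : HasDual 𝓕 σ k j d P) (hk : k ≤ k₁)
    (hj : j₁ ≤ j) : HasDual 𝓕 σ k₁ j₁ d P := let ⟨_, h1⟩ := hP; ⟨_, h1.weaken hσ hk hj⟩

lemma one_coef_mul (hσ : ∀ i, 0 ≤ σ i) (hF : Sym 𝓕 (fun _ => 1) (max k j) m F)
    (hP : HasDual 𝓕 σ k j d P) : HasDual 𝓕 σ k j (d + m) fun i h x => F i x * P i h x := let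
  ⟨_, h1⟩ := hP; ⟨_, h1.one_coef_mul hσ hF⟩

lemma coef_mul_one (hσ : ∀ i, 0 ≤ σ i) (hF : Sym 𝓕 σ (max k j) m F)
    (hP : HasDual 𝓕 (fun _ => 1) k j d P) : HasDual 𝓕 σ k j (d + m) fun i h x => F i x * P i h x :=
  let ⟨_, h1⟩ := hP; ⟨_, h1.coef_mul_one hσ hF⟩

lemma sum {κ : Type*} {s : Finset κ} {P : κ → 𝓕.ι → Tensor2 n → Fn n}
    (hP : ∀ c ∈ s, HasDual 𝓕 σ k j d (P c)) : HasDual 𝓕 σ k j d fun i h x => ∑ c ∈ s, P c i h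
    x := by
  classical
  choose! P' hP' using hP
  exact ⟨_, DualOp.sum hP'⟩

lemma pd (hσ : ∀ i, 0 ≤ σ i) (hP : HasDual 𝓕 σ k (j + 1) d P) (a : Fin n) : HasDual 𝓕 σ (k + 1) j
    (d + 1) fun i h => Constraint.pd a (P i h) := let ⟨_, h1⟩ := hP; ⟨_, h1.pd hσ a⟩

lemma const_mul (hP : HasDual 𝓕 σ k j d P) (c : ℝ) : HasDual 𝓕 σ k j d fun i h x => c * P i h x :=
  let ⟨_, h1⟩ := hP; ⟨_, h1.const_mul c⟩

end HasDual

/-! ### The flat linearization and the error terms -/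

def christoffelFlat (h : Tensor2 n) (k i j : Fin n) (x : E n) : ℝ :=
  (1 / 2 : ℝ) * lowChristoffel h i j k x

def christoffelErr (g h : Tensor2 n) (k i j : Fin n) (x : E n) : ℝ :=
  (1 / 2 : ℝ) * ∑ l, (lowChristoffel g i j l x * dInv g h k l x +
    ((g x)⁻¹ k l - 𝟙 k l) * lowChristoffel h i j l x)

lemma dChristoffel_eq (g h : Tensor2 n) (k i j : Fin n) : dChristoffel g h k i j = fun x =>
    christoffelFlat h k i j x + christoffelErr g h k i j x := by
  ext x
  simp only [dChristoffel, christoffelFlat, christoffelErr, sub_mul, ← mul_add]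
  congr 1
  simp only [sum_add_distrib, sum_sub_distrib, Matrix.one_apply, ite_mul, one_mul, zero_mul,
    Finset.sum_ite_eq, Finset.mem_univ, if_true]
  ring

def ricciFlat (h : Tensor2 n) (i j : Fin n) (x : E n) : ℝ :=
  ∑ k, (pd k (christoffelFlat h k i j) x + -1 * pd j (christoffelFlat h k i k) x)

def ricciErr (g h : Tensor2 n) (i j : Fin n) (x : E n) : ℝ :=
  (∑ k, (pd k (christoffelErr g h k i j) x + -1 * pd j (christoffelErr g h k i k) x)) +
    ∑ k, ∑ l, (christoffel g l i j x * dChristoffel g h k k l x +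
      christoffel g k k l x * dChristoffel g h l i j x +
      (-1 * christoffel g l i k x) * dChristoffel g h k j l x +
      (-1 * christoffel g k j l x) * dChristoffel g h l i k x)

/-- The flat linearization `∂_i ∂_j h_ij - Δ tr h` of the scalar curvature. -/
def scalarFlat (h : Tensor2 n) (x : E n) : ℝ :=
  ∑ a, ∑ b, (pd a (pd b fun y => h y a b) x + -1 * pd b (pd b fun y => h y a a) x)

def scalarErr (g h : Tensor2 n) (x : E n) : ℝ :=
  ∑ i, ∑ j, (ricci g i j x * dInv g h i j x +
    ((g x)⁻¹ i j - 𝟙 i j) * ricciFlat h i j x +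
    (g x)⁻¹ i j * ricciErr g h i j x)

lemma contDiff_christoffelFlat (hh : SmoothTensor h) (k i j : Fin n) : Smooth
    (christoffelFlat h k i j) := contDiff_const.mul (hh.contDiff_low i j k)

lemma sum_ricciFlat (hh : SmoothTensor h) (x : E n) : ∑ i, ricciFlat h i i x = scalarFlat h x := by
  have hd : ∀ a b c y, DifferentiableAt ℝ (pd a fun y => h y b c) y := fun a b c y =>
    (contDiff_pd (hh b c) a).differentiable (by simp) y
  have hlow : ∀ m i j l, pd m (christoffelFlat h l i j) x = 1 / 2 *
      (pd m (pd i fun y => h y j l) x + pd m (pd j fun y => h y i l) x + -1 * pd m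
        (pd l fun y => h y i j) x) := by
    intro m i j l
    change pd m (fun y => (1 / 2 : ℝ) * ((pd i (fun y => h y j l) y + pd j (fun y => h y i l) y) +
      -1 * pd l (fun y => h y i j) y)) x = _
    rw [pd_const_mul (f := fun y => (pd i (fun y => h y j l) y + pd j (fun y => h y i l) y) + -1 *
      pd l (fun y => h y i j) y) (((hd i j l x).add (hd j i l x)).add ((hd l i j x).const_mul (-1))),
      pd_add (f := fun y => pd i (fun y => h y j l) y + pd j (fun y => h y i l) y)
        (g := fun y => -1 * pd l (fun y => h y i j) y) ((hd i j l x).add (hd j i l x))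
        ((hd l i j x).const_mul (-1)), pd_add (hd i j l x) (hd j i l x), pd_const_mul (hd l i j x)]
  have hcomm : ∀ a b c d, pd a (pd b fun y => h y c d) x = pd b (pd a fun y => h y c d) x :=
    fun a b c d => pd_comm ((hh c d).contDiffAt.of_le (WithTop.coe_le_coe.2 le_top)) a b
  simp only [ricciFlat, scalarFlat, hlow]
  simp only [mul_add, sum_add_distrib]
  have s1 : ∑ i, ∑ k, (1 / 2 : ℝ) * pd k (pd k fun y => h y i i) x = ∑ i, ∑ k, (1 / 2 : ℝ) * pd i
    (pd i fun y => h y k k) x := sum_comm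
  have s2 : ∑ i, ∑ k, (-1 : ℝ) * pd k (pd k fun y => h y i i) x = -2 * ∑ i, ∑ k, (1 / 2 : ℝ) * pd k
      (pd k fun y => h y i i) x := by
    simp only [mul_sum]
    refine sum_congr rfl fun i _ => sum_congr rfl fun k _ => by ring
  have s3 : ∑ i, ∑ k, pd i (pd k fun y => h y i k) x = 2 * ∑ i, ∑ k, (1 / 2 : ℝ) * pd k
      (pd i fun y => h y i k) x := by
    simp only [mul_sum]
    refine sum_congr rfl fun i _ => sum_congr rfl fun k _ => by rw [hcomm]; ring
  have s4 : ∑ i, ∑ k, (1 / 2 : ℝ) * (-1 * pd k (pd k fun y => h y i i) x) = -∑ i, ∑ k, (1 / 2 : ℝ) *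
      pd k (pd k fun y => h y i i) x := by
    simp only [← sum_neg_distrib]
    refine sum_congr rfl fun i _ => sum_congr rfl fun k _ => by ring
  have s5 : ∑ i, ∑ k, (-1 : ℝ) * (1 / 2 * pd i (pd i fun y => h y k k) x) = -∑ i, ∑ k, (1 / 2 : ℝ) *
      pd i (pd i fun y => h y k k) x := by
    simp only [← sum_neg_distrib]
    refine sum_congr rfl fun i _ => sum_congr rfl fun k _ => by ring
  have s6 : ∑ i, ∑ k, (-1 : ℝ) * (1 / 2 * (-1 * pd i (pd k fun y => h y i k) x)) = -∑ i, ∑ k,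
      (-1 : ℝ) * (1 / 2 * pd i (pd k fun y => h y i k) x) := by
    simp only [← sum_neg_distrib]
    refine sum_congr rfl fun i _ => sum_congr rfl fun k _ => by ring
  rw [s2, s3, s4, s5, s6, s1]
  ring

lemma SmallData.hasDual_dInv {ε : 𝓕.ι → ℝ} {g π : 𝓕.ι → Tensor2 n} (H : SmallData 𝓕 ε g π)
    (k l : Fin n) : HasDual 𝓕 (fun _ => 1) 0 2 0 fun i h => dInv (g i) h k l := HasDual.sum
  fun a _ => HasDual.sum fun b _ => (HasDual.entry a b).one_coef_mul (fun _ => zero_le_one)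
    (((H.inverse_one k a).one_mul (H.inverse_one b l)).const_mul (-1))

lemma hasDual_low (i j l : Fin n) : HasDual 𝓕 (fun _ => 1) 1 1 1 fun _ h => lowChristoffel h i j
    l := by
  have h01 : ∀ _ : 𝓕.ι, (0 : ℝ) ≤ 1 := fun _ => zero_le_one
  exact (((HasDual.entry j l).pd h01 i).add ((HasDual.entry i l).pd h01 j)).add
    (((HasDual.entry i j).pd h01 l).const_mul (-1))

lemma hasDual_christoffelFlat (k i j : Fin n) : HasDual 𝓕 (fun _ => 1) 1 1 1 fun _ h =>
    christoffelFlat h k i j := (hasDual_low i j k).const_mul _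

namespace SmallData
variable {ε : 𝓕.ι → ℝ} {g π : 𝓕.ι → Tensor2 n}

lemma hasDual_christoffelErr (H : SmallData 𝓕 ε g π) (k i j : Fin n) : HasDual 𝓕 ε 1 1 1 fun m h =>
    christoffelErr (g m) h k i j := by
  refine HasDual.const_mul (HasDual.sum fun l _ => ?_) _
  have h1 := ((H.hasDual_dInv k l).weaken (k₁ := 1) (j₁ := 1) (fun _ => zero_le_one) zero_le_one
    one_le_two).coef_mul_one H.nonneg (H.low i j l)
  have h2 := (hasDual_low (𝓕 := 𝓕) i j l).coef_mul_one H.nonneg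
    ((H.inverse_sub k l).of_le one_le_two)
  exact HasDual.add h1 h2

lemma hasDual_dChristoffel (H : SmallData 𝓕 ε g π) (k i j : Fin n) : HasDual 𝓕 (fun _ => 1) 1 1 1
    fun m h => dChristoffel (g m) h k i j := by
  simp only [dChristoffel_eq]
  exact (hasDual_christoffelFlat k i j).add ((H.hasDual_christoffelErr k i j).mono H.le_one)

lemma hasDual_ricciErr (H : SmallData 𝓕 ε g π) (i j : Fin n) : HasDual 𝓕 ε 2 0 2 fun m h => ricciErr
    (g m) h i j := by
  have hC := fun k i j => (H.hasDual_dChristoffel k i j).weaken (k₁ := 1) (j₁ := 0)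
    (fun _ => zero_le_one) le_rfl zero_le_one
  have h1 : ∀ {c : ℝ} {a b d k l m : Fin n}, HasDual 𝓕 ε 2 0 2 fun i h x =>
      (c * Constraint.christoffel (g i) a b d x) * dChristoffel (g i) h k l m x := fun {c a b d k l m} =>
    ((hC k l m).coef_mul_one H.nonneg ((H.christoffel a b d).const_mul c)).weaken H.nonneg
      one_le_two le_rfl
  have h1' : ∀ {a b d k l m : Fin n}, HasDual 𝓕 ε 2 0 2 fun i h x => Constraint.christoffel (g i) a
      b d x * dChristoffel (g i) h k l m x := fun {a b d k l m} =>
    ((hC k l m).coef_mul_one H.nonneg (H.christoffel a b d)).weaken H.nonneg one_le_two le_rfl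
  exact (HasDual.sum fun k _ => ((H.hasDual_christoffelErr k i j).pd H.nonneg k).add
    (((H.hasDual_christoffelErr k i k).pd H.nonneg j).const_mul (-1))).add
    (HasDual.sum fun k _ => HasDual.sum fun l _ => ((h1'.add h1').add h1).add h1)

lemma _root_.Constraint.hasDual_ricciFlat (i j : Fin n) : HasDual 𝓕 (fun _ => 1) 2 0 2 fun _ h =>
    ricciFlat h i j := HasDual.sum fun k _ =>
  ((hasDual_christoffelFlat k i j).pd (fun _ => zero_le_one) k).add
    (((hasDual_christoffelFlat k i k).pd (fun _ => zero_le_one) j).const_mul (-1))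

lemma hasDual_scalarErr (H : SmallData 𝓕 ε g π) : HasDual 𝓕 ε 2 0 2 fun m h => scalarErr (g m)
    h := by
  refine HasDual.sum fun i _ => HasDual.sum fun j _ => ?_
  refine HasDual.add (HasDual.add ?_ ?_) ?_
  · exact (((H.hasDual_dInv i j).weaken (j₁ := 0) (fun _ => zero_le_one) le_rfl
      zero_le_two).coef_mul_one H.nonneg (H.ricci i j)).weaken H.nonneg zero_le_two le_rfl
  · exact (hasDual_ricciFlat i j).coef_mul_one H.nonneg (H.inverse_sub i j)
  · exact (H.hasDual_ricciErr i j).one_coef_mul H.nonneg (H.inverse_one i j)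

lemma dRicci_eq (H : SmallData 𝓕 ε g π) : ∀ᶠ m in 𝓕.l, ∀ h, SmoothTensor h → ∀ x ∈ 𝓕.Ω m, ∀ i j,
    dRicci (g m) h i j x = ricciFlat h i j x + ricciErr (g m) h i j x := by
  have h1 : ∀ᶠ m in 𝓕.l, ∀ k i j, ∀ h, SmoothTensor h → ContDiffOn ℝ 1
      (christoffelErr (g m) h k i j) (𝓕.Ω m) := eventually_all.2 fun k => eventually_all.2 fun i =>
    eventually_all.2 fun j => by
      obtain ⟨P', hP'⟩ := H.hasDual_christoffelErr k i j
      simpa using hP'.smooth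
  filter_upwards [h1] with m hm h hh x hx i j
  have h2 : ∀ a k i j, pd a (dChristoffel (g m) h k i j) x = pd a (christoffelFlat h k i j) x + pd a
      (christoffelErr (g m) h k i j) x := by
    intro a k i j
    rw [dChristoffel_eq]
    exact pd_add ((contDiff_christoffelFlat hh k i j).differentiable (by simp) x)
      (((hm k i j h hh).differentiableOn (by simp)).differentiableAt ((𝓕.isOpen m).mem_nhds hx)) a
  simp only [dRicci, ricciFlat, ricciErr, h2, mul_add, sum_add_distrib]
  ring

lemma dScalar_eq (H : SmallData 𝓕 ε g π) : ∀ᶠ m in 𝓕.l, ∀ h, SmoothTensor h → ∀ x ∈ 𝓕.Ω m, dScalar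
    (g m) h x = scalarFlat h x + scalarErr (g m) h x := by
  filter_upwards [H.dRicci_eq] with m hm h hh x hx
  rw [← sum_ricciFlat hh, dScalar, scalarErr]
  have h1 : ∑ i, ricciFlat h i i x = ∑ i, ∑ j, 𝟙 i j * ricciFlat h i j x := by
    simp [Matrix.one_apply]
  rw [h1]
  simp only [← sum_add_distrib]
  refine sum_congr rfl fun i _ => sum_congr rfl fun j _ => ?_
  rw [hm h hh x hx]
  ring

/-- The error in the linearization of the Hamiltonian constraint, with the volume density. -/
def _root_.Constraint.hamiltonianErr (g π h : Tensor2 n) (x : E n) : ℝ :=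
  (volDensity g x - 1) * scalarFlat h x + volDensity g x * (scalarErr g h x +
    (∑ i, ∑ j, (2 / ((n : ℝ) - 1) * traceUp (g x) (π x) * π x i j) * h x i j) +
    ∑ i, ∑ j, ∑ k, ∑ l, ((-1 * (g x j l * π x i j * π x k l)) * h x i k +
      (-1 * (g x i k * π x i j * π x k l)) * h x j l))

lemma hamiltonianLow_eq (H : SmallData 𝓕 ε g π) : ∀ᶠ m in 𝓕.l, ∀ h, SmoothTensor h → ∀ x ∈ 𝓕.Ω m,
    volDensity (g m) x * hamiltonianLow (g m) (π m) h x = scalarFlat h x + hamiltonianErr (g m)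
      (π m) h x := by
  filter_upwards [H.dScalar_eq] with m hm h hh x hx
  rw [hamiltonianLow, hm h hh x hx, hamiltonianErr]
  ring

lemma traceUp (H : SmallData 𝓕 ε g π) : Sym 𝓕 ε 1 1 fun m x => Constraint.traceUp (g m x) (π m x) :=
  Sym.sum H.nonneg fun i _ => Sym.sum H.nonneg fun j _ =>
    ((H.metric_one i j).of_le one_le_two).one_mul (H.momentum i j)

lemma _root_.Constraint.hasDual_scalarFlat : HasDual 𝓕 (fun _ => 1) 2 0 2 fun _ h =>
    scalarFlat h := by
  have h01 : ∀ _ : 𝓕.ι, (0 : ℝ) ≤ 1 := fun _ => zero_le_one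
  exact HasDual.sum fun a _ => HasDual.sum fun b _ => (((HasDual.entry a b).pd h01 b).pd h01 a).add
      ((((HasDual.entry a a).pd h01 b).pd h01 b).const_mul (-1))

lemma hasDual_hamiltonianErr (H : SmallData 𝓕 ε g π) : HasDual 𝓕 ε 2 0 2 fun m h => hamiltonianErr
    (g m) (π m) h := by
  have hg := fun a b => (H.metric_one a b).of_le (zero_le_two (α := ℕ))
  have hπ := fun a b => (H.momentum a b).of_le zero_le_one
  have hπ1 := fun a b => (hπ a b).mono H.le_one
  have hc : ∀ {F : 𝓕.ι → Fn n} {a b : Fin n}, Sym 𝓕 ε 0 2 F → HasDual 𝓕 ε 2 0 2 fun i h x => F i x *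
      h x a b := fun hF => ((HasDual.entry _ _).coef_mul_one H.nonneg hF).weaken H.nonneg
    zero_le_two le_rfl
  refine (hasDual_scalarFlat.coef_mul_one H.nonneg H.volDensity_sub).add
    (HasDual.one_coef_mul H.nonneg H.volDensity_one ((H.hasDual_scalarErr.add
      (HasDual.sum fun i _ => HasDual.sum fun j _ => hc ?_)).add
      (HasDual.sum fun i _ => HasDual.sum fun j _ => HasDual.sum fun k _ => HasDual.sum fun l _ =>
        (hc ?_).add (hc ?_))))
  · exact ((H.traceUp.of_le zero_le_one).const_mul _).mul_one H.nonneg (hπ1 i j)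
  · exact (((hg j l).one_mul (hπ i j)).mul_one H.nonneg (hπ1 k l)).const_mul (-1)
  · exact (((hg i k).one_mul (hπ i j)).mul_one H.nonneg (hπ1 k l)).const_mul (-1)

lemma hasDual_hamiltonianUp (H : SmallData 𝓕 ε g π) : HasDual 𝓕 ε 0 0 1 fun m τ x => volDensity
    (g m) x * hamiltonianUp (g m) (π m) τ x := by
  have hg := fun a b => (H.metric_one a b).of_le (zero_le_two (α := ℕ))
  have hπ := fun a b => (H.momentum a b).of_le zero_le_one
  have hc : ∀ {F : 𝓕.ι → Fn n} {a b : Fin n}, Sym 𝓕 ε 0 1 F → HasDual 𝓕 ε 0 0 1 fun i h x => F i x *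
      h x a b := fun hF => (HasDual.entry _ _).coef_mul_one H.nonneg hF
  refine HasDual.one_coef_mul H.nonneg (m := 0) (H.volDensity_one.of_le zero_le_two)
    ((HasDual.sum fun i _ => HasDual.sum fun j _ => hc ?_).add
      (HasDual.sum fun i _ => HasDual.sum fun j _ => HasDual.sum fun k _ => HasDual.sum fun l _ =>
        (hc ?_).add (hc ?_)))
  · exact ((H.traceUp.of_le zero_le_one).const_mul _).mul_one H.nonneg (hg i j)
  · exact (((hg i k).one_mul (hg j l)).one_mul (hπ k l)).const_mul (-1)
  · exact (((hg i k).one_mul (hg j l)).one_mul (hπ i j)).const_mul (-1)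

lemma hasDual_divLow (H : SmallData 𝓕 ε g π) (k : Fin n) : HasDual 𝓕 ε 1 0 2 fun m h x => ∑ j,
      (volDensity (g m) x * g m x j k) * divLow (g m) (π m) h j x := by
  have hC := fun k i j => (H.hasDual_dChristoffel k i j).weaken (k₁ := 1) (j₁ := 0)
    (fun _ => zero_le_one) le_rfl zero_le_one
  refine HasDual.sum fun j _ => HasDual.one_coef_mul H.nonneg (m := 0)
    ((H.volDensity_one.of_le one_le_two).one_mul ((H.metric_one j k).of_le one_le_two)) ?_
  exact HasDual.sum fun i _ => HasDual.sum fun l _ =>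
    ((hC i i l).coef_mul_one H.nonneg (H.momentum l j)).add
      ((hC j i l).coef_mul_one H.nonneg (H.momentum i l))

def _root_.Constraint.divFlat (τ : Tensor2 n) (j : Fin n) (x : E n) : ℝ :=
  ∑ i, pd i (fun y => τ y i j) x

def _root_.Constraint.divErr (g τ : Tensor2 n) (k : Fin n) (x : E n) : ℝ :=
  ∑ j, (((volDensity g x - 1) * g x j k + (g x j k - 𝟙 j k)) *
      divFlat τ j x +
    (volDensity g x * g x j k) * ∑ i, ∑ l, (Constraint.christoffel g i i l x * τ x l j +
      Constraint.christoffel g j i l x * τ x i l))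

lemma _root_.Constraint.divLin_eq (g τ : Tensor2 n) (k : Fin n) (x : E n) : ∑ j,
    (volDensity g x * g x j k) * divLin g τ j x = divFlat τ k x + divErr g τ k x := by
  have h1 : divFlat τ k x = ∑ j, 𝟙 j k * divFlat τ j x := by simp [Matrix.one_apply]
  rw [h1, divErr, ← sum_add_distrib]
  refine sum_congr rfl fun j _ => ?_
  rw [divLin, divFlat]
  ring

lemma _root_.Constraint.hasDual_divFlat (j : Fin n) : HasDual 𝓕 (fun _ => 1) 1 0 1 fun _ τ =>
    divFlat τ j := HasDual.sum fun i _ => (HasDual.entry i j).pd (fun _ => zero_le_one) i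

lemma hasDual_divErr (H : SmallData 𝓕 ε g π) (k : Fin n) : HasDual 𝓕 ε 1 0 1 fun m τ => divErr (g m)
    τ k := by
  have hg := fun a b => (H.metric_one a b).of_le one_le_two
  have hc : ∀ {a b d k l : Fin n}, HasDual 𝓕 ε 1 0 1 fun i h x => Constraint.christoffel (g i) a b d
      x * h x k l := fun {a b d k l} =>
    ((HasDual.entry _ _).coef_mul_one H.nonneg ((H.christoffel a b d).of_le zero_le_one)).weaken
      H.nonneg zero_le_one le_rfl
  refine HasDual.sum fun j _ => ((hasDual_divFlat j).coef_mul_one H.nonneg (m := 0) ?_).add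
    (HasDual.one_coef_mul H.nonneg (m := 0) ((H.volDensity_one.of_le one_le_two).one_mul (hg j k))
      (HasDual.sum fun i _ => HasDual.sum fun l _ => hc.add hc))
  exact ((H.volDensity_sub.of_le one_le_two).mul_one H.nonneg (hg j k)).add
    ((H.metric j k).of_le one_le_two)

end SmallData

lemma dualOp_scalarFlat : ∃ P', DualOp 𝓕 (fun _ => 1) 2 0 2 (fun _ h => scalarFlat h) P' ∧
    ∀ i v x a b, P' i v x a b = pd b (pd a v) x - 𝟙 a b * ∑ c, pd c (pd c v) x := by
  have h01 : ∀ _ : 𝓕.ι, (0 : ℝ) ≤ 1 := fun _ => zero_le_one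
  refine ⟨_, DualOp.sum fun a _ => DualOp.sum fun b _ =>
    (((DualOp.entry a b).pd h01 b).pd h01 a).add
      (((((DualOp.entry a a).pd h01 b).pd h01 b)).const_mul (-1)), fun i v x a b => ?_⟩
  simp only [neg_neg, Matrix.sum_apply, Matrix.add_apply, Matrix.smul_apply, Matrix.single_apply,
    smul_eq_mul, sum_add_distrib, ite_and, Matrix.one_apply]
  simp only [Finset.sum_ite_eq', Finset.sum_ite_irrel, Finset.mem_univ, if_true,
    Finset.sum_const_zero, neg_mul, one_mul, ite_mul, zero_mul, sum_neg_distrib, sub_eq_add_neg]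

lemma dualOp_divFlat (k : Fin n) : ∃ P', DualOp 𝓕 (fun _ => 1) 1 0 1 (fun _ τ => divFlat τ k) P' ∧
    ∀ i v x a b, P' i v x a b = -(𝟙 b k * pd a v x) := by
  have h01 : ∀ _ : 𝓕.ι, (0 : ℝ) ≤ 1 := fun _ => zero_le_one
  refine ⟨_, DualOp.sum fun a _ => (DualOp.entry a k).pd h01 a, fun i v x a b => ?_⟩
  simp only [Matrix.sum_apply, Matrix.neg_apply, Matrix.single_apply, ite_and, Matrix.one_apply,
    sum_neg_distrib]
  simp [eq_comm]

end Perturbation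

section Model
variable {n : ℕ}

/-- Explicit operators `M₁`, `M₂` dual to the linearized constraint map, which are perturbations of
the flat ones of size `c`. -/
structure AdjointModel (Ω : Set (E n)) (r : Fn n) (g π : Tensor2 n) (c : ℝ)
    (M₁ M₂ : Fn n → VF n → Tensor2 n) : Prop where
  symm : ∀ x ∈ Ω, (g x).IsSymm
  det_pos : ∀ x ∈ Ω, 0 < (g x).det
  metric : ∀ x ∈ Ω, ∀ a b, |g x a b - 𝟙 a b| ≤ c
  inverse : ∀ x ∈ Ω, ∀ a b, |(g x)⁻¹ a b - 𝟙 a b| ≤ c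
  density : ∀ x ∈ Ω, |volDensity g x - 1| ≤ c
  metric_continuousOn : ∀ a b, ContinuousOn (fun x => g x a b) Ω
  inverse_continuousOn : ∀ a b, ContinuousOn (fun x => (g x)⁻¹ a b) Ω
  density_continuousOn : ContinuousOn (volDensity g) Ω
  continuousOn₁ : ∀ (u : Fn n) (Z : VF n), Smooth u → Smooth Z → ∀ a b,
    ContinuousOn (fun x => M₁ u Z x a b) Ω
  continuousOn₂ : ∀ (u : Fn n) (Z : VF n), Smooth u → Smooth Z → ∀ a b,
    ContinuousOn (fun x => M₂ u Z x a b) Ω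
  bound₁ : ∀ (u : Fn n) (Z : VF n), Smooth u → Smooth Z → ∀ x ∈ Ω, ∀ a b,
    |M₁ u Z x a b - (pd b (pd a u) x -
      𝟙 a b * ∑ c, pd c (pd c u) x)| * r x ^ 2 ≤
      c * (jet r 2 u x + ∑ k, jet r 1 (fun y => Z y k) x)
  bound₂ : ∀ (u : Fn n) (Z : VF n), Smooth u → Smooth Z → ∀ x ∈ Ω, ∀ a b,
    |M₂ u Z x a b + pd a (fun y => Z y b) x| * r x ≤
      c * (jet r 0 u x + ∑ k, jet r 1 (fun y => Z y k) x)
  dual : ∀ h τ, IsTestTensor Ω h → IsTestTensor Ω τ → ∃ (L₀ : Fn n) (L : Fin n → Fn n),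
    (Continuous L₀ ∧ HasCompactSupport L₀ ∧ tsupport L₀ ⊆ Ω) ∧
    (∀ k, Continuous (L k) ∧ HasCompactSupport (L k) ∧ tsupport (L k) ⊆ Ω) ∧
    (∀ x ∈ Ω, linHamiltonian g π h τ x * volDensity g x = L₀ x) ∧
    (∀ x ∈ Ω, ∀ k, (∑ j, g x j k * linDiv g π h τ x j) * volDensity g x = L k x) ∧
    ∀ (u : Fn n) (Z : VF n), Smooth u → Smooth Z →
      (∫ x in Ω, L₀ x * u x) + ∑ k, ∫ x in Ω, L k x * Z x k =
        (∫ x in Ω, ∑ a, ∑ b, h x a b * M₁ u Z x a b) + ∫ x in Ω, ∑ a, ∑ b, τ x a b * M₂ u Z x a b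

variable {𝓕 : RegionFamily n} {ε : 𝓕.ι → ℝ} {g π : 𝓕.ι → Tensor2 n}

lemma abs_sub_le_of_sym {k : ℕ} {F : 𝓕.ι → Fn n} {c : ℝ} (hF : Sym 𝓕 ε k 0 fun i x => F i x - c) :
    ∃ C, 0 ≤ C ∧ ∀ᶠ i in 𝓕.l, ∀ x ∈ 𝓕.Ω i, |F i x - c| ≤ C * ε i := by
  obtain ⟨C, hC0, hC⟩ := hF.bound.order
  grind

lemma support_of_eq_zero {Ω K : Set (E n)} (hΩ : IsOpen Ω) {F : Fn n}
    (hF : ContDiffOn ℝ ((0 : ℕ) : WithTop ℕ∞) F Ω) (hK : IsCompact K) (hKΩ : K ⊆ Ω)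
    (h0 : ∀ x ∉ K, F x = 0) : Continuous F ∧ HasCompactSupport F ∧ tsupport F ⊆ Ω := by
  refine ⟨continuous_of_continuousOn_of_eq_zero hΩ hF.continuousOn hK.isClosed hKΩ h0,
    HasCompactSupport.intro hK h0, (closure_minimal (fun x hx => ?_) hK.isClosed).trans hKΩ⟩
  by_contra h
  exact hx (h0 x h)

lemma sum_mul_add_sum {κ : Type*} [Fintype κ] (h A : Mat n) (B : κ → Mat n) : ∑ a, ∑ b, h a b *
    (A + ∑ k, B k) a b = (∑ a, ∑ b, h a b * A a b) + ∑ k, ∑ a, ∑ b, h a b * B k a b := by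
  simp only [Matrix.add_apply, Matrix.sum_apply, mul_add, mul_sum, sum_add_distrib]
  congr 1
  exact (sum_congr rfl fun a _ => sum_comm).trans sum_comm

lemma abs_add_sum_mul_le {κ : Type*} [Fintype κ] {A w c D J : ℝ} {B C J' : κ → ℝ}
    (hA : |A| * w ≤ c * J) (hB : ∀ k, |B k| * w ≤ C k * J' k) (hw : 0 ≤ w) (hJ : 0 ≤ J)
    (hJ' : ∀ k, 0 ≤ J' k) (hc : c ≤ D) (hC : ∀ k, C k ≤ D) :
    |A + ∑ k, B k| * w ≤ D * (J + ∑ k, J' k) := by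
  have h : |A + ∑ k, B k| ≤ |A| + ∑ k, |B k| := (abs_add_le _ _).trans
    (add_le_add le_rfl (abs_sum_le_sum_abs _ _))
  refine (mul_le_mul_of_nonneg_right h hw).trans ?_
  rw [add_mul, sum_mul, mul_add, mul_sum]
  exact add_le_add (hA.trans (by gcongr)) (sum_le_sum fun k _ => (hB k).trans
    (mul_le_mul_of_nonneg_right (hC k) (hJ' k)))

lemma SmallData.exists_adjointModel (H : SmallData 𝓕 ε g π)
    (hsymm : ∀ᶠ i in 𝓕.l, ∀ x ∈ 𝓕.Ω i, (g i x).IsSymm) : ∃ C : ℝ, ∀ᶠ i in 𝓕.l, ∃ M₁ M₂, AdjointModel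
    (𝓕.Ω i) (𝓕.r i) (g i) (π i) (C * ε i) M₁ M₂ := by
  obtain ⟨P₀', hP₀, eP₀⟩ := dualOp_scalarFlat (𝓕 := 𝓕)
  obtain ⟨P', hP⟩ := H.hasDual_hamiltonianErr
  obtain ⟨D', hD⟩ := H.hasDual_hamiltonianUp
  choose Q' hQ using H.hasDual_divLow
  choose S₀' hS₀ eS₀ using dualOp_divFlat (𝓕 := 𝓕)
  choose S' hS using H.hasDual_divErr
  choose C₁ hC₁0 hC₁ using fun a b => abs_sub_le_of_sym (H.metric a b)
  choose C₂ hC₂0 hC₂ using fun a b => abs_sub_le_of_sym (H.inverse_sub a b)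
  obtain ⟨C₃, hC₃0, hC₃⟩ := abs_sub_le_of_sym H.volDensity_sub
  obtain ⟨C₄, hC₄0, hC₄⟩ := hP.bound
  obtain ⟨C₅, hC₅0, hC₅⟩ := hD.bound
  choose C₆ hC₆0 hC₆ using fun k => (hQ k).bound
  choose C₇ hC₇0 hC₇ using fun k => (hS k).bound
  set s₁ := ∑ a, ∑ b, C₁ a b
  set s₂ := ∑ a, ∑ b, C₂ a b
  set s₆ := ∑ k, C₆ k
  set s₇ := ∑ k, C₇ k
  have hs₁ : 0 ≤ s₁ := sum_nonneg fun a _ => sum_nonneg fun b _ => hC₁0 a b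
  have hs₂ : 0 ≤ s₂ := sum_nonneg fun a _ => sum_nonneg fun b _ => hC₂0 a b
  have hs₆ : 0 ≤ s₆ := sum_nonneg fun k _ => hC₆0 k
  have hs₇ : 0 ≤ s₇ := sum_nonneg fun k _ => hC₇0 k
  have l₁ : ∀ a b, C₁ a b ≤ s₁ := fun a b =>
    (single_le_sum (f := fun b => C₁ a b) (fun b _ => hC₁0 a b) (Finset.mem_univ b)).trans
      (single_le_sum (f := fun a => ∑ b, C₁ a b) (fun a _ => sum_nonneg fun b _ => hC₁0 a b)
        (Finset.mem_univ a))
  have l₂ : ∀ a b, C₂ a b ≤ s₂ := fun a b =>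
    (single_le_sum (f := fun b => C₂ a b) (fun b _ => hC₂0 a b) (Finset.mem_univ b)).trans
      (single_le_sum (f := fun a => ∑ b, C₂ a b) (fun a _ => sum_nonneg fun b _ => hC₂0 a b)
        (Finset.mem_univ a))
  have l₆ : ∀ k, C₆ k ≤ s₆ := fun k => single_le_sum (f := C₆) (fun k _ => hC₆0 k)
    (Finset.mem_univ k)
  have l₇ : ∀ k, C₇ k ≤ s₇ := fun k => single_le_sum (f := C₇) (fun k _ => hC₇0 k)
    (Finset.mem_univ k)
  refine ⟨s₁ + s₂ + C₃ + C₄ + C₅ + s₆ + s₇, ?_⟩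
  have hP₁ := hP₀.add (hP.mono H.le_one)
  have hS₁ := fun k => (hS₀ k).add ((hS k).mono H.le_one)
  have hm := eventually_all.2 fun a => eventually_all.2 fun b => (H.metric_one a b).smooth
  have hi := eventually_all.2 fun a => eventually_all.2 fun b => (H.inverse_one a b).smooth
  have hπ := eventually_all.2 fun a => eventually_all.2 fun b => (H.momentum a b).differentiableAt
  filter_upwards [hsymm, H.eventually_det, H.regularMetric, hm, hi, hπ, H.volDensity_one.smooth,
    eventually_all.2 fun a => eventually_all.2 fun b => hC₁ a b, eventually_all.2 fun a =>
    eventually_all.2 fun b => hC₂ a b, hC₃, hC₄, hC₅, eventually_all.2 hC₆, eventually_all.2 hC₇,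
    hP₁.smooth, hP₁.dual, hP₁.dual_continuousOn, hD.smooth, hD.dual, hD.dual_continuousOn,
    eventually_all.2 fun k => (hQ k).smooth, eventually_all.2 fun k => (hQ k).dual, eventually_all.2
    fun k => (hQ k).dual_continuousOn, eventually_all.2 fun k => (hS₁ k).smooth, eventually_all.2
    fun k => (hS₁ k).dual, eventually_all.2 fun k => (hS₁ k).dual_continuousOn, H.hamiltonianLow_eq]
    with i symm det reg hm hi hπ hv b₁ b₂ b₃ b₄ b₅ b₆ b₇ smP duP coP smD duD coD smQ duQ coQ smS duS
      coS hlow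
  have hε := H.nonneg i
  have sm : ∀ {f : Fn n} {k : ℕ}, Smooth f → ContDiffOn ℝ k f (𝓕.Ω i) := fun hf =>
    (hf.of_le (by exact_mod_cast le_top)).contDiffOn
  have hj : ∀ k v x, 0 ≤ jet (𝓕.r i) k v x := fun k v x => jet_nonneg (𝓕.pos i) x k v
  refine ⟨fun u Z x => (P₀' i u x + P' i u x) + ∑ k, Q' k i (fun y => Z y k) x, fun u Z x => D' i u
    x + ∑ k, (S₀' k i (fun y => Z y k) x + S' k i (fun y => Z y k) x),
    symm, fun x hx => by linarith [det x hx], fun x hx a b => ?_, fun x hx a b => ?_, fun x hx =>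
    ?_, fun a b => (hm a b).continuousOn, fun a b => (hi a b).continuousOn, hv.continuousOn,
    fun u Z hu hZ a b => ?_, fun u Z hu hZ a b => ?_, fun u Z hu hZ x hx a b => ?_,
    fun u Z hu hZ x hx a b => ?_, fun h τ hh hτ => ?_⟩
  · refine (b₁ a b x hx).trans (mul_le_mul_of_nonneg_right ?_ hε)
    linarith [l₁ a b]
  · refine (b₂ a b x hx).trans (mul_le_mul_of_nonneg_right ?_ hε)
    linarith [l₂ a b]
  · refine (b₃ x hx).trans (mul_le_mul_of_nonneg_right ?_ hε)
    linarith
  · simp only [Matrix.add_apply, Matrix.sum_apply]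
    exact (coP u (sm hu) a b).add (continuousOn_finsetSum _ fun k _ => coQ k _
      (sm (contDiff_component hZ k)) a b)
  · simp only [Matrix.add_apply, Matrix.sum_apply]
    exact (coD u (sm hu) a b).add (continuousOn_finsetSum _ fun k _ => coS k _
      (sm (contDiff_component hZ k)) a b)
  · have e : (P₀' i u x + P' i u x + ∑ k, Q' k i (fun y => Z y k) x) a b - (pd b (pd a u) x - 𝟙 a b
        * ∑ c, pd c (pd c u) x) = P' i u x a b + ∑ k, Q' k i (fun y => Z y k) x a b := by
      rw [Matrix.add_apply, Matrix.add_apply, Matrix.sum_apply, eP₀]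
      ring
    rw [e]
    exact abs_add_sum_mul_le (b₄ u (sm hu) x hx a b)
      (fun k => b₆ k _ (sm (contDiff_component hZ k)) x hx a b) (sq_nonneg _) (hj ..)
      (fun _ => hj ..) (mul_le_mul_of_nonneg_right (by linarith) hε) fun k =>
      mul_le_mul_of_nonneg_right (by linarith [l₆ k]) hε
  · have e : (D' i u x + ∑ k, (S₀' k i (fun y => Z y k) x + S' k i (fun y => Z y k) x)) a b + pd a
        (fun y => Z y b) x = D' i u x a b + ∑ k, S' k i (fun y => Z y k) x a b := by
      simp only [Matrix.add_apply, Matrix.sum_apply, eS₀, sum_add_distrib, sum_neg_distrib,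
        Matrix.one_apply, ite_mul, one_mul, zero_mul, Finset.sum_ite_eq, Finset.mem_univ, if_true]
      ring
    rw [e]
    simp only [pow_one] at b₅ b₇
    exact abs_add_sum_mul_le (b₅ u (sm hu) x hx a b)
      (fun k => b₇ k _ (sm (contDiff_component hZ k)) x hx a b) (𝓕.pos i x).le (hj ..)
      (fun _ => hj ..) (mul_le_mul_of_nonneg_right (by linarith) hε) fun k =>
      mul_le_mul_of_nonneg_right (by linarith [l₇ k]) hε
  · have hΩ := 𝓕.isOpen i
    have hhs : SmoothTensor h := fun a b => (hh.2 a b).1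
    have hτs : SmoothTensor τ := fun a b => (hτ.2 a b).1
    set K : Set (E n) := ⋃ a, ⋃ b, (tsupport (fun x => h x a b) ∪ tsupport (fun x => τ x a b))
      with hKdef
    have hK : IsCompact K := isCompact_iUnion fun a => isCompact_iUnion fun b =>
      (hh.2 a b).2.1.isCompact.union (hτ.2 a b).2.1.isCompact
    have hKΩ : K ⊆ 𝓕.Ω i := iUnion_subset fun a => iUnion_subset fun b => union_subset
      (hh.2 a b).2.2 (hτ.2 a b).2.2
    have hnot : ∀ x ∉ K, ∀ a b, x ∉ tsupport (fun x => h x a b) ∧ x ∉ tsupport fun x => τ x a b := by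
      intro x hx a b
      rw [hKdef] at hx
      simp only [mem_iUnion, mem_union, not_exists, not_or] at hx
      exact hx a b
    have h0 : ∀ x ∉ K, h x = 0 := fun x hx => by
      ext a b
      exact image_eq_zero_of_notMem_tsupport (f := fun x => h x a b) (hnot x hx a b).1
    have τ0 : ∀ x ∉ K, τ x = 0 := fun x hx => by
      ext a b
      exact image_eq_zero_of_notMem_tsupport (f := fun x => τ x a b) (hnot x hx a b).2
    have z1 := hP₁.locality i h K hK.isClosed h0
    have z2 := hD.locality i τ K hK.isClosed τ0
    have z3 := fun k => (hQ k).locality i h K hK.isClosed h0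
    have z4 := fun k => (hS₁ k).locality i τ K hK.isClosed τ0
    have c1 := smP h hhs
    have c2 := smD τ hτs
    have c3 := fun k => smQ k h hhs
    have c4 := fun k => smS k τ hτs
    refine ⟨fun x => (scalarFlat h x + hamiltonianErr (g i) (π i) h x) + volDensity (g i) x *
        hamiltonianUp (g i) (π i) τ x, fun k x =>
      (∑ j, (volDensity (g i) x * g i x j k) * divLow (g i) (π i) h j x) +
        (divFlat τ k x + divErr (g i) τ k x), support_of_eq_zero hΩ (c1.add c2) hK hKΩ fun x hx =>
        ?_, fun k => support_of_eq_zero hΩ ((c3 k).add (c4 k)) hK hKΩ fun x hx => ?_, fun x hx =>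
        ?_, fun x hx k => ?_, fun u Z hu hZ => ?_⟩
    · exact (congrArg₂ _ (z1 x hx) (z2 x hx)).trans (add_zero 0)
    · change (_ + _ : ℝ) = 0
      exact (congrArg₂ _ (z3 k x hx) (z4 k x hx)).trans (add_zero 0)
    · simp only [linHamiltonian_eq hΩ reg hhs hx, ← hlow h hhs x hx]
      ring
    · simp only [linDiv_eq hΩ reg hhs hτs (fun a b => hπ a b) hx, ← divLin_eq, ← sum_add_distrib,
        sum_mul]
      exact sum_congr rfl fun j _ => by ring
    · have hZc := fun k => contDiff_component hZ k
      have I1 := DualOp.integrable_left (j := 0) (k := 0) c1 (sm hu) hK hKΩ z1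
      have I2 := DualOp.integrable_left (j := 0) (k := 0) c2 (sm hu) hK hKΩ z2
      have I3 := fun k => DualOp.integrable_left (j := 0) (k := 0) (c3 k) (sm (hZc k)) hK hKΩ (z3 k)
      have I4 := fun k => DualOp.integrable_left (j := 0) (k := 0) (c4 k) (sm (hZc k)) hK hKΩ (z4 k)
      have R1 := DualOp.integrable_right hhs (fun a b => coP u (sm hu) a b) hK hKΩ h0
      have R2 := DualOp.integrable_right hτs (fun a b => coD u (sm hu) a b) hK hKΩ τ0
      have R3 := fun k => DualOp.integrable_right hhs (fun a b => coQ k _ (sm (hZc k)) a b) hK hKΩ h0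
      have R4 := fun k => DualOp.integrable_right hτs (fun a b => coS k _ (sm (hZc k)) a b) hK hKΩ τ0
      have e1 : ∀ x, ∑ a, ∑ b, h x a b * ((P₀' i u x + P' i u x) + ∑ k, Q' k i (fun y => Z y k) x) a
          b = (∑ a, ∑ b, h x a b * (P₀' i u x + P' i u x) a b) + ∑ k, ∑ a, ∑ b, h x a b * Q' k i
            (fun y => Z y k) x a b := fun x => sum_mul_add_sum _ _ _
      have e2 : ∀ x, ∑ a, ∑ b, τ x a b * (D' i u x + ∑ k,
          (S₀' k i (fun y => Z y k) x + S' k i (fun y => Z y k) x)) a b =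
          (∑ a, ∑ b, τ x a b * D' i u x a b) + ∑ k, ∑ a, ∑ b, τ x a b *
              (S₀' k i (fun y => Z y k) x + S' k i (fun y => Z y k) x) a b := fun x =>
        sum_mul_add_sum _ _ _
      simp only [e1, e2]
      have f0 : ∫ x in 𝓕.Ω i, ((scalarFlat h x + hamiltonianErr (g i) (π i) h x) + volDensity (g i)
          x * hamiltonianUp (g i) (π i) τ x) * u x = _ :=
        (integral_congr_ae (of_forall fun x => add_mul _ _ (u x))).trans (integral_add I1 I2)
      have f1 : ∀ k, ∫ x in 𝓕.Ω i, ((∑ j, (volDensity (g i) x * g i x j k) * divLow (g i) (π i) h j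
          x) + (divFlat τ k x + divErr (g i) τ k x)) * Z x k = _ := fun k =>
        (integral_congr_ae (of_forall fun x => add_mul _ _ (Z x k))).trans
          (integral_add (I3 k) (I4 k))
      rw [f0, sum_congr rfl fun k _ => f1 k, integral_add R1 (integrable_finsetSum _ fun k _ => R3 k),
        integral_add R2 (integrable_finsetSum _ fun k _ => R4 k), integral_finsetSum _ fun k _ => R3
        k, integral_finsetSum _ fun k _ => R4 k, sum_add_distrib, duP h hhs K hK hKΩ h0 u (sm hu),
        duD τ hτs K hK hKΩ τ0 u (sm hu), sum_congr rfl fun k _ => duQ k h hhs K hK hKΩ h0 _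
        (sm (hZc k)), sum_congr rfl fun k _ => duS k τ hτs K hK hKΩ τ0 _ (sm (hZc k))]
      ring

end Model

section Transport
variable {n : ℕ} {Ω : Set (E n)}

lemma measurePreserving_motion (a : E n) (T : E n ≃ₗᵢ[ℝ] E n) : MeasurePreserving
    (fun y => T (y - a)) volume volume := T.measurePreserving.comp
  (measurePreserving_sub_right volume a)

lemma measurableEmbedding_motion (a : E n) (T : E n ≃ₗᵢ[ℝ] E n) : MeasurableEmbedding
    (fun y : E n => T (y - a)) := T.toHomeomorph.measurableEmbedding.comp
  (measurableEmbedding_subRight a)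

lemma setLIntegral_motion (a : E n) (T : E n ≃ₗᵢ[ℝ] E n) (Ω : Set (E n)) (F : E n → ℝ≥0∞) :
    ∫⁻ y in {y | T (y - a) ∈ Ω}, F (T (y - a)) = ∫⁻ x in Ω, F x :=
  (measurePreserving_motion a T).setLIntegral_comp_preimage_emb (measurableEmbedding_motion a T) F Ω

lemma hasFDerivAt_motion (a : E n) (T : E n ≃ₗᵢ[ℝ] E n) (y : E n) : HasFDerivAt (fun y => T (y - a))
    (T : E n →L[ℝ] E n) y := (T : E n →L[ℝ] E n).hasFDerivAt.comp y ((hasFDerivAt_id y).sub_const a)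

lemma KornBound.motion {r ρ : Fn n} {σ : ℝ} {C : NNReal} (H : KornBound Ω r ρ σ C) (a : E n)
    (T : E n ≃ₗᵢ[ℝ] E n) : KornBound {y | T (y - a) ∈ Ω} (place a T r) (place a T ρ) σ C := by
  intro Z hZ hs
  set W : VF n := fun x => T (Z (T.symm x + a)) with hW
  have hWs : Smooth W := by fun_prop
  have hWc : HasCompactSupport W := by
    have h1 : HasCompactSupport fun x => Z (T.symm x + a) := hs.comp_homeomorph
      (T.symm.toHomeomorph.trans (Homeomorph.addRight a))
    exact h1.comp_left (g := T) (map_zero T)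
  have hval : ∀ y, W (T (y - a)) = T (Z y) := fun y => by simp [hW]
  have hder : ∀ y v, fderiv ℝ W (T (y - a)) (T v) = T (fderiv ℝ Z y v) := by
    intro y v
    have h1 := ((hWs.differentiable (by simp)) (T (y - a))).hasFDerivAt.comp y
      (hasFDerivAt_motion a T y)
    have h2 : HasFDerivAt (fun y => T (Z y)) _ y := (T : E n →L[ℝ] E n).hasFDerivAt.comp y
      ((hZ.differentiable (by simp)) y).hasFDerivAt
    have h3 := h1.unique (h2.congr_of_eventuallyEq (of_forall hval))
    exact congrArg (fun L : E n →L[ℝ] E n => L v) h3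
  have hadj : ∀ y v, ContinuousLinearMap.adjoint (fderiv ℝ W (T (y - a))) (T v) = T
      (ContinuousLinearMap.adjoint (fderiv ℝ Z y) v) := by
    intro y v
    refine ext_inner_right ℝ fun w => ?_
    obtain ⟨w, rfl⟩ := T.surjective w
    rw [ContinuousLinearMap.adjoint_inner_left, hder, T.inner_map_map, T.inner_map_map,
      ContinuousLinearMap.adjoint_inner_left]
  have hnorm : ∀ L M : E n →L[ℝ] E n, (∀ v, M (T v) = T (L v)) → ‖M‖ₑ = ‖L‖ₑ := by
    intro L M h
    have h1 : ‖M‖ = ‖L‖ := by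
      refine le_antisymm (M.opNorm_le_bound (norm_nonneg _) fun v => ?_)
        (L.opNorm_le_bound (norm_nonneg _) fun v => ?_)
      · obtain ⟨v, rfl⟩ := T.surjective v
        rw [h, T.norm_map, T.norm_map]; exact L.le_opNorm v
      · rw [← T.norm_map (L v), ← h, ← T.norm_map v]; exact M.le_opNorm _
    rw [← ofReal_norm, ← ofReal_norm, h1]
  have hW' := H W hWs hWc
  rw [← setLIntegral_motion a T Ω fun z => ofReal (r z ^ (ℓ n σ) * ρ z) * ‖W z‖ₑ ^ 2, ←
    setLIntegral_motion a T Ω fun z => ofReal (r z ^ (ℓ n (1 + σ)) * ρ z) * ‖fderiv ℝ W z‖ₑ ^ 2, ←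
    setLIntegral_motion a T Ω fun z =>
      ofReal (r z ^ (ℓ n (1 + σ)) * ρ z) * ‖strain W z‖ₑ ^ 2] at hW'
  have e1 : ∀ y, ‖W (T (y - a))‖ₑ = ‖Z y‖ₑ := fun y => by
    rw [hval, ← ofReal_norm, T.norm_map, ofReal_norm]
  have e2 : ∀ y, ‖fderiv ℝ W (T (y - a))‖ₑ = ‖fderiv ℝ Z y‖ₑ := fun y => hnorm _ _ (hder y)
  have e3 : ∀ y, ‖strain W (T (y - a))‖ₑ = ‖strain Z y‖ₑ := fun y => hnorm _ _ fun v => by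
    simp only [strain, add_apply, hder, hadj, map_add]
  simp only [e1, e2, e3] at hW'
  exact hW'

/-! ### The flat second order estimate -/

lemma normSq_zero {F : Type*} [NormedAddCommGroup F] [NormedSpace ℝ F] (Ω : Set (E n)) (r ρ : Fn n)
    (s : ℝ) (v : E n → F) : normSq Ω r ρ 0 s v = ∫⁻ x in Ω, ‖v x‖ₑ ^ 2 * ofReal
      (r x ^ (ℓ n s) * ρ x) := by
  simp [normSq]

lemma normSq_one {F : Type*} [NormedAddCommGroup F] [NormedSpace ℝ F] (Ω : Set (E n)) (r ρ : Fn n)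
    (s : ℝ) (v : E n → F) : normSq Ω r ρ 1 s v = normSq Ω r ρ 0 s v + ∑ a, ∫⁻ x in Ω, ‖fderiv ℝ v x
      (single a 1)‖ₑ ^ 2 * ofReal (r x ^ (ℓ n (1 + s)) * ρ x) := by
  rw [normSq, normSq, Finset.sum_range_succ]
  congr 1
  rw [← (Equiv.funUnique (Fin 1) (Fin n)).symm.sum_comp]
  simp

lemma normSq_two (Ω : Set (E n)) (r ρ : Fn n) (s : ℝ) {u : Fn n} (hu : Smooth u) : normSq Ω r ρ 2 s
    u = normSq Ω r ρ 1 s u + ∑ a, ∑ b, ∫⁻ x in Ω, ‖pd b (pd a u) x‖ₑ ^ 2 * ofReal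
        (r x ^ (ℓ n (2 + s)) * ρ x) := by
  have hd : ∀ x, DifferentiableAt ℝ (fderiv ℝ u) x := fun x =>
    ((hu.fderiv_right (m := ∞) (by simp)).differentiable (by simp)) x
  rw [normSq, normSq, Finset.sum_range_succ]
  congr 1
  rw [← (finTwoArrowEquiv (Fin n)).symm.sum_comp, Fintype.sum_prod_type, sum_comm]
  refine sum_congr rfl fun a _ => sum_congr rfl fun b _ => ?_
  refine lintegral_congr fun x => ?_
  rw [iteratedFDeriv_two_apply]
  have : pd b (pd a u) x = fderiv ℝ (fderiv ℝ u) x (single b 1) (single a 1) := by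
    change fderiv ℝ (fun y => fderiv ℝ u y (single a 1)) x _ = _
    rw [fderiv_clm_apply (hd x) (differentiableAt_const _)]
    simp
  rw [this]
  simp

/-- The coercivity estimate for the flat operators. -/
def FlatBound (Ω : Set (E n)) (r ρ : Fn n) (s : ℝ) (K : NNReal) : Prop :=
  ∀ (u : Fn n) (Z : VF n), Smooth u → HasCompactSupport u →
    Smooth Z → HasCompactSupport Z →
    normSq Ω r ρ 2 s u + normSq Ω r ρ 1 s Z ≤
      K * ((∑ a, ∑ b, ∫⁻ x in Ω, ‖pd b (pd a u) x‖ₑ ^ 2 *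
          ofReal (r x ^ (ℓ n (2 + s)) * ρ x)) +
        ∑ a, ∑ b, ∫⁻ x in Ω, ‖pd a (fun y => Z y b) x + pd b (fun y => Z y a) x‖ₑ ^ 2 *
          ofReal (r x ^ (ℓ n (1 + s)) * ρ x))

lemma lintegral_mul_norm_sq_le_sum {w : Fn n} (hw : Continuous w)
    {L : E n → E n →L[ℝ] E n} (hL : Continuous L) :
    ∫⁻ x in Ω, ofReal (w x) * ‖L x‖ₑ ^ 2 ≤ ∑ i, ∑ j, ∫⁻ x in Ω, ‖L x (single i 1) j‖ₑ ^ 2 * ofReal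
      (w x) := by
  have hm : ∀ i j, Measurable fun x => ‖L x (single i 1) j‖ₑ ^ 2 * ofReal (w x) := fun i j => by
    have h1 : Continuous fun x => L x (single i 1) j := by fun_prop
    exact (h1.measurable.enorm.pow_const 2).mul hw.measurable.ennreal_ofReal
  calc _ ≤ ∫⁻ x in Ω, ∑ i, ∑ j, ‖L x (single i 1) j‖ₑ ^ 2 * ofReal (w x) := by
        refine lintegral_mono fun x => ?_
        simp only [← sum_mul]
        rw [mul_comm]
        gcongr
        simp only [enorm_sq_eq_ofReal, norm_eq_abs, sq_abs]
        simp_rw [← ofReal_sum_of_nonneg fun j _ => sq_nonneg _]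
        rw [← ofReal_sum_of_nonneg fun i _ => sum_nonneg fun j _ => sq_nonneg _]
        exact ofReal_le_ofReal (norm_sq_le_sum_entries _)
    _ = _ := by
        rw [lintegral_finsetSum _ fun i _ => measurable_fun_sum _ fun j _ => hm i j]
        exact sum_congr rfl fun i _ => lintegral_finsetSum _ fun j _ => hm i j

lemma exists_flatBound (hn : 0 < n) (s : ℝ) (C₀ C₁ : NNReal) : ∃ K : NNReal,
    ∀ (Ω : Set (E n)) (r ρ : Fn n), (∀ x, 0 < r x) → Continuous r → Continuous ρ → KornBound Ω r ρ s
      C₀ → KornBound Ω r ρ (1 + s) C₁ → FlatBound Ω r ρ s K := by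
  refine ⟨(C₀ * 4 * C₁ * 4 + n * C₁ * 4 + 1) + (C₀ + n * C₀), ?_⟩
  intro Ω r ρ hr hrc hρ H₀ H₁ u Z hu huc hZ hZc
  have hwc : ∀ m : ℝ, Continuous fun x => r x ^ m * ρ x := fun m =>
    (hrc.rpow_const fun x => Or.inl (hr x).ne').mul hρ
  set A := ∑ a, ∑ b, ∫⁻ x in Ω, ‖pd b (pd a u) x‖ₑ ^ 2 * ofReal (r x ^ (ℓ n (2 + s)) * ρ x) with hA
  set B := ∑ a, ∑ b, ∫⁻ x in Ω, ‖pd a (fun y => Z y b) x + pd b (fun y => Z y a) x‖ₑ ^ 2 * ofReal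
          (r x ^ (ℓ n (1 + s)) * ρ x) with hB
  -- the vector field
  have hBZ : normSq Ω r ρ 1 s Z ≤ (C₀ + n * C₀ : NNReal) * B := by
    have h1 := H₀ Z hZ hZc
    have h2 := lintegral_mul_norm_sq_le_sum (Ω := Ω) (hwc (ℓ n (1 + s))) (continuous_strain hZ)
    have h3 : ∀ x (i j : Fin n), strain Z x (single i 1) j = pd i (fun y => Z y j) x + pd j
        (fun y => Z y i) x := fun x i j => by
      have hd := (hZ.differentiable (by simp)) x
      rw [strain_entry, pd_component hd, pd_component hd]
    simp only [h3] at h2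
    have h4 := h1.trans (mul_le_mul_right h2 _)
    rw [normSq_one, normSq_zero]
    have h5 : ∀ a : Fin n, ∫⁻ x in Ω, ‖fderiv ℝ Z x (single a 1)‖ₑ ^ 2 * ofReal
        (r x ^ (ℓ n (1 + s)) * ρ x) ≤ C₀ * B := fun a => by
      refine le_trans (lintegral_mono fun x => ?_) ((le_add_self).trans h4)
      dsimp only
      rw [mul_comm]
      gcongr
      rw [← ofReal_norm, ← ofReal_norm]
      refine ofReal_le_ofReal ?_
      simpa using (fderiv ℝ Z x).le_opNorm (single a 1)
    have h6 : ∫⁻ x in Ω, ‖Z x‖ₑ ^ 2 * ofReal (r x ^ (ℓ n s) * ρ x) ≤ C₀ * B := by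
      refine le_trans (le_of_eq (lintegral_congr fun x => mul_comm _ _)) (le_self_add.trans h4)
    refine (add_le_add h6 (sum_le_sum fun a _ => h5 a)).trans (le_of_eq ?_)
    rw [Finset.sum_const, Finset.card_univ, Fintype.card_fin, nsmul_eq_mul]
    push_cast; ring
  -- the gradient
  set G : VF n := fun x => WithLp.toLp 2 fun i => pd i u x with hG
  have hGs : Smooth G := by rw [contDiff_euclidean]; exact fun i => contDiff_pd hu i
  have hGc : HasCompactSupport G := by
    refine (huc.fderiv ℝ).mono fun x hx => ?_
    rw [Function.mem_support] at hx ⊢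
    contrapose! hx
    ext i; simp [hG, pd, hx]
  have hGB := H₁ G hGs hGc
  have e12 : (1 : ℝ) + (1 + s) = 2 + s := by ring
  rw [e12] at hGB
  have hGA : ∫⁻ z in Ω, ofReal (r z ^ (ℓ n (2 + s)) * ρ z) * ‖strain G z‖ₑ ^ 2 ≤ 4 * A := by
    refine (lintegral_mul_norm_sq_le_sum (Ω := Ω) (hwc (ℓ n (2 + s))) (continuous_strain hGs)).trans
      (le_of_eq ?_)
    rw [hA, mul_sum]
    refine sum_congr rfl fun i _ => ?_
    rw [mul_sum]
    refine sum_congr rfl fun j _ => ?_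
    rw [← lintegral_const_mul' _ _ (by norm_num)]
    refine lintegral_congr fun x => ?_
    have hd := (hGs.differentiable (by simp)) x
    rw [strain_entry, ← pd_component hd, ← pd_component hd]
    change ‖pd i (pd j u) x + pd j (pd i u) x‖ₑ ^ 2 * _ = _
    rw [pd_comm (hu.contDiffAt.of_le (WithTop.coe_le_coe.2 le_top)) i j, ← two_mul, enorm_mul,
      mul_pow, mul_assoc]
    congr 1
    rw [enorm_sq_eq_ofReal]; norm_num
  have hG1 : ∫⁻ z in Ω, ofReal (r z ^ (ℓ n (1 + s)) * ρ z) * ‖G z‖ₑ ^ 2 ≤ C₁ * (4 * A) :=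
      le_self_add.trans (hGB.trans (mul_le_mul_right hGA _))
  have hpd : ∀ a : Fin n, ∫⁻ x in Ω, ‖fderiv ℝ u x (single a 1)‖ₑ ^ 2 * ofReal
      (r x ^ (ℓ n (1 + s)) * ρ x) ≤ C₁ * (4 * A) := fun a => by
    refine le_trans (lintegral_mono fun x => ?_) hG1
    dsimp only
    rw [mul_comm]
    gcongr
    rw [← ofReal_norm, ← ofReal_norm]
    exact ofReal_le_ofReal (PiLp.norm_apply_le (G x) a)
  -- the function
  set e : E n := single ⟨0, hn⟩ 1 with he
  have hen : ‖e‖ = 1 := by simp [he]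
  have hUB := H₀ (fun x => u x • e) (hu.smul contDiff_const) (huc.mono fun x hx => by
    rw [Function.mem_support] at hx ⊢
    contrapose! hx; rw [hx, zero_smul])
  have hU : ∫⁻ x in Ω, ‖u x‖ₑ ^ 2 * ofReal (r x ^ (ℓ n s) * ρ x) ≤ C₀ * (4 * (C₁ * (4 * A))) := by
    have h1 : ∫⁻ x in Ω, ‖u x‖ₑ ^ 2 * ofReal (r x ^ (ℓ n s) * ρ x) = ∫⁻ z in Ω, ofReal
        (r z ^ (ℓ n s) * ρ z) * ‖u z • e‖ₑ ^ 2 := by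
      refine lintegral_congr fun x => ?_
      rw [enorm_smul, ← ofReal_norm e, hen, ofReal_one, mul_one, mul_comm]
    rw [h1]
    refine (le_self_add.trans hUB).trans (mul_le_mul_right ?_ _)
    have h2 : ∀ x, ‖strain (fun x => u x • e) x‖ ^ 2 ≤ 4 * ‖G x‖ ^ 2 := fun x => by
      have h3 := norm_adjoint_add_le (fderiv ℝ (fun x => u x • e) x)
      have h4 : ‖fderiv ℝ (fun x => u x • e) x‖ ≤ ‖G x‖ := by
        refine ContinuousLinearMap.opNorm_le_bound _ (norm_nonneg _) fun v => ?_
        have h5 : fderiv ℝ (fun x => u x • e) x v = inner ℝ (G x) v • e := by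
          rw [fderiv_smul_const ((hu.differentiable (by simp)) x)]
          simp only [ContinuousLinearMap.smulRight_apply]
          congr 1
          conv_lhs => rw [← (EuclideanSpace.basisFun (Fin n) ℝ).sum_repr v]
          simp only [map_sum, map_smul, EuclideanSpace.basisFun_apply, PiLp.inner_apply,
            EuclideanSpace.basisFun_repr]
          exact sum_congr rfl fun i _ => by simp [hG, pd]
        rw [h5, norm_smul, hen, mul_one]
        exact norm_inner_le_norm _ _
      have h5 : ‖strain (fun x => u x • e) x‖ ≤ 2 * ‖G x‖ := h3.trans (by linarith)
      nlinarith [norm_nonneg (strain (fun x => u x • e) x), norm_nonneg (G x)]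
    calc _ ≤ ∫⁻ z in Ω, 4 * (ofReal (r z ^ (ℓ n (1 + s)) * ρ z) * ‖G z‖ₑ ^ 2) := by
          refine lintegral_mono fun x => ?_
          dsimp only
          rw [mul_left_comm]
          gcongr
          rw [enorm_sq_eq_ofReal, enorm_sq_eq_ofReal]
          refine (ofReal_le_ofReal (h2 x)).trans (le_of_eq ?_)
          rw [ofReal_mul (by norm_num)]; norm_num
      _ ≤ _ := by
          rw [lintegral_const_mul' _ _ (by norm_num)]
          exact mul_le_mul_right hG1 _
  have hAu : normSq Ω r ρ 2 s u ≤ (C₀ * 4 * C₁ * 4 + n * C₁ * 4 + 1 : NNReal) * A := by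
    rw [normSq_two Ω r ρ s hu, normSq_one, normSq_zero]
    refine (add_le_add_left (add_le_add hU (sum_le_sum fun a _ => hpd a)) A).trans (le_of_eq ?_)
    rw [Finset.sum_const, Finset.card_univ, Fintype.card_fin, nsmul_eq_mul]
    push_cast; ring
  refine (add_le_add hAu hBZ).trans ?_
  rw [ENNReal.coe_add _ (C₀ + n * C₀), add_mul _ _ (A + B), mul_add, mul_add]
  exact add_le_add le_self_add le_add_self

end Transport

section Coercivity
variable {n : ℕ} {Ω : Set (E n)} {r ρ : Fn n} {Z : VF n} {u : Fn n} {x : E n}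

/-- The symmetric part of a tensor with two indices. -/
def symPart (M : Tensor2 n) : Tensor2 n := fun x => (1 / 2 : ℝ) • (M x + (M x).transpose)

lemma symPart_apply (M : Tensor2 n) (x : E n) (a b : Fin n) : symPart M x a b = (1 / 2 : ℝ) *
    (M x a b + M x b a) := rfl

lemma symPart_isSymm (M : Tensor2 n) (x : E n) : (symPart M x).IsSymm := by
  ext a b
  rw [Matrix.transpose_apply, symPart_apply, symPart_apply, add_comm]

/-- The integrand of the squared norm of `(u, Z)`, with the common weight taken out. -/
def jetSq (r : Fn n) (u : Fn n) (Z : VF n) (x : E n) : ℝ :=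
  u x ^ 2 + r x ^ 2 * ∑ a, pd a u x ^ 2 + r x ^ 4 * ∑ a, ∑ b, pd b (pd a u) x ^ 2 +
    ∑ k, Z x k ^ 2 + r x ^ 2 * ∑ k, ∑ a, pd a (fun y => Z y k) x ^ 2

lemma jet_one_sq_le (v : Fn n) (x : E n) : jet r 1 v x ^ 2 ≤ 2 * v x ^ 2 + 2 * n *
    (r x ^ 2 * ∑ a, pd a v x ^ 2) := by
  have h := sq_sum_le_card_mul_sum_sq (s := Finset.univ) (f := fun a => |pd a v x|)
  simp only [sq_abs, Finset.card_univ, Fintype.card_fin] at h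
  simp only [jet]
  nlinarith [sq_nonneg (|v x| - r x * ∑ a, |pd a v x|), sq_abs (v x)]

lemma jet_two_sq_le (v : Fn n) (x : E n) : jet r 2 v x ^ 2 ≤ 2 * v x ^ 2 + 4 * n *
    (r x ^ 2 * ∑ a, pd a v x ^ 2) + 4 * n ^ 2 * (r x ^ 4 * ∑ a, ∑ b, pd b (pd a v) x ^ 2) := by
  have h := sq_sum_le_card_mul_sum_sq (s := Finset.univ) (f := fun a => jet r 1 (pd a v) x)
  simp only [Finset.card_univ, Fintype.card_fin] at h
  have h1 : ∑ a, jet r 1 (pd a v) x ^ 2 ≤ 2 * ∑ a, pd a v x ^ 2 + 2 * n *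
      (r x ^ 2 * ∑ a, ∑ b, pd b (pd a v) x ^ 2) := by
    refine (sum_le_sum fun a _ => jet_one_sq_le (r := r) (pd a v) x).trans (le_of_eq ?_)
    rw [sum_add_distrib]
    simp only [mul_sum]
  have h3 := mul_le_mul_of_nonneg_left (h.trans (mul_le_mul_of_nonneg_left h1 n.cast_nonneg))
    (sq_nonneg (r x))
  have e : jet r 2 v x = |v x| + r x * ∑ a, jet r 1 (pd a v) x := rfl
  rw [e]
  nlinarith [sq_nonneg (|v x| - r x * ∑ a, jet r 1 (pd a v) x), sq_abs (v x)]

/-- The sum of the weighted jets that controls the perturbation of the adjoint. -/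
def fullJet (r : Fn n) (u : Fn n) (Z : VF n) (x : E n) : ℝ :=
  jet r 2 u x + ∑ k, jet r 1 (fun y => Z y k) x

lemma fullJet_sq_le (hn : 0 < n) (u : Fn n) (Z : VF n) (x : E n) : fullJet r u Z x ^ 2 ≤ 8 * n ^ 2 *
    jetSq r u Z x := by
  have h := sq_sum_le_card_mul_sum_sq (s := Finset.univ) (f := fun k => jet r 1 (fun y => Z y k) x)
  simp only [Finset.card_univ, Fintype.card_fin] at h
  have h1 : ∑ k, jet r 1 (fun y => Z y k) x ^ 2 ≤ 2 * ∑ k, Z x k ^ 2 + 2 * n *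
      (r x ^ 2 * ∑ k, ∑ a, pd a (fun y => Z y k) x ^ 2) := by
    refine (sum_le_sum fun k _ => jet_one_sq_le (r := r) (fun y => Z y k) x).trans (le_of_eq ?_)
    rw [sum_add_distrib]
    simp only [mul_sum]
  have h2 := jet_two_sq_le (r := r) u x
  have hn1 : (1 : ℝ) ≤ n := by exact_mod_cast hn
  have p1 : 0 ≤ r x ^ 2 * ∑ a, pd a u x ^ 2 := by positivity
  have p2 : 0 ≤ ∑ k, Z x k ^ 2 := by positivity
  have c1 : (n : ℝ) ≤ n ^ 2 := by nlinarith
  have c2 : (1 : ℝ) ≤ n ^ 2 := by nlinarith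
  rw [fullJet, jetSq]
  nlinarith [sq_nonneg (jet r 2 u x - ∑ k, jet r 1 (fun y => Z y k) x)]

lemma fullJet_nonneg (hr : ∀ x, 0 < r x) (u : Fn n) (Z : VF n) (x : E n) : 0 ≤ fullJet r u Z x :=
  add_nonneg (jet_nonneg hr x _ _) (sum_nonneg fun _ _ => jet_nonneg hr x _ _)

lemma abs_pd_pd_le_fullJet (hr : ∀ x, 0 < r x) (u : Fn n) (Z : VF n) (x : E n) (a b : Fin n) : |pd b
    (pd a u) x| * r x ^ 2 ≤ fullJet r u Z x := by
  have h1 := jet_pd_le hr x 0 (pd a u) b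
  have h2 := jet_pd_le hr x 1 u a
  have h3 : 0 ≤ ∑ k, jet r 1 (fun y => Z y k) x := sum_nonneg fun _ _ => jet_nonneg hr x _ _
  have h4 := mul_le_mul_of_nonneg_right h1 (hr x).le
  rw [fullJet]
  change |pd b (pd a u) x| * r x * r x ≤ _ at h4
  nlinarith

lemma abs_pd_le_fullJet (hr : ∀ x, 0 < r x) (u : Fn n) (Z : VF n) (x : E n) (a k : Fin n) : |pd a
    (fun y => Z y k) x| * r x ≤ fullJet r u Z x := by
  have h1 := jet_pd_le hr x 0 (fun y => Z y k) a
  have h2 := single_le_sum (f := fun k => jet r 1 (fun y => Z y k) x)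
    (fun _ _ => jet_nonneg hr x _ _) (Finset.mem_univ k)
  have h3 := jet_nonneg hr x 2 u
  change |pd a (fun y => Z y k) x| * r x ≤ _ at h1
  rw [fullJet]
  linarith

lemma rpow_pow_mul (hr : ∀ x, 0 < r x) (x : E n) (s : ℝ) (m : ℕ) : r x ^ (ℓ n (m + s)) * ρ x = r x ^
      (2 * m) * (r x ^ (ℓ n s) * ρ x) := by
  rw [← rpow_natCast (r x) (2 * m), ← mul_assoc, ← rpow_add (hr x)]
  congr 2; push_cast; ring

lemma enorm_sq_mul_ofReal {v : ℝ} {w : ℝ} : ‖v‖ₑ ^ 2 * ofReal w = ofReal (v ^ 2 * w) := by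
  rw [enorm_sq_eq_ofReal, norm_eq_abs, sq_abs, ofReal_mul (sq_nonneg v)]

lemma norm_sq_eq_sum (v : E n) : ‖v‖ ^ 2 = ∑ k, v k ^ 2 := by simp [EuclideanSpace.norm_sq_eq]

lemma normSq_add_normSq (hr : ∀ x, 0 < r x) (hrc : Continuous r) (hρ : Continuous ρ)
    (hρ0 : ∀ x, 0 ≤ ρ x) (s : ℝ) (hu : Smooth u) (hZ : Smooth Z) : normSq Ω r ρ 2 s u + normSq Ω r ρ
    1 s Z = ∫⁻ x in Ω, ofReal (jetSq r u Z x * (r x ^ (ℓ n s) * ρ x)) := by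
  set w : Fn n := fun x => r x ^ (ℓ n s) * ρ x with hw
  have hwc : Continuous w := (hrc.rpow_const fun x => Or.inl (hr x).ne').mul hρ
  have hw0 : ∀ x, 0 ≤ w x := fun x => mul_nonneg (rpow_nonneg (hr x).le _) (hρ0 x)
  have e1 : ∀ x, r x ^ (ℓ n (1 + s)) * ρ x = r x ^ 2 * w x := fun x => by
    have := rpow_pow_mul (ρ := ρ) hr x s 1
    simpa using this
  have e2 : ∀ x, r x ^ (ℓ n (2 + s)) * ρ x = r x ^ 4 * w x := fun x => by
    have := rpow_pow_mul (ρ := ρ) hr x s 2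
    simpa using this
  have hcz : ∀ k, Smooth fun y => Z y k := contDiff_component hZ
  have c1 : ∀ a, Continuous fun x => pd a u x := fun a => (contDiff_pd hu a).continuous
  have c2 : ∀ a b, Continuous fun x => pd b (pd a u) x := fun a b =>
    (contDiff_pd (contDiff_pd hu a) b).continuous
  have c3 : ∀ a k, Continuous fun x => pd a (fun y => Z y k) x := fun a k =>
    (contDiff_pd (hcz k) a).continuous
  have c4 := hu.continuous
  have c5 : ∀ k, Continuous fun x => Z x k := fun k => (hcz k).continuous
  have hm : ∀ f : Fn n, Continuous f → Measurable fun x => ofReal (f x) := fun f hf =>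
    hf.measurable.ennreal_ofReal
  have hZ1 : ∀ x, ‖Z x‖ₑ ^ 2 * ofReal (w x) = ofReal ((∑ k, Z x k ^ 2) * w x) := fun x => by
    rw [enorm_sq_eq_ofReal, ← norm_sq_eq_sum]
    exact (ofReal_mul (sq_nonneg _)).symm
  have hZ2 : ∀ x (a : Fin n), ‖fderiv ℝ Z x (single a 1)‖ₑ ^ 2 * ofReal (r x ^ 2 * w x) = ofReal
      ((∑ k, pd a (fun y => Z y k) x ^ 2) * (r x ^ 2 * w x)) := fun x a => by
    simp only [pd_component ((hZ.differentiable (by simp)) x)]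
    rw [enorm_sq_eq_ofReal, ← norm_sq_eq_sum]
    exact (ofReal_mul (sq_nonneg _)).symm
  rw [normSq_two Ω r ρ s hu, normSq_one, normSq_one, normSq_zero, normSq_zero]
  have e0 : ∀ x, r x ^ (ℓ n s) * ρ x = w x := fun _ => rfl
  have e3 : ∀ x a, fderiv ℝ u x (single a 1) = pd a u x := fun _ _ => rfl
  simp only [e0, e1, e2, hZ2, hZ1, e3, enorm_sq_mul_ofReal]
  have key : ∀ x, ofReal (jetSq r u Z x * w x) = ofReal (u x ^ 2 * w x) +
      (∑ a, ofReal (pd a u x ^ 2 * (r x ^ 2 * w x))) +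
      (∑ a, ∑ b, ofReal (pd b (pd a u) x ^ 2 * (r x ^ 4 * w x))) +
      (ofReal ((∑ k, Z x k ^ 2) * w x) + ∑ a, ofReal
        ((∑ k, pd a (fun y => Z y k) x ^ 2) * (r x ^ 2 * w x))) := by
    intro x
    have w0 := hw0 x
    have p1 : 0 ≤ ∑ k, Z x k ^ 2 := sum_nonneg fun _ _ => sq_nonneg _
    have p2 : ∀ a, 0 ≤ ∑ k, pd a (fun y => Z y k) x ^ 2 := fun a => sum_nonneg fun _ _ => sq_nonneg
      _
    have r0 := hr x
    have s1 : ∀ a, 0 ≤ ∑ b, pd b (pd a u) x ^ 2 * (r x ^ 4 * w x) := fun a => sum_nonneg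
      fun _ _ => by positivity
    have s2 : 0 ≤ ∑ a, ∑ b, pd b (pd a u) x ^ 2 * (r x ^ 4 * w x) := sum_nonneg fun a _ => s1 a
    have s3 : 0 ≤ ∑ a, pd a u x ^ 2 * (r x ^ 2 * w x) := sum_nonneg fun _ _ => by positivity
    have s4 : ∀ a, 0 ≤ (∑ k, pd a (fun y => Z y k) x ^ 2) * (r x ^ 2 * w x) := fun a => mul_nonneg
      (p2 a) (by positivity)
    have s5 := sum_nonneg fun a (_ : a ∈ Finset.univ) => s4 a
    rw [← ofReal_sum_of_nonneg fun a _ => s4 a, ← ofReal_sum_of_nonneg fun a _ => by positivity]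
    have hab : ∀ a, ∑ b, ofReal (pd b (pd a u) x ^ 2 * (r x ^ 4 * w x)) = ofReal
        (∑ b, pd b (pd a u) x ^ 2 * (r x ^ 4 * w x)) := fun a =>
      (ofReal_sum_of_nonneg fun b _ => by positivity).symm
    simp only [hab]
    rw [← ofReal_sum_of_nonneg fun a _ => s1 a, ← ofReal_add (by positivity) s5, ← ofReal_add
      (by positivity) s3, ← ofReal_add (by positivity) s2, ← ofReal_add (by positivity)
      (by positivity), jetSq]
    congr 1
    simp only [← sum_mul]
    rw [sum_comm (f := fun a k => pd a (fun y => Z y k) x ^ 2)]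
    ring
  simp only [key]
  rw [lintegral_add_left, lintegral_add_left, lintegral_add_left, lintegral_add_left,
    lintegral_finsetSum, lintegral_finsetSum, lintegral_finsetSum]
  · congr 1
    congr 1
    refine sum_congr rfl fun a _ => ?_
    rw [lintegral_finsetSum]
    exact fun b _ => hm _ (by fun_prop)
  · exact fun a _ => hm _ (by fun_prop)
  · exact fun a _ => measurable_fun_sum _ fun b _ => hm _ (by fun_prop)
  · exact fun a _ => hm _ (by fun_prop)
  · exact hm _ (by fun_prop)
  · exact hm _ (by fun_prop)
  · exact (hm _ (by fun_prop)).add (measurable_fun_sum _ fun a _ => hm _ (by fun_prop))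
  · fun_prop

lemma lintegral_sum_sum_ofReal {F : Fin n → Fin n → Fn n} (hF : ∀ a b, ContinuousOn (F a b) Ω)
    (hΩ : MeasurableSet Ω) {w : Fn n} (hw : Continuous w) (hw0 : ∀ x, 0 ≤ w x) : ∑ a, ∑ b,
    ∫⁻ x in Ω, ‖F a b x‖ₑ ^ 2 * ofReal (w x) = ∫⁻ x in Ω, ofReal
      ((∑ a, ∑ b, F a b x ^ 2) * w x) := by
  have hm : ∀ a b, AEMeasurable (fun x => ofReal (F a b x ^ 2 * w x)) (𝔪 Ω) := fun a b =>
    ((((hF a b).pow 2).mul hw.continuousOn).aemeasurable hΩ).ennreal_ofReal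
  have key : ∀ x, ofReal ((∑ a, ∑ b, F a b x ^ 2) * w x) = ∑ a, ∑ b, ofReal (F a b x ^ 2 * w x) :=
      fun x => by
    have w0 := hw0 x
    have hab : ∀ a, ∑ b, ofReal (F a b x ^ 2 * w x) = ofReal (∑ b, F a b x ^ 2 * w x) := fun a =>
      (ofReal_sum_of_nonneg fun b _ => by positivity).symm
    simp only [hab]
    rw [← ofReal_sum_of_nonneg fun a _ => sum_nonneg fun b _ => by positivity]
    simp only [sum_mul]
  simp only [key, enorm_sq_mul_ofReal]
  rw [lintegral_finsetSum' _ fun a _ => Finset.aemeasurable_fun_sum _ fun b _ => hm a b]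
  exact sum_congr rfl fun a _ => (lintegral_finsetSum' _ fun b _ => hm a b).symm

/-- The squared norm of the symmetrized values of the operators. -/
def adjointNormSq (Ω : Set (E n)) (r ρ : Fn n) (s : ℝ) (P Q : Tensor2 n) : ℝ≥0∞ :=
  (∑ a, ∑ b, ∫⁻ x in Ω, ‖P x a b‖ₑ ^ 2 *
      ofReal (r x ^ (ℓ n (2 + s)) * ρ x)) +
    ∑ a, ∑ b, ∫⁻ x in Ω, ‖Q x a b‖ₑ ^ 2 *
      ofReal (r x ^ (ℓ n (1 + s)) * ρ x)

lemma adjointNormSq_eq (hr : ∀ x, 0 < r x) (hrc : Continuous r) (hρ : Continuous ρ)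
    (hρ0 : ∀ x, 0 ≤ ρ x) (s : ℝ) (hΩ : MeasurableSet Ω) {P Q : Tensor2 n}
    (hP : ∀ a b, ContinuousOn (fun x => P x a b) Ω)
    (hQ : ∀ a b, ContinuousOn (fun x => Q x a b) Ω) : adjointNormSq Ω r ρ s P Q = ∫⁻ x in Ω, ofReal
      ((r x ^ 4 * (∑ a, ∑ b, P x a b ^ 2) + r x ^ 2 * ∑ a, ∑ b, Q x a b ^ 2) *
        (r x ^ (ℓ n s) * ρ x)) := by
  have hwc : ∀ m : ℝ, Continuous fun x => r x ^ m * ρ x := fun m =>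
    (hrc.rpow_const fun x => Or.inl (hr x).ne').mul hρ
  have hw0 : ∀ (m : ℝ) x, 0 ≤ r x ^ m * ρ x := fun m x => mul_nonneg (rpow_nonneg (hr x).le _)
    (hρ0 x)
  rw [adjointNormSq, lintegral_sum_sum_ofReal hP hΩ (hwc _) (hw0 _), lintegral_sum_sum_ofReal hQ hΩ
    (hwc _) (hw0 _), ← lintegral_add_left']
  · refine lintegral_congr fun x => ?_
    have h1 := rpow_pow_mul (ρ := ρ) hr x s 1
    have h2 := rpow_pow_mul (ρ := ρ) hr x s 2
    simp only [Nat.cast_one, Nat.cast_ofNat] at h1 h2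
    have hp : ∀ M : Tensor2 n, 0 ≤ ∑ a, ∑ b, M x a b ^ 2 := fun M => sum_nonneg fun _ _ =>
      sum_nonneg fun _ _ => sq_nonneg _
    rw [← ofReal_add (mul_nonneg (hp P) (hw0 _ _)) (mul_nonneg (hp Q) (hw0 _ _)), h1, h2]
    congr 1; ring
  · exact (((continuousOn_finsetSum _ fun a _ => continuousOn_finsetSum _ fun b _ => (hP a b).pow
      2).mul (hwc _).continuousOn).aemeasurable hΩ).ennreal_ofReal

variable {g π : Tensor2 n} {c : ℝ} {M₁ M₂ : Fn n → VF n → Tensor2 n}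

lemma AdjointModel.symPart₁ (H : AdjointModel Ω r g π c M₁ M₂) (hu : Smooth u) (hZ : Smooth Z)
    (hx : x ∈ Ω) (a b : Fin n) :
    |symPart (M₁ u Z) x a b - (pd b (pd a u) x - 𝟙 a b * ∑ c, pd c (pd c u) x)| * r x ^ 2 ≤ c *
      fullJet r u Z x := by
  have h1 := H.bound₁ u Z hu hZ x hx a b
  have h2 := H.bound₁ u Z hu hZ x hx b a
  rw [pd_comm (hu.contDiffAt.of_le (WithTop.coe_le_coe.2 le_top)) a b, show 𝟙 b a = 𝟙 a b by
      simp [Matrix.one_apply, eq_comm]] at h2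
  rw [fullJet, symPart_apply]
  set t := pd b (pd a u) x - 𝟙 a b * ∑ c, pd c (pd c u) x
  have h3 : |1 / 2 * (M₁ u Z x a b + M₁ u Z x b a) - t| ≤ 1 / 2 *
      (|M₁ u Z x a b - t| + |M₁ u Z x b a - t|) := by
    rw [show 1 / 2 * (M₁ u Z x a b + M₁ u Z x b a) - t = 1 / 2 *
      ((M₁ u Z x a b - t) + (M₁ u Z x b a - t)) by ring, abs_mul, abs_of_pos (by norm_num)]
    gcongr
    exact abs_add_le _ _
  nlinarith [sq_nonneg (r x), mul_le_mul_of_nonneg_right h3 (sq_nonneg (r x))]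

lemma AdjointModel.symPart₂ (hr : ∀ x, 0 < r x) (H : AdjointModel Ω r g π c M₁ M₂) (hc : 0 ≤ c)
 (hu : Smooth u) (hZ : Smooth Z) (hx : x ∈ Ω) (a b : Fin n) :
    |symPart (M₂ u Z) x a b + 1 / 2 * (pd a (fun y => Z y b) x + pd b (fun y => Z y a) x)| * r x ≤ c
      * fullJet r u Z x := by
  have h1 := H.bound₂ u Z hu hZ x hx a b
  have h2 := H.bound₂ u Z hu hZ x hx b a
  have h0 := mul_le_mul_of_nonneg_left (jet_mono hr x u (Nat.zero_le 2)) hc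
  rw [fullJet, symPart_apply]
  set t := pd a (fun y => Z y b) x
  set t' := pd b (fun y => Z y a) x
  have h3 : |1 / 2 * (M₂ u Z x a b + M₂ u Z x b a) + 1 / 2 * (t + t')| ≤ 1 / 2 *
      (|M₂ u Z x a b + t| + |M₂ u Z x b a + t'|) := by grind
  nlinarith [mul_le_mul_of_nonneg_right h3 (hr x).le]

lemma sum_sum_le_of_le {F : Fin n → Fin n → ℝ} {B : ℝ} (h : ∀ a b, F a b ≤ B) : ∑ a, ∑ b, F a b ≤ n
    ^ 2 * B := by
  refine (sum_le_sum fun a _ => sum_le_sum fun b _ => h a b).trans (le_of_eq ?_)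
  simp; ring

lemma AdjointModel.density_le (hr : ∀ x, 0 < r x) (H : AdjointModel Ω r g π c M₁ M₂) (hc : 0 ≤ c)
    (hc1 : c ≤ 1) (hu : Smooth u) (hZ : Smooth Z) (hx : x ∈ Ω) : r x ^ 4 *
    (∑ a, ∑ b, symPart (M₁ u Z) x a b ^ 2) + r x ^ 2 * (∑ a, ∑ b, symPart (M₂ u Z) x a b ^ 2) ≤
      (n ^ 2 * ((n + 2) ^ 2 + 4)) * fullJet r u Z x ^ 2 := by
  set J := fullJet r u Z x with hJ
  have hJ0 : 0 ≤ J := fullJet_nonneg hr u Z x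
  have hcJ : c * J ≤ J := by nlinarith
  have r0 := hr x
  have hT : |∑ c, pd c (pd c u) x| * r x ^ 2 ≤ n * J := by
    refine (mul_le_mul_of_nonneg_right (abs_sum_le_sum_abs _ _) (sq_nonneg _)).trans ?_
    rw [sum_mul]
    refine (sum_le_sum fun c _ => abs_pd_pd_le_fullJet hr u Z x c c).trans (le_of_eq ?_)
    simp [hJ]
  have h1 : ∀ a b, r x ^ 4 * symPart (M₁ u Z) x a b ^ 2 ≤ ((n + 2) * J) ^ 2 := fun a b => by
    have e1 := H.symPart₁ hu hZ hx a b
    have e2 := abs_pd_pd_le_fullJet hr u Z x a b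
    have e3 : |𝟙 a b * ∑ c, pd c (pd c u) x| * r x ^ 2 ≤ n * J := by
      refine le_trans (mul_le_mul_of_nonneg_right ?_ (sq_nonneg _)) hT
      rw [abs_mul]
      rw [Matrix.one_apply]; split_ifs <;> simp
    set t := pd b (pd a u) x
    set t' := 𝟙 a b * ∑ c, pd c (pd c u) x
    set m := symPart (M₁ u Z) x a b
    have e4 : |m| ≤ |m - (t - t')| + |t| + |t'| := by
      have : m = (m - (t - t')) + t - t' := by ring
      calc |m| = |(m - (t - t')) + t - t'| := by rw [← this]
        _ ≤ |(m - (t - t')) + t| + |t'| := abs_sub _ _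
        _ ≤ _ := by gcongr; exact abs_add_le _ _
    have e5 : |m| * r x ^ 2 ≤ (n + 2) * J := by
      nlinarith [mul_le_mul_of_nonneg_right e4 (sq_nonneg (r x))]
    calc _ = (|m| * r x ^ 2) ^ 2 := by rw [mul_pow, sq_abs]; ring
      _ ≤ _ := pow_le_pow_left₀ (by positivity) e5 2
  have h2 : ∀ a b, r x ^ 2 * symPart (M₂ u Z) x a b ^ 2 ≤ (2 * J) ^ 2 := fun a b => by
    have e1 := H.symPart₂ hr hc hu hZ hx a b
    have e2 := abs_pd_le_fullJet hr u Z x a b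
    have e3 := abs_pd_le_fullJet hr u Z x b a
    set t := pd a (fun y => Z y b) x
    set t' := pd b (fun y => Z y a) x
    set m := symPart (M₂ u Z) x a b
    have e4 : |m| ≤ |m + 1 / 2 * (t + t')| + 1 / 2 * (|t| + |t'|) := by
      have : m = (m + 1 / 2 * (t + t')) - 1 / 2 * (t + t') := by ring
      calc |m| = |(m + 1 / 2 * (t + t')) - 1 / 2 * (t + t')| := by rw [← this]
        _ ≤ |m + 1 / 2 * (t + t')| + |1 / 2 * (t + t')| := abs_sub _ _
        _ ≤ _ := by grind
    have e5 : |m| * r x ≤ 2 * J := by nlinarith [mul_le_mul_of_nonneg_right e4 r0.le]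
    calc _ = (|m| * r x) ^ 2 := by rw [mul_pow, sq_abs]; ring
      _ ≤ _ := pow_le_pow_left₀ (by positivity) e5 2
  simp only [mul_sum]
  refine (add_le_add (sum_sum_le_of_le h1) (sum_sum_le_of_le h2)).trans (le_of_eq ?_)
  ring

lemma AdjointModel.flat_le (hn : 3 ≤ n) (hr : ∀ x, 0 < r x) (H : AdjointModel Ω r g π c M₁ M₂)
    (hc : 0 ≤ c) (hu : Smooth u) (hZ : Smooth Z) (hx : x ∈ Ω) : r x ^ 4 *
    (∑ a, ∑ b, pd b (pd a u) x ^ 2) + r x ^ 2 * (∑ a, ∑ b,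
      (pd a (fun y => Z y b) x + pd b (fun y => Z y a) x) ^ 2) ≤ 8 * n ^ 4 *
      (r x ^ 4 * (∑ a, ∑ b, symPart (M₁ u Z) x a b ^ 2) + r x ^ 2 *
        (∑ a, ∑ b, symPart (M₂ u Z) x a b ^ 2)) + (n ^ 2 * (2 * (n + 1) ^ 2 + 8)) *
      (c ^ 2 * fullJet r u Z x ^ 2) := by
  set J := fullJet r u Z x with hJ
  have hJ0 : 0 ≤ J := fullJet_nonneg hr u Z x
  have r0 := hr x
  have hn3 : (3 : ℝ) ≤ n := by exact_mod_cast hn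
  have hn1 : (1 : ℝ) ≤ n := by linarith
  set m := symPart (M₁ u Z) x with hm
  set m' := symPart (M₂ u Z) x with hm'
  set t := ∑ c, pd c (pd c u) x with ht
  set S := ∑ a, ∑ b, |m a b| with hS
  have hS0 : 0 ≤ S := sum_nonneg fun _ _ => sum_nonneg fun _ _ => abs_nonneg _
  have hsum : S ^ 2 ≤ n ^ 2 * ∑ a, ∑ b, m a b ^ 2 := by
    have e1 := sq_sum_le_card_mul_sum_sq (s := Finset.univ) (f := fun a => ∑ b, |m a b|)
    have e2 : ∀ a, (∑ b, |m a b|) ^ 2 ≤ n * ∑ b, m a b ^ 2 := fun a => by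
      have := sq_sum_le_card_mul_sum_sq (s := Finset.univ) (f := fun b => |m a b|)
      simpa using this
    simp only [Finset.card_univ, Fintype.card_fin] at e1
    refine e1.trans ((mul_le_mul_of_nonneg_left (sum_le_sum fun a _ => e2 a) n.cast_nonneg).trans
      (le_of_eq ?_))
    rw [← mul_sum]; ring
  have hle : ∀ a b, |m a b| ≤ S := fun a b =>
    (single_le_sum (f := fun b => |m a b|) (fun _ _ => abs_nonneg _) (Finset.mem_univ b)).trans
      (single_le_sum (f := fun a => ∑ b, |m a b|) (fun _ _ => sum_nonneg fun _ _ => abs_nonneg _)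
      (Finset.mem_univ a))
  have e1 := fun a b => H.symPart₁ hu hZ hx a b
  -- the trace
  have htr : |t| * r x ^ 2 ≤ S * r x ^ 2 + n * (c * J) := by
    have h1 : (1 - (n : ℝ)) * t = ∑ a, (pd a (pd a u) x - 𝟙 a a * t) := by
      simp only [Matrix.one_apply_eq, one_mul, sum_sub_distrib, ← ht, Finset.sum_const,
        Finset.card_univ, Fintype.card_fin, nsmul_eq_mul]
      ring
    have h2 : |(1 - (n : ℝ)) * t| * r x ^ 2 ≤ S * r x ^ 2 + n * (c * J) := by
      have h3 : ∀ a, |pd a (pd a u) x - 𝟙 a a * t| * r x ^ 2 ≤ (∑ b, |m a b|) * r x ^ 2 + c * J :=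
          fun a => by
        have h4 := e1 a a
        have h5 := single_le_sum (f := fun b => |m a b|) (fun _ _ => abs_nonneg _)
          (Finset.mem_univ a)
        set y := pd a (pd a u) x - 𝟙 a a * t
        have h6 : |y| ≤ |m a a - y| + |m a a| := by
          have := abs_sub (m a a) (m a a - y)
          rw [sub_sub_cancel] at this; linarith
        nlinarith [mul_le_mul_of_nonneg_right (h6.trans (add_le_add le_rfl h5)) (sq_nonneg (r x))]
      rw [h1]
      refine (mul_le_mul_of_nonneg_right (abs_sum_le_sum_abs _ _) (sq_nonneg _)).trans ?_
      rw [sum_mul]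
      refine (sum_le_sum fun a _ => h3 a).trans (le_of_eq ?_)
      rw [sum_add_distrib, ← sum_mul]; simp [hS]
    refine le_trans (mul_le_mul_of_nonneg_right ?_ (sq_nonneg _)) h2
    rw [abs_mul, abs_of_nonpos (by linarith : 1 - (n : ℝ) ≤ 0)]
    nlinarith [abs_nonneg t]
  have h1 : ∀ a b, r x ^ 4 * pd b (pd a u) x ^ 2 ≤ 8 * (S * r x ^ 2) ^ 2 + 2 * ((n + 1) * (c * J)) ^
      2 := fun a b => by
    have h2 := e1 a b
    have h3 : |𝟙 a b * t| ≤ |t| := by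
      rw [abs_mul]
      refine mul_le_of_le_one_left (abs_nonneg _) ?_
      rw [Matrix.one_apply]; split_ifs <;> simp
    have h4 := hle a b
    set y := pd b (pd a u) x
    set d := 𝟙 a b * t
    have h5 : |y| ≤ |m a b - (y - d)| + |m a b| + |d| := by
      have : y = m a b - (m a b - (y - d)) + d := by ring
      calc |y| = |m a b - (m a b - (y - d)) + d| := by rw [← this]
        _ ≤ |m a b - (m a b - (y - d))| + |d| := abs_add_le _ _
        _ ≤ _ := by linarith [abs_sub (m a b) (m a b - (y - d))]
    have h6 : |y| * r x ^ 2 ≤ 2 * (S * r x ^ 2) + (n + 1) * (c * J) := by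
      nlinarith [mul_le_mul_of_nonneg_right (h5.trans (add_le_add (add_le_add le_rfl h4) h3))
        (sq_nonneg (r x))]
    calc _ = (|y| * r x ^ 2) ^ 2 := by rw [mul_pow, sq_abs]; ring
      _ ≤ (2 * (S * r x ^ 2) + (n + 1) * (c * J)) ^ 2 := pow_le_pow_left₀ (by positivity) h6 2
      _ ≤ _ := by nlinarith [sq_nonneg (2 * (S * r x ^ 2) - (n + 1) * (c * J))]
  have h2 : ∀ a b, r x ^ 2 * (pd a (fun y => Z y b) x + pd b (fun y => Z y a) x) ^ 2 ≤ 8 *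
      (r x ^ 2 * m' a b ^ 2) + 8 * (c * J) ^ 2 := fun a b => by
    have h2 := H.symPart₂ hr hc hu hZ hx a b
    set y := pd a (fun y => Z y b) x + pd b (fun y => Z y a) x
    have h3 : |y| ≤ 2 * |m' a b + 1 / 2 * y| + 2 * |m' a b| := by grind
    have h4 : |y| * r x ≤ 2 * (|m' a b| * r x) + 2 * (c * J) := by
      nlinarith [mul_le_mul_of_nonneg_right h3 r0.le]
    calc _ = (|y| * r x) ^ 2 := by rw [mul_pow, sq_abs]; ring
      _ ≤ (2 * (|m' a b| * r x) + 2 * (c * J)) ^ 2 := pow_le_pow_left₀ (by positivity) h4 2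
      _ ≤ 8 * (|m' a b| * r x) ^ 2 + 8 * (c * J) ^ 2 := by
          nlinarith [sq_nonneg (2 * (|m' a b| * r x) - 2 * (c * J))]
      _ = _ := by rw [mul_pow, sq_abs]; ring
  have k1 := sum_sum_le_of_le h1
  have k2 := sum_le_sum fun a (_ : a ∈ Finset.univ) => sum_le_sum fun b (_ : b ∈ Finset.univ) => h2
    a b
  simp only [sum_add_distrib, ← mul_sum, Finset.sum_const, Finset.card_univ,
    Fintype.card_fin, nsmul_eq_mul] at k1 k2
  have k3 := mul_le_mul_of_nonneg_left hsum (show 0 ≤ (n : ℝ) ^ 2 * (8 * r x ^ 4) by positivity)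
  have k4 : 0 ≤ r x ^ 2 * ∑ a, ∑ b, m' a b ^ 2 := mul_nonneg (sq_nonneg _)
    (sum_nonneg fun _ _ => sum_nonneg fun _ _ => sq_nonneg _)
  have k5 : (1 : ℝ) ≤ n ^ 4 := one_le_pow₀ hn1
  have k6 := mul_le_mul_of_nonneg_right k5 k4
  have k7 : (S * r x ^ 2) ^ 2 = S ^ 2 * r x ^ 4 := by ring
  rw [k7] at k1
  linarith

lemma pd_eventuallyEq_zero (h : u =ᶠ[𝓝 x] 0) (a : Fin n) : pd a u =ᶠ[𝓝 x] 0 := by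
  filter_upwards [h.fderiv (𝕜 := ℝ)] with y hy
  rw [pd, hy]; simp

lemma jetSq_eq_zero (hu : u =ᶠ[𝓝 x] 0) (hZ : Z =ᶠ[𝓝 x] 0) : jetSq r u Z x = 0 := by
  have h1 : ∀ k, (fun y => Z y k) =ᶠ[𝓝 x] 0 := fun k => hZ.mono fun y hy => by simp [hy]
  have e1 : ∀ k, Z x k = 0 := fun k => (h1 k).eq_of_nhds
  have e2 : ∀ a k, pd a (fun y => Z y k) x = 0 := fun a k =>
    (pd_eventuallyEq_zero (h1 k) a).eq_of_nhds
  have e3 : ∀ a, pd a u x = 0 := fun a => (pd_eventuallyEq_zero hu a).eq_of_nhds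
  have e4 : ∀ a b, pd b (pd a u) x = 0 := fun a b =>
    (pd_eventuallyEq_zero (pd_eventuallyEq_zero hu a) b).eq_of_nhds
  simp [jetSq, hu.eq_of_nhds, e1, e2, e3, e4]

lemma continuous_jetSq (hrc : Continuous r) (hu : Smooth u) (hZ : Smooth Z) : Continuous
    (jetSq r u Z) := by
  have hcz : ∀ k, Smooth fun y => Z y k := by fun_prop
  have c1 : ∀ a, Continuous fun x => pd a u x := fun a => (contDiff_pd hu a).continuous
  have c2 : ∀ a b, Continuous fun x => pd b (pd a u) x := fun a b =>
    (contDiff_pd (contDiff_pd hu a) b).continuous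
  have c3 : ∀ a k, Continuous fun x => pd a (fun y => Z y k) x := fun a k =>
    (contDiff_pd (hcz k) a).continuous
  unfold jetSq
  fun_prop

lemma normSq_add_normSq_lt_top (hr : ∀ x, 0 < r x) (hrc : Continuous r) (hρ : Continuous ρ)
    (hρ0 : ∀ x, 0 ≤ ρ x) (s : ℝ) (hu : Smooth u) (huc : HasCompactSupport u) (hZ : Smooth Z)
    (hZc : HasCompactSupport Z) : normSq Ω r ρ 2 s u + normSq Ω r ρ 1 s Z < ⊤ := by
  rw [normSq_add_normSq hr hrc hρ hρ0 s hu hZ]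
  have hwc : Continuous fun x => r x ^ (ℓ n s) * ρ x :=
    (hrc.rpow_const fun x => Or.inl (hr x).ne').mul hρ
  have hjs : HasCompactSupport fun x => jetSq r u Z x * (r x ^ (ℓ n s) * ρ x) := by
    refine HasCompactSupport.intro (huc.isCompact.union hZc.isCompact) fun x hx => ?_
    rw [mem_union, not_or, notMem_tsupport_iff_eventuallyEq,
      notMem_tsupport_iff_eventuallyEq] at hx
    rw [jetSq_eq_zero hx.1 hx.2, zero_mul]
  have hi : Integrable (fun x => jetSq r u Z x * (r x ^ (ℓ n s) * ρ x)) volume :=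
    ((continuous_jetSq hrc hu hZ).mul hwc).integrable_of_hasCompactSupport hjs
  exact (hi.integrableOn (s := Ω)).lintegral_lt_top

lemma exists_coercive (hn : 3 ≤ n) (s : ℝ) (K : NNReal) : ∃ c₀ : ℝ, 0 < c₀ ∧ ∃ K' : NNReal,
    ∀ (Ω : Set (E n)) (r ρ : Fn n) (g π : Tensor2 n) (c : ℝ) (M₁ M₂ : Fn n → VF n → Tensor2 n),
      IsOpen Ω → (∀ x, 0 < r x) → Continuous r → Continuous ρ → (∀ x, 0 ≤ ρ x) → FlatBound Ω r ρ s K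
      → AdjointModel Ω r g π c M₁ M₂ → 0 ≤ c → c ≤ c₀ → ∀ (u : Fn n) (Z : VF n), Smooth u →
      HasCompactSupport u → Smooth Z → HasCompactSupport Z → normSq Ω r ρ 2 s u + normSq Ω r ρ 1 s Z
        ≤ K' * adjointNormSq Ω r ρ s (symPart (M₁ u Z)) (symPart (M₂ u Z)) ∧ adjointNormSq Ω r ρ s
          (symPart (M₁ u Z)) (symPart (M₂ u Z)) ≤ K' *
            (normSq Ω r ρ 2 s u + normSq Ω r ρ 1 s Z) := by
  set b : ℝ := (n ^ 2 * (2 * (n + 1) ^ 2 + 8)) * (8 * n ^ 2) with hb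
  have hb0 : 0 ≤ b := by positivity
  set a : ℝ := 8 * (n : ℝ) ^ 4 with ha
  have ha0 : 0 ≤ a := by positivity
  set d : ℝ := (n ^ 2 * ((n + 2) ^ 2 + 4)) * (8 * n ^ 2) with hd
  have hd0 : 0 ≤ d := by positivity
  set c₀ : ℝ := (1 + 2 * (K * b))⁻¹ with hc₀
  have hKb : 0 ≤ K * b := mul_nonneg K.coe_nonneg hb0
  have hc₀p : 0 < c₀ := inv_pos.2 (by positivity)
  have hc₀1 : c₀ ≤ 1 := inv_le_one_of_one_le₀ (by linarith)
  refine ⟨c₀, hc₀p, 2 * K * a.toNNReal + d.toNNReal, ?_⟩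
  intro Ω r ρ g π c M₁ M₂ hΩ hr hrc hρ hρ0 hF H hc hcc u Z hu huc hZ hZc
  have hn0 : 0 < n := by omega
  have hwc : Continuous fun x => r x ^ (ℓ n s) * ρ x :=
    (hrc.rpow_const fun x => Or.inl (hr x).ne').mul hρ
  have hw0 : ∀ x, 0 ≤ r x ^ (ℓ n s) * ρ x := fun x => mul_nonneg (rpow_nonneg (hr x).le _) (hρ0 x)
  have hsym : ∀ (M : Tensor2 n), (∀ a b, ContinuousOn (fun x => M x a b) Ω) → ∀ a b, ContinuousOn
      (fun x => symPart M x a b) Ω := fun M hM a b => continuousOn_const.mul ((hM a b).add (hM b a))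
  have eY := adjointNormSq_eq hr hrc hρ hρ0 s hΩ.measurableSet (hsym _ (H.continuousOn₁ u Z hu hZ))
    (hsym _ (H.continuousOn₂ u Z hu hZ))
  have hcz : ∀ k, Smooth fun y => Z y k := contDiff_component hZ
  have eF := adjointNormSq_eq (Ω := Ω) (P := fun x => Matrix.of fun a b => pd b (pd a u) x)
    (Q := fun x => Matrix.of fun a b => pd a (fun y => Z y b) x + pd b (fun y => Z y a) x) hr hrc hρ
    hρ0 s hΩ.measurableSet (fun a b => (contDiff_pd (contDiff_pd hu a) b).continuous.continuousOn)
    (fun a b => ((contDiff_pd (hcz b) a).continuous.add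
      (contDiff_pd (hcz a) b).continuous).continuousOn)
  have hX := hF u Z hu huc hZ hZc
  have eX := normSq_add_normSq (Ω := Ω) hr hrc hρ hρ0 s hu hZ
  set X := normSq Ω r ρ 2 s u + normSq Ω r ρ 1 s Z with hXdef
  set Y := adjointNormSq Ω r ρ s (symPart (M₁ u Z)) (symPart (M₂ u Z)) with hYdef
  have hJc := continuous_jetSq hrc hu hZ
  have hJ0 : ∀ x, 0 ≤ jetSq r u Z x := fun x => by
    have h1 := fullJet_sq_le (r := r) hn0 u Z x
    have h2 : (0 : ℝ) < 8 * n ^ 2 := by positivity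
    by_contra h
    nlinarith [sq_nonneg (fullJet r u Z x), mul_pos h2 (neg_pos.2 (not_le.1 h))]
  have hYX : Y ≤ d.toNNReal * X := by
    rw [eY, eX, ← lintegral_const_mul' _ _ (by simp)]
    refine setLIntegral_mono' (μ := volume) hΩ.measurableSet fun x hx => ?_
    change _ ≤ ofReal d * _
    rw [← ofReal_mul hd0, ← mul_assoc d]
    refine ofReal_le_ofReal (mul_le_mul_of_nonneg_right ?_ (hw0 x))
    refine (H.density_le hr hc (hcc.trans hc₀1) hu hZ hx).trans ?_
    rw [hd, mul_assoc _ (8 * (n : ℝ) ^ 2)]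
    exact mul_le_mul_of_nonneg_left (fullJet_sq_le hn0 u Z x) (by positivity)
  have hsmall : c ^ 2 * b ≤ c₀ * b := mul_le_mul_of_nonneg_right (by nlinarith) hb0
  have hFY : adjointNormSq Ω r ρ s (fun x => Matrix.of fun a b => pd b (pd a u) x)
      (fun x => Matrix.of fun a b => pd a (fun y => Z y b) x + pd b (fun y => Z y a) x) ≤ a.toNNReal
      * Y + ofReal (c₀ * b) * X := by
    have hmeas : Measurable fun x => ofReal (c₀ * b) * ofReal
        (jetSq r u Z x * (r x ^ (ℓ n s) * ρ x)) := (hJc.mul hwc).measurable.ennreal_ofReal.const_mul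
      _
    rw [eF, eY, eX, ← lintegral_const_mul' _ _ (by simp), ← lintegral_const_mul' _ _ (by simp), ←
      lintegral_add_right _ hmeas]
    refine setLIntegral_mono' (μ := volume) hΩ.measurableSet fun x hx => ?_
    change _ ≤ ofReal a * _ + _
    have h1 := H.flat_le hn hr hc hu hZ hx
    have p1 : 0 ≤ r x ^ 4 * (∑ a, ∑ b, symPart (M₁ u Z) x a b ^ 2) + r x ^ 2 *
        (∑ a, ∑ b, symPart (M₂ u Z) x a b ^ 2) := by positivity
    rw [← ofReal_mul ha0, ← ofReal_mul (by positivity), ← ofReal_add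
      (mul_nonneg ha0 (mul_nonneg p1 (hw0 x)))
        (mul_nonneg (by positivity) (mul_nonneg (hJ0 x) (hw0 x)))]
    refine ofReal_le_ofReal ?_
    rw [← mul_assoc a, ← mul_assoc (c₀ * b), ← add_mul]
    refine mul_le_mul_of_nonneg_right (h1.trans (add_le_add le_rfl ?_)) (hw0 x)
    refine le_trans ?_ (mul_le_mul_of_nonneg_right hsmall (hJ0 x))
    have h2 := mul_le_mul_of_nonneg_left (fullJet_sq_le (r := r) hn0 u Z x)
      (show 0 ≤ (n ^ 2 * (2 * ((n : ℝ) + 1) ^ 2 + 8)) * c ^ 2 by positivity)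
    rw [hb]
    linarith
  have hXtop : X ≠ ⊤ := (normSq_add_normSq_lt_top hr hrc hρ hρ0 s hu huc hZ hZc).ne
  refine ⟨?_, hYX.trans (mul_le_mul_left (by push_cast; exact le_add_self) _)⟩
  have h1 : X ≤ K * a.toNNReal * Y + ofReal (1 / 2) * X := by
    refine (hX.trans (mul_le_mul_right hFY _)).trans ?_
    rw [mul_add, ← mul_assoc, ← mul_assoc]
    refine add_le_add le_rfl (mul_le_mul_left ?_ _)
    rw [← ofReal_coe_nnreal, ← ofReal_mul K.coe_nonneg]
    refine ofReal_le_ofReal ?_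
    rw [hc₀, show (K : ℝ) * ((1 + 2 * (K * b))⁻¹ * b) = (K * b) / (1 + 2 * (K * b)) by
      field_simp, div_le_iff₀ (by positivity)]
    linarith
  have h2 : X ≤ 2 * (K * a.toNNReal * Y) := by
    have h3 : ofReal (1 / 2) * X = X / 2 := by
      rw [ENNReal.ofReal_div_of_pos (by norm_num), ofReal_one, ENNReal.ofReal_ofNat, mul_comm, ←
        div_eq_mul_one_div]
    rw [h3] at h1
    have h4 : X / 2 + X / 2 ≤ K * a.toNNReal * Y + X / 2 := by rwa [ENNReal.add_halves]
    have h5 := (ENNReal.add_le_add_iff_right (ENNReal.div_ne_top hXtop (by norm_num))).1 h4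
    rw [ENNReal.div_le_iff (by norm_num) (by norm_num)] at h5
    rwa [mul_comm]
  refine h2.trans ?_
  push_cast
  rw [add_mul, ← mul_assoc, ← mul_assoc]
  exact le_self_add

end Coercivity

/-! ### The Hilbert space of weighted square integrable fields -/

lemma exists_forall_eq_of_coercive {H : Type*} [NormedAddCommGroup H] [InnerProductSpace ℝ H]
    [CompleteSpace H] (S : Submodule ℝ H) (hS : IsClosed (S : Set H)) (B : H →L[ℝ] H →L[ℝ] ℝ)
    {c : ℝ} (hc : 0 < c) (hB : ∀ ξ ∈ S, c * ‖ξ‖ ^ 2 ≤ B ξ ξ) (Λ : H →L[ℝ] ℝ) :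
    ∃ ξ ∈ S, ∀ η ∈ S, B ξ η = Λ η := by
  have : CompleteSpace S := hS.completeSpace_coe
  set B' : S →L[ℝ] S →L[ℝ] ℝ := B.bilinearComp S.subtypeL S.subtypeL with hB'
  have hco : IsCoercive B' := ⟨c, hc, fun u => by
    have := hB u u.2
    rw [sq, ← mul_assoc] at this
    exact this⟩
  set v : S := hco.continuousLinearEquivOfBilin.symm
    ((InnerProductSpace.toDual ℝ S).symm (Λ.comp S.subtypeL)) with hv
  refine ⟨v, v.2, fun η hη => ?_⟩
  have h1 := hco.continuousLinearEquivOfBilin_apply v ⟨η, hη⟩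
  rw [hv, ContinuousLinearEquiv.apply_symm_apply, InnerProductSpace.toDual_symm_apply] at h1
  exact h1.symm

section Weighted
variable {n : ℕ} {Ω : Set (E n)} {ι : Type*} [Fintype ι]

/-- Families of square integrable functions on `Ω`. -/
abbrev FieldSpace {n : ℕ} (Ω : Set (E n)) (ι : Type*) [Fintype ι] : Type _ :=
  PiLp 2 fun _ : ι => Lp ℝ 2 (𝔪 Ω)

/-- The members of a family, with the weights taken out. -/
def value (w : ι → Fn n) (ξ : FieldSpace Ω ι) (j : ι) (x : E n) : ℝ :=
  ξ j x / Real.sqrt (w j x)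

/-- Continuous weights that are positive on `Ω`. -/
structure IsWeight (Ω : Set (E n)) (w : ι → Fn n) : Prop where
  continuous : ∀ j, Continuous (w j)
  pos : ∀ j, ∀ x ∈ Ω, 0 < w j x

variable {w : ι → Fn n}

lemma value_add (ξ η : FieldSpace Ω ι) (j : ι) : value w (ξ + η) j =ᵐ[𝔪 Ω] fun x => value w ξ j x +
    value w η j x := by
  filter_upwards [Lp.coeFn_add (ξ j) (η j)] with x hx
  rw [value, PiLp.add_apply, hx, Pi.add_apply, add_div]; rfl

lemma value_sub (ξ η : FieldSpace Ω ι) (j : ι) : value w (ξ - η) j =ᵐ[𝔪 Ω] fun x => value w ξ j x -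
    value w η j x := by
  filter_upwards [Lp.coeFn_sub (ξ j) (η j)] with x hx
  rw [value, PiLp.sub_apply, hx, Pi.sub_apply, sub_div]; rfl

lemma value_smul (c : ℝ) (ξ : FieldSpace Ω ι) (j : ι) : value w (c • ξ) j =ᵐ[𝔪 Ω] fun x => c * value
    w ξ j x := by
  filter_upwards [Lp.coeFn_smul c (ξ j)] with x hx
  rw [value, PiLp.smul_apply, hx, Pi.smul_apply, smul_eq_mul, mul_div_assoc]; rfl

lemma value_zero (j : ι) : value w (0 : FieldSpace Ω ι) j =ᵐ[𝔪 Ω] fun _ => 0 := by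
  filter_upwards [Lp.coeFn_zero ℝ 2 (𝔪 Ω)] with x hx
  rw [value, PiLp.zero_apply, hx, Pi.zero_apply, zero_div]

lemma enorm_sq_eq_lintegral (f : Lp ℝ 2 (𝔪 Ω)) : ‖f‖ₑ ^ 2 = ∫⁻ x in Ω, ‖f x‖ₑ ^ 2 := by
  have := eLpNorm_nnreal_pow_eq_lintegral (p := 2) (f := f) (μ := 𝔪 Ω) (by norm_num)
  rw [Lp.enorm_def]
  simpa using this

lemma lintegral_value_sq (hΩ : MeasurableSet Ω) (hw : IsWeight Ω w) (ξ : FieldSpace Ω ι) (j : ι) :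
    ∫⁻ x in Ω, ‖value w ξ j x‖ₑ ^ 2 * ofReal (w j x) = ‖ξ j‖ₑ ^ 2 := by
  rw [enorm_sq_eq_lintegral]
  refine setLIntegral_congr_fun hΩ fun x hx => ?_
  have h := hw.pos j x hx
  dsimp only
  rw [enorm_sq_mul_ofReal, enorm_sq_eq_ofReal, norm_eq_abs, sq_abs, value, div_pow, sq_sqrt h.le,
    div_mul_cancel₀ _ h.ne']

lemma enorm_sq_eq_sum (ξ : FieldSpace Ω ι) : ‖ξ‖ₑ ^ 2 = ∑ j, ‖ξ j‖ₑ ^ 2 := by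
  simp only [enorm_sq_eq_ofReal]
  rw [← ofReal_sum_of_nonneg fun j _ => sq_nonneg _, PiLp.norm_sq_eq_of_L2]

lemma exists_value_eq (hΩ : MeasurableSet Ω) (hw : IsWeight Ω w) (v : ι → Fn n)
    (hm : ∀ j, AEStronglyMeasurable (v j) (𝔪 Ω))
    (hv : ∀ j, ∫⁻ x in Ω, ‖v j x‖ₑ ^ 2 * ofReal (w j x) < ⊤) : ∃ ξ : FieldSpace Ω ι, ∀ j, value w ξ
    j =ᵐ[𝔪 Ω] v j := by
  have hL : ∀ j, MemLp (fun x => v j x * Real.sqrt (w j x)) 2 (𝔪 Ω) := fun j => by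
    refine ⟨(hm j).mul (hw.continuous j).sqrt.aestronglyMeasurable, ?_⟩
    have := eLpNorm_nnreal_pow_eq_lintegral (p := 2) (f := fun x => v j x * Real.sqrt (w j x))
      (μ := 𝔪 Ω) (by norm_num)
    have h2 : ∫⁻ x in Ω, ‖v j x * Real.sqrt (w j x)‖ₑ ^ 2 = ∫⁻ x in Ω, ‖v j x‖ₑ ^ 2 * ofReal
        (w j x) := by
      refine setLIntegral_congr_fun hΩ fun x hx => ?_
      have h := hw.pos j x hx
      rw [enorm_sq_mul_ofReal, enorm_sq_eq_ofReal, norm_eq_abs, sq_abs, mul_pow, sq_sqrt h.le]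
    have h3 : eLpNorm (fun x => v j x * Real.sqrt (w j x)) 2 (𝔪 Ω) ^ 2 < ⊤ := by
      have h4 := h2.trans_lt (hv j)
      simp only [ENNReal.coe_ofNat, NNReal.coe_ofNat, ENNReal.rpow_ofNat] at this
      rwa [← this] at h4
    exact (ENNReal.pow_lt_top_iff.1 h3).resolve_right (by norm_num)
  refine ⟨WithLp.toLp 2 fun j => (hL j).toLp, fun j => ?_⟩
  filter_upwards [(hL j).coeFn_toLp, ae_restrict_mem hΩ] with x hx hxΩ
  have := (sqrt_pos.2 (hw.pos j x hxΩ)).ne'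
  change (hL j).toLp _ x / _ = _
  rw [hx, mul_div_cancel_right₀ _ this]

lemma locallyIntegrableOn_value (hΩ : IsOpen Ω) (hw : IsWeight Ω w) (ξ : FieldSpace Ω ι) (j : ι) :
    LocallyIntegrableOn (value w ξ j) Ω := by
  have h1 : LocallyIntegrableOn (ξ j : Fn n) Ω := locallyIntegrableOn_of_locallyIntegrable_restrict
      ((Lp.memLp (ξ j)).locallyIntegrable (by norm_num))
  have h2 : ContinuousOn (fun x => (Real.sqrt (w j x))⁻¹) Ω :=
    (hw.continuous j).sqrt.continuousOn.inv₀ fun x hx => (sqrt_pos.2 (hw.pos j x hx)).ne'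
  exact h1.mul_continuousOn h2 hΩ.isLocallyClosed

lemma aestronglyMeasurable_value (hw : IsWeight Ω w) (ξ : FieldSpace Ω ι) (j : ι) :
    AEStronglyMeasurable (value w ξ j) (𝔪 Ω) := (Lp.aestronglyMeasurable (ξ j)).div₀
  (hw.continuous j).sqrt.aestronglyMeasurable

lemma exists_pairing (hΩ : MeasurableSet Ω) (hw : IsWeight Ω w) (j : ι) {F : Fn n}
    (hF : AEStronglyMeasurable F (𝔪 Ω)) (hF2 : ∫⁻ x in Ω, ‖F x‖ₑ ^ 2 * ofReal (w j x)⁻¹ < ⊤) :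
    ∃ Λ : FieldSpace Ω ι →L[ℝ] ℝ, ∀ ξ, IntegrableOn (fun x => F x * value w ξ j x) Ω ∧ Λ ξ =
      ∫ x in Ω, F x * value w ξ j x := by
  have hL : MemLp (fun x => F x / Real.sqrt (w j x)) 2 (𝔪 Ω) := by
    refine ⟨hF.div₀ (hw.continuous j).sqrt.aestronglyMeasurable, ?_⟩
    have := eLpNorm_nnreal_pow_eq_lintegral (p := 2) (f := fun x => F x / Real.sqrt (w j x))
      (μ := 𝔪 Ω) (by norm_num)
    have h2 : ∫⁻ x in Ω, ‖F x / Real.sqrt (w j x)‖ₑ ^ 2 = ∫⁻ x in Ω, ‖F x‖ₑ ^ 2 * ofReal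
        (w j x)⁻¹ := by
      refine setLIntegral_congr_fun hΩ fun x hx => ?_
      have h := hw.pos j x hx
      rw [enorm_sq_mul_ofReal, enorm_sq_eq_ofReal, norm_eq_abs, sq_abs, div_pow, sq_sqrt h.le,
        div_eq_mul_inv]
    have h3 : eLpNorm (fun x => F x / Real.sqrt (w j x)) 2 (𝔪 Ω) ^ 2 < ⊤ := by
      have h4 := h2.trans_lt hF2
      simp only [ENNReal.coe_ofNat, NNReal.coe_ofNat, ENNReal.rpow_ofNat] at this
      rwa [← this] at h4
    exact (ENNReal.pow_lt_top_iff.1 h3).resolve_right (by norm_num)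
  have he : ∀ ξ : FieldSpace Ω ι, (fun x => inner ℝ (hL.toLp _ x) (ξ j x)) =ᵐ[𝔪 Ω] fun x => F x *
      value w ξ j x := fun ξ => by
    filter_upwards [hL.coeFn_toLp] with x hx
    rw [hx, value]
    simp only [RCLike.inner_apply, conj_trivial]
    ring
  refine ⟨(innerSL ℝ hL.toLp).comp (PiLp.proj 2 (fun _ : ι => Lp ℝ 2 (𝔪 Ω)) j), fun ξ =>
    ⟨(L2.integrable_inner hL.toLp (ξ j)).congr (he ξ), ?_⟩⟩
  rw [← integral_congr_ae (he ξ), ← L2.inner_def]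
  rfl

lemma exists_bilin (hΩ : MeasurableSet Ω) (hw : IsWeight Ω w) (i j : ι) (hij : w i = w j)
    {κ : Fn n} (hκ : AEStronglyMeasurable κ (𝔪 Ω)) {C : ℝ}
    (hC : ∀ x ∈ Ω, |κ x| ≤ C) :
    ∃ B : FieldSpace Ω ι →L[ℝ] FieldSpace Ω ι →L[ℝ] ℝ, ∀ ξ η, IntegrableOn
      (fun x => κ x * (w i x * (value w ξ i x * value w η j x))) Ω ∧ B ξ η = ∫ x in Ω, κ x *
      (w i x * (value w ξ i x * value w η j x)) := by
  have hL : MemLp κ ⊤ (𝔪 Ω) := memLp_top_of_bound hκ C ((ae_restrict_mem hΩ).mono hC)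
  set M : Lp ℝ 2 (𝔪 Ω) →L[ℝ] Lp ℝ 2 (𝔪 Ω) := (ContinuousLinearMap.mul ℝ ℝ).holderL (𝔪 Ω) ⊤ 2 2
    hL.toLp with hM
  have hMv : ∀ f, M f =ᵐ[𝔪 Ω] fun x => κ x * f x := fun f => by
    have h1 := (ContinuousLinearMap.mul ℝ ℝ).coeFn_holder (r := 2) hL.toLp f
    filter_upwards [h1, hL.coeFn_toLp] with x hx hx'
    rw [hM, ContinuousLinearMap.holderL_apply_apply, hx, hx']
    rfl
  have he : ∀ ξ η : FieldSpace Ω ι, (fun x => inner ℝ (M (ξ i) x) (η j x)) =ᵐ[𝔪 Ω] fun x => κ x *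
      (w i x * (value w ξ i x * value w η j x)) := fun ξ η => by
    filter_upwards [hMv (ξ i), ae_restrict_mem hΩ] with x hx hxΩ
    have h := hw.pos i x hxΩ
    rw [hx, value, value, ← hij]
    simp only [RCLike.inner_apply, conj_trivial]
    have h2 := Real.mul_self_sqrt h.le
    have h3 := (sqrt_pos.2 h).ne'
    rw [div_mul_div_comm, h2]
    field_simp
  refine ⟨(innerSL ℝ).bilinearComp (M.comp (PiLp.proj 2 (fun _ : ι => Lp ℝ 2 (𝔪 Ω)) i))
    (PiLp.proj 2 (fun _ : ι => Lp ℝ 2 (𝔪 Ω)) j), fun ξ η =>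
    ⟨(L2.integrable_inner (M (ξ i)) (η j)).congr (he ξ η), ?_⟩⟩
  rw [← integral_congr_ae (he ξ η), ← L2.inner_def]
  rfl

end Weighted

section FlatAdjoint
variable {n : ℕ} {Ω : Set (E n)} {g π : Tensor2 n} {Z : VF n} {u : Fn n} {x : E n}

/-- The adjoint relation tested against `(h, τ)`, in terms of coordinate densities. -/
def AdjointAt (Ω : Set (E n)) (g π : Tensor2 n) (u : Fn n) (Z : VF n) (P Q h τ : Tensor2 n) :
    Prop :=
  ∫ x in Ω, (linHamiltonian g π h τ x * u x + innerVec (g x) (linDiv g π h τ x) (Z x)) *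
      volDensity g x = ∫ x in Ω, ((∑ a, ∑ b, h x a b * P x a b) + ∑ a, ∑ b, τ x a b * Q x a b)

/-- The formal adjoint, represented by coordinate densities. -/
def IsDensityAdjoint (Ω : Set (E n)) (g π : Tensor2 n) (u : Fn n) (Z : VF n)
    (P Q : Tensor2 n) : Prop :=
  ∀ h τ, IsTestTensor Ω h → IsTestTensor Ω τ → AdjointAt Ω g π u Z P Q h τ

lemma AdjointAt.congr {u u' : Fn n} {Z Z' : VF n} {P Q P' Q' h τ : Tensor2 n}
    (H : AdjointAt Ω g π u Z P Q h τ) (hu : u =ᵐ[𝔪 Ω] u') (hZ : Z =ᵐ[𝔪 Ω] Z') (hP : P =ᵐ[𝔪 Ω] P')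
    (hQ : Q =ᵐ[𝔪 Ω] Q') : AdjointAt Ω g π u' Z' P' Q' h τ := by
  rw [AdjointAt] at H ⊢
  have e1 : ∫ x in Ω, (linHamiltonian g π h τ x * u x + innerVec (g x) (linDiv g π h τ x) (Z x)) *
      volDensity g x = ∫ x in Ω, (linHamiltonian g π h τ x * u' x + innerVec (g x)
      (linDiv g π h τ x) (Z' x)) * volDensity g x := by
    refine integral_congr_ae ?_
    filter_upwards [hu, hZ] with x h1 h2
    rw [h1, h2]
  have e2 : ∫ x in Ω, ((∑ a, ∑ b, h x a b * P x a b) + ∑ a, ∑ b, τ x a b * Q x a b) = ∫ x in Ω,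
      ((∑ a, ∑ b, h x a b * P' x a b) + ∑ a, ∑ b, τ x a b * Q' x a b) := by
    refine integral_congr_ae ?_
    filter_upwards [hP, hQ] with x h1 h2
    rw [h1, h2]
  linarith

/-! ### Uniqueness -/

/-- The symmetric tensor with the entry `η` in the positions `(a, b)` and `(b, a)`. -/
def elementaryTensor (η : Fn n) (a b : Fin n) : Tensor2 n := fun x =>
  η x • (Matrix.single a b (1 : ℝ) + Matrix.single b a 1)

lemma isTest_zero : IsTest Ω (fun _ : E n => (0 : ℝ)) := ⟨contDiff_const, HasCompactSupport.zero, by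
    rw [show (fun _ : E n => (0 : ℝ)) = 0 from rfl, tsupport_zero]; exact empty_subset _⟩

lemma IsTest.mul_const {η : Fn n} (hη : IsTest Ω η) (c : ℝ) : IsTest Ω fun x => η x * c := by
  refine ⟨hη.1.mul contDiff_const, hη.2.1.mono fun x hx => ?_, (closure_mono fun x hx => ?_).trans
    hη.2.2⟩ <;>
  exact left_ne_zero_of_mul hx

lemma isTestTensor_elementary {η : Fn n} (hη : IsTest Ω η) (a b : Fin n) : IsTestTensor Ω
    (elementaryTensor η a b) := by
  refine ⟨fun x => ?_, fun i j => hη.mul_const _⟩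
  refine Matrix.IsSymm.smul ?_ _
  rw [Matrix.IsSymm, Matrix.transpose_add, Matrix.transpose_single, Matrix.transpose_single,
    add_comm]

lemma isTestTensor_zero : IsTestTensor Ω (fun _ : E n => (0 : Mat n)) :=
  ⟨fun _ => Matrix.isSymm_zero, fun _ _ => isTest_zero⟩

lemma sum_elementaryTensor (η : Fn n) (a b : Fin n) (x : E n)
    {P : Mat n} (hP : P.IsSymm) :
    ∑ i, ∑ j, elementaryTensor η a b x i j * P i j = η x * (2 * P a b) := by
  have h1 : ∀ c d : Fin n, ∑ i, ∑ j, Matrix.single c d (1 : ℝ) i j * P i j = P c d := fun c d => by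
    simp [Matrix.single_apply, ite_and]
  have h2 := h1 a b
  have h3 := h1 b a
  rw [hP.apply a b] at h3
  simp only [elementaryTensor, Matrix.smul_apply, Matrix.add_apply, smul_eq_mul, mul_assoc, add_mul,
    ← mul_sum, sum_add_distrib, h2, h3]
  ring

lemma ae_eq_of_forall_test (hΩ : IsOpen Ω) {F F' : Fn n} (hF : LocallyIntegrableOn F Ω)
    (hF' : LocallyIntegrableOn F' Ω)
    (h : ∀ η, IsTest Ω η → ∫ x in Ω, η x * (2 * F x) = ∫ x in Ω, η x * (2 * F' x)) : F =ᵐ[𝔪 Ω]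
    F' := by
  have hint : ∀ {G : Fn n}, LocallyIntegrableOn G Ω → ∀ η, IsTest Ω η → IntegrableOn
      (fun x => η x * (2 * G x)) Ω := by
    intro G hG η hη
    have h1 := (hG.integrableOn_compact_subset hη.2.2 hη.2.1.isCompact).continuousOn_mul
      (hη.1.continuous.mul continuous_const).continuousOn hη.2.1.isCompact (g := fun x => η x * 2)
    refine (h1.of_forall_sdiff_eq_zero hΩ.measurableSet fun x hx => ?_).congr_fun
      (fun x _ => by ring) hΩ.measurableSet
    rw [image_eq_zero_of_notMem_tsupport (f := η) hx.2]; ring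
  have key := hΩ.ae_eq_zero_of_integral_contDiff_smul_eq_zero (hF.sub hF') fun η h1 h2 h3 => by
    have e1 := h η ⟨h1, h2, h3⟩
    rw [← sub_eq_zero, ← integral_sub (hint hF η ⟨h1, h2, h3⟩) (hint hF' η ⟨h1, h2, h3⟩)] at e1
    rw [← setIntegral_eq_integral_of_forall_compl_eq_zero (s := Ω) fun x hx => by
      rw [image_eq_zero_of_notMem_tsupport (f := η) fun h => hx (h3 h), zero_smul]]
    have e2 : ∀ x, η x * (2 * F x) - η x * (2 * F' x) = 2 * (η x • (F - F') x) := fun x => by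
      simp only [smul_eq_mul, Pi.sub_apply]; ring
    simp only [e2, integral_const_mul] at e1
    simpa using e1
  rw [EventuallyEq, ae_restrict_iff' hΩ.measurableSet]
  filter_upwards [key] with x hx hxΩ
  exact sub_eq_zero.1 (hx hxΩ)

lemma IsDensityAdjoint.unique (hΩ : IsOpen Ω) {u u' : Fn n} {Z Z' : VF n}
    {P Q P' Q' : Tensor2 n} (H : IsDensityAdjoint Ω g π u Z P Q)
    (H' : IsDensityAdjoint Ω g π u' Z' P' Q') (hu : u =ᵐ[𝔪 Ω] u')
    (hZ : Z =ᵐ[𝔪 Ω] Z') (hP : IsLocIntTensor Ω P) (hQ : IsLocIntTensor Ω Q)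
    (hP' : IsLocIntTensor Ω P') (hQ' : IsLocIntTensor Ω Q') :
    P =ᵐ[𝔪 Ω] P' ∧ Q =ᵐ[𝔪 Ω] Q' := by
  have H2 : IsDensityAdjoint Ω g π u' Z' P Q := fun h τ hh hτ => (H h τ hh hτ).congr hu hZ .rfl .rfl
  have hz : ∀ (P : Tensor2 n) x, ∑ a, ∑ b, ((fun _ : E n => (0 : Mat n)) x) a b * P x a b = 0 := by
      simp
  have e : ∀ {P P' : Tensor2 n}, (∀ a b, (fun x => P x a b) =ᵐ[𝔪 Ω] fun x => P' x a b) → P =ᵐ[𝔪 Ω]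
      P' := fun h => by
    filter_upwards [ae_all_iff.2 fun a => ae_all_iff.2 fun b => h a b] with x hx
    exact Matrix.ext hx
  constructor
  · refine e fun a b => ae_eq_of_forall_test hΩ (hP.2 a b) (hP'.2 a b) fun η hη => ?_
    have h1 := (H2 _ _ (isTestTensor_elementary hη a b) isTestTensor_zero).symm.trans
      (H' _ _ (isTestTensor_elementary hη a b) isTestTensor_zero)
    simpa only [hz, add_zero, sum_elementaryTensor η a b _ (hP.1 _), sum_elementaryTensor η a b _
      (hP'.1 _)] using h1
  · refine e fun a b => ae_eq_of_forall_test hΩ (hQ.2 a b) (hQ'.2 a b) fun η hη => ?_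
    have h1 := (H2 _ _ isTestTensor_zero (isTestTensor_elementary hη a b)).symm.trans
      (H' _ _ isTestTensor_zero (isTestTensor_elementary hη a b))
    simpa only [hz, zero_add, sum_elementaryTensor η a b _ (hQ.1 _), sum_elementaryTensor η a b _
      (hQ'.1 _)] using h1

/-! ### Tensors and densities -/

/-- The tensor `v G P Gᵀ` on `Ω`, extended by zero. -/
def sandwich (Ω : Set (E n)) (G : Tensor2 n) (v : Fn n) (P : Tensor2 n) : Tensor2 n :=
  Ω.indicator fun x => v x • (G x * P x * (G x).transpose)

lemma sandwich_of_mem {G P : Tensor2 n} {v : Fn n} (hx : x ∈ Ω) : sandwich Ω G v P x = v x •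
    (G x * P x * (G x).transpose) := indicator_of_mem hx _

lemma innerUp_eq (G P Q : Mat n) : innerUp G P Q = ∑ i, ∑ j, P i j * (G * Q * G.transpose) i j := by
  simp only [innerUp, Matrix.mul_apply, Matrix.transpose_apply, sum_mul, mul_sum]
  refine sum_congr rfl fun i _ => sum_congr rfl fun j _ => ?_
  rw [sum_comm]
  exact sum_congr rfl fun k _ => sum_congr rfl fun l _ => by ring

lemma isLocIntTensor_sandwich (hΩ : IsOpen Ω) {G P : Tensor2 n} {v : Fn n}
    (hG : ∀ a b, ContinuousOn (fun x => G x a b) Ω) (hv : ContinuousOn v Ω)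
    (hP : IsLocIntTensor Ω P) : IsLocIntTensor Ω (sandwich Ω G v P) := by
  constructor
  · intro x
    by_cases hx : x ∈ Ω
    · rw [sandwich_of_mem hx]
      refine Matrix.IsSymm.smul ?_ _
      rw [Matrix.IsSymm, Matrix.transpose_mul, Matrix.transpose_mul, Matrix.transpose_transpose,
        (hP.1 x).eq, Matrix.mul_assoc]
    · rw [sandwich, indicator_of_notMem hx]; exact Matrix.isSymm_zero
  · intro i j
    have h1 : ∀ k l, LocallyIntegrableOn (fun x => v x * G x i k * G x j l * P x k l) Ω :=
      fun k l => (hP.2 k l).continuousOn_mul ((hv.mul (hG i k)).mul (hG j l)) hΩ.isLocallyClosed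
    have h2 : LocallyIntegrableOn (fun x => ∑ l, ∑ k, v x * G x i k * G x j l * P x k l) Ω := by
      have h3 : ∀ (κ : Finset (Fin n)) (F : Fin n → Fn n), (∀ k, LocallyIntegrableOn (F k) Ω) →
          LocallyIntegrableOn (fun x => ∑ k ∈ κ, F k x) Ω := fun κ F hF => by
        classical
        induction κ using Finset.induction_on with
        | empty => simpa using locallyIntegrableOn_zero
        | insert k κ hk ih =>
          simp only [sum_insert hk]
          exact (hF k).add ih
      exact h3 _ _ fun l => h3 _ _ fun k => h1 k l
    rw [locallyIntegrableOn_iff hΩ.isLocallyClosed] at h2 ⊢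
    intro K hK hKc
    refine (h2 K hK hKc).congr_fun (fun y hy => ?_) hKc.measurableSet
    dsimp only
    rw [sandwich_of_mem (hK hy)]
    simp only [Matrix.smul_apply, smul_eq_mul, Matrix.mul_apply, Matrix.transpose_apply, sum_mul,
      mul_sum]
    exact sum_congr rfl fun _ _ => sum_congr rfl fun _ _ => by ring

variable {r : Fn n} {c : ℝ} {M₁ M₂ : Fn n → VF n → Tensor2 n}

lemma AdjointModel.volDensity_pos (H : AdjointModel Ω r g π c M₁ M₂) (hx : x ∈ Ω) : 0 < volDensity g
    x := sqrt_pos.2 (H.det_pos x hx)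

lemma AdjointModel.isUnit_det (H : AdjointModel Ω r g π c M₁ M₂) (hx : x ∈ Ω) : IsUnit (g x).det :=
    (H.det_pos x hx).ne'.isUnit

lemma AdjointModel.inv_density_continuousOn (H : AdjointModel Ω r g π c M₁ M₂) : ContinuousOn
    (fun x => (volDensity g x)⁻¹) Ω := H.density_continuousOn.inv₀ fun _ hx =>
  (H.volDensity_pos hx).ne'

lemma mul_conj_mul_conj {G K P : Mat n} (h : G * K = 1) : G * (K * P * K.transpose) * G.transpose =
    P := by
  have h2 : K.transpose * G.transpose = 1 := by rw [← Matrix.transpose_mul, h, Matrix.transpose_one]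
  calc _ = (G * K) * P * (K.transpose * G.transpose) := by simp only [Matrix.mul_assoc]
    _ = P := by rw [h, h2, Matrix.one_mul, Matrix.mul_one]

lemma sum_mul_smul (c : ℝ) (h P : Mat n) : ∑ i, ∑ j, h i j * (c • P) i j = c * ∑ i, ∑ j, h i j * P i
    j := by
  simp only [Matrix.smul_apply, smul_eq_mul, mul_sum]
  exact sum_congr rfl fun _ _ => sum_congr rfl fun _ _ => by ring

lemma AdjointModel.isAdjoint (hΩ : IsOpen Ω) (H : AdjointModel Ω r g π c M₁ M₂)
    {P Q : Tensor2 n} (hPQ : IsDensityAdjoint Ω g π u Z P Q)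
    (hP : IsLocIntTensor Ω P) (hQ : IsLocIntTensor Ω Q) :
    IsAdjoint Ω g π u Z (sandwich Ω g (fun x => (volDensity g x)⁻¹) P, sandwich Ω (fun x => (g x)⁻¹)
      (fun x => (volDensity g x)⁻¹) Q) := by
  refine ⟨isLocIntTensor_sandwich hΩ H.metric_continuousOn H.inv_density_continuousOn hP,
    isLocIntTensor_sandwich hΩ H.inverse_continuousOn H.inv_density_continuousOn hQ,
    fun h τ hh hτ => (hPQ h τ hh hτ).trans (setIntegral_congr_fun hΩ.measurableSet fun x hx => ?_)⟩
  have hv := (H.volDensity_pos hx).ne'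
  dsimp only
  rw [innerLow, innerUp_eq, innerUp_eq, sandwich_of_mem hx, sandwich_of_mem hx]
  simp only [Matrix.mul_smul, Matrix.smul_mul, sum_mul_smul]
  rw [mul_conj_mul_conj (Matrix.nonsing_inv_mul _ (H.isUnit_det hx)), mul_conj_mul_conj
    (Matrix.mul_nonsing_inv _ (H.isUnit_det hx)), ← mul_add, mul_comm, mul_inv_cancel_left₀ hv]

lemma IsAdjoint.isDensityAdjoint (hΩ : IsOpen Ω) {A B : Tensor2 n} (hAB : IsAdjoint Ω g π u Z (A, B)) :
    IsDensityAdjoint Ω g π u Z (sandwich Ω (fun x => (g x)⁻¹) (volDensity g) A)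
      (sandwich Ω g (volDensity g) B) := by
  refine fun h τ hh hτ => (hAB.2.2 h τ hh hτ).trans
    (setIntegral_congr_fun hΩ.measurableSet fun x hx => ?_)
  rw [innerLow, innerUp_eq, innerUp_eq, sandwich_of_mem hx, sandwich_of_mem hx, sum_mul_smul,
    sum_mul_smul, add_mul, mul_comm, mul_comm _ (volDensity g x)]

lemma AdjointModel.adjoint_ae_eq (hΩ : IsOpen Ω) (H : AdjointModel Ω r g π c M₁ M₂)
    {P Q : Tensor2 n} (hPQ : IsDensityAdjoint Ω g π u Z P Q)
    (hP : IsLocIntTensor Ω P) (hQ : IsLocIntTensor Ω Q) :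
    IsAdjoint Ω g π u Z (adjoint Ω g π u Z) ∧
    ∀ᵐ x ∂𝔪 Ω, (adjoint Ω g π u Z).1 x = (volDensity g x)⁻¹ • (g x * P x * (g x).transpose) ∧
      (adjoint Ω g π u Z).2 x = (volDensity g x)⁻¹ • ((g x)⁻¹ * Q x * ((g x)⁻¹).transpose) := by
  have hex : ∃ AB, IsAdjoint Ω g π u Z AB := ⟨_, H.isAdjoint hΩ hPQ hP hQ⟩
  have hadj : IsAdjoint Ω g π u Z (adjoint Ω g π u Z) := by
    rw [adjoint, dif_pos hex]; exact hex.choose_spec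
  refine ⟨hadj, ?_⟩
  generalize adjoint Ω g π u Z = AB at hadj ⊢
  have h1 := hadj.isDensityAdjoint hΩ
  obtain ⟨e1, e2⟩ := h1.unique hΩ hPQ .rfl .rfl
    (isLocIntTensor_sandwich hΩ H.inverse_continuousOn H.density_continuousOn hadj.1)
    (isLocIntTensor_sandwich hΩ H.metric_continuousOn H.density_continuousOn hadj.2.1) hP hQ
  filter_upwards [e1, e2, ae_restrict_mem hΩ.measurableSet] with x h1 h2 hx
  have hv := (H.volDensity_pos hx).ne'
  rw [sandwich_of_mem hx] at h1 h2
  rw [← h1, ← h2]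
  simp only [Matrix.mul_smul, Matrix.smul_mul, smul_smul, inv_mul_cancel₀ hv, one_smul]
  rw [mul_conj_mul_conj (Matrix.nonsing_inv_mul _ (H.isUnit_det hx)), mul_conj_mul_conj
    (Matrix.mul_nonsing_inv _ (H.isUnit_det hx))]
  exact ⟨rfl, rfl⟩

lemma innerVec_mul (G : Mat n) (V Z : E n) (v : ℝ) : innerVec G V Z * v = ∑ k,
    ((∑ j, G j k * V j) * v) * Z k := by
  simp only [innerVec, sum_mul]
  rw [sum_comm]
  exact sum_congr rfl fun _ _ => sum_congr rfl fun _ _ => by ring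

lemma IsTestTensor.sum_symPart {h : Tensor2 n} (hh : IsTestTensor Ω h) (M : Tensor2 n) (x : E n) :
    ∑ a, ∑ b, h x a b * symPart M x a b = ∑ a, ∑ b, h x a b * M x a b := by
  have h1 : ∑ a, ∑ b, h x a b * M x b a = ∑ a, ∑ b, h x a b * M x a b := by
    rw [sum_comm]
    exact sum_congr rfl fun a _ => sum_congr rfl fun b _ => by rw [(hh.1 x).apply]
  have h2 : ∀ a b, h x a b * symPart M x a b = 1 / 2 * (h x a b * M x a b) + 1 / 2 *
      (h x a b * M x b a) := fun a b => by
    rw [symPart_apply]; ring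
  simp only [h2, sum_add_distrib, ← mul_sum, h1]
  ring

lemma integrableOn_mul_of_support (hΩ : IsOpen Ω) {L F : Fn n} (hL : Continuous L)
    (hs : HasCompactSupport L) (hsΩ : tsupport L ⊆ Ω) (hF : LocallyIntegrableOn F Ω) : IntegrableOn
    (fun x => L x * F x) Ω := by
  have h1 := (hF.integrableOn_compact_subset hsΩ hs.isCompact).continuousOn_mul hL.continuousOn
    hs.isCompact
  refine h1.of_forall_sdiff_eq_zero hΩ.measurableSet fun x hx => ?_
  rw [image_eq_zero_of_notMem_tsupport (f := L) hx.2, zero_mul]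

lemma integrableOn_sum_mul (hΩ : IsOpen Ω) {h P : Tensor2 n} (hh : IsTestTensor Ω h)
    (hP : ∀ a b, LocallyIntegrableOn (fun x => P x a b) Ω) : IntegrableOn
    (fun x => ∑ a, ∑ b, h x a b * P x a b) Ω := integrable_finsetSum _ fun a _ =>
  integrable_finsetSum _ fun b _ => integrableOn_mul_of_support hΩ (hh.2 a b).1.continuous
    (hh.2 a b).2.1 (hh.2 a b).2.2 (hP a b)

lemma AdjointModel.exists_dual (hΩ : IsOpen Ω) (H : AdjointModel Ω r g π c M₁ M₂)
    {h τ : Tensor2 n} (hh : IsTestTensor Ω h) (hτ : IsTestTensor Ω τ) :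
    ∃ L : Option (Fin n) → Fn n,
      (∀ k, Continuous (L k) ∧ HasCompactSupport (L k) ∧ tsupport (L k) ⊆ Ω) ∧
      (∀ (u : Fn n) (Z : VF n), LocallyIntegrableOn u Ω →
        (∀ k, LocallyIntegrableOn (fun x => Z x k) Ω) → ∫ x in Ω,
        (linHamiltonian g π h τ x * u x + innerVec (g x) (linDiv g π h τ x) (Z x)) * volDensity g x
          = (∫ x in Ω, L none x * u x) + ∑ k, ∫ x in Ω, L (some k) x * Z x k) ∧
      ∀ (u : Fn n) (Z : VF n), Smooth u → Smooth Z → (∫ x in Ω, L none x * u x) + ∑ k, ∫ x in Ω, L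
        (some k) x * Z x k = (∫ x in Ω, ∑ a, ∑ b, h x a b * M₁ u Z x a b) + ∫ x in Ω, ∑ a, ∑ b, τ x
            a b * M₂ u Z x a b := by
  obtain ⟨L₀, L, h0, h1, e0, e1, hd⟩ := H.dual h τ hh hτ
  refine ⟨fun k => k.elim L₀ L, fun k => by cases k; exacts [h0, h1 _], fun u Z hu hZ => ?_, hd⟩
  have hi0 := integrableOn_mul_of_support hΩ h0.1 h0.2.1 h0.2.2 hu
  have hi1 := fun k => integrableOn_mul_of_support hΩ (h1 k).1 (h1 k).2.1 (h1 k).2.2 (hZ k)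
  change _ = (∫ x in Ω, L₀ x * u x) + ∑ k, ∫ x in Ω, L k x * Z x k
  rw [← integral_finsetSum _ fun k _ => hi1 k, ← integral_add hi0
    (integrable_finsetSum _ fun k _ => hi1 k)]
  refine setIntegral_congr_fun hΩ.measurableSet fun x hx => ?_
  rw [add_mul, innerVec_mul, ← e0 x hx]
  simp only [e1 x hx]
  ring

lemma AdjointModel.isDensityAdjoint_smooth (hΩ : IsOpen Ω) (H : AdjointModel Ω r g π c M₁ M₂)
    (hu : Smooth u) (hZ : Smooth Z) : IsDensityAdjoint Ω g π u Z (symPart (M₁ u Z))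
    (symPart (M₂ u Z)) := by
  intro h τ hh hτ
  obtain ⟨L, -, h1, h2⟩ := H.exists_dual hΩ hh hτ
  have hl : ∀ {F : Fn n}, ContinuousOn F Ω → LocallyIntegrableOn F Ω := fun hF =>
    hF.locallyIntegrableOn hΩ.measurableSet
  rw [AdjointAt, h1 u Z (hl hu.continuous.continuousOn)
    (fun k => hl (contDiff_component hZ k).continuous.continuousOn), h2 u Z hu hZ, ← integral_add
    (integrableOn_sum_mul hΩ hh fun a b => hl (H.continuousOn₁ u Z hu hZ a b))
      (integrableOn_sum_mul hΩ hτ fun a b => hl (H.continuousOn₂ u Z hu hZ a b))]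
  simp only [hh.sum_symPart, hτ.sum_symPart]

end FlatAdjoint

section Fields
variable {n : ℕ} {Ω : Set (E n)} {r ρ : Fn n} {s : ℝ} {g π : Tensor2 n} {Z : VF n} {u : Fn n}

/-- The components of a function, a vector field and two tensors. -/
abbrev Slot (n : ℕ) : Type := Option (Fin n) ⊕ ((Fin n × Fin n) ⊕ (Fin n × Fin n))

local notation "𝓧" => FieldSpace Ω (Slot n)

def slotWeight (r ρ : Fn n) (s : ℝ) : Slot n → Fn n
  | .inl _, x => r x ^ (ℓ n s) * ρ x
  | .inr (.inl _), x => r x ^ (ℓ n (2 + s)) * ρ x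
  | .inr (.inr _), x => r x ^ (ℓ n (1 + s)) * ρ x

def fieldU (r ρ : Fn n) (s : ℝ) (ξ : 𝓧) : Fn n :=
  value (slotWeight r ρ s) ξ (.inl none)

def fieldZ (r ρ : Fn n) (s : ℝ) (ξ : 𝓧) : VF n := fun x =>
  WithLp.toLp 2 fun k => value (slotWeight r ρ s) ξ (.inl (some k)) x

def fieldP (r ρ : Fn n) (s : ℝ) (ξ : 𝓧) : Tensor2 n := fun x =>
  Matrix.of fun a b => value (slotWeight r ρ s) ξ (.inr (.inl (a, b))) x

def fieldQ (r ρ : Fn n) (s : ℝ) (ξ : 𝓧) : Tensor2 n := fun x =>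
  Matrix.of fun a b => value (slotWeight r ρ s) ξ (.inr (.inr (a, b))) x

/-- A function and a vector field, together with the coordinate densities of their adjoint. -/
structure IsField (Ω : Set (E n)) (r ρ : Fn n) (s : ℝ) (g π : Tensor2 n)
    (ξ : 𝓧) : Prop where
  symm₁ : ∀ a b, ξ (.inr (.inl (a, b))) = ξ (.inr (.inl (b, a)))
  symm₂ : ∀ a b, ξ (.inr (.inr (a, b))) = ξ (.inr (.inr (b, a)))
  adjoint : IsDensityAdjoint Ω g π (fieldU r ρ s ξ) (fieldZ r ρ s ξ) (fieldP r ρ s ξ)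
    (fieldQ r ρ s ξ)

lemma normSq_zero_congr {F : Type*} [NormedAddCommGroup F] [NormedSpace ℝ F] {v v' : E n → F}
    (h : v =ᵐ[𝔪 Ω] v') : normSq Ω r ρ 0 s v = normSq Ω r ρ 0 s v' := by
  rw [normSq_zero, normSq_zero]
  exact lintegral_congr_ae (by filter_upwards [h] with x hx; rw [hx])

lemma adjointNormSq_congr {P Q P' Q' : Tensor2 n} (hP : P =ᵐ[𝔪 Ω] P') (hQ : Q =ᵐ[𝔪 Ω] Q') :
    adjointNormSq Ω r ρ s P Q = adjointNormSq Ω r ρ s P' Q' := by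
  rw [adjointNormSq, adjointNormSq]
  congr 1 <;> refine sum_congr rfl fun a _ => sum_congr rfl fun b _ => ?_
  · exact lintegral_congr_ae (by filter_upwards [hP] with x hx; rw [hx])
  · exact lintegral_congr_ae (by filter_upwards [hQ] with x hx; rw [hx])

/-- The structural assumptions under which the functional is minimized. -/
structure CoerciveModel (Ω : Set (E n)) (r ρ : Fn n) (s : ℝ) (g π : Tensor2 n) (c : ℝ)
    (M₁ M₂ : Fn n → VF n → Tensor2 n) (K : NNReal) : Prop where
  dim_pos : 0 < n
  isOpen : IsOpen Ω
  pos : ∀ x, 0 < r x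
  continuous : Continuous r
  continuous_boundary : Continuous ρ
  boundary_nonneg : ∀ x, 0 ≤ ρ x
  boundary_pos : ∀ x ∈ Ω, 0 < ρ x
  model : AdjointModel Ω r g π c M₁ M₂
  nonneg : 0 ≤ c
  small : 22 * c * n ^ 2 ≤ 1
  coercive : ∀ (u : Fn n) (Z : VF n), Smooth u → HasCompactSupport u →
    Smooth Z → HasCompactSupport Z →
    normSq Ω r ρ 2 s u + normSq Ω r ρ 1 s Z ≤
        K * adjointNormSq Ω r ρ s (symPart (M₁ u Z)) (symPart (M₂ u Z)) ∧
      adjointNormSq Ω r ρ s (symPart (M₁ u Z)) (symPart (M₂ u Z)) ≤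
        K * (normSq Ω r ρ 2 s u + normSq Ω r ρ 1 s Z)

variable {c : ℝ} {M₁ M₂ : Fn n → VF n → Tensor2 n} {K : NNReal}
local notation "𝓜" => CoerciveModel Ω r ρ s g π c M₁ M₂ K

namespace CoerciveModel

lemma isWeight (H : 𝓜) : IsWeight Ω (slotWeight r ρ s) := by
  have hwc : ∀ m : ℝ, Continuous fun x => r x ^ m * ρ x := fun m =>
    (H.continuous.rpow_const fun x => Or.inl (H.pos x).ne').mul H.continuous_boundary
  have hwp : ∀ (m : ℝ), ∀ x ∈ Ω, 0 < r x ^ m * ρ x := fun m x hx => mul_pos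
    (rpow_pos_of_pos (H.pos x) _) (H.boundary_pos x hx)
  exact ⟨fun j => by rcases j with j | j | j <;> exact hwc _,
    fun j => by rcases j with j | j | j <;> exact hwp _⟩

lemma normSq_fieldU (H : 𝓜) (ξ : 𝓧) : normSq Ω r ρ 0 s (fieldU r ρ s ξ) = ‖ξ (.inl none)‖ₑ ^ 2 := by
  rw [normSq_zero, ← lintegral_value_sq H.isOpen.measurableSet H.isWeight]
  rfl

lemma normSq_fieldZ (H : 𝓜) (ξ : 𝓧) : normSq Ω r ρ 0 s (fieldZ r ρ s ξ) = ∑ k, ‖ξ (.inl (some k))‖ₑ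
    ^ 2 := by
  rw [normSq_zero]
  simp only [← lintegral_value_sq H.isOpen.measurableSet H.isWeight]
  have hm : ∀ k : Fin n, AEMeasurable (fun x => ‖value (slotWeight r ρ s) ξ (.inl (some k)) x‖ₑ ^ 2 *
      ofReal (slotWeight r ρ s (.inl (some k)) x)) (𝔪 Ω) := fun k =>
    ((aestronglyMeasurable_value H.isWeight ξ _).enorm.pow_const 2).mul
      (H.isWeight.continuous _).measurable.ennreal_ofReal.aemeasurable
  rw [← lintegral_finsetSum' _ fun k _ => hm k]
  refine lintegral_congr fun x => ?_
  have h1 : ‖fieldZ r ρ s ξ x‖ₑ ^ 2 = ∑ k, ‖fieldZ r ρ s ξ x k‖ₑ ^ 2 := by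
    simp only [enorm_sq_eq_ofReal, norm_eq_abs, sq_abs]
    rw [← ofReal_sum_of_nonneg fun k _ => sq_nonneg _, norm_sq_eq_sum]
  rw [h1, sum_mul]
  rfl

lemma adjointNormSq_field (H : 𝓜) (ξ : 𝓧) : adjointNormSq Ω r ρ s (fieldP r ρ s ξ) (fieldQ r ρ s ξ)
    = (∑ a, ∑ b, ‖ξ (.inr (.inl (a, b)))‖ₑ ^ 2) + ∑ a, ∑ b, ‖ξ (.inr (.inr (a, b)))‖ₑ ^ 2 := by
  simp only [← lintegral_value_sq H.isOpen.measurableSet H.isWeight]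
  rfl

lemma enorm_sq_eq (H : 𝓜) (ξ : 𝓧) : ‖ξ‖ₑ ^ 2 = normSq Ω r ρ 0 s (fieldU r ρ s ξ) + normSq Ω r ρ 0 s
    (fieldZ r ρ s ξ) + adjointNormSq Ω r ρ s (fieldP r ρ s ξ) (fieldQ r ρ s ξ) := by
  rw [H.normSq_fieldU, H.normSq_fieldZ, H.adjointNormSq_field, enorm_sq_eq_sum,
    Fintype.sum_sum_type, Fintype.sum_sum_type, Fintype.sum_option, Fintype.sum_prod_type,
    Fintype.sum_prod_type]

lemma isLocIntTensor_fieldP (H : 𝓜)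
    {ξ : 𝓧} (hξ : IsField Ω r ρ s g π ξ) :
    IsLocIntTensor Ω (fieldP r ρ s ξ) := by
  refine ⟨fun x => Matrix.IsSymm.ext fun a b => ?_, fun a b => locallyIntegrableOn_value H.isOpen
    H.isWeight ξ _⟩
  simp only [fieldP, Matrix.of_apply, value, hξ.symm₁ b a]
  rfl

lemma isLocIntTensor_fieldQ (H : 𝓜)
    {ξ : 𝓧} (hξ : IsField Ω r ρ s g π ξ) :
    IsLocIntTensor Ω (fieldQ r ρ s ξ) := by
  refine ⟨fun x => Matrix.IsSymm.ext fun a b => ?_, fun a b => locallyIntegrableOn_value H.isOpen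
    H.isWeight ξ _⟩
  simp only [fieldQ, Matrix.of_apply, value, hξ.symm₂ b a]
  rfl

lemma exists_pairing (H : 𝓜) {F : Fn n} (hF : Continuous F) (hs : HasCompactSupport F)
    (hsΩ : tsupport F ⊆ Ω) (j : Slot n) : ∃ Λ : 𝓧 →L[ℝ] ℝ, ∀ ξ, Λ ξ = ∫ x in Ω, F x * value
      (slotWeight r ρ s) ξ j x := by
  have hc : ContinuousOn (fun x => F x ^ 2 * (slotWeight r ρ s j x)⁻¹) Ω :=
    (hF.pow 2).continuousOn.mul ((H.isWeight.continuous j).continuousOn.inv₀ fun x hx =>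
      (H.isWeight.pos j x hx).ne')
  have hi := integrable_of_continuousOn_of_eq_zero H.isOpen hc hs.isCompact hsΩ fun x hx => by
    rw [image_eq_zero_of_notMem_tsupport hx]; ring
  obtain ⟨Λ, hΛ⟩ := Constraint.exists_pairing H.isOpen.measurableSet H.isWeight j
    hF.aestronglyMeasurable (by
      simp only [enorm_sq_mul_ofReal]
      exact hi.integrableOn.lintegral_lt_top)
  exact ⟨Λ, fun ξ => (hΛ ξ).2⟩

lemma exists_adjointAt_iff (H : 𝓜) {h τ : Tensor2 n} (hh : IsTestTensor Ω h)
    (hτ : IsTestTensor Ω τ) : ∃ Λ : 𝓧 →L[ℝ] ℝ, ∀ ξ, AdjointAt Ω g π (fieldU r ρ s ξ)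
    (fieldZ r ρ s ξ) (fieldP r ρ s ξ) (fieldQ r ρ s ξ) h τ ↔ Λ ξ = 0 := by
  obtain ⟨L, hL, h1, -⟩ := H.model.exists_dual H.isOpen hh hτ
  choose Λ₀ hΛ₀ using fun k => H.exists_pairing (hL k).1 (hL k).2.1 (hL k).2.2 (.inl k)
  choose Λ₁ hΛ₁ using fun a b => H.exists_pairing (hh.2 a b).1.continuous (hh.2 a b).2.1
    (hh.2 a b).2.2 (.inr (.inl (a, b)))
  choose Λ₂ hΛ₂ using fun a b => H.exists_pairing (hτ.2 a b).1.continuous (hτ.2 a b).2.1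
    (hτ.2 a b).2.2 (.inr (.inr (a, b)))
  refine ⟨(Λ₀ none + ∑ k, Λ₀ (some k)) - ((∑ a, ∑ b, Λ₁ a b) + ∑ a, ∑ b, Λ₂ a b), fun ξ => ?_⟩
  have hv := fun j => locallyIntegrableOn_value H.isOpen H.isWeight ξ j
  have i1 : ∀ a b, IntegrableOn (fun x => h x a b * fieldP r ρ s ξ x a b) Ω := fun a b =>
    integrableOn_mul_of_support H.isOpen (hh.2 a b).1.continuous (hh.2 a b).2.1 (hh.2 a b).2.2
      (hv _)
  have i2 : ∀ a b, IntegrableOn (fun x => τ x a b * fieldQ r ρ s ξ x a b) Ω := fun a b =>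
    integrableOn_mul_of_support H.isOpen (hτ.2 a b).1.continuous (hτ.2 a b).2.1 (hτ.2 a b).2.2
      (hv _)
  rw [AdjointAt, h1 (fieldU r ρ s ξ) (fieldZ r ρ s ξ) (hv _) fun k => hv _, integral_add
    (integrable_finsetSum _ fun a _ => integrable_finsetSum _ fun b _ => i1 a b)
      (integrable_finsetSum _ fun a _ => integrable_finsetSum _ fun b _ => i2 a b),
    integral_finsetSum _ fun a _ => integrable_finsetSum _ fun b _ => i1 a b, integral_finsetSum _
    fun a _ => integrable_finsetSum _ fun b _ => i2 a b]
  simp only [integral_finsetSum _ fun b _ => i1 _ b, integral_finsetSum _ fun b _ => i2 _ b]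
  simp only [sub_apply, add_apply, sum_apply, hΛ₀, hΛ₁, hΛ₂, sub_eq_zero]
  rfl

/-- The closed subspace of the fields. -/
def fields (H : 𝓜) : Submodule ℝ (𝓧) where
  carrier := {ξ | IsField Ω r ρ s g π ξ}
  zero_mem' := ⟨fun _ _ => rfl, fun _ _ => rfl, fun h τ hh hτ => by
    obtain ⟨Λ, hΛ⟩ := H.exists_adjointAt_iff hh hτ
    rw [hΛ, map_zero]⟩
  add_mem' {ξ η} hξ hη := ⟨fun a b => by rw [PiLp.add_apply, hξ.symm₁, hη.symm₁]; rfl,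
    fun a b => by rw [PiLp.add_apply, hξ.symm₂, hη.symm₂]; rfl, fun h τ hh hτ => by
    obtain ⟨Λ, hΛ⟩ := H.exists_adjointAt_iff hh hτ
    rw [hΛ, map_add, (hΛ ξ).1 (hξ.adjoint h τ hh hτ), (hΛ η).1 (hη.adjoint h τ hh hτ), add_zero]⟩
  smul_mem' t ξ hξ := ⟨fun a b => by rw [PiLp.smul_apply, hξ.symm₁]; rfl,
    fun a b => by rw [PiLp.smul_apply, hξ.symm₂]; rfl, fun h τ hh hτ => by
    obtain ⟨Λ, hΛ⟩ := H.exists_adjointAt_iff hh hτ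
    rw [hΛ, map_smul, (hΛ ξ).1 (hξ.adjoint h τ hh hτ), smul_zero]⟩

lemma isClosed_fields (H : 𝓜) : IsClosed (H.fields : Set (𝓧)) := by
  have hc : ∀ j : Slot n, Continuous fun ξ : 𝓧 => ξ j := fun j => PiLp.continuous_apply 2 _ j
  have h1 : IsClosed {ξ : 𝓧 | ∀ a b, ξ (.inr (.inl (a, b))) = ξ (.inr (.inl (b, a)))} := by
    simp only [ofPred_forall]
    exact isClosed_iInter fun a => isClosed_iInter fun b => isClosed_eq (hc _) (hc _)
  have h2 : IsClosed {ξ : 𝓧 | ∀ a b, ξ (.inr (.inr (a, b))) = ξ (.inr (.inr (b, a)))} := by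
    simp only [ofPred_forall]
    exact isClosed_iInter fun a => isClosed_iInter fun b => isClosed_eq (hc _) (hc _)
  have h3 : IsClosed {ξ : 𝓧 | IsDensityAdjoint Ω g π (fieldU r ρ s ξ) (fieldZ r ρ s ξ)
      (fieldP r ρ s ξ) (fieldQ r ρ s ξ)} := by
    simp only [IsDensityAdjoint, ofPred_forall]
    refine isClosed_iInter fun h => isClosed_iInter fun τ => isClosed_iInter fun hh =>
      isClosed_iInter fun hτ => ?_
    obtain ⟨Λ, hΛ⟩ := H.exists_adjointAt_iff hh hτ
    simp only [hΛ]
    exact isClosed_eq Λ.continuous continuous_const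
  convert (h1.inter h2).inter h3 using 1
  ext ξ
  exact ⟨fun h => ⟨⟨h.symm₁, h.symm₂⟩, h.adjoint⟩, fun h => ⟨h.1.1, h.1.2, h.2⟩⟩

/-- The family `ξ` comes from the function `u` and the vector field `Z`. -/
def Represents (r ρ : Fn n) (s : ℝ) (ξ : 𝓧) (u : Fn n)
    (Z : VF n) : Prop :=
  fieldU r ρ s ξ =ᵐ[𝔪 Ω] u ∧ fieldZ r ρ s ξ =ᵐ[𝔪 Ω] Z

lemma Represents.sub {ξ η : 𝓧} {u v : Fn n} {Z W : VF n} (hξ : Represents r ρ s ξ u Z)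
    (hη : Represents r ρ s η v W) : Represents r ρ s (ξ - η) (u - v) (Z - W) := by
  constructor
  · filter_upwards [hξ.1, hη.1, value_sub (w := slotWeight r ρ s) ξ η (.inl none)] with x h1 h2 h3
    rw [fieldU, h3, Pi.sub_apply, ← h1, ← h2]; rfl
  · filter_upwards [hξ.2, hη.2, ae_all_iff.2 fun k : Fin n => value_sub (w := slotWeight r ρ s) ξ η
      (.inl (some k))] with x h1 h2 h3
    rw [Pi.sub_apply, ← h1, ← h2]
    ext k
    exact h3 k

lemma Represents.add {ξ η : 𝓧} {u v : Fn n} {Z W : VF n} (hξ : Represents r ρ s ξ u Z)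
    (hη : Represents r ρ s η v W) : Represents r ρ s (ξ + η) (u + v) (Z + W) := by
  constructor
  · filter_upwards [hξ.1, hη.1, value_add (w := slotWeight r ρ s) ξ η (.inl none)] with x h1 h2 h3
    rw [fieldU, h3, Pi.add_apply, ← h1, ← h2]; rfl
  · filter_upwards [hξ.2, hη.2, ae_all_iff.2 fun k : Fin n => value_add (w := slotWeight r ρ s) ξ η
      (.inl (some k))] with x h1 h2 h3
    rw [Pi.add_apply, ← h1, ← h2]
    ext k
    exact h3 k

lemma Represents.smul {ξ : 𝓧} (t : ℝ) (hξ : Represents r ρ s ξ u Z) : Represents r ρ s (t • ξ)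
    (t • u) (t • Z) := by
  constructor
  · filter_upwards [hξ.1, value_smul (w := slotWeight r ρ s) t ξ (.inl none)] with x h1 h3
    rw [fieldU, h3, Pi.smul_apply, ← h1]; rfl
  · filter_upwards [hξ.2, ae_all_iff.2 fun k : Fin n => value_smul (w := slotWeight r ρ s) t ξ
      (.inl (some k))] with x h1 h3
    rw [Pi.smul_apply, ← h1]
    ext k
    exact h3 k

lemma represents_zero : Represents r ρ s (0 : 𝓧) 0 0 := by
  constructor
  · exact value_zero _
  · filter_upwards [ae_all_iff.2 fun k : Fin n => value_zero (Ω := Ω) (w := slotWeight r ρ s)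
      (.inl (some k))] with x h3
    ext k
    exact h3 k

/-- The fields of smooth functions and vector fields with bounded support. -/
def smoothFields (H : 𝓜) :
    Submodule ℝ (𝓧) where
  carrier := {ξ | IsField Ω r ρ s g π ξ ∧ ∃ (u : Fn n) (Z : VF n), Smooth u ∧
    HasCompactSupport u ∧ Smooth Z ∧ HasCompactSupport Z ∧ Represents r ρ s ξ u Z}
  zero_mem' := ⟨H.fields.zero_mem, 0, 0, contDiff_const, HasCompactSupport.zero, contDiff_const,
    HasCompactSupport.zero, represents_zero⟩
  add_mem' := by
    rintro ξ η ⟨hξ, u, Z, h1, h2, h3, h4, h5⟩ ⟨hη, v, W, k1, k2, k3, k4, k5⟩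
    exact ⟨H.fields.add_mem hξ hη, u + v, Z + W, h1.add k1, h2.add k2, h3.add k3, h4.add k4,
      h5.add k5⟩
  smul_mem' := by
    rintro t ξ ⟨hξ, u, Z, h1, h2, h3, h4, h5⟩
    refine ⟨H.fields.smul_mem t hξ, t • u, t • Z, contDiff_const.smul h1, h2.mono fun x hx => ?_,
      contDiff_const.smul h3, h4.mono fun x hx => ?_, h5.smul t⟩ <;>
    · rw [Function.mem_support] at hx ⊢
      contrapose! hx
      rw [Pi.smul_apply, hx, smul_zero]

lemma adjoint_ae_eq_smooth (H : 𝓜)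
    {ξ : 𝓧} (hξ : IsField Ω r ρ s g π ξ)
    (hu : Smooth u) (hZ : Smooth Z) (h : Represents r ρ s ξ u Z) :
    fieldP r ρ s ξ =ᵐ[𝔪 Ω] symPart (M₁ u Z) ∧ fieldQ r ρ s ξ =ᵐ[𝔪 Ω] symPart (M₂ u Z) := by
  have hl : ∀ {M : Tensor2 n}, (∀ a b, ContinuousOn (fun x => M x a b) Ω) → IsLocIntTensor Ω
      (symPart M) := fun hM => ⟨symPart_isSymm _, fun a b =>
    (continuousOn_const.mul ((hM a b).add (hM b a))).locallyIntegrableOn H.isOpen.measurableSet⟩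
  exact hξ.adjoint.unique H.isOpen (H.model.isDensityAdjoint_smooth H.isOpen hu hZ) h.1 h.2
    (H.isLocIntTensor_fieldP hξ) (H.isLocIntTensor_fieldQ hξ) (hl (H.model.continuousOn₁ u Z hu hZ))
    (hl (H.model.continuousOn₂ u Z hu hZ))

lemma normSq_zero_le {F : Type*} [NormedAddCommGroup F] [NormedSpace ℝ F] (k : ℕ) (v : E n → F) :
    normSq Ω r ρ 0 s v ≤ normSq Ω r ρ k s v := by
  exact Finset.sum_le_sum_of_subset (Finset.range_subset_range.2 (by omega))

lemma smooth_bounds (H : 𝓜)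
    {ξ : 𝓧} (hξ : IsField Ω r ρ s g π ξ)
    (hu : Smooth u) (huc : HasCompactSupport u) (hZ : Smooth Z)
    (hZc : HasCompactSupport Z) (h : Represents r ρ s ξ u Z) :
    ‖ξ‖ₑ ^ 2 ≤ (K + 1) * (normSq Ω r ρ 2 s u + normSq Ω r ρ 1 s Z) ∧
    normSq Ω r ρ 2 s u + normSq Ω r ρ 1 s Z ≤ K * ‖ξ‖ₑ ^ 2 ∧
    ‖ξ‖ₑ ^ 2 ≤ (K + 1) * adjointNormSq Ω r ρ s (fieldP r ρ s ξ) (fieldQ r ρ s ξ) := by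
  obtain ⟨e1, e2⟩ := H.adjoint_ae_eq_smooth hξ hu hZ h
  obtain ⟨h1, h2⟩ := H.coercive u Z hu huc hZ hZc
  have h3 := H.enorm_sq_eq ξ
  rw [normSq_zero_congr h.1, normSq_zero_congr h.2] at h3
  rw [adjointNormSq_congr e1 e2] at h3 ⊢
  have h4 := add_le_add (normSq_zero_le (Ω := Ω) (r := r) (ρ := ρ) (s := s) 2 u)
    (normSq_zero_le (Ω := Ω) (r := r) (ρ := ρ) (s := s) 1 Z)
  refine ⟨?_, ?_, ?_⟩
  · rw [h3, add_mul, one_mul, add_comm]; exact add_le_add h2 h4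
  · exact h1.trans (mul_le_mul_right (h3 ▸ le_add_self) _)
  · rw [h3, add_mul, one_mul]; exact add_le_add (h4.trans h1) le_rfl

lemma exists_smooth (H : 𝓜) (hu : Smooth u) (huc : HasCompactSupport u) (hZ : Smooth Z)
    (hZc : HasCompactSupport Z) : ∃ ξ : 𝓧, IsField Ω r ρ s g π ξ ∧ Represents r ρ s ξ u Z := by
  have hX := normSq_add_normSq_lt_top (Ω := Ω) H.pos H.continuous H.continuous_boundary
    H.boundary_nonneg s hu huc hZ hZc
  have hY : adjointNormSq Ω r ρ s (symPart (M₁ u Z)) (symPart (M₂ u Z)) < ⊤ :=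
    (H.coercive u Z hu huc hZ hZc).2.trans_lt (ENNReal.mul_lt_top (by simp) hX)
  set v : Slot n → Fn n := fun j => match j with
    | .inl none => u
    | .inl (some k) => fun x => Z x k
    | .inr (.inl (a, b)) => fun x => symPart (M₁ u Z) x a b
    | .inr (.inr (a, b)) => fun x => symPart (M₂ u Z) x a b with hv
  have hsym : ∀ {M : Tensor2 n}, (∀ a b, ContinuousOn (fun x => M x a b) Ω) → ∀ a b,
      AEStronglyMeasurable (fun x => symPart M x a b) (𝔪 Ω) := fun hM a b =>
    (continuousOn_const.mul ((hM a b).add (hM b a))).aestronglyMeasurable H.isOpen.measurableSet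
  rw [ENNReal.add_lt_top] at hX
  rw [adjointNormSq, ENNReal.add_lt_top] at hY
  simp only [ENNReal.sum_lt_top, Finset.mem_univ, true_imp_iff] at hY
  have hZ0 : normSq Ω r ρ 0 s Z < ⊤ := (normSq_zero_le 1 Z).trans_lt hX.2
  rw [normSq_zero] at hZ0
  obtain ⟨ξ, hξ⟩ := exists_value_eq H.isOpen.measurableSet H.isWeight v (fun j => by
      rcases j with (_ | k) | ⟨a, b⟩ | ⟨a, b⟩
      · exact hu.continuous.aestronglyMeasurable
      · exact (contDiff_component hZ k).continuous.aestronglyMeasurable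
      · exact hsym (H.model.continuousOn₁ u Z hu hZ) a b
      · exact hsym (H.model.continuousOn₂ u Z hu hZ) a b)
    (fun j => by
      rcases j with (_ | k) | ⟨a, b⟩ | ⟨a, b⟩
      · have := (normSq_zero_le 2 u).trans_lt hX.1
        rw [normSq_zero] at this
        exact this
      · refine (lintegral_mono fun x => ?_).trans_lt hZ0
        refine mul_le_mul_left ?_ _
        rw [enorm_sq_eq_ofReal, enorm_sq_eq_ofReal]
        exact ofReal_le_ofReal (pow_le_pow_left₀ (norm_nonneg _) (PiLp.norm_apply_le (Z x) k) 2)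
      · exact hY.1 a b
      · exact hY.2 a b)
  have hrep : Represents r ρ s ξ u Z := by
    refine ⟨hξ (.inl none), ?_⟩
    filter_upwards [ae_all_iff.2 fun k : Fin n => hξ (.inl (some k))] with x hx
    ext k; exact hx k
  have hP : fieldP r ρ s ξ =ᵐ[𝔪 Ω] symPart (M₁ u Z) := by
    filter_upwards [ae_all_iff.2 fun a => ae_all_iff.2 fun b => hξ (.inr (.inl (a, b)))] with x hx
    ext a b; exact hx a b
  have hQ : fieldQ r ρ s ξ =ᵐ[𝔪 Ω] symPart (M₂ u Z) := by
    filter_upwards [ae_all_iff.2 fun a => ae_all_iff.2 fun b => hξ (.inr (.inr (a, b)))] with x hx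
    ext a b; exact hx a b
  have hsw : ∀ i j : Slot n, slotWeight r ρ s i = slotWeight r ρ s j → v i = v j → ξ i = ξ j :=
      fun i j h1 h2 => by
    refine Lp.ext ?_
    filter_upwards [hξ i, hξ j, ae_restrict_mem H.isOpen.measurableSet] with x h3 h4 hx
    have h5 := (sqrt_pos.2 (H.isWeight.pos i x hx)).ne'
    rw [h2, ← h4, value, value, ← h1] at h3
    exact (div_left_inj' h5).1 h3
  refine ⟨ξ, ⟨fun a b => hsw _ _ rfl ?_, fun a b => hsw _ _ rfl ?_, fun h τ hh hτ => ?_⟩, hrep⟩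
  · exact funext fun x => (symPart_isSymm (M₁ u Z) x).apply b a
  · exact funext fun x => (symPart_isSymm (M₂ u Z) x).apply b a
  · exact (H.model.isDensityAdjoint_smooth H.isOpen hu hZ h τ hh hτ).congr hrep.1.symm hrep.2.symm
      hP.symm hQ.symm

end CoerciveModel

end Fields

section Completion
variable {n : ℕ} {Ω : Set (E n)} {r ρ : Fn n} {s : ℝ} {g π : Tensor2 n}
  {c : ℝ} {M₁ M₂ : Fn n → VF n → Tensor2 n} {K : NNReal}
local notation "𝓧" => FieldSpace Ω (Slot n)
local notation "𝓜" => CoerciveModel Ω r ρ s g π c M₁ M₂ K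

lemma tendsto_norm_iff_enorm_sq {α H : Type*} [SeminormedAddCommGroup H] {l : Filter α}
    {f : α → H} : Tendsto (fun i => ‖f i‖ₑ ^ 2) l (𝓝 0) ↔ Tendsto (fun i => ‖f i‖) l (𝓝 0) := by
  constructor
  · intro h
    have h1 := (ENNReal.tendsto_toReal (by simp : (0 : ℝ≥0∞) ≠ ⊤)).comp h
    have h2 : Tendsto (fun i => ‖f i‖ ^ 2) l (𝓝 0) := by simpa [Function.comp_def] using h1
    have h3 := h2.sqrt
    simpa using h3
  · intro h
    have h1 : Tendsto (fun i => ofReal (‖f i‖ ^ 2)) l (𝓝 (ofReal (0 ^ 2))) := ENNReal.tendsto_ofReal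
      (h.pow 2)
    rw [zero_pow two_ne_zero, ENNReal.ofReal_zero] at h1
    simpa only [enorm_sq_eq_ofReal] using h1

lemma normSq_sub_le {F : Type*} [NormedAddCommGroup F] [NormedSpace ℝ F] (hr : Continuous r)
    (hr0 : ∀ x, 0 < r x) (hρ : Continuous ρ) {v v' v'' : E n → F}
    (hv : AEStronglyMeasurable v (𝔪 Ω)) (hv' : AEStronglyMeasurable v' (𝔪 Ω)) : normSq Ω r ρ 0 s
    (v' - v'') ≤ 2 * normSq Ω r ρ 0 s (v - v') + 2 * normSq Ω r ρ 0 s (v - v'') := by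
  have hw : Measurable fun x => ofReal (r x ^ (ℓ n s) * ρ x) :=
    ((hr.rpow_const fun x => Or.inl (hr0 x).ne').mul hρ).measurable.ennreal_ofReal
  have hm : AEMeasurable (fun x => ‖(v - v') x‖ₑ ^ 2 * ofReal (r x ^ (ℓ n s) * ρ x)) (𝔪 Ω) :=
    ((hv.sub hv').enorm.pow_const 2).mul hw.aemeasurable
  rw [normSq_zero, normSq_zero, normSq_zero, ← mul_add, ← lintegral_add_left' hm, ←
    lintegral_const_mul' _ _ (by norm_num)]
  refine lintegral_mono fun x => ?_
  dsimp only
  rw [← add_mul, ← mul_assoc]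
  refine mul_le_mul_left ?_ _
  simp only [enorm_sq_eq_ofReal, Pi.sub_apply]
  rw [← ofReal_add (sq_nonneg _) (sq_nonneg _), show (2 : ℝ≥0∞) = ofReal 2 by simp, ← ofReal_mul
    (by norm_num)]
  refine ofReal_le_ofReal ?_
  have h1 : ‖v' x - v'' x‖ ≤ ‖v x - v' x‖ + ‖v x - v'' x‖ := by
    rw [show v' x - v'' x = (v x - v'' x) - (v x - v' x) by abel, add_comm]
    exact norm_sub_le _ _
  nlinarith [norm_nonneg (v' x - v'' x), sq_nonneg (‖v x - v' x‖ - ‖v x - v'' x‖)]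

lemma ae_eq_of_normSq_sub {F : Type*} [NormedAddCommGroup F] [NormedSpace ℝ F]
    (hΩ : MeasurableSet Ω) (hr : Continuous r) (hr0 : ∀ x, 0 < r x) (hρ : Continuous ρ)
    (hρ0 : ∀ x ∈ Ω, 0 < ρ x) {f : ℕ → E n → F}
    {v v' : E n → F} (hf : ∀ m, AEStronglyMeasurable (f m) (𝔪 Ω))
    (hv : AEStronglyMeasurable v (𝔪 Ω))
    (hv' : AEStronglyMeasurable v' (𝔪 Ω))
    (h : Tendsto (fun m => normSq Ω r ρ 0 s (f m - v)) atTop (𝓝 0))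
    (h' : Tendsto (fun m => normSq Ω r ρ 0 s (f m - v')) atTop (𝓝 0)) :
    v =ᵐ[𝔪 Ω] v' := by
  have hw : Measurable fun x => ofReal (r x ^ (ℓ n s) * ρ x) :=
    ((hr.rpow_const fun x => Or.inl (hr0 x).ne').mul hρ).measurable.ennreal_ofReal
  have h1 : Tendsto (fun m => 2 * normSq Ω r ρ 0 s (f m - v) + 2 * normSq Ω r ρ 0 s (f m - v'))
      atTop (𝓝 (2 * 0 + 2 * 0)) := (ENNReal.Tendsto.const_mul h (by simp)).add
    (ENNReal.Tendsto.const_mul h' (by simp))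
  have h2 : normSq Ω r ρ 0 s (v - v') ≤ 2 * 0 + 2 * 0 := ge_of_tendsto' h1 fun m => normSq_sub_le hr
    hr0 hρ (hf m) hv
  have hm : AEMeasurable (fun x => ‖(v - v') x‖ₑ ^ 2 * ofReal (r x ^ (ℓ n s) * ρ x)) (𝔪 Ω) :=
    ((hv.sub hv').enorm.pow_const 2).mul hw.aemeasurable
  rw [mul_zero, add_zero, nonpos_iff_eq_zero, normSq_zero, lintegral_eq_zero_iff' hm] at h2
  filter_upwards [h2, ae_restrict_mem hΩ] with x hx hxΩ
  have h3 : 0 < r x ^ (ℓ n s) * ρ x := mul_pos (rpow_pos_of_pos (hr0 x) _) (hρ0 x hxΩ)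
  simp only [Pi.zero_apply, mul_eq_zero, ENNReal.ofReal_eq_zero, not_le.2 h3, or_false] at hx
  have h4 : ‖v x - v' x‖ₑ = 0 := by simpa using hx
  exact sub_eq_zero.1 (enorm_eq_zero.1 h4)

namespace CoerciveModel

def completeFields (H : 𝓜) :
    Submodule ℝ (𝓧) := H.smoothFields.topologicalClosure

lemma isField_of_mem (H : 𝓜) {ξ : 𝓧} (hξ : ξ ∈ H.completeFields) : IsField Ω r ρ s g π ξ :=
  closure_minimal (fun _ h => And.left h) H.isClosed_fields hξ

lemma aestronglyMeasurable_fieldZ (H : 𝓜) (ξ : 𝓧) : AEStronglyMeasurable (fieldZ r ρ s ξ)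
    (𝔪 Ω) := by
  have h1 : AEStronglyMeasurable (fun x => fun k : Fin n => value (slotWeight r ρ s) ξ
      (.inl (some k)) x) (𝔪 Ω) := (aemeasurable_pi_lambda _ fun k =>
      (aestronglyMeasurable_value H.isWeight ξ _).aemeasurable).aestronglyMeasurable
  exact (PiLp.continuous_toLp 2 fun _ : Fin n => ℝ).comp_aestronglyMeasurable h1

lemma normSq_sub_le_enorm (H : 𝓜)
    {ξ η : 𝓧} {u v : Fn n} {Z W : VF n}
    (hξ : Represents r ρ s ξ u Z) (hη : Represents r ρ s η v W) :
    normSq Ω r ρ 0 s (u - v) ≤ ‖ξ - η‖ₑ ^ 2 ∧ normSq Ω r ρ 0 s (Z - W) ≤ ‖ξ - η‖ₑ ^ 2 := by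
  have h := hξ.sub hη
  rw [← normSq_zero_congr h.1, ← normSq_zero_congr h.2, H.enorm_sq_eq]
  exact ⟨le_self_add.trans le_self_add, le_add_self.trans le_self_add⟩

lemma exists_field_of_memSobolev (H : 𝓜) {u : Fn n}
    {Z : VF n} (hu : MemSobolev Ω r ρ 2 s u) (hZ : MemSobolev Ω r ρ 1 s Z) :
    ∃ ξ ∈ H.completeFields, Represents r ρ s ξ u Z := by
  obtain ⟨hum, ψ, hψ, hψc, hψl⟩ := hu
  obtain ⟨hZm, Ψ, hΨ, hΨc, hΨl⟩ := hZ
  choose ξ hξ hrep using fun m => H.exists_smooth (hψ m).1 (hψ m).2 (hΨ m).1 (hΨ m).2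
  have hsub : ∀ m k, ‖ξ m - ξ k‖ₑ ^ 2 ≤ (K + 1) *
      (normSq Ω r ρ 2 s (ψ m - ψ k) + normSq Ω r ρ 1 s (Ψ m - Ψ k)) := fun m k =>
    (H.smooth_bounds (H.fields.sub_mem (hξ m) (hξ k)) ((hψ m).1.sub (hψ k).1)
      ((hψ m).2.sub (hψ k).2) ((hΨ m).1.sub (hΨ k).1) ((hΨ m).2.sub (hΨ k).2)
      ((hrep m).sub (hrep k))).1
  have hlim : Tendsto (fun m : ℕ × ℕ => ‖ξ m.1 - ξ m.2‖ₑ ^ 2) atTop (𝓝 0) := by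
    have h1 := ENNReal.Tendsto.const_mul (a := (K + 1 : ℝ≥0∞)) (hψc.add hΨc) (by simp)
    rw [add_zero, mul_zero] at h1
    exact tendsto_of_tendsto_of_tendsto_of_le_of_le tendsto_const_nhds h1 (fun _ => zero_le)
      fun m => hsub m.1 m.2
  have hcau : CauchySeq ξ := by
    rw [cauchySeq_iff_tendsto_dist_atTop_0]
    simpa only [dist_eq_norm] using tendsto_norm_iff_enorm_sq.1 hlim
  obtain ⟨ζ, hζ⟩ := cauchySeq_tendsto_of_complete hcau
  have hζ0 : Tendsto (fun m => ‖ξ m - ζ‖ₑ ^ 2) atTop (𝓝 0) := tendsto_norm_iff_enorm_sq.2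
    (tendsto_iff_norm_sub_tendsto_zero.1 hζ)
  have hself : Represents r ρ s ζ (fieldU r ρ s ζ) (fieldZ r ρ s ζ) := ⟨.rfl, .rfl⟩
  refine ⟨ζ, mem_closure_of_tendsto hζ (of_forall fun m =>
    ⟨hξ m, ψ m, Ψ m, (hψ m).1, (hψ m).2, (hΨ m).1, (hΨ m).2, hrep m⟩), ?_, ?_⟩
  · exact ae_eq_of_normSq_sub H.isOpen.measurableSet H.continuous H.pos H.continuous_boundary
      H.boundary_pos (fun m => (hψ m).1.continuous.aestronglyMeasurable)
      (aestronglyMeasurable_value H.isWeight ζ _) hum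
      (tendsto_of_tendsto_of_tendsto_of_le_of_le tendsto_const_nhds hζ0 (fun _ => zero_le) fun m =>
        (H.normSq_sub_le_enorm (hrep m) hself).1) hψl
  · exact ae_eq_of_normSq_sub H.isOpen.measurableSet H.continuous H.pos H.continuous_boundary
      H.boundary_pos (fun m => (hΨ m).1.continuous.aestronglyMeasurable)
      (H.aestronglyMeasurable_fieldZ ζ) hZm
      (tendsto_of_tendsto_of_tendsto_of_le_of_le tendsto_const_nhds hζ0 (fun _ => zero_le) fun m =>
        (H.normSq_sub_le_enorm (hrep m) hself).2) hΨl

lemma memSobolev_of_mem (H : 𝓜) {ζ : 𝓧} (hζ : ζ ∈ H.completeFields) : MemSobolev Ω r ρ 2 s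
    (fieldU r ρ s ζ) ∧ MemSobolev Ω r ρ 1 s (fieldZ r ρ s ζ) := by
  obtain ⟨ξ, hξ, hlim⟩ := mem_closure_iff_seq_limit.1 hζ
  choose hfield ψ Ψ h1 h2 h3 h4 hrep using hξ
  have hζ0 : Tendsto (fun m => ‖ξ m - ζ‖ₑ ^ 2) atTop (𝓝 0) := tendsto_norm_iff_enorm_sq.2
    (tendsto_iff_norm_sub_tendsto_zero.1 hlim)
  have hself : Represents r ρ s ζ (fieldU r ρ s ζ) (fieldZ r ρ s ζ) := ⟨.rfl, .rfl⟩
  have hcau := cauchySeq_iff_tendsto_dist_atTop_0.1 hlim.cauchySeq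
  simp only [dist_eq_norm] at hcau
  have hK := ENNReal.Tendsto.const_mul (a := (K : ℝ≥0∞)) (tendsto_norm_iff_enorm_sq.2 hcau)
    (by simp)
  rw [mul_zero] at hK
  have hb : ∀ m : ℕ × ℕ, normSq Ω r ρ 2 s (ψ m.1 - ψ m.2) + normSq Ω r ρ 1 s (Ψ m.1 - Ψ m.2) ≤ K *
      ‖ξ m.1 - ξ m.2‖ₑ ^ 2 := fun m =>
    (H.smooth_bounds (H.fields.sub_mem (hfield _) (hfield _)) ((h1 _).sub (h1 _))
      ((h2 _).sub (h2 _)) ((h3 _).sub (h3 _)) ((h4 _).sub (h4 _)) ((hrep _).sub (hrep _))).2.1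
  refine ⟨⟨aestronglyMeasurable_value H.isWeight ζ _, ψ, fun m => ⟨h1 m, h2 m⟩, ?_, ?_⟩,
    ⟨H.aestronglyMeasurable_fieldZ ζ, Ψ, fun m => ⟨h3 m, h4 m⟩, ?_, ?_⟩⟩
  · exact tendsto_of_tendsto_of_tendsto_of_le_of_le tendsto_const_nhds hK (fun _ => zero_le)
      fun m => le_self_add.trans (hb m)
  · exact tendsto_of_tendsto_of_tendsto_of_le_of_le tendsto_const_nhds hζ0 (fun _ => zero_le)
      fun m => (H.normSq_sub_le_enorm (hrep m) hself).1
  · exact tendsto_of_tendsto_of_tendsto_of_le_of_le tendsto_const_nhds hK (fun _ => zero_le)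
      fun m => le_add_self.trans (hb m)
  · exact tendsto_of_tendsto_of_tendsto_of_le_of_le tendsto_const_nhds hζ0 (fun _ => zero_le)
      fun m => (H.normSq_sub_le_enorm (hrep m) hself).2

end CoerciveModel

/-! ### The energy form -/

lemma innerUp_comm {G : Mat n} (hG : G.IsSymm) (P Q : Mat n) : innerUp G P Q = innerUp G Q P := by
  rw [innerUp, innerUp]
  calc _ = ∑ i, ∑ k, ∑ j, ∑ l, G i k * G j l * P i j * Q k l := sum_congr rfl fun i _ => sum_comm
    _ = ∑ k, ∑ i, ∑ l, ∑ j, G i k * G j l * P i j * Q k l := by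
        rw [sum_comm]
        exact sum_congr rfl fun k _ => sum_congr rfl fun i _ => sum_comm
    _ = ∑ k, ∑ l, ∑ i, ∑ j, G i k * G j l * P i j * Q k l := sum_congr rfl fun i _ => sum_comm
    _ = _ := by
        refine sum_congr rfl fun k _ => sum_congr rfl fun l _ => sum_congr rfl fun i _ => sum_congr
          rfl fun j _ => ?_
        rw [hG.apply i k, hG.apply j l]; ring

lemma innerUp_smul_left (G : Mat n) (t : ℝ) (P Q : Mat n) : innerUp G (t • P) Q = t * innerUp G P
    Q := by
  simp only [innerUp, mul_sum, Matrix.smul_apply, smul_eq_mul]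
  exact sum_congr rfl fun _ _ => sum_congr rfl fun _ _ => sum_congr rfl fun _ _ => sum_congr rfl
    fun _ _ => by ring

lemma innerUp_conj {G K : Mat n} (h : K * G = 1) (v v' : ℝ) (P Q : Mat n) : innerUp K
    (v • (G * P * G.transpose)) (v' • (G * Q * G.transpose)) = v * v' * innerUp G Q P := by
  rw [innerUp_eq, innerUp_eq]
  simp only [Matrix.mul_smul, Matrix.smul_mul, mul_conj_mul_conj h, Matrix.smul_apply, smul_eq_mul,
    mul_sum]
  exact sum_congr rfl fun _ _ => sum_congr rfl fun _ _ => by ring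

lemma abs_coefficient_sub_le {c : ℝ} (hc : 0 ≤ c) (hc1 : 22 * c ≤ 1)
    {x y d e v : ℝ} (hd : |d| ≤ 1) (he : |e| ≤ 1) (hx : |x - d| ≤ c) (hy : |y - e| ≤ c)
    (hv : |v - 1| ≤ c) : |x * y * v⁻¹ - d * e| ≤ 11 * c := by
  rw [abs_le] at hv
  have hv0 : 1 / 2 ≤ v := by linarith
  have hv1 : 0 < v := by linarith
  have h1 : |v⁻¹ - 1| ≤ 2 * c := by
    have : v⁻¹ - 1 = (1 - v) * v⁻¹ := by field_simp
    rw [this, abs_mul, abs_of_pos (inv_pos.2 hv1)]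
    have h2 : v⁻¹ ≤ 2 := by rw [inv_le_comm₀ hv1 (by norm_num)]; linarith
    have h3 : |1 - v| ≤ c := abs_le.2 ⟨by linarith, by linarith⟩
    calc _ ≤ c * 2 := mul_le_mul h3 h2 (inv_pos.2 hv1).le hc
      _ = _ := by ring
  have h2 : |v⁻¹| ≤ 2 := by
    have := abs_sub_abs_le_abs_sub v⁻¹ 1
    rw [abs_one] at this; linarith
  have h3 : |x| ≤ 2 := by have := abs_sub_abs_le_abs_sub x d; linarith
  have e1 : x * y * v⁻¹ - d * e = x * (y - e) * v⁻¹ + (x - d) * e * v⁻¹ + d * e * (v⁻¹ - 1) := by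
    ring
  rw [e1]
  have a1 : |x * (y - e) * v⁻¹| ≤ 2 * c * 2 := by
    rw [abs_mul, abs_mul]
    exact mul_le_mul (mul_le_mul h3 hy (abs_nonneg _) (by norm_num)) h2 (abs_nonneg _) (by positivity)
  have a2 : |(x - d) * e * v⁻¹| ≤ c * 1 * 2 := by
    rw [abs_mul, abs_mul]
    exact mul_le_mul (mul_le_mul hx he (abs_nonneg _) hc) h2 (abs_nonneg _) (by positivity)
  have a3 : |d * e * (v⁻¹ - 1)| ≤ 1 * 1 * (2 * c) := by
    rw [abs_mul, abs_mul]
    exact mul_le_mul (mul_le_mul hd he (abs_nonneg _) zero_le_one) h1 (abs_nonneg _) (by norm_num)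
  linarith [abs_add_le (x * (y - e) * v⁻¹ + (x - d) * e * v⁻¹) (d * e * (v⁻¹ - 1)), abs_add_le
    (x * (y - e) * v⁻¹) ((x - d) * e * v⁻¹)]

lemma abs_one_apply_le (a b : Fin n) : |𝟙 a b| ≤ 1 := by rw [Matrix.one_apply]; split_ifs <;> simp

lemma le_innerUp {c : ℝ} (hc : 0 ≤ c) (hn : 0 < n) (hs : 22 * c * n ^ 2 ≤ 1)
    {G : Mat n} (hG : ∀ a b, |G a b - 𝟙 a b| ≤ c)
    {v : ℝ} (hv : |v - 1| ≤ c) (X : Mat n) :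
    1 / 2 * ∑ a, ∑ b, X a b ^ 2 ≤ innerUp G X X * v⁻¹ := by
  have hn1 : (1 : ℝ) ≤ n ^ 2 := one_le_pow₀ (by exact_mod_cast hn)
  have hc1 : 22 * c ≤ 1 := by nlinarith
  set S := ∑ a, ∑ b, |X a b| with hS
  have hsum : S ^ 2 ≤ n ^ 2 * ∑ a, ∑ b, X a b ^ 2 := by
    have e1 := sq_sum_le_card_mul_sum_sq (s := Finset.univ) (f := fun a => ∑ b, |X a b|)
    have e2 : ∀ a, (∑ b, |X a b|) ^ 2 ≤ n * ∑ b, X a b ^ 2 := fun a => by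
      have := sq_sum_le_card_mul_sum_sq (s := Finset.univ) (f := fun b => |X a b|)
      simpa using this
    simp only [Finset.card_univ, Fintype.card_fin] at e1
    refine e1.trans ((mul_le_mul_of_nonneg_left (sum_le_sum fun a _ => e2 a) n.cast_nonneg).trans
      (le_of_eq ?_))
    rw [← mul_sum]; ring
  set T := ∑ a, ∑ b, X a b ^ 2 with hT
  have hT0 : 0 ≤ T := sum_nonneg fun _ _ => sum_nonneg fun _ _ => sq_nonneg _
  have e1 : T = innerUp 1 X X := by
    rw [innerUp_eq, Matrix.transpose_one, Matrix.one_mul, Matrix.mul_one, hT]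
    simp only [sq]
  have e2 : innerUp G X X * v⁻¹ - T = ∑ i, ∑ j, ∑ k, ∑ l, (G i k * G j l * v⁻¹ - 𝟙 i k * 𝟙 j l) *
        (X i j * X k l) := by
    rw [e1, innerUp, innerUp]
    simp only [sum_mul, ← sum_sub_distrib]
    exact sum_congr rfl fun _ _ => sum_congr rfl fun _ _ => sum_congr rfl fun _ _ => sum_congr rfl
      fun _ _ => by ring
  have e3 : |innerUp G X X * v⁻¹ - T| ≤ 11 * c * S ^ 2 := by
    have e4 : 11 * c * S ^ 2 = ∑ i, ∑ j, ∑ k, ∑ l, 11 * c * (|X i j| * |X k l|) := by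
      rw [sq, hS]
      simp only [sum_mul, mul_sum]
      exact sum_congr rfl fun _ _ => sum_congr rfl fun _ _ => sum_congr rfl fun _ _ => sum_congr rfl
        fun _ _ => by ring
    rw [e2, e4]
    refine (abs_sum_le_sum_abs _ _).trans (sum_le_sum fun i _ => ?_)
    refine (abs_sum_le_sum_abs _ _).trans (sum_le_sum fun j _ => ?_)
    refine (abs_sum_le_sum_abs _ _).trans (sum_le_sum fun k _ => ?_)
    refine (abs_sum_le_sum_abs _ _).trans (sum_le_sum fun l _ => ?_)
    rw [abs_mul, abs_mul (X i j)]
    exact mul_le_mul_of_nonneg_right (abs_coefficient_sub_le hc hc1 (abs_one_apply_le _ _)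
      (abs_one_apply_le _ _) (hG _ _) (hG _ _) hv) (by positivity)
  have e5 : 11 * c * S ^ 2 ≤ 1 / 2 * T := by
    have h1 := mul_le_mul_of_nonneg_left hsum (show 0 ≤ 11 * c by positivity)
    have h2 := mul_le_mul_of_nonneg_right hs hT0
    linarith
  linarith [(abs_le.1 e3).1]

end Completion

section Solve
variable {n : ℕ} {Ω : Set (E n)} {r ρ : Fn n} {s : ℝ} {g π : Tensor2 n}
  {c : ℝ} {M₁ M₂ : Fn n → VF n → Tensor2 n} {K : NNReal}
local notation "𝓧" => FieldSpace Ω (Slot n)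
local notation "𝓜" => CoerciveModel Ω r ρ s g π c M₁ M₂ K

/-- The integrand of the quadratic part of the functional, in terms of coordinate densities. -/
def fieldEnergy (g : Tensor2 n) (r ρ : Fn n) (s : ℝ) (ξ η : 𝓧) (x : E n) :
    ℝ :=
  (innerUp (g x) (fieldP r ρ s ξ x) (fieldP r ρ s η x) *
      (r x ^ (ℓ n (2 + s)) * ρ x) +
    innerUp (g x)⁻¹ (fieldQ r ρ s ξ x) (fieldQ r ρ s η x) *
      (r x ^ (ℓ n (1 + s)) * ρ x)) * (volDensity g x)⁻¹

namespace CoerciveModel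

lemma abs_coefficient_le (H : 𝓜) {G : Tensor2 n} (hG : ∀ x ∈ Ω, ∀ a b, |G x a b - 𝟙 a b| ≤ c)
    {x : E n} (hx : x ∈ Ω) (i j k l : Fin n) : |G x i k * G x j l * (volDensity g x)⁻¹| ≤ 2 := by
  have hn1 : (1 : ℝ) ≤ n ^ 2 := one_le_pow₀ (by exact_mod_cast H.dim_pos)
  have hc := H.nonneg
  have hc1 : 22 * c ≤ 1 := by nlinarith [H.small]
  have h1 := abs_coefficient_sub_le hc hc1 (abs_one_apply_le i k) (abs_one_apply_le j l)
    (hG x hx i k) (hG x hx j l) (H.model.density x hx)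
  have h2 : |𝟙 i k * 𝟙 j l| ≤ 1 := by
    rw [abs_mul]
    exact mul_le_one₀ (abs_one_apply_le _ _) (abs_nonneg _) (abs_one_apply_le _ _)
  have h3 := abs_sub_abs_le_abs_sub (G x i k * G x j l * (volDensity g x)⁻¹) (𝟙 i k * 𝟙 j l)
  linarith

lemma exists_tensorForm (H : 𝓜) {G : Tensor2 n} (hG : ∀ x ∈ Ω, ∀ a b, |G x a b - 𝟙 a b| ≤ c)
    (hGc : ∀ a b, ContinuousOn (fun x => G x a b) Ω) (slot : Fin n × Fin n → Slot n)
    {w : Fn n} (hw : ∀ i, slotWeight r ρ s (slot i) = w) :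
    ∃ B : 𝓧 →L[ℝ] 𝓧 →L[ℝ] ℝ, ∀ ξ η, IntegrableOn (fun x => innerUp (G x)
          (Matrix.of fun a b => value (slotWeight r ρ s) ξ (slot (a, b)) x)
          (Matrix.of fun a b => value (slotWeight r ρ s) η (slot (a, b)) x) * w x *
        (volDensity g x)⁻¹) Ω ∧ B ξ η = ∫ x in Ω, innerUp (G x)
          (Matrix.of fun a b => value (slotWeight r ρ s) ξ (slot (a, b)) x)
          (Matrix.of fun a b => value (slotWeight r ρ s) η (slot (a, b)) x) * w x *
        (volDensity g x)⁻¹ := by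
  choose B hB using fun i j k l : Fin n => exists_bilin H.isOpen.measurableSet H.isWeight
    (slot (i, j)) (slot (k, l)) ((hw _).trans (hw _).symm)
    (κ := fun x => G x i k * G x j l * (volDensity g x)⁻¹)
    ((((hGc i k).mul (hGc j l)).mul H.model.inv_density_continuousOn).aestronglyMeasurable
      H.isOpen.measurableSet) (C := 2) fun x hx => H.abs_coefficient_le hG hx i j k l
  have e : ∀ (ξ η : 𝓧) x, innerUp (G x)
      (Matrix.of fun a b => value (slotWeight r ρ s) ξ (slot (a, b)) x)
      (Matrix.of fun a b => value (slotWeight r ρ s) η (slot (a, b)) x) * w x * (volDensity g x)⁻¹ =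
      ∑ i, ∑ j, ∑ k, ∑ l, G x i k * G x j l * (volDensity g x)⁻¹ *
        (slotWeight r ρ s (slot (i, j)) x * (value (slotWeight r ρ s) ξ (slot (i, j)) x * value
          (slotWeight r ρ s) η (slot (k, l)) x)) := fun ξ η x => by
    simp only [innerUp, sum_mul, Matrix.of_apply, hw]
    exact sum_congr rfl fun _ _ => sum_congr rfl fun _ _ => sum_congr rfl fun _ _ => sum_congr rfl
      fun _ _ => by ring
  refine ⟨∑ i, ∑ j, ∑ k, ∑ l, B i j k l, fun ξ η => ?_⟩
  simp only [e]
  have i4 := fun i j k => integrable_finsetSum Finset.univ fun l _ => (hB i j k l ξ η).1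
  have i3 := fun i j => integrable_finsetSum Finset.univ fun k _ => i4 i j k
  have i2 := fun i => integrable_finsetSum Finset.univ fun j _ => i3 i j
  refine ⟨integrable_finsetSum _ fun i _ => i2 i, ?_⟩
  rw [integral_finsetSum _ fun i _ => i2 i]
  simp only [sum_apply]
  refine sum_congr rfl fun i _ => ?_
  rw [integral_finsetSum _ fun j _ => i3 i j]
  refine sum_congr rfl fun j _ => ?_
  rw [integral_finsetSum _ fun k _ => i4 i j k]
  refine sum_congr rfl fun k _ => ?_
  rw [integral_finsetSum _ fun l _ => (hB i j k l ξ η).1]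
  exact sum_congr rfl fun l _ => (hB i j k l ξ η).2

lemma exists_energyForm (H : 𝓜) : ∃ B : 𝓧 →L[ℝ] 𝓧 →L[ℝ] ℝ, ∀ ξ η, IntegrableOn
      (fieldEnergy g r ρ s ξ η) Ω ∧ B ξ η = ∫ x in Ω, fieldEnergy g r ρ s ξ η x := by
  obtain ⟨B₁, h1⟩ := H.exists_tensorForm H.model.metric H.model.metric_continuousOn
    (fun i => .inr (.inl i)) (w := fun x => r x ^ (ℓ n (2 + s)) * ρ x) fun _ => rfl
  obtain ⟨B₂, h2⟩ := H.exists_tensorForm H.model.inverse H.model.inverse_continuousOn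
    (fun i => .inr (.inr i)) (w := fun x => r x ^ (ℓ n (1 + s)) * ρ x) fun _ => rfl
  refine ⟨B₁ + B₂, fun ξ η => ?_⟩
  have e : fieldEnergy g r ρ s ξ η = fun x => innerUp (g x) (fieldP r ρ s ξ x) (fieldP r ρ s η x) *
        (r x ^ (ℓ n (2 + s)) * ρ x) * (volDensity g x)⁻¹ + innerUp (g x)⁻¹ (fieldQ r ρ s ξ x)
      (fieldQ r ρ s η x) * (r x ^ (ℓ n (1 + s)) * ρ x) * (volDensity g x)⁻¹ := by
    funext x; rw [fieldEnergy, add_mul]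
  rw [e, add_apply, add_apply, (h1 ξ η).2, (h2 ξ η).2]
  exact ⟨(h1 ξ η).1.add (h2 ξ η).1, (integral_add (h1 ξ η).1 (h2 ξ η).1).symm⟩

lemma integral_value_sq (H : 𝓜) (ξ : 𝓧) (j : Slot n) : IntegrableOn
    (fun x => value (slotWeight r ρ s) ξ j x ^ 2 * slotWeight r ρ s j x) Ω ∧ ∫ x in Ω, value
      (slotWeight r ρ s) ξ j x ^ 2 * slotWeight r ρ s j x = ‖ξ j‖ ^ 2 := by
  have he : (fun x => inner ℝ (ξ j x) (ξ j x)) =ᵐ[𝔪 Ω] fun x => value (slotWeight r ρ s) ξ j x ^ 2 *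
      slotWeight r ρ s j x := by
    filter_upwards [ae_restrict_mem H.isOpen.measurableSet] with x hx
    have h := H.isWeight.pos j x hx
    rw [value, div_pow, sq_sqrt h.le, div_mul_cancel₀ _ h.ne']
    simp only [RCLike.inner_apply, conj_trivial, sq]
  refine ⟨(L2.integrable_inner (ξ j) (ξ j)).congr he, ?_⟩
  rw [← integral_congr_ae he, ← real_inner_self_eq_norm_sq]
  exact (L2.inner_def (ξ j) (ξ j)).symm

lemma le_energyForm (H : 𝓜) (ξ : 𝓧) (hi : IntegrableOn (fieldEnergy g r ρ s ξ ξ) Ω) : 1 / 2 *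
    ((∑ a, ∑ b, ‖ξ (.inr (.inl (a, b)))‖ ^ 2) + ∑ a, ∑ b, ‖ξ (.inr (.inr (a, b)))‖ ^ 2) ≤ ∫ x in Ω,
      fieldEnergy g r ρ s ξ ξ x := by
  have hI := fun j => H.integral_value_sq ξ j
  have hS : ∀ slot : Fin n × Fin n → Slot n, IntegrableOn
      (fun x => ∑ a, ∑ b, value (slotWeight r ρ s) ξ (slot (a, b)) x ^ 2 * slotWeight r ρ s
        (slot (a, b)) x) Ω ∧ ∫ x in Ω, ∑ a, ∑ b, value (slotWeight r ρ s) ξ (slot (a, b)) x ^ 2 *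
        slotWeight r ρ s (slot (a, b)) x = ∑ a, ∑ b, ‖ξ (slot (a, b))‖ ^ 2 := fun slot => by
    have i1 := fun a => integrable_finsetSum Finset.univ fun b _ => (hI (slot (a, b))).1
    refine ⟨integrable_finsetSum _ fun a _ => i1 a, ?_⟩
    rw [integral_finsetSum _ fun a _ => i1 a]
    refine sum_congr rfl fun a _ => ?_
    rw [integral_finsetSum _ fun b _ => (hI (slot (a, b))).1]
    exact sum_congr rfl fun b _ => (hI (slot (a, b))).2
  have h1 := hS fun i => .inr (.inl i)
  have h2 := hS fun i => .inr (.inr i)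
  rw [← h1.2, ← h2.2, ← integral_add h1.1 h2.1, ← integral_const_mul]
  refine setIntegral_mono_on ((h1.1.add h2.1).const_mul _) hi H.isOpen.measurableSet fun x hx => ?_
  have w1 : 0 ≤ r x ^ (ℓ n (2 + s)) * ρ x := mul_nonneg (rpow_nonneg (H.pos x).le _)
    (H.boundary_nonneg x)
  have w2 : 0 ≤ r x ^ (ℓ n (1 + s)) * ρ x := mul_nonneg (rpow_nonneg (H.pos x).le _)
    (H.boundary_nonneg x)
  have k1 := mul_le_mul_of_nonneg_right (le_innerUp H.nonneg H.dim_pos H.small (H.model.metric x hx)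
    (H.model.density x hx) (fieldP r ρ s ξ x)) w1
  have k2 := mul_le_mul_of_nonneg_right (le_innerUp H.nonneg H.dim_pos H.small
    (H.model.inverse x hx) (H.model.density x hx) (fieldQ r ρ s ξ x)) w2
  simp only [slotWeight, ← sum_mul]
  change 1 / 2 * ((∑ a, ∑ b, fieldP r ρ s ξ x a b ^ 2) * _ + (∑ a, ∑ b, fieldQ r ρ s ξ x a b ^ 2) *
    _) ≤ _
  rw [fieldEnergy]
  linarith

lemma energyForm_coercive (H : 𝓜)
    {B : 𝓧 →L[ℝ] 𝓧 →L[ℝ] ℝ}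
    (hB : ∀ ξ η, IntegrableOn (fieldEnergy g r ρ s ξ η) Ω ∧ B ξ η = ∫ x in Ω, fieldEnergy g r ρ s ξ
      η x) {ξ : 𝓧}
    (hξ : ξ ∈ H.completeFields) : (2 * ((K : ℝ) + 1))⁻¹ * ‖ξ‖ ^ 2 ≤ B ξ ξ := by
  have hcl : IsClosed {ξ : 𝓧 | (2 * ((K : ℝ) + 1))⁻¹ * ‖ξ‖ ^ 2 ≤ B ξ ξ} := isClosed_le
    (by fun_prop) (by fun_prop)
  refine closure_minimal (s := (H.smoothFields : Set (𝓧))) ?_ hcl hξ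
  rintro ξ ⟨hf, u, Z, h1, h2, h3, h4, h5⟩
  have h6 := (H.smooth_bounds hf h1 h2 h3 h4 h5).2.2
  rw [H.adjointNormSq_field] at h6
  simp only [enorm_sq_eq_ofReal] at h6
  have h7 := H.le_energyForm ξ (hB ξ ξ).1
  rw [← (hB ξ ξ).2] at h7
  have p1 : 0 ≤ ∑ a, ∑ b, ‖ξ (.inr (.inl (a, b)))‖ ^ 2 := sum_nonneg fun _ _ => sum_nonneg
    fun _ _ => sq_nonneg _
  have p2 : 0 ≤ ∑ a, ∑ b, ‖ξ (.inr (.inr (a, b)))‖ ^ 2 := sum_nonneg fun _ _ => sum_nonneg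
    fun _ _ => sq_nonneg _
  have e1 : ∀ F : Fin n → Fin n → ℝ, ∑ a, ∑ b, ofReal (F a b ^ 2) = ofReal (∑ a, ∑ b, F a b ^ 2) :=
      fun F => by
    rw [ofReal_sum_of_nonneg fun a _ => sum_nonneg fun b _ => sq_nonneg _]
    exact sum_congr rfl fun a _ => (ofReal_sum_of_nonneg fun b _ => sq_nonneg _).symm
  rw [e1 fun a b => ‖ξ (.inr (.inl (a, b)))‖, e1 fun a b => ‖ξ (.inr (.inr (a, b)))‖, ← ofReal_add
    p1 p2, show (K + 1 : ℝ≥0∞) = ofReal ((K : ℝ) + 1) by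
      rw [ofReal_add K.coe_nonneg zero_le_one, ofReal_coe_nnreal, ofReal_one],
    ← ofReal_mul (by positivity),
    ENNReal.ofReal_le_ofReal_iff (mul_nonneg (by positivity) (add_nonneg p1 p2))] at h6
  have hK : (0 : ℝ) < K + 1 := by positivity
  rw [mem_ofPred_eq, inv_mul_le_iff₀ (by positivity)]
  nlinarith

lemma energyForm_comm (H : 𝓜) (ξ η : 𝓧) : ∫ x in Ω, fieldEnergy g r ρ s ξ η x = ∫ x in Ω,
    fieldEnergy g r ρ s η ξ x := by
  refine setIntegral_congr_fun H.isOpen.measurableSet fun x hx => ?_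
  have h1 := H.model.symm x hx
  have h2 : ((g x)⁻¹).IsSymm := by rw [Matrix.IsSymm, Matrix.transpose_nonsing_inv, h1.eq]
  simp only [fieldEnergy]
  rw [innerUp_comm h1, innerUp_comm h2]

lemma exists_source (H : 𝓜) {ρ' : Fn n} (hρ' : ∀ x, ρ' x = (ρ x)⁻¹) {f : Fn n} {V : VF n}
    (hf : MemL2 Ω r ρ' ((n : ℝ) - s) f) (hV : MemL2 Ω r ρ' ((n : ℝ) - s) V) : ∃ Λ : 𝓧 →L[ℝ] ℝ, ∀ ξ,
      IntegrableOn (fun x => (f x * fieldU r ρ s ξ x + innerVec (g x) (V x) (fieldZ r ρ s ξ x)) *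
        volDensity g x) Ω ∧ Λ ξ = ∫ x in Ω,
      (f x * fieldU r ρ s ξ x + innerVec (g x) (V x) (fieldZ r ρ s ξ x)) * volDensity g x := by
  have hΩ := H.isOpen.measurableSet
  have hn1 : (1 : ℝ) ≤ n ^ 2 := one_le_pow₀ (by exact_mod_cast H.dim_pos)
  have hc1 : 22 * c ≤ 1 := by nlinarith [H.small, H.nonneg]
  have hvol : ∀ x ∈ Ω, |volDensity g x| ≤ 2 := fun x hx => by
    have h1 := H.model.density x hx
    have h2 := abs_sub_abs_le_abs_sub (volDensity g x) 1
    rw [abs_one] at h2; linarith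
  have hmet : ∀ x ∈ Ω, ∀ a b, |g x a b| ≤ 2 := fun x hx a b => by
    have h1 := H.model.metric x hx a b
    have h2 := abs_sub_abs_le_abs_sub (g x a b) (𝟙 a b)
    have h3 := abs_one_apply_le a b
    linarith
  have hwt : ∀ (k : Option (Fin n)) x, (slotWeight r ρ s (.inl k) x)⁻¹ = r x ^ (ℓ n (n - s)) * ρ'
      x := fun k x => by
    rw [slotWeight, mul_inv, ← Real.rpow_neg (H.pos x).le, hρ']
    congr 2; ring
  have hvm := H.model.density_continuousOn.aestronglyMeasurable (μ := volume) hΩ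
  have hdom : ∀ {F : Fn n} {W : VF n} (C : ℝ), normSq Ω r ρ' 0 (n - s) W < ⊤ →
      (∀ x ∈ Ω, |F x| ≤ C * ‖W x‖) → ∀ k : Option (Fin n), ∫⁻ x in Ω, ‖F x‖ₑ ^ 2 * ofReal
      (slotWeight r ρ s (.inl k) x)⁻¹ < ⊤ := by
    intro F W C hW hF k
    rw [normSq_zero] at hW
    refine lt_of_le_of_lt ?_ (ENNReal.mul_lt_top (a := ofReal (C ^ 2)) (by simp) hW)
    rw [← lintegral_const_mul' _ _ (by simp)]
    refine setLIntegral_mono' (μ := volume) hΩ fun x hx => ?_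
    rw [hwt, ← mul_assoc]
    refine mul_le_mul_left ?_ _
    rw [enorm_sq_eq_ofReal, enorm_sq_eq_ofReal, ← ofReal_mul (sq_nonneg _), ← mul_pow]
    exact ofReal_le_ofReal (pow_le_pow_left₀ (norm_nonneg _) (hF x hx) 2)
  have hdom' : ∀ {F : Fn n} (C : ℝ), (∀ x ∈ Ω, |F x| ≤ C * |f x|) → ∀ k : Option (Fin n), ∫⁻ x in Ω,
      ‖F x‖ₑ ^ 2 * ofReal (slotWeight r ρ s (.inl k) x)⁻¹ < ⊤ := by
    intro F C hF k
    have hW := hf.2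
    rw [normSq_zero] at hW
    refine lt_of_le_of_lt ?_ (ENNReal.mul_lt_top (a := ofReal (C ^ 2)) (by simp) hW)
    rw [← lintegral_const_mul' _ _ (by simp)]
    refine setLIntegral_mono' (μ := volume) hΩ fun x hx => ?_
    rw [hwt, ← mul_assoc]
    refine mul_le_mul_left ?_ _
    rw [enorm_sq_eq_ofReal, enorm_sq_eq_ofReal, ← ofReal_mul (sq_nonneg _), ← mul_pow]
    exact ofReal_le_ofReal (pow_le_pow_left₀ (norm_nonneg _) (hF x hx) 2)
  obtain ⟨Λ₀, h0⟩ := Constraint.exists_pairing hΩ H.isWeight (.inl none)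
    (F := fun x => f x * volDensity g x) (hf.1.mul hvm) (hdom' 2 (fun x hx => by
      rw [abs_mul, mul_comm]
      exact mul_le_mul_of_nonneg_right (hvol x hx) (abs_nonneg _)) none)
  have hVc : ∀ j, AEStronglyMeasurable (fun x => V x j) (𝔪 Ω) := fun j =>
    (proj (𝕜 := ℝ) j : E n →L[ℝ] ℝ).continuous.comp_aestronglyMeasurable hV.1
  choose Λ₁ h1 using fun k : Fin n => Constraint.exists_pairing hΩ H.isWeight (.inl (some k))
    (F := fun x => (∑ j, g x j k * V x j) * volDensity g x)
    ((Finset.aestronglyMeasurable_fun_sum _ fun j _ =>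
      ((H.model.metric_continuousOn j k).aestronglyMeasurable hΩ).mul (hVc j)).mul hvm)
    (hdom (n * 2 * 2) hV.2 (fun x hx => by
      rw [abs_mul]
      have h2 : |∑ j, g x j k * V x j| ≤ n * 2 * ‖V x‖ := by
        refine (abs_sum_le_sum_abs _ _).trans ?_
        refine (sum_le_sum (g := fun _ => 2 * ‖V x‖) fun j _ => ?_).trans (le_of_eq ?_)
        · rw [abs_mul]
          exact mul_le_mul (hmet x hx j k) (PiLp.norm_apply_le (V x) j) (abs_nonneg _) (by norm_num)
        · simp; ring
      calc _ ≤ n * 2 * ‖V x‖ * 2 := mul_le_mul h2 (hvol x hx) (abs_nonneg _) (by positivity)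
        _ = _ := by ring) (some k))
  refine ⟨Λ₀ + ∑ k, Λ₁ k, fun ξ => ?_⟩
  have e : (fun x => (f x * fieldU r ρ s ξ x + innerVec (g x) (V x) (fieldZ r ρ s ξ x)) * volDensity
      g x) = fun x => f x * volDensity g x * value (slotWeight r ρ s) ξ (.inl none) x + ∑ k,
      (∑ j, g x j k * V x j) * volDensity g x * value (slotWeight r ρ s) ξ (.inl (some k)) x := by
    funext x
    rw [add_mul, innerVec_mul]
    congr 1
    rw [fieldU]; ring
  rw [e]
  have i1 := integrable_finsetSum Finset.univ fun k _ => (h1 k ξ).1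
  refine ⟨(h0 ξ).1.add i1, ?_⟩
  rw [integral_add (h0 ξ).1 i1, integral_finsetSum _ fun k _ => (h1 k ξ).1, add_apply, sum_apply,
    (h0 ξ).2]
  congr 1
  exact sum_congr rfl fun k _ => (h1 k ξ).2

end CoerciveModel

end Solve

section Minimize
variable {n : ℕ} {Ω : Set (E n)} {r ρ : Fn n} {s p : ℝ} {g π : Tensor2 n}
  {c : ℝ} {M₁ M₂ : Fn n → VF n → Tensor2 n} {K : NNReal} {Z : VF n} {u : Fn n} {f : Fn n}
local notation "𝓧" => FieldSpace Ω (Slot n)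
local notation "𝓜" => CoerciveModel Ω r ρ s g π c M₁ M₂ K

namespace CoerciveModel

lemma adjoint_of_isField (H : 𝓜) {ξ : 𝓧} (hξ : IsField Ω r ρ s g π ξ) (h : Represents r ρ s ξ u Z) :
    IsAdjoint Ω g π u Z (adjoint Ω g π u Z) ∧ ∀ᵐ x ∂𝔪 Ω, (adjoint Ω g π u Z).1 x =
        (volDensity g x)⁻¹ • (g x * fieldP r ρ s ξ x * (g x).transpose) ∧ (adjoint Ω g π u Z).2 x =
        (volDensity g x)⁻¹ • ((g x)⁻¹ * fieldQ r ρ s ξ x * ((g x)⁻¹).transpose) :=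
  H.model.adjoint_ae_eq H.isOpen (fun h' τ hh hτ => (hξ.adjoint h' τ hh hτ).congr h.1 h.2 .rfl .rfl)
    (H.isLocIntTensor_fieldP hξ) (H.isLocIntTensor_fieldQ hξ)

lemma ae_inner_adjoint (H : 𝓜) {ξ η : 𝓧} (hξ : IsField Ω r ρ s g π ξ) (hη : IsField Ω r ρ s g π η)
    {u v : Fn n} {Z W : VF n} (h : Represents r ρ s ξ u Z) (h' : Represents r ρ s η v W) : ∀ᵐ x ∂𝔪
    Ω, (innerLow (g x) ((adjoint Ω g π u Z).1 x) ((adjoint Ω g π v W).1 x) *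
          (r x ^ (ℓ n (2 + s)) * ρ x) + innerUp (g x) ((adjoint Ω g π u Z).2 x)
        ((adjoint Ω g π v W).2 x) * (r x ^ (ℓ n (1 + s)) * ρ x)) * volDensity g x = fieldEnergy g r
        ρ s η ξ x := by
  filter_upwards [(H.adjoint_of_isField hξ h).2, (H.adjoint_of_isField hη h').2, ae_restrict_mem
    H.isOpen.measurableSet] with x h1 h2 hx
  have hv := (H.model.volDensity_pos hx).ne'
  rw [h1.1, h1.2, h2.1, h2.2, innerLow, innerUp_conj
    (Matrix.nonsing_inv_mul _ (H.model.isUnit_det hx)), innerUp_conj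
    (Matrix.mul_nonsing_inv _ (H.model.isUnit_det hx)), fieldEnergy]
  field_simp

lemma energy_eq (H : CoerciveModel Ω r ρ ((n : ℝ) - p - 2) g π c M₁ M₂ K)
    {B : 𝓧 →L[ℝ] 𝓧 →L[ℝ] ℝ}
    (hB : ∀ ξ η, IntegrableOn (fieldEnergy g r ρ ((n : ℝ) - p - 2) ξ η) Ω ∧ B ξ η = ∫ x in Ω,
      fieldEnergy g r ρ ((n : ℝ) - p - 2) ξ η x)
    {V : VF n} {Λ : 𝓧 →L[ℝ] ℝ}
    (hΛ : ∀ ξ, IntegrableOn (fun x => (f x * fieldU r ρ ((n : ℝ) - p - 2) ξ x + innerVec (g x) (V x)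
        (fieldZ r ρ ((n : ℝ) - p - 2) ξ x)) * volDensity g x) Ω ∧ Λ ξ = ∫ x in Ω,
      (f x * fieldU r ρ ((n : ℝ) - p - 2) ξ x + innerVec (g x) (V x)
        (fieldZ r ρ ((n : ℝ) - p - 2) ξ x)) * volDensity g x)
    {ξ : 𝓧} (hξ : IsField Ω r ρ ((n : ℝ) - p - 2) g π ξ)
    (h : Represents r ρ ((n : ℝ) - p - 2) ξ u Z) :
    IntegrableOn (energyDensity Ω g π r ρ p f V u Z) Ω ∧ energy Ω g π r ρ p f V u Z = 1 / 2 * B ξ ξ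
      - Λ ξ := by
  have he : (fun x => 1 / 2 * fieldEnergy g r ρ ((n : ℝ) - p - 2) ξ ξ x -
      (f x * fieldU r ρ ((n : ℝ) - p - 2) ξ x + innerVec (g x) (V x)
        (fieldZ r ρ ((n : ℝ) - p - 2) ξ x)) * volDensity g x) =ᵐ[𝔪 Ω] energyDensity Ω g π r ρ p f V
      u Z := by
    filter_upwards [H.ae_inner_adjoint hξ hξ h h, h.1, h.2] with x h1 h2 h3
    rw [← h1, h2, h3, energyDensity, show -(n : ℝ) + 2 * (2 + ((n : ℝ) - p - 2)) = n - 2 * p by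
      ring, show -(n : ℝ) + 2 * (1 + ((n : ℝ) - p - 2)) = n - 2 * p - 2 by ring]
    ring
  have hi := ((hB ξ ξ).1.const_mul (1 / 2)).sub (hΛ ξ).1
  refine ⟨hi.congr he, ?_⟩
  rw [energy, ← integral_congr_ae he, integral_sub ((hB ξ ξ).1.const_mul (1 / 2)) (hΛ ξ).1,
    integral_const_mul, ← (hB ξ ξ).2, ← (hΛ ξ).2]

lemma represents_self (ξ : 𝓧) : Represents r ρ s ξ (fieldU r ρ s ξ) (fieldZ r ρ s ξ) := ⟨.rfl, .rfl⟩

lemma isLocIntTensor_smul {h : Tensor2 n} {w : Fn n} (hΩ : IsOpen Ω) (hw : Continuous w)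
    (hh : IsLocIntTensor Ω h) : IsLocIntTensor Ω fun x => w x • h x :=
  ⟨fun x => (hh.1 x).smul _, fun i j => (hh.2 i j).continuousOn_mul hw.continuousOn
    hΩ.isLocallyClosed⟩

lemma uniquelySolvable (H : CoerciveModel Ω r ρ ((n : ℝ) - p - 2) g π c M₁ M₂ K)
    {ρ' : Fn n} (hρ' : ∀ x, ρ' x = (ρ x)⁻¹) {V : VF n}
    (hf : MemL2 Ω r ρ' (p + 2) f) (hV : MemL2 Ω r ρ' (p + 2) V) :
    UniquelySolvable Ω g π r ρ p f V := by
  rw [show p + 2 = (n : ℝ) - ((n : ℝ) - p - 2) by ring] at hf hV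
  obtain ⟨Λ, hΛ⟩ := H.exists_source hρ' hf hV
  obtain ⟨B, hB⟩ := H.exists_energyForm
  set s : ℝ := (n : ℝ) - p - 2 with hs
  have hcoer := fun {ξ} (hξ : ξ ∈ H.completeFields) => H.energyForm_coercive hB hξ
  have hc0 : 0 < (2 * ((K : ℝ) + 1))⁻¹ := by positivity
  obtain ⟨ξ, hξ, hEL⟩ := exists_forall_eq_of_coercive H.completeFields
    (Submodule.isClosed_topologicalClosure _) B hc0 (fun η hη => hcoer hη) Λ
  have hsymm : ∀ ξ η, B ξ η = B η ξ := fun ξ η => by rw [(hB ξ η).2, (hB η ξ).2, H.energyForm_comm]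
  have hquad : ∀ η ∈ H.completeFields, 1 / 2 * B η η - Λ η = (1 / 2 * B ξ ξ - Λ ξ) + 1 / 2 * B
      (η - ξ) (η - ξ) := fun η hη => by
    rw [← hEL η hη, ← hEL ξ hξ]
    simp only [map_sub, sub_apply]
    rw [hsymm η ξ]; ring
  have hE := fun {η} (hη : η ∈ H.completeFields) {u : Fn n} {Z : VF n}
    (h : Represents r ρ s η u Z) => H.energy_eq hB hΛ (H.isField_of_mem hη) h
  refine ⟨fun u Z hd => ?_, fieldU r ρ s ξ, fieldZ r ρ s ξ, ⟨H.memSobolev_of_mem hξ, ?_⟩, ?_, ?_⟩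
  · obtain ⟨η, hη, hrep⟩ := H.exists_field_of_memSobolev hd.1 hd.2
    exact ⟨(H.adjoint_of_isField (H.isField_of_mem hη) hrep).1, (hE hη hrep).1⟩
  · intro u' Z' hd
    obtain ⟨η, hη, hrep⟩ := H.exists_field_of_memSobolev hd.1 hd.2
    rw [(hE hξ (represents_self ξ)).2, (hE hη hrep).2, hquad η hη]
    have := hcoer (H.completeFields.sub_mem hη hξ)
    have h2 : 0 ≤ (2 * ((K : ℝ) + 1))⁻¹ * ‖η - ξ‖ ^ 2 := by positivity
    linarith
  · intro u' Z' hmin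
    obtain ⟨η, hη, hrep⟩ := H.exists_field_of_memSobolev hmin.1.1 hmin.1.2
    have h1 := hmin.2 _ _ (H.memSobolev_of_mem hξ)
    rw [(hE hξ (represents_self ξ)).2, (hE hη hrep).2, hquad η hη] at h1
    have h2 := hcoer (H.completeFields.sub_mem hη hξ)
    have h3 : ‖η - ξ‖ ^ 2 = 0 := by
      refine le_antisymm ?_ (sq_nonneg _)
      by_contra h
      have := mul_pos hc0 (not_le.1 h)
      linarith
    have h4 : η = ξ := sub_eq_zero.1 (norm_eq_zero.1 (pow_eq_zero_iff two_ne_zero |>.1 h3))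
    subst h4
    exact ⟨hrep.1.symm, hrep.2.symm⟩
  · have hwc : ∀ m : ℝ, Continuous fun x => r x ^ m * ρ x := fun m =>
      (H.continuous.rpow_const fun x => Or.inl (H.pos x).ne').mul H.continuous_boundary
    have hfield := H.isField_of_mem hξ
    have hadj := (H.adjoint_of_isField hfield (represents_self ξ)).1
    refine ⟨isLocIntTensor_smul H.isOpen (hwc _) hadj.1, isLocIntTensor_smul H.isOpen (hwc _)
      hadj.2.1, fun u Z hu hZ => ?_⟩
    have hZs : Smooth Z := contDiff_euclidean.2 fun i => (hZ i).1
    have hZc : HasCompactSupport Z := by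
      refine HasCompactSupport.intro (isCompact_iUnion fun i => (hZ i).2.1.isCompact) fun x hx => ?_
      rw [mem_iUnion, not_exists] at hx
      ext i
      exact image_eq_zero_of_notMem_tsupport (f := fun x => Z x i) (hx i)
    obtain ⟨η, hη, hrep⟩ := H.exists_smooth hu.1 hu.2.1 hZs hZc
    have hηK : η ∈ H.completeFields := Submodule.le_topologicalClosure _
      ⟨hη, u, Z, hu.1, hu.2.1, hZs, hZc, hrep⟩
    have e1 := H.ae_inner_adjoint hfield hη (represents_self ξ) hrep
    have e2 : ∫ x in Ω, (f x * u x + innerVec (g x) (V x) (Z x)) * volDensity g x = Λ η := by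
      rw [(hΛ η).2]
      refine integral_congr_ae ?_
      filter_upwards [hrep.1, hrep.2] with x h1 h2
      rw [h1, h2]
    rw [e2, ← hEL η hηK, hsymm, (hB η ξ).2]
    refine integral_congr_ae ?_
    filter_upwards [e1] with x hx
    rw [← hx, show ℓ n (2 + s) = n - 2 * p by rw [hs]; ring,
      show ℓ n (1 + s) = n - 2 * p - 2 by rw [hs]; ring]
    simp only [innerLow, innerUp_smul_left]
    ring

end CoerciveModel

end Minimize

section Symbols
variable {n : ℕ}

lemma norm_iteratedFDeriv_pd_le {Ω : Set (E n)} (hΩ : IsOpen Ω) {F : Fn n} {j : ℕ}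
    (hF : ContDiffOn ℝ ((j + 1 : ℕ) : WithTop ℕ∞) F Ω) {x : E n} (hx : x ∈ Ω) (a : Fin n) :
    ‖iteratedFDeriv ℝ j (pd a F) x‖ ≤ ‖iteratedFDeriv ℝ (j + 1) F x‖ := by
  have h1 : ContDiffAt ℝ j (fderiv ℝ F) x :=
    (hF.fderiv_of_isOpen hΩ (m := j) (by norm_cast)).contDiffAt (hΩ.mem_nhds hx)
  have h2 := ContinuousLinearMap.norm_iteratedFDeriv_comp_left
    (ContinuousLinearMap.apply ℝ ℝ (single a (1 : ℝ) : E n)) h1 (n := j) le_rfl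
  rw [norm_iteratedFDeriv_fderiv] at h2
  have h3 : ‖ContinuousLinearMap.apply ℝ ℝ (single a (1 : ℝ) : E n)‖ ≤ 1 := by
    refine ContinuousLinearMap.opNorm_le_bound _ zero_le_one fun L => ?_
    have := L.le_opNorm (single a (1 : ℝ))
    simpa using this
  exact h2.trans (mul_le_of_le_one_left (norm_nonneg _) h3)

variable {𝓕 : RegionFamily n} {σ : 𝓕.ι → ℝ}

lemma Sym.of_iteratedFDeriv : ∀ {k m : ℕ} {F : 𝓕.ι → Fn n},
    (∀ᶠ i in 𝓕.l, ContDiffOn ℝ k (F i) (𝓕.Ω i)) →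
    (∃ C : ℝ, 0 ≤ C ∧ ∀ᶠ i in 𝓕.l, ∀ j ≤ k, ∀ x ∈ 𝓕.Ω i, ‖iteratedFDeriv ℝ j (F i) x‖ * 𝓕.r i x ^
      (m + j) ≤ C * σ i) → Sym 𝓕 σ k m F
  | 0, m, F, hs, ⟨C, hC0, hC⟩ => ⟨hs, C, hC0, hC.mono fun i hi x hx => by
      simpa using hi 0 le_rfl x hx⟩
  | k + 1, m, F, hs, ⟨C, hC0, hC⟩ => by
    refine Sym.mk_succ hs ⟨C, hC0, hC.mono fun i hi x hx => by
      simpa using hi 0 (Nat.zero_le _) x hx⟩ fun a => Sym.of_iteratedFDeriv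
        (hs.mono fun i h => ContDiffOn.pd (𝓕.isOpen i) h a) ⟨C, hC0, ?_⟩
    filter_upwards [hs, hC] with i h1 h2 j hj x hx
    refine le_trans ?_ (h2 (j + 1) (by omega) x hx)
    rw [show m + 1 + j = m + (j + 1) by ring]
    have := (pow_pos (𝓕.pos i x) (m + (j + 1))).le
    gcongr
    exact norm_iteratedFDeriv_pd_le (𝓕.isOpen i) (h1.of_le (by exact_mod_cast by omega)) hx a

end Symbols

section Geometry
variable {n : ℕ} {θ₁ θ₂ : ℝ}

lemma norm_iteratedFDeriv_place (a : E n) (T : E n ≃ₗᵢ[ℝ] E n) (f : Fn n) (j : ℕ) (y : E n) :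
    ‖iteratedFDeriv ℝ j (place a T f) y‖ = ‖iteratedFDeriv ℝ j f (T (y - a))‖ := by
  have h1 : place a T f = fun y => (f ∘ T) (y - a) := rfl
  rw [h1, iteratedFDeriv_comp_sub, LinearIsometryEquiv.norm_iteratedFDeriv_comp_right]

lemma ContDiff.place {f : Fn n} (hf : Smooth f) (a : E n) (T : E n ≃ₗᵢ[ℝ] E n) : Smooth
    (place a T f) := hf.comp (T.contDiff.comp (contDiff_id.sub contDiff_const))

lemma exists_polar_eq (hn : 2 ≤ n) {e : E n} (he : ‖e‖ = 1) {θ : ℝ} (h0 : 0 ≤ θ)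
    (hπ : θ ≤ Real.pi) : ∃ x : E n, ‖x‖ = 2 ∧ polar e x = θ := by
  obtain ⟨v, hv, hv0⟩ : ∃ v : E n, inner ℝ e v = 0 ∧ v ≠ 0 := by
    have h1 : 0 < Module.finrank ℝ (ℝ ∙ e)ᗮ := by
      have h2 := Submodule.finrank_add_finrank_orthogonal (ℝ ∙ e)
      have h3 := finrank_span_singleton (K := ℝ) (v := e) (by rintro rfl; simp at he)
      rw [h3, finrank_euclideanSpace_fin] at h2
      omega
    have := Module.finrank_pos_iff.1 h1
    obtain ⟨v, hv⟩ := exists_ne (0 : (ℝ ∙ e)ᗮ)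
    exact ⟨v, Submodule.mem_orthogonal_singleton_iff_inner_right.1 v.2, by simpa using hv⟩
  set w : E n := ‖v‖⁻¹ • v with hw
  have hw1 : ‖w‖ = 1 := by rw [hw, norm_smul, norm_inv, norm_norm, inv_mul_cancel₀ (by simpa)]
  have hew : inner ℝ e w = 0 := by rw [hw, inner_smul_right, hv, mul_zero]
  set x : E n := Real.cos θ • e + Real.sin θ • w with hx
  have hx1 : ‖x‖ = 1 := by
    have h1 : ‖x‖ ^ 2 = 1 := by
      rw [hx, norm_add_sq_real, norm_smul, norm_smul, he, hw1, inner_smul_left, inner_smul_right,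
        hew]
      simp only [norm_eq_abs, mul_one, sq_abs, mul_zero, add_zero]
      exact Real.cos_sq_add_sin_sq θ
    nlinarith [norm_nonneg x]
  refine ⟨(2 : ℝ) • x, by rw [norm_smul, hx1]; norm_num, ?_⟩
  rw [polar, InnerProductGeometry.angle_smul_right_of_pos _ _ two_pos, InnerProductGeometry.angle,
    he, hx1, hx, inner_add_right, inner_smul_right, inner_smul_right, hew,
    real_inner_self_eq_norm_sq, he]
  simp [Real.arccos_cos h0 hπ]

lemma RegularizedCone.mem_carrier_smul (D : RegularizedCone n θ₁ θ₂) {x : E n} (hx : 1 ≤ ‖x‖)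
    {c : ℝ} (hc : 1 ≤ c) : c • x ∈ D.carrier ↔ x ∈ D.carrier := by
  have h1 : 1 ≤ ‖c • x‖ := by rw [norm_smul, norm_of_nonneg (by linarith)]; nlinarith
  rw [D.carrier_far x hx, D.carrier_far _ h1, polar, InnerProductGeometry.angle_smul_right_of_pos _
    _ (by linarith)]

lemma RegularizedCone.coneDomain (D : RegularizedCone n θ₁ θ₂) (hn : 2 ≤ n) (hθ₁ : 0 < θ₁)
    (hθ : θ₁ < θ₂) (hθ₂ : θ₂ < Real.pi) {r φ : Fn n} (hr : IsRadialWeight r)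
    (hφ : IsAngularWeight D φ) : ConeDomain D.carrier φ r where
  isOpen := D.isOpen_carrier
  isPreconnected := D.isConnected_carrier.isPreconnected
  far_point := by
    obtain ⟨x, hx, hxθ⟩ := exists_polar_eq hn D.norm_axis (θ := (θ₁ + θ₂) / 2) (by linarith)
      (by linarith)
    exact ⟨x, (D.carrier_far x (by linarith)).2 ⟨by linarith, by linarith⟩, by linarith⟩
  smooth := hφ.smooth
  pos := hφ.pos
  zero := hφ.zero
  grad := hφ.grad
  cone _ hx _ hc := D.mem_carrier_smul hx hc
  ray := hφ.ray
  weight_smooth := hr.smooth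
  weight_pos := hr.pos
  weight_far := hr.far

lemma RegularizedCone.exists_norm_le (D : RegularizedCone n θ₁ θ₂) (hθ₁ : 0 < θ₁) (hθ : θ₁ < θ₂)
    (hθ₂ : θ₂ < Real.pi) {r : Fn n} (hr : IsRadialWeight r) : ∃ c : ℝ, 0 < c ∧
    ∀ (a : E n) (T : E n ≃ₗᵢ[ℝ] E n), T (-a) = ‖a‖ • D.axis → 2 ≤ ‖a‖ → ∀ y ∈ D.region a T, c * ‖a‖
      ≤ ‖y‖ ∧ c * place a T r y ≤ ‖y‖ := by
  obtain ⟨w, hw, hmax⟩ := (isCompact_closedBall (0 : E n) 1).exists_isMaxOn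
    ⟨0, mem_closedBall_self zero_le_one⟩ hr.smooth.continuous.continuousOn
  set κ := max (Real.cos θ₁) 0 with hκ
  have hκ1 : κ < 1 := max_lt (by
    rw [← Real.cos_zero]
    exact Real.cos_lt_cos_of_nonneg_of_le_pi le_rfl (by linarith) hθ₁) one_pos
  have hκ0 : 0 ≤ κ := le_max_right _ _
  have hrw := hr.pos w
  set c := min (Real.sqrt (1 - κ)) (min (1 / 2) (1 / r w)) with hc
  have hc0 : 0 < c := lt_min (sqrt_pos.2 (by linarith)) (lt_min (by norm_num) (by positivity))
  have hc1 : c ^ 2 ≤ 1 - κ := by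
    rw [← sq_sqrt (show 0 ≤ 1 - κ by linarith)]
    exact pow_le_pow_left₀ hc0.le (min_le_left _ _) 2
  have hc2 : c ≤ 1 / 2 := (min_le_right _ _).trans (min_le_left _ _)
  have hc3 : c * r w ≤ 1 := by
    rw [← le_div_iff₀ hrw]; exact (min_le_right _ _).trans (min_le_right _ _)
  refine ⟨c, hc0, fun a T hT ha y hy => ?_⟩
  set x := T (y - a) with hx
  have hyx : ‖y‖ = ‖x - ‖a‖ • D.axis‖ := by
    rw [← hT, hx, ← map_sub, sub_neg_eq_add, sub_add_cancel, T.norm_map]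
  have hrx : place a T r y = r x := rfl
  rw [hrx]
  rcases le_total 1 ‖x‖ with h | h
  · rw [hr.far x h]
    have hpol := ((D.carrier_far x h).1 hy).1
    have hin : Inner.inner ℝ x D.axis ≤ ‖x‖ * κ := by
      have h1 := InnerProductGeometry.cos_angle_mul_norm_mul_norm D.axis x
      rw [D.norm_axis, one_mul, real_inner_comm] at h1
      rw [← h1, mul_comm]
      refine mul_le_mul_of_nonneg_left (le_trans ?_ (le_max_left _ _)) (norm_nonneg x)
      exact Real.cos_le_cos_of_nonneg_of_le_pi hθ₁.le (InnerProductGeometry.angle_le_pi _ _) hpol.le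
    have hsq : (1 - κ) * (‖x‖ ^ 2 + ‖a‖ ^ 2) ≤ ‖y‖ ^ 2 := by
      rw [hyx, norm_sub_sq_real, norm_smul, inner_smul_right, D.norm_axis, norm_norm, mul_one]
      have h2 := mul_le_mul_of_nonneg_left hin (norm_nonneg a)
      nlinarith [mul_nonneg hκ0 (sq_nonneg (‖x‖ - ‖a‖))]
    have hx2 := sq_nonneg ‖x‖
    have ha2 := sq_nonneg ‖a‖
    constructor
    · refine le_of_sq_le_sq ?_ (norm_nonneg y)
      nlinarith [mul_le_mul_of_nonneg_right hc1 ha2, mul_nonneg (sub_pos.2 hκ1).le hx2]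
    · refine le_of_sq_le_sq ?_ (norm_nonneg y)
      nlinarith [mul_le_mul_of_nonneg_right hc1 hx2, mul_nonneg (sub_pos.2 hκ1).le ha2]
  · have h1 : ‖a‖ - ‖x‖ ≤ ‖y‖ := by
      have := norm_sub_norm_le (‖a‖ • D.axis) x
      rwa [norm_smul, D.norm_axis, norm_norm, mul_one, norm_sub_rev, ← hyx] at this
    have h2 : r x ≤ r w := hmax (mem_closedBall_zero_iff.2 h)
    constructor
    · nlinarith [mul_le_mul_of_nonneg_right hc2 (norm_nonneg a)]
    · nlinarith [mul_le_mul_of_nonneg_left h2 hc0.le]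

end Geometry

section Patch
variable {n : ℕ} {θ₁ θ₂ : ℝ} {r : Fn n}

/-- The placed regions, as the vertex goes to infinity. -/
def RegularizedCone.family (D : RegularizedCone n θ₁ θ₂) {r : Fn n} (hr : IsRadialWeight r) :
    RegionFamily n where
  ι := E n × (E n ≃ₗᵢ[ℝ] E n)
  l := comap (fun i => ‖i.1‖) atTop ⊓ 𝓟 {i | i.2 (-i.1) = ‖i.1‖ • D.axis}
  Ω i := D.region i.1 i.2
  r i := place i.1 i.2 r
  isOpen i := D.isOpen_carrier.preimage
    (i.2.continuous.comp (continuous_id.sub continuous_const))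
  pos _ _ := hr.pos _
  weight_continuous i := hr.smooth.continuous.comp
    (i.2.continuous.comp (continuous_id.sub continuous_const))

lemma RegularizedCone.eventually_family (D : RegularizedCone n θ₁ θ₂) (hr : IsRadialWeight r)
    {P : E n → (E n ≃ₗᵢ[ℝ] E n) → Prop} : (∀ᶠ i in (D.family hr).l, P i.1 i.2) ↔ ∃ A : ℝ, ∀ a : E n,
      A < ‖a‖ → ∀ T : E n ≃ₗᵢ[ℝ] E n, T (-a) = ‖a‖ • D.axis → P a T := by
  change (∀ᶠ i : E n × (E n ≃ₗᵢ[ℝ] E n) in comap (fun i => ‖i.1‖) atTop ⊓ 𝓟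
    {i | i.2 (-i.1) = ‖i.1‖ • D.axis}, P i.1 i.2) ↔ _
  rw [eventually_inf_principal, eventually_comap]
  constructor
  · intro h
    obtain ⟨A, hA⟩ := eventually_atTop.1 h
    exact ⟨A, fun a ha T hT => hA ‖a‖ ha.le (a, T) rfl hT⟩
  · rintro ⟨A, hA⟩
    filter_upwards [eventually_gt_atTop A] with t ht i hi hT
    exact hA i.1 (hi ▸ ht) i.2 hT

lemma RegularizedCone.tendsto_rpow_neg (D : RegularizedCone n θ₁ θ₂) (hr : IsRadialWeight r) {q : ℝ}
    (hq : 0 < q) : Tendsto (fun i : (D.family hr).ι => ‖i.1‖ ^ (-q)) (D.family hr).l (𝓝 0) :=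
  (tendsto_rpow_neg_atTop hq).comp (tendsto_comap.mono_left inf_le_left)

lemma RegularizedCone.sym_of_decay (D : RegularizedCone n θ₁ θ₂) (hθ₁ : 0 < θ₁) (hθ : θ₁ < θ₂)
    (hθ₂ : θ₂ < Real.pi) (hr : IsRadialWeight r) {q R₀ : ℝ} (hq : 0 < q) {F : Fn n} {k m : ℕ}
    (hF : ContDiffOn ℝ k F {y | R₀ < ‖y‖}) (hd : ∃ C : ℝ, ∀ j ≤ k, ∀ y, R₀ < ‖y‖ → ‖iteratedFDeriv ℝ
      j F y‖ ≤ C * ‖y‖ ^ (-q - (m : ℝ) - (j : ℝ))) : Sym (D.family hr) (fun i => ‖i.1‖ ^ (-q)) k m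
    fun _ => F := by
  obtain ⟨c, hc0, hc⟩ := D.exists_norm_le hθ₁ hθ hθ₂ hr
  obtain ⟨C, hC⟩ := hd
  have hfar : ∀ᶠ i in (D.family hr).l, 2 ≤ ‖i.1‖ ∧ i.2 (-i.1) = ‖i.1‖ • D.axis ∧
      ∀ y ∈ D.region i.1 i.2, R₀ < ‖y‖ := by
    refine (D.eventually_family hr (P := fun a T => 2 ≤ ‖a‖ ∧ T (-a) = ‖a‖ • D.axis ∧
      ∀ y ∈ D.region a T, R₀ < ‖y‖)).2 ⟨max 2 (R₀ / c), fun a ha T hT => ?_⟩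
    have h2 : 2 ≤ ‖a‖ := (le_max_left _ _).trans ha.le
    refine ⟨h2, hT, fun y hy => ?_⟩
    have h3 := (div_lt_iff₀ hc0).1 ((le_max_right _ _).trans_lt ha)
    linarith [(hc a T hT h2 y hy).1]
  refine Sym.of_iteratedFDeriv (hfar.mono fun i hi => hF.mono fun y hy => hi.2.2 y hy)
    ⟨max C 0 * (c ^ (-q) * max 1 c⁻¹ ^ (m + k)), by positivity, ?_⟩
  filter_upwards [hfar] with i hi j hj y hy
  obtain ⟨h2, hT, hR⟩ := hi
  obtain ⟨h3, h4⟩ := hc i.1 i.2 hT h2 y hy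
  have hy0 : 0 < ‖y‖ := lt_of_lt_of_le (by positivity) h3
  have hr0 : 0 < place i.1 i.2 r y := hr.pos _
  have h5 : place i.1 i.2 r y ≤ c⁻¹ * ‖y‖ := by rw [inv_mul_eq_div, le_div_iff₀ hc0]; linarith
  have h6 : ‖y‖ ^ (-q - (m : ℝ) - (j : ℝ)) * ‖y‖ ^ (m + j) = ‖y‖ ^ (-q) := by
    rw [← rpow_natCast, ← rpow_add hy0]
    simp
  have h7 : ‖y‖ ^ (-q) ≤ c ^ (-q) * ‖i.1‖ ^ (-q) := by
    rw [← Real.mul_rpow hc0.le (norm_nonneg _)]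
    exact Real.rpow_le_rpow_of_nonpos (by positivity) h3 (by linarith)
  have h8 : c⁻¹ ^ (m + j) ≤ max 1 c⁻¹ ^ (m + k) :=
    (pow_le_pow_left₀ (by positivity) (le_max_right _ _) _).trans
      (pow_le_pow_right₀ (le_max_left _ _) (by omega))
  calc ‖iteratedFDeriv ℝ j F y‖ * place i.1 i.2 r y ^ (m + j) ≤
      (max C 0 * ‖y‖ ^ (-q - (m : ℝ) - (j : ℝ))) * (c⁻¹ * ‖y‖) ^ (m + j) := by
        gcongr
        exact (hC j hj y (hR y hy)).trans (by gcongr; exact le_max_left _ _)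
    _ = max C 0 * (‖y‖ ^ (-q) * c⁻¹ ^ (m + j)) := by rw [mul_pow, ← h6]; ring
    _ ≤ max C 0 * ((c ^ (-q) * ‖i.1‖ ^ (-q)) * max 1 c⁻¹ ^ (m + k)) := by gcongr
    _ = _ := by ring

lemma IsCutoff.sym {D : RegularizedCone n θ₁ θ₂} {χ : Fn n} (hχ : IsCutoff D χ)
    (hr : IsRadialWeight r) (k : ℕ) : Sym (D.family hr) (fun _ => 1) k 0 fun i => place i.1 i.2
    χ := by
  obtain ⟨w, hw⟩ := hχ.angular
  have hray : ∀ x ∈ (univ : Set (E n)), 1 ≤ ‖x‖ → ∀ c : ℝ, 1 ≤ c → χ (c • x) = χ x := by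
    intro x _ hx c hc
    have h1 : 1 ≤ ‖c • x‖ := by rw [norm_smul, norm_of_nonneg (by linarith)]; nlinarith
    rw [hw x hx, hw _ h1, polar, InnerProductGeometry.angle_smul_right_of_pos _ _ (by linarith)]
  choose C hC using exists_bound_iteratedFDeriv_of_ray isOpen_univ (by simp) hχ.smooth hray
    hr.smooth.continuous hr.far
  have hC0 : ∀ j, 0 ≤ C j := fun j => le_trans (by positivity) (hC j 0 (mem_univ _))
  refine Sym.of_iteratedFDeriv (of_forall fun i =>
    ((ContDiff.place hχ.smooth i.1 i.2).of_le (by exact_mod_cast le_top)).contDiffOn)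
    ⟨∑ j ∈ Finset.range (k + 1), C j, sum_nonneg fun j _ => hC0 j, of_forall fun i j hj y _ => ?_⟩
  rw [norm_iteratedFDeriv_place, mul_one, zero_add]
  have h1 := hC j (i.2 (y - i.1)) (mem_univ _)
  rw [abs_of_pos (hr.pos _)] at h1
  exact h1.trans (single_le_sum (f := C) (fun j _ => hC0 j) (Finset.mem_range.2 (by omega)))

variable {q : ℝ}

lemma AFEnd.smallData (data : AFEnd n q) (hq : 0 < q) {D : RegularizedCone n θ₁ θ₂} (hθ₁ : 0 < θ₁)
    (hθ : θ₁ < θ₂) (hθ₂ : θ₂ < Real.pi) {r χ : Fn n} (hr : IsRadialWeight r) (hχ : IsCutoff D χ) :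
    SmallData (D.family hr) (fun i => ‖i.1‖ ^ (-q)) (fun i => data.patchMetric (place i.1 i.2 χ))
      fun i => data.patchMomentum (place i.1 i.2 χ) := by
  have h0 : ∀ i : (D.family hr).ι, 0 ≤ ‖i.1‖ ^ (-q) := fun i => rpow_nonneg (norm_nonneg _) _
  have ht := D.tendsto_rpow_neg hr hq
  have hg : ∀ a b, Sym (D.family hr) (fun i => ‖i.1‖ ^ (-q)) 2 0 fun i x => data.patchMetric
      (place i.1 i.2 χ) x a b - 𝟙 a b := by
    intro a b
    have h1 := D.sym_of_decay hθ₁ hθ hθ₂ hr hq (k := 2) (m := 0) (R₀ := data.R₀)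
      ((data.contDiff_g a b).sub contDiffOn_const)
      (data.decay_g.imp fun C hC j hj y hy => by simpa using hC a b j hj y hy)
    refine ((hχ.sym hr 2).one_mul h1).congr (of_forall fun i x _ => ?_)
    simp only [AFEnd.patchMetric, Matrix.add_apply, Matrix.smul_apply, smul_eq_mul]
    ring
  have hk : ∀ a b, Sym (D.family hr) (fun i => ‖i.1‖ ^ (-q)) 1 1 fun i x => data.patchForm
      (place i.1 i.2 χ) x a b := by
    intro a b
    have h1 := D.sym_of_decay hθ₁ hθ hθ₂ hr hq (k := 1) (m := 1) (R₀ := data.R₀)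
      (F := fun z => data.k z a b) (data.contDiff_k a b)
      (data.decay_k.imp fun C hC j hj y hy => by simpa using hC a b j hj y hy)
    exact (hχ.sym hr 1).one_mul h1
  have H : SmallData (D.family hr) (fun i => ‖i.1‖ ^ (-q))
      (fun i => data.patchMetric (place i.1 i.2 χ)) fun _ _ => 0 :=
    ⟨h0, ht, hg, fun a b => Sym.zero h0⟩
  have hi := fun a b => (H.inverse_one a b).of_le one_le_two
  refine ⟨h0, ht, hg, fun a b => ?_⟩
  have h1 := (Sym.sum h0 (s := Finset.univ) fun d _ =>
    (Sym.sum h0 (s := Finset.univ) fun c _ => (hi a c).one_mul (hk c d)).mul_one h0 (hi d b)).sub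
    ((Sym.sum h0 (s := Finset.univ) fun c _ => Sym.sum h0 (s := Finset.univ) fun d _ =>
      (hi c d).one_mul (hk d c)).mul_one h0 (hi a b))
  refine h1.congr (of_forall fun i x _ => ?_)
  simp only [AFEnd.patchMomentum, Constraint.momentum, Matrix.sub_apply, Matrix.smul_apply,
    Matrix.mul_apply, Matrix.trace, Matrix.diag, smul_eq_mul]

lemma AFEnd.eventually_isSymm (data : AFEnd n q) {D : RegularizedCone n θ₁ θ₂} (hθ₁ : 0 < θ₁)
    (hθ : θ₁ < θ₂) (hθ₂ : θ₂ < Real.pi) {r χ : Fn n} (hr : IsRadialWeight r) : ∀ᶠ i in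
    (D.family hr).l, ∀ x ∈ (D.family hr).Ω i, (data.patchMetric (place i.1 i.2 χ) x).IsSymm := by
  obtain ⟨c, hc0, hc⟩ := D.exists_norm_le hθ₁ hθ hθ₂ hr
  refine (D.eventually_family hr (P := fun a T => ∀ x ∈ D.region a T,
    (data.patchMetric (place a T χ) x).IsSymm)).2 ⟨max 2 (data.R₀ / c), fun a ha T hT x hx => ?_⟩
  have h3 := (div_lt_iff₀ hc0).1 ((le_max_right _ _).trans_lt ha)
  have h4 : (data.g x).IsSymm := by
    have := (data.posDef x (by
      linarith [(hc a T hT ((le_max_left _ _).trans ha.le) x hx).1])).isHermitian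
    simpa [Matrix.IsHermitian, Matrix.IsSymm, Matrix.conjTranspose_eq_transpose_of_trivial]
  exact (h4.smul _).add (Matrix.isSymm_one.smul _)

end Patch

lemma RegularizedCone.nonempty_region {n : ℕ} {θ₁ θ₂ : ℝ} (D : RegularizedCone n θ₁ θ₂) (a : E n)
    (T : E n ≃ₗᵢ[ℝ] E n) : (D.region a T).Nonempty := by
  obtain ⟨x, hx⟩ := D.isConnected_carrier.nonempty
  exact ⟨T.symm x + a, by simpa [RegularizedCone.region] using hx⟩

end Constraint

end

theorem proposition4 (n : ℕ) (hn : 3 ≤ n) (θ₁ θ₂ : ℝ) (hθ₁ : 0 < θ₁) (hθ : θ₁ < θ₂)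
    (hθ₂ : θ₂ < Real.pi) (p q : ℝ) (hp : ((n : ℝ) - 2) / 2 < p) (hpq : p < q)
    (hq : q ≤ (n : ℝ) - 2) (hpn : 5 ≤ n → p ≠ (n : ℝ) / 2)
    (D : Constraint.RegularizedCone n θ₁ θ₂)
    (r : Constraint.E n → ℝ) (hr : Constraint.IsRadialWeight r)
    (φ : Constraint.E n → ℝ) (hφ : Constraint.IsAngularWeight D φ) :
    ∃ N₀ : ℕ, ∀ N : ℕ, N₀ ≤ N →
      ∀ (χ : Constraint.E n → ℝ), Constraint.IsCutoff D χ →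
      ∀ data : Constraint.AFEnd n q,
      ∃ aInf : ℝ, ∀ a : Constraint.E n, aInf < ‖a‖ →
      ∀ T : Constraint.E n ≃ₗᵢ[ℝ] Constraint.E n, T (-a) = ‖a‖ • D.axis →
      ∀ (f : Constraint.E n → ℝ) (V : Constraint.E n → Constraint.E n),
        Constraint.MemL2 (D.region a T) (Constraint.place a T r)
          (Constraint.place a T fun x => (φ x ^ (2 * N))⁻¹) (p + 2) f →
        Constraint.MemL2 (D.region a T) (Constraint.place a T r)
          (Constraint.place a T fun x => (φ x ^ (2 * N))⁻¹) (p + 2) V →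
        Constraint.UniquelySolvable (D.region a T)
          (data.patchMetric (Constraint.place a T χ))
          (data.patchMomentum (Constraint.place a T χ))
          (Constraint.place a T r) (Constraint.place a T fun x => φ x ^ (2 * N)) p f V := by
  refine ⟨3, fun N hN χ hχ data => ?_⟩
  have hn3 : (3 : ℝ) ≤ n := by exact_mod_cast hn
  have hC := D.coneDomain (by omega) hθ₁ hθ hθ₂ hr hφ
  have hs : 0 < (n : ℝ) - p - 2 := by linarith
  obtain ⟨C₀, hC₀⟩ := hC.exists_kornBound hN hs
  obtain ⟨C₁, hC₁⟩ := hC.exists_kornBound hN (show 0 < 1 + ((n : ℝ) - p - 2) by linarith)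
  obtain ⟨K, hK⟩ := Constraint.exists_flatBound (show 0 < n by omega) ((n : ℝ) - p - 2) C₀ C₁
  obtain ⟨c₀, hc₀, K', hK'⟩ := Constraint.exists_coercive hn ((n : ℝ) - p - 2) K
  have hq0 : 0 < q := by linarith
  obtain ⟨C, hM⟩ := (data.smallData hq0 hθ₁ hθ hθ₂ hr hχ).exists_adjointModel
    (data.eventually_isSymm hθ₁ hθ hθ₂ hr)
  have ht : Filter.Tendsto (fun i : (D.family hr).ι => C * ‖i.1‖ ^ (-q)) (D.family hr).l
      (nhds 0) := by simpa using (D.tendsto_rpow_neg hr hq0).const_mul C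
  have hsmall := ht.eventually_lt_const
    (show 0 < min c₀ (1 / (22 * (n : ℝ) ^ 2)) from lt_min hc₀ (by positivity))
  have hboth := hM.and hsmall
  obtain ⟨A, hA⟩ := (D.eventually_family hr (P := fun a T =>
    (∃ M₁ M₂, Constraint.AdjointModel (D.region a T) (Constraint.place a T r)
      (data.patchMetric (Constraint.place a T χ)) (data.patchMomentum (Constraint.place a T χ))
      (C * ‖a‖ ^ (-q)) M₁ M₂) ∧ C * ‖a‖ ^ (-q) < min c₀ (1 / (22 * (n : ℝ) ^ 2)))).1 hboth
  refine ⟨A, fun a ha T hT f V hf hV => ?_⟩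
  obtain ⟨⟨M₁, M₂, hmod⟩, hlt⟩ := hA a ha T hT
  set c := C * ‖a‖ ^ (-q)
  have hc0 : 0 ≤ c := by
    obtain ⟨x, hx⟩ := D.nonempty_region a T
    exact (abs_nonneg _).trans (hmod.density x hx)
  have hTa : Continuous fun y : Constraint.E n => T (y - a) :=
    T.continuous.comp (continuous_id.sub continuous_const)
  have hopen : IsOpen (D.region a T) := D.isOpen_carrier.preimage hTa
  have hrc : Continuous (Constraint.place a T r) := hr.smooth.continuous.comp hTa
  have hρc : Continuous (Constraint.place a T fun x => φ x ^ (2 * N)) :=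
    (hφ.smooth.continuous.pow _).comp hTa
  have hρ0 : ∀ x, 0 ≤ Constraint.place a T (fun x => φ x ^ (2 * N)) x :=
    fun x => (even_two_mul N).pow_nonneg _
  have hflat := hK _ _ _ (fun x => hr.pos _) hrc hρc (hC₀.motion a T) (hC₁.motion a T)
  have hmodel : Constraint.CoerciveModel (D.region a T) (Constraint.place a T r)
      (Constraint.place a T fun x => φ x ^ (2 * N)) ((n : ℝ) - p - 2)
      (data.patchMetric (Constraint.place a T χ)) (data.patchMomentum (Constraint.place a T χ))
      c M₁ M₂ K' :=
    { dim_pos := by omega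
      isOpen := hopen
      pos := fun x => hr.pos _
      continuous := hrc
      continuous_boundary := hρc
      boundary_nonneg := hρ0
      boundary_pos := fun x hx => pow_pos (hφ.pos _ hx) _
      model := hmod
      nonneg := hc0
      small := by
        have h1 := (lt_div_iff₀ (by positivity)).1 (hlt.trans_le (min_le_right _ _))
        linarith
      coercive := hK' _ _ _ _ _ c M₁ M₂ hopen (fun x => hr.pos _) hrc hρc hρ0 hflat hmod hc0
        (hlt.le.trans (min_le_left _ _)) }
  exact hmodel.uniquelySolvable (fun x => rfl) hf hV
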